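/- **Setting.** All functions are real-valued and $\langle v,w\rangle=\int_{\mathbb R}vw\,dx$. *Nonlinearity.* For some $k\ge 3$, $f\in C^k(\mathbb R)$ with $f^{(k)}$ bounded, and $f(0)=f'(0)=0$. *Potential.* $b:\mathbb R\times\mathbb R\to\mathbb R$, $(t,x)\mapsto b(t,x)$, is twice differentiable and, for constants $\epsilon_a,\epsilon_t,\epsilon_x>0$, $$|\partial_t^n\partial_x^m b|\le \epsilon_a\epsilon_t^n\epsilon_x^m\qquad (n\in\{0,1\},\ m\in\{0,1,2\},\ n+m\le 2);$$ write $b'=\partial_x b$. The bKdV equation is $\partial_t u=-\partial_x\big(\partial_x^2u+f(u)-b(t,x)u\big)$; a solution on $[0,T]$, $T>0$, is a $u\in C([0,T];H^1(\mathbb R))$ that satisfies it in the sense of distributions in $x$ at every time of $[0,T]$ (one-sided at the end points). *Solitary waves.* $I_0\subset(0,\infty)$ is open, and for each $c\in I_0$, $Q_c$ is a positive, even $C^2$ solution of $-Q_c''+cQ_c-f(Q_c)=0$ with $Q_c(x)\to0$ as $|x|\to\infty$. The map $(c,x)\mapsto Q_c(x)$ is $C^3$ on $I_0\times\mathbb R$,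 and $x^m\partial_c^nQ_c\in L^1$ for $n=1,2,3$, $m=0,1,2$, $c\in I_0$. Put $Q_{ca}(x)=Q_c(x-a)$, $\zeta^{tr}_{ca}=\partial_aQ_{ca}$, $\zeta^{n}_{ca}=\partial_cQ_{ca}$, $T_{ca}=\mathrm{span}\{\zeta^{tr}_{ca},\zeta^n_{ca}\}$ and $\delta(c)=\frac12\|Q_c\|_{L^2}^2$. Let $I\subset I_0$ be compact with $\delta'(c)>0$ and $\int\zeta^n_{c0}\,dx\neq0$ for all $c\in I$. *Regularized symplectic operator.* For $\alpha>0$ let $\mathcal K_{Q\alpha}=\mathcal K P_Q+\partial_\alpha^{-1}(1-P_Q)$, where $P_Q$ is the $L^2$-orthogonal projection onto $\mathrm{span}\{\zeta^{tr}_{ca}\}$, $\mathcal Kg(x)=\int_{-\infty}^xg(y)\,dy$ and $\partial_\alpha^{-1}g(x)=\int_{-\infty}^xg(y)e^{\alpha(y-x)}\,dy$. *Splitting of the fluctuation.* Let $\mathcal L_Q=-\partial_x^2+c-f'(Q_{ca})$, and let $\eta\in H^1$ be a minimizer of $\langle\mathcal L_Q\chi,\chi\rangle$ over all $\chi\in H^1$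 with $\chi\perp\mathcal K_{Q\alpha}T_{ca}$ and $\|\chi\|_{L^2}=1$. For $\xi\in H^1$ put $\xi_g=\xi-\langle\xi,\eta\rangle\eta$. **Proposition.** There are positive constants $C,\kappa,\alpha_0$, depending only on $I$ (and on $f$ and the family $Q$), such that the following holds whenever $0<\alpha\le\min(1,\alpha_0)$, $\epsilon_a,\epsilon_t>0$, $0<\epsilon_x\le1$ and $b$ is as above. Let $u$ be a solution of bKdV on $[0,T]$ and suppose that for all $t\in[0,T]$ $$u(t)=Q_{c(t)a(t)}+\xi(t),\qquad \xi(t)\in H^1,\quad \xi(t)\perp\mathcal K_{Q\alpha}T_{c(t)a(t)},$$ where $a:[0,T]\to\mathbb R$ and $c:[0,T]\to I_0$ are continuous. Let $t\in[0,T]$ be such that $c(t)\in I$, let $\eta$ be any minimizer as above for $(c,a)=(c(t),a(t))$, and suppose that $\alpha^{-1/2}\|\xi_g(t)\|_{H^1}+\|\xi(t)\|_{H^1}\le\kappa$. Then $a$ and $c$ are differentiable at $t$ (one-sidedly at the end points) and, at time $t$, $$\begin{pmatrix}\dot a\\ \dot c\end{pmatrix}=\begin{pmatrix}c-b(t,a)\\0\end{pmatrix}+b'(t,a)\frac{\delta(c)}{\delta'(c)^2}\begin{pmatrix}-\frac12\left(\int\zeta^n_{ca}\,dx\right)^2\\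 \delta'(c)\end{pmatrix}+Z,$$ where $$|Z|\le C\Big(\alpha\epsilon_a\epsilon_x+\epsilon_a\epsilon_x^2+\big(\alpha^{1/2}+\alpha^{-1/2}\epsilon_a\epsilon_x\big)\|\xi_g\|_{H^1}+(\alpha+\epsilon_a\epsilon_x)\|\xi\|_{H^1}+\|\xi\|_{H^1}^2\Big).$$ -/

import Mathlib

open MeasureTheory Set Filter Topology
open scoped ContDiff

noncomputable section

namespace BKdV

/-! ### The real Sobolev space `H¹(ℝ)` -/

/-- Smooth, compactly supported test functions on the line. -/
def IsTest (φ : ℝ → ℝ) : Prop := ContDiff ℝ ∞ φ ∧ HasCompactSupport φ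

/-- Real `L²(ℝ)`. -/
abbrev L2 : Type := Lp ℝ 2 (volume : Measure ℝ)

theorem IsTest.memLp {φ : ℝ → ℝ} (h : IsTest φ) : MemLp φ 2 volume :=
  h.1.continuous.memLp_of_hasCompactSupport h.2

theorem IsTest.deriv {φ : ℝ → ℝ} (h : IsTest φ) : IsTest (deriv φ) :=
  ⟨((contDiff_infty_iff_deriv (f := φ)).1 h.1).2, h.2.deriv⟩

theorem integrable_L2_mul (v : L2) {φ : ℝ → ℝ} (h : MemLp φ 2 volume) :
    Integrable (fun x => v x * φ x) volume :=
  (Lp.memLp v).integrable_mul h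

/-- `H¹(ℝ)` as a space of `(v, w)` in `L² × L²` with `w` the weak derivative of `v`.  As a
subspace of the Hilbert product it carries the norm `‖v‖_{H¹}² = ‖v‖_{L²}² + ‖∂ₓ v‖_{L²}²`. -/
def h1Space : Submodule ℝ (WithLp 2 (L2 × L2)) where
  carrier := {p | ∀ φ : ℝ → ℝ, IsTest φ →
    ∫ x, p.fst x * deriv φ x = -∫ x, p.snd x * φ x}
  zero_mem' := by
    intro φ _
    have h : ∀ ψ : ℝ → ℝ, ∫ x, (0 : L2) x * ψ x = 0 := by
      intro ψ
      rw [← integral_zero ℝ ℝ (μ := volume)]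
      refine integral_congr_ae ?_
      filter_upwards [Lp.coeFn_zero ℝ 2 (volume : Measure ℝ)] with x hx
      rw [hx, Pi.zero_apply, zero_mul]
    rw [WithLp.zero_fst, WithLp.zero_snd, h, h, neg_zero]
  add_mem' := by
    intro p q hp hq φ hφ
    have h : ∀ (v w : L2) (ψ : ℝ → ℝ), IsTest ψ →
        ∫ x, (v + w) x * ψ x = (∫ x, v x * ψ x) + ∫ x, w x * ψ x := by
      intro v w ψ hψ
      rw [← integral_add (integrable_L2_mul v hψ.memLp) (integrable_L2_mul w hψ.memLp)]
      refine integral_congr_ae ?_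
      filter_upwards [Lp.coeFn_add v w] with x hx
      rw [hx, Pi.add_apply, add_mul]
    rw [WithLp.add_fst, WithLp.add_snd, h _ _ _ hφ.deriv, h _ _ _ hφ, hp φ hφ, hq φ hφ]
    ring
  smul_mem' := by
    intro r p hp φ hφ
    have h : ∀ (v : L2) (ψ : ℝ → ℝ),
        ∫ x, (r • v) x * ψ x = r * ∫ x, v x * ψ x := by
      intro v ψ
      rw [← integral_const_mul]
      refine integral_congr_ae ?_
      filter_upwards [Lp.coeFn_smul r v] with x hx
      rw [hx, Pi.smul_apply, smul_eq_mul, mul_assoc]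
    rw [WithLp.smul_fst, WithLp.smul_snd, h, h, hp φ hφ]
    ring

/-- The Hilbert space `H¹(ℝ)` of real-valued functions. -/
abbrev H1 : Type := h1Space

/-- A representative of an `H¹` function. -/
def H1.fn (v : H1) : ℝ → ℝ := v.1.fst

/-- A representative of its weak derivative. -/
def H1.dx (v : H1) : ℝ → ℝ := v.1.snd

/-- The real `L²(ℝ)` pairing `⟨v, w⟩ = ∫ v w dx`. -/
def ip (v w : ℝ → ℝ) : ℝ := ∫ x, v x * w x

/-! ### The equation -/

/-- Assumptions on the nonlinearity: `f ∈ C^k` with `f^{(k)}` bounded for some `k ≥ 3`, and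
`f(0) = f'(0) = 0`. -/
structure IsNonlinearity (f : ℝ → ℝ) : Prop where
  smooth : ∃ k : ℕ, 3 ≤ k ∧ ContDiff ℝ k f ∧ ∃ M : ℝ, ∀ x, |iteratedDeriv k f x| ≤ M
  zero : f 0 = 0
  deriv_zero : deriv f 0 = 0

/-- Assumptions on the potential `b(t,x)`, with amplitude, time and length scales `εa, εt, εx`. -/
structure IsPotential (b : ℝ → ℝ → ℝ) (εa εt εx : ℝ) : Prop where
  differentiable : Differentiable ℝ (Function.uncurry b)
  differentiable_fderiv : Differentiable ℝ (fderiv ℝ (Function.uncurry b))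
  bound : ∀ n m : ℕ, n ≤ 1 → m ≤ 2 → n + m ≤ 2 → ∀ t x : ℝ,
    |iteratedDeriv n (fun s => iteratedDeriv m (b s) x) t| ≤ εa * εt ^ n * εx ^ m

/-- `u ∈ C([0,T]; H¹)` solves `∂ₜ u = -∂ₓ (∂ₓ² u + f(u) - b u)` in the sense of distributions
in `x`, for every time of `[0,T]` (one-sided time derivatives at the end points). -/
structure IsSolution (f : ℝ → ℝ) (b : ℝ → ℝ → ℝ) (T : ℝ) (u : ℝ → H1) : Prop where
  continuousOn : ContinuousOn u (Icc 0 T)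
  equation : ∀ φ : ℝ → ℝ, IsTest φ → ∀ t ∈ Icc 0 T,
    HasDerivWithinAt (fun s => ip (u s).fn φ)
      (∫ x, (-((u t).dx x * iteratedDeriv 2 φ x)
        + (f ((u t).fn x) - b t x * (u t).fn x) * deriv φ x))
      (Icc 0 T) t

/-! ### Solitary waves -/

/-- `q` is the solitary wave profile of speed `c`, centred at the origin: a positive, even `C²`
solution of `-q'' + c q - f(q) = 0` that vanishes at infinity. -/
structure IsSolitaryWave (f : ℝ → ℝ) (c : ℝ) (q : ℝ → ℝ) : Prop where
  contDiff : ContDiff ℝ 2 q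
  pos : ∀ x, 0 < q x
  even : ∀ x, q (-x) = q x
  decay : Tendsto q (cocompact ℝ) (𝓝 0)
  equation : ∀ x, -(iteratedDeriv 2 q x) + c * q x - f (q x) = 0

/-- A family `c ↦ Q_c`, `c ∈ I₀ ⊆ (0,∞)`, of solitary wave profiles, regular in `c`, with
`x^m ∂_c^n Q_c ∈ L¹` for `n = 1, 2, 3` and `m = 0, 1, 2`. -/
structure IsSolitaryWaveFamily (f : ℝ → ℝ) (I₀ : Set ℝ) (Q : ℝ → ℝ → ℝ) : Prop where
  isOpen : IsOpen I₀
  pos : I₀ ⊆ Ioi 0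
  wave : ∀ c ∈ I₀, IsSolitaryWave f c (Q c)
  contDiffOn : ContDiffOn ℝ 3 (Function.uncurry Q) (I₀ ×ˢ univ)
  integrable : ∀ c ∈ I₀, ∀ n ∈ Finset.Icc 1 3, ∀ m ∈ Finset.Icc 0 2,
    Integrable (fun x => x ^ m * iteratedDeriv n (fun c' => Q c' x) c) volume

/-- `Q_{ca}(x) = Q_c(x - a)`. -/
def soliton (Q : ℝ → ℝ → ℝ) (c a : ℝ) : ℝ → ℝ := fun x => Q c (x - a)

/-- The translation vector `ζ^{tr}_{ca} = ∂_a Q_{ca}`. -/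
def zetaTr (Q : ℝ → ℝ → ℝ) (c a : ℝ) : ℝ → ℝ :=
  fun x => deriv (fun a' => soliton Q c a' x) a

/-- The normalization vector `ζ^n_{ca} = ∂_c Q_{ca}`. -/
def zetaN (Q : ℝ → ℝ → ℝ) (c a : ℝ) : ℝ → ℝ :=
  fun x => deriv (fun c' => soliton Q c' a x) c

/-- The tangent space to the manifold of solitary waves at `Q_{ca}`. -/
def tangentSpace (Q : ℝ → ℝ → ℝ) (c a : ℝ) : Submodule ℝ (ℝ → ℝ) :=
  Submodule.span ℝ {zetaTr Q c a, zetaN Q c a}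

/-- The momentum of the solitary wave, `δ(c) = ½ ‖Q_c‖²_{L²}`. -/
def delta (Q : ℝ → ℝ → ℝ) (c : ℝ) : ℝ := 1 / 2 * ∫ x, Q c x ^ 2

/-! ### The regularized symplectic operator -/

/-- `(𝒦 g)(x) = ∫_{-∞}^x g(y) dy`. -/
def antideriv (g : ℝ → ℝ) : ℝ → ℝ := fun x => ∫ y in Iic x, g y

/-- `((∂ₓ + α)⁻¹ g)(x) = ∫_{-∞}^x g(y) e^{α (y - x)} dy`. -/
def regInv (α : ℝ) (g : ℝ → ℝ) : ℝ → ℝ :=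
  fun x => ∫ y in Iic x, g y * Real.exp (α * (y - x))

/-- The `L²`-orthogonal projection `P_Q` onto the span of the translation vector. -/
def projTr (Q : ℝ → ℝ → ℝ) (c a : ℝ) (g : ℝ → ℝ) : ℝ → ℝ :=
  (ip (zetaTr Q c a) g / ip (zetaTr Q c a) (zetaTr Q c a)) • zetaTr Q c a

/-- `𝒦_{Qα} = 𝒦 P_Q + (∂ₓ + α)⁻¹ (1 - P_Q)`. -/
def regSymp (Q : ℝ → ℝ → ℝ) (α c a : ℝ) (g : ℝ → ℝ) : ℝ → ℝ :=
  antideriv (projTr Q c a g) + regInv α (g - projTr Q c a g)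

/-- `ξ ⊥ 𝒦_{Qα} T_{Q_{ca}} M_s`. -/
def SympOrthogonal (Q : ℝ → ℝ → ℝ) (α c a : ℝ) (ξ : H1) : Prop :=
  ∀ ζ ∈ tangentSpace Q c a, ip ξ.fn (regSymp Q α c a ζ) = 0

/-! ### The Hessian and the splitting of the fluctuation -/

/-- The quadratic form `⟨ℒ_Q ξ, ξ⟩` on `H¹` of the Hessian `ℒ_Q = -∂ₓ² + c - f'(Q_{ca})`. -/
def hessian (f : ℝ → ℝ) (Q : ℝ → ℝ → ℝ) (c a : ℝ) (ξ : H1) : ℝ :=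
  ∫ x, (ξ.dx x ^ 2 + (c - deriv f (soliton Q c a x)) * ξ.fn x ^ 2)

/-- `{ξ ∈ H¹ | ξ ⊥ 𝒦_{Qα} T_{Q_{ca}} M_s, ‖ξ‖_{L²} = 1}`. -/
def constraintSet (Q : ℝ → ℝ → ℝ) (α c a : ℝ) : Set H1 :=
  {ξ | SympOrthogonal Q α c a ξ ∧ ip ξ.fn ξ.fn = 1}

/-- `η` minimizes `⟨ℒ_Q ξ, ξ⟩` over the constraint set. -/
def IsHessianMinimizer (f : ℝ → ℝ) (Q : ℝ → ℝ → ℝ) (α c a : ℝ) (η : H1) : Prop :=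
  η ∈ constraintSet Q α c a ∧ IsMinOn (hessian f Q c a) (constraintSet Q α c a) η

/-- `ξ_b = ⟨ξ, η⟩ η`. -/
def badPart (η ξ : H1) : H1 := ip ξ.fn η.fn • η

/-- `ξ_g = ξ - ξ_b`. -/
def goodPart (η ξ : H1) : H1 := ξ - badPart η ξ

/-- On `[0,T]`, `u(t) = Q_{c(t)a(t)} + ξ(t)` with continuous parameters `a(t) ∈ ℝ`, `c(t) ∈ I₀` and
a fluctuation `ξ(t) ∈ H¹` with `ξ(t) ⊥ 𝒦_{Qα} T_{Q_{c(t)a(t)}} M_s`. -/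
structure IsModulation (Q : ℝ → ℝ → ℝ) (I₀ : Set ℝ) (α T : ℝ) (u : ℝ → H1)
    (a c : ℝ → ℝ) (ξ : ℝ → H1) : Prop where
  continuousOn_a : ContinuousOn a (Icc 0 T)
  continuousOn_c : ContinuousOn c (Icc 0 T)
  mem : ∀ t ∈ Icc 0 T, c t ∈ I₀
  decomposition : ∀ t ∈ Icc 0 T,
    (u t).fn =ᵐ[volume] fun x => soliton Q (c t) (a t) x + (ξ t).fn x
  orthogonal : ∀ t ∈ Icc 0 T, SympOrthogonal Q α (c t) (a t) (ξ t)

end BKdV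

end

open BKdV

/-!
The operator `K_{Qα}` maps the translation vector `ζ^{tr}` to `-Q_{ca}`, and by parity it maps
`ζ^n = ∂_c Q_{ca}` to its regularized antiderivative `w = ∂_α^{-1} ζ^n`.  Hence the symplectic
orthogonality of `ξ` consists of the two conditions `⟨ξ, Q_{ca}⟩ = 0` and `⟨ξ, w⟩ = 0`
(`sympOrthogonal_iff`).  Differentiating them along the flow gives a linear system for `(ȧ, ċ)`,
which is solved with error control.

*Decay of the profiles.*  Conservation of energy for the profile equation traps the profiles with
speed near a given one below a small constant outside a common interval.  There `Q_c`, its first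
differences and its second differences in `c` solve linear equations `D'' = p D + O(e^{-γ|x|})` with
`p` bounded below, and the maximum principle gives exponential decay that is uniform in the speed
(`exists_hasDecay`).  This settles all questions of integrability and of differentiation under the
integral sign.  The function `w` decays only at rate `α`, with `‖w‖_{L²}²` of order `1/α`.

*Differentiability.*  The equation extends from test functions to functions that are twice
differentiable and square integrable with their derivatives (`IsSolution.hasDerivWithinAt_ip`), and
pairings with the profiles are differentiable in `(c, a)`.  So each orthogonality condition is a
linear relation between the increments of `t` and of `(c, a)` up to terms of higher order.  The two
relations are independent, and therefore the parameters are differentiable and their velocities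
solve a `2 × 2` system (`exists_hasDerivWithinAt_modulation`).

*The system.*  With `y = ȧ - (c - b(t, a))` it reads
`(δ' - ⟨ξ, ζ^n⟩) ċ + ⟨ξ, ∂ₓQ⟩ y = b' δ + E₁` and
`(δ' - α⟨Q, w⟩ + ⟨ξ, w'⟩) y + (⟨ζ^n, w⟩ - ⟨ξ, ∂_c w⟩) ċ = E₂`, and `⟨ζ^n, w⟩` is half of
`(∫ ζ^n)²` up to `O(α)`.  The errors `E₁`, `E₂` are found by expanding the equation around the wave
(`exists_flux_fst_const`, `exists_flux_snd_const`): the linear terms cancel by the profile equation,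
by its derivative in the speed, by parity, and by orthogonality.

*The fluctuation against slowly varying functions.*  The terms `⟨ξ, ∂_c w⟩` and
`α⟨ξ, (b - b(t, a)) w⟩` pair `ξ` with functions whose `L²` norm may be of size `α^{-1/2}`.  The good
part `ξ_g` is estimated by the Cauchy–Schwarz inequality, which is the origin of the factor
`α^{-1/2}`.  The remaining part is a multiple of `η`.  The translation mode `∂ₓQ`, corrected to be
admissible, shows that the minimum of the Hessian is `O(α)`, hence smaller than `c`, whereas on a
slowly varying function the Hessian acts as multiplication by `c` up to a bounded error.  The
Euler–Lagrange equation then bounds the pairing of `η` with such a function uniformly in `α`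
(`exists_slow_pairing_const`).

For small `α` and `ξ` the system is a small perturbation of a triangular one, and solving it gives
the claim near each speed (`exists_modulationBound_ball`); compactness of `I` makes the constants
uniform.
-/

noncomputable section
namespace BKdV

/-! ### Exponential weights -/

/-- The weight `e^{-β|x|}`. -/
def ew (β x : ℝ) : ℝ := Real.exp (-(β * |x|))

theorem ew_pos (β x : ℝ) : 0 < ew β x := Real.exp_pos _

theorem ew_nonneg (β x : ℝ) : 0 ≤ ew β x := (ew_pos β x).le

theorem ew_le_one {β : ℝ} (h : 0 ≤ β) (x : ℝ) : ew β x ≤ 1 :=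
  Real.exp_le_one_iff.2 (by have := abs_nonneg x; nlinarith)

theorem ew_anti {β β' : ℝ} (h : β ≤ β') (x : ℝ) : ew β' x ≤ ew β x :=
  Real.exp_le_exp.2 (by have := abs_nonneg x; nlinarith)

theorem ew_mul (β β' x : ℝ) : ew β x * ew β' x = ew (β + β') x := by
  rw [ew, ew, ew, ← Real.exp_add]; congr 1; ring

theorem ew_neg (β x : ℝ) : ew β (-x) = ew β x := by rw [ew, ew, abs_neg]

theorem continuous_ew (β : ℝ) : Continuous (ew β) := by unfold ew; fun_prop

/-- Moving the argument by `d` costs a factor `e^{β|d|}`. -/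
theorem ew_shift_le {β : ℝ} (h : 0 ≤ β) (x y : ℝ) :
    ew β y ≤ Real.exp (β * |x - y|) * ew β x := by
  rw [ew, ew, ← Real.exp_add]
  refine Real.exp_le_exp.2 ?_
  have h1 : |x| ≤ |x - y| + |y| := by simpa using abs_add_le (x - y) y
  nlinarith

theorem integral_ew {β : ℝ} (h : 0 < β) : ∫ x, ew β x = 2 / β := by
  have := integral_comp_abs (f := fun x => Real.exp (-β * x))
  simp only [ew]
  rw [show (fun x : ℝ => Real.exp (-(β * |x|))) = fun x => Real.exp (-β * |x|) by
    ext x; ring_nf, this, integral_exp_mul_Ioi (by linarith)]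
  simp; field_simp

theorem integrable_ew {β : ℝ} (h : 0 < β) : Integrable (ew β) := by
  by_contra hc
  have h1 := integral_ew h
  rw [integral_undef hc] at h1
  have : 0 < 2 / β := by positivity
  linarith

theorem integral_ew_sub {β : ℝ} (h : 0 < β) (a : ℝ) : ∫ x, ew β (x - a) = 2 / β := by
  rw [integral_sub_right_eq_self (ew β), integral_ew h]

theorem integrable_ew_sub {β : ℝ} (h : 0 < β) (a : ℝ) : Integrable fun x => ew β (x - a) :=
  (integrable_ew h).comp_sub_right a

/-- A polynomial factor is absorbed by half of the decay rate. -/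
theorem abs_mul_ew_le {β : ℝ} (h : 0 < β) (x : ℝ) : |x| * ew β x ≤ 2 / β * ew (β / 2) x := by
  have h1 : ew β x = ew (β / 2) x * ew (β / 2) x := by rw [ew_mul]; congr 1; ring
  have h2 : |x| * ew (β / 2) x ≤ 2 / β := by
    have h3 := Real.add_one_le_exp (β / 2 * |x|)
    have h4 : ew (β / 2) x * Real.exp (β / 2 * |x|) = 1 := by
      rw [ew, ← Real.exp_add]; simp
    have h5 : β / 2 * |x| * ew (β / 2) x ≤ 1 := by
      have := ew_pos (β / 2) x
      nlinarith
    rw [le_div_iff₀ h]; linarith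
  rw [h1, ← mul_assoc]
  exact mul_le_mul_of_nonneg_right h2 (ew_nonneg _ _)

theorem sq_mul_ew_le {β : ℝ} (h : 0 < β) (x : ℝ) :
    |x| ^ 2 * ew β x ≤ 8 / β ^ 2 * ew (β / 4) x := by
  have h1 := abs_mul_ew_le h x
  have h2 := abs_mul_ew_le (half_pos h) x
  rw [show β / 2 / 2 = β / 4 by ring] at h2
  calc |x| ^ 2 * ew β x = |x| * (|x| * ew β x) := by ring
    _ ≤ |x| * (2 / β * ew (β / 2) x) := by gcongr
    _ = 2 / β * (|x| * ew (β / 2) x) := by ring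
    _ ≤ 2 / β * (2 / (β / 2) * ew (β / 4) x) := by gcongr
    _ = _ := by field_simp; ring

section Decay

variable {g : ℝ → ℝ} {B β a : ℝ}

theorem integrable_of_ew (hβ : 0 < β) (hm : AEStronglyMeasurable g volume)
    (h : ∀ x, |g x| ≤ B * ew β (x - a)) : Integrable g :=
  ((integrable_ew_sub hβ a).const_mul B).mono' hm (ae_of_all _ h)

theorem abs_integral_le_of_ew (hβ : 0 < β) (h : ∀ x, |g x| ≤ B * ew β (x - a)) :
    |∫ x, g x| ≤ B * (2 / β) := by
  have := norm_integral_le_of_norm_le (f := g) ((integrable_ew_sub hβ a).const_mul B)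
    (ae_of_all _ h)
  rwa [integral_const_mul, integral_ew_sub hβ] at this

theorem nonneg_of_ew (h : ∀ x, |g x| ≤ B * ew β (x - a)) : 0 ≤ B := by
  have h1 := (abs_nonneg _).trans (h a)
  exact nonneg_of_mul_nonneg_left h1 (ew_pos _ _)

theorem sq_le_of_ew (h : ∀ x, |g x| ≤ B * ew β (x - a)) (x : ℝ) :
    g x ^ 2 ≤ B ^ 2 * ew (2 * β) (x - a) := by
  have h1 := pow_le_pow_left₀ (abs_nonneg _) (h x) 2
  rw [sq_abs] at h1
  refine h1.trans (le_of_eq ?_)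
  rw [mul_pow, sq (ew β _), ew_mul]; congr 2; ring

theorem memLp_of_ew (hβ : 0 < β) (hm : AEStronglyMeasurable g volume)
    (h : ∀ x, |g x| ≤ B * ew β (x - a)) : MemLp g 2 volume := by
  rw [memLp_two_iff_integrable_sq hm]
  refine integrable_of_ew (B := B ^ 2) (β := 2 * β) (a := a) (by positivity) (hm.pow 2) fun x => ?_
  rw [abs_of_nonneg (sq_nonneg _)]
  exact sq_le_of_ew h x

theorem integral_sq_le_of_ew (hβ : 0 < β) (h : ∀ x, |g x| ≤ B * ew β (x - a)) :
    ∫ x, g x ^ 2 ≤ B ^ 2 / β := by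
  have h2 : (0:ℝ) < 2 * β := by positivity
  have := abs_integral_le_of_ew (g := fun x => g x ^ 2) (B := B ^ 2) h2 (a := a) (fun x => by
    rw [abs_of_nonneg (sq_nonneg _)]
    exact sq_le_of_ew h x)
  refine (le_abs_self _).trans (this.trans (le_of_eq ?_))
  field_simp

end Decay

/-! ### Pairings in `L²` -/

/-- Cauchy–Schwarz for the raw pairing. -/
theorem abs_ip_le {v g : ℝ → ℝ} (hv : MemLp v 2 volume) (hg : MemLp g 2 volume) :
    |ip v g| ≤ √(∫ x, v x ^ 2) * √(∫ x, g x ^ 2) := by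
  have e : ∀ {p r : ℝ → ℝ} (hp : MemLp p 2 volume) (hr : MemLp r 2 volume),
      inner ℝ (hp.toLp p) (hr.toLp r) = ∫ x, p x * r x := by
    intro p r hp hr
    rw [L2.inner_def]
    refine integral_congr_ae ?_
    filter_upwards [hp.coeFn_toLp, hr.coeFn_toLp] with x h1 h2
    rw [h1, h2]; simp [mul_comm]
  have n : ∀ {p : ℝ → ℝ} (hp : MemLp p 2 volume), ‖hp.toLp p‖ = √(∫ x, p x ^ 2) := by
    intro p hp
    rw [norm_eq_sqrt_real_inner, e hp hp]; simp only [sq]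
  rw [ip, ← e hv hg, ← n hv, ← n hg]
  exact abs_real_inner_le_norm _ _

theorem integral_sq_L2 (v : L2) : ∫ x, v x ^ 2 = ‖v‖ ^ 2 := by
  rw [← real_inner_self_eq_norm_sq, L2.inner_def]
  simp [sq]

theorem abs_ip_L2_le (v : L2) {g : ℝ → ℝ} (hg : MemLp g 2 volume) :
    |∫ x, v x * g x| ≤ ‖v‖ * √(∫ x, g x ^ 2) := by
  have := abs_ip_le (Lp.memLp v) hg
  rwa [integral_sq_L2, Real.sqrt_sq (norm_nonneg _)] at this

theorem abs_ip_L2_le_of_ew (v : L2) {g : ℝ → ℝ} {B β a : ℝ} (hβ : 0 < β)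
    (hm : AEStronglyMeasurable g volume) (h : ∀ x, |g x| ≤ B * ew β (x - a)) :
    |∫ x, v x * g x| ≤ ‖v‖ * (B / √β) := by
  refine (abs_ip_L2_le v (memLp_of_ew hβ hm h)).trans ?_
  gcongr
  rw [← Real.sqrt_sq (nonneg_of_ew h), ← Real.sqrt_div (sq_nonneg _)]
  exact Real.sqrt_le_sqrt (integral_sq_le_of_ew hβ h)

theorem ip_congr {v v' g g' : ℝ → ℝ} (h : v =ᵐ[volume] v') (h' : g =ᵐ[volume] g') :
    ip v g = ip v' g' := by
  refine integral_congr_ae ?_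
  filter_upwards [h, h'] with x h1 h2
  rw [h1, h2]

theorem ip_comm (v g : ℝ → ℝ) : ip v g = ip g v := by simp only [ip, mul_comm]

/-! ### Elements of `H¹` -/

theorem H1.memLp_fn (v : H1) : MemLp v.fn 2 volume := Lp.memLp _

theorem H1.memLp_dx (v : H1) : MemLp v.dx 2 volume := Lp.memLp _

theorem H1.norm_sq (v : H1) : ‖v‖ ^ 2 = ‖v.1.fst‖ ^ 2 + ‖v.1.snd‖ ^ 2 := by
  rw [Submodule.coe_norm, WithLp.prod_norm_sq_eq_of_L2]

theorem H1.norm_fst_le (v : H1) : ‖v.1.fst‖ ≤ ‖v‖ := by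
  refine abs_le_of_sq_le_sq' ?_ (norm_nonneg _) |>.2
  rw [v.norm_sq]; nlinarith [sq_nonneg ‖v.1.snd‖]

theorem H1.norm_snd_le (v : H1) : ‖v.1.snd‖ ≤ ‖v‖ := by
  refine abs_le_of_sq_le_sq' ?_ (norm_nonneg _) |>.2
  rw [v.norm_sq]; nlinarith [sq_nonneg ‖v.1.fst‖]

theorem H1.ip_self (v : H1) : ip v.fn v.fn = ‖v.1.fst‖ ^ 2 := by
  rw [← integral_sq_L2]; simp only [ip, sq]; rfl

theorem H1.fn_add (v w : H1) : (v + w).fn =ᵐ[volume] fun x => v.fn x + w.fn x :=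
  Lp.coeFn_add _ _

theorem H1.fn_sub (v w : H1) : (v - w).fn =ᵐ[volume] fun x => v.fn x - w.fn x :=
  Lp.coeFn_sub _ _

theorem H1.fn_smul (r : ℝ) (v : H1) : (r • v).fn =ᵐ[volume] fun x => r * v.fn x :=
  Lp.coeFn_smul _ _

theorem H1.dx_sub (v w : H1) : (v - w).dx =ᵐ[volume] fun x => v.dx x - w.dx x :=
  Lp.coeFn_sub _ _

theorem H1.abs_ip_le (v : H1) {g : ℝ → ℝ} {B β a : ℝ} (hβ : 0 < β)
    (hm : AEStronglyMeasurable g volume) (h : ∀ x, |g x| ≤ B * ew β (x - a)) :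
    |ip v.fn g| ≤ ‖v‖ * (B / √β) := by
  refine (abs_ip_L2_le_of_ew v.1.fst hβ hm h).trans ?_
  have := nonneg_of_ew h
  gcongr
  exact v.norm_fst_le

/-- The `H¹` element given by a classical function whose derivative is square integrable. -/
def mkH1 (g g' : ℝ → ℝ) (hd : ∀ x, HasDerivAt g (g' x) x) (h : MemLp g 2 volume)
    (h' : MemLp g' 2 volume) : H1 :=
  ⟨WithLp.toLp 2 (h.toLp g, h'.toLp g'), by
    intro φ hφ
    have e : ∀ {p ψ : ℝ → ℝ} (hp : MemLp p 2 volume),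
        ∫ x, (hp.toLp p) x * ψ x = ∫ x, p x * ψ x := by
      intro p ψ hp
      refine integral_congr_ae ?_
      filter_upwards [hp.coeFn_toLp] with x h1
      rw [h1]
    change ∫ x, (h.toLp g) x * deriv φ x = -∫ x, (h'.toLp g') x * φ x
    rw [e, e]
    refine integral_mul_deriv_eq_deriv_mul_of_integrable (fun x _ => hd x)
      (fun x _ => ((hφ.1.differentiable (by simp)) x).hasDerivAt) ?_ ?_ ?_
    · exact h.integrable_mul hφ.deriv.memLp
    · exact h'.integrable_mul hφ.memLp
    · exact h.integrable_mul hφ.memLp⟩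

section mkH1
variable {g g' : ℝ → ℝ} (hd : ∀ x, HasDerivAt g (g' x) x) (h : MemLp g 2 volume)
    (h' : MemLp g' 2 volume)

theorem mkH1_fn : (mkH1 g g' hd h h').fn =ᵐ[volume] g := h.coeFn_toLp

theorem mkH1_dx : (mkH1 g g' hd h h').dx =ᵐ[volume] g' := h'.coeFn_toLp

end mkH1

/-! ### Maximum principle and exponential decay for second order equations -/

/-- Maximum principle on a half-line. -/
theorem nonpos_of_deriv2_pos {Y Y1 Y2 : ℝ → ℝ} {R : ℝ} (h1 : ∀ x, HasDerivAt Y (Y1 x) x)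
    (h2 : ∀ x, HasDerivAt Y1 (Y2 x) x) (hR : Y R ≤ 0) (hlim : Tendsto Y atTop (𝓝 0))
    (hpos : ∀ x > R, 0 < Y x → 0 < Y2 x) : ∀ x ≥ R, Y x ≤ 0 := by
  intro x0 hx0
  by_contra! hc
  obtain ⟨X, hX⟩ := eventually_atTop.1 (hlim.eventually (gt_mem_nhds hc))
  have hcont : Continuous Y := continuous_iff_continuousAt.2 fun x => (h1 x).continuousAt
  set N := max X (x0 + 1) with hN
  obtain ⟨x1, hx1, hmax⟩ := (isCompact_Icc (a := R) (b := N)).exists_isMaxOn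
    ⟨x0, hx0, by rw [hN]; exact le_max_of_le_right (by linarith)⟩ hcont.continuousOn
  have hge : Y x0 ≤ Y x1 :=
    hmax ⟨hx0, by rw [hN]; exact le_max_of_le_right (by linarith)⟩
  have hR1 : R < x1 := lt_of_le_of_ne hx1.1 (by rintro rfl; linarith)
  have hN1 : x1 < N := lt_of_le_of_ne hx1.2 (by
    intro h
    have := hX x1 (by rw [h]; exact le_max_left _ _)
    linarith)
  have hloc : IsLocalMax Y x1 := hmax.isLocalMax (Icc_mem_nhds hR1 hN1)
  have e1 : deriv Y = Y1 := funext fun x => (h1 x).deriv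
  have e2 : deriv (deriv Y) x1 = Y2 x1 := by rw [e1]; exact (h2 x1).deriv
  have p2 : 0 < Y2 x1 := hpos x1 hR1 (hc.trans_le hge)
  have hmin : IsLocalMin Y x1 :=
    isLocalMin_of_deriv_deriv_pos (by rw [e2]; exact p2) hloc.deriv_eq_zero hcont.continuousAt
  -- a point that is both a local maximum and a local minimum is one of local constancy
  have hconst : Y =ᶠ[𝓝 x1] fun _ => Y x1 := by
    filter_upwards [hloc, hmin] with y hy1 hy2 using le_antisymm hy1 hy2
  have : deriv (deriv Y) x1 = 0 := by
    rw [hconst.deriv.deriv_eq]; simp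
  linarith

/-- Comparison with an exponential: solutions of `D'' = p D + O(e^{-γx})`, `p ≥ p₀ ≥ 2γ²`, that
vanish at infinity decay at rate `γ`. -/
theorem le_exp_of_ode {D D1 D2 : ℝ → ℝ} {R γ p0 S A : ℝ} (h1 : ∀ x, HasDerivAt D (D1 x) x)
    (h2 : ∀ x, HasDerivAt D1 (D2 x) x) (hγ : 0 < γ) (hγp : γ ^ 2 ≤ p0 / 2) (hp0 : 0 < p0)
    (hS : ∀ x > R, ∃ p ≥ p0, |D2 x - p * D x| ≤ S * Real.exp (-γ * x))
    (hlim : Tendsto D atTop (𝓝 0)) (hR : D R ≤ A * Real.exp (-γ * R)) (hA0 : 0 ≤ A)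
    (hA : 2 * S / p0 ≤ A) : ∀ x ≥ R, D x ≤ A * Real.exp (-γ * x) := by
  have he : ∀ x, HasDerivAt (fun x => Real.exp (-γ * x)) (-γ * Real.exp (-γ * x)) x := by
    intro x
    have := ((hasDerivAt_id x).const_mul (-γ)).exp
    simpa [mul_comm] using this
  have hexp : Tendsto (fun x => Real.exp (-γ * x)) atTop (𝓝 0) := by
    refine Real.tendsto_exp_atBot.comp ?_
    exact Tendsto.const_mul_atTop_of_neg (by linarith) tendsto_id
  have key := nonpos_of_deriv2_pos (R := R) (Y := fun x => D x - A * Real.exp (-γ * x))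
    (Y1 := fun x => D1 x - A * (-γ * Real.exp (-γ * x)))
    (Y2 := fun x => D2 x - A * (-γ * (-γ * Real.exp (-γ * x))))
    (fun x => (h1 x).sub ((he x).const_mul A))
    (fun x => (h2 x).sub (((he x).const_mul (-γ)).const_mul A)) (by linarith)
    (by simpa using hlim.sub (hexp.const_mul A)) ?_
  · intro x hx
    have := key x hx
    linarith
  · intro x hx hpos
    obtain ⟨p, hp, hb⟩ := hS x hx
    have hE := Real.exp_pos (-γ * x)
    set E := Real.exp (-γ * x)
    have hb' := (abs_le.1 hb).1
    have hS' : S ≤ A * (p0 / 2) := by rw [div_le_iff₀ hp0] at hA; linarith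
    have t1 : 0 < p * (D x - A * E) := mul_pos (by linarith) hpos
    have t2 : p0 * (A * E) ≤ p * (A * E) := by gcongr
    have t3 : γ ^ 2 * (A * E) ≤ p0 / 2 * (A * E) := by gcongr
    have t4 : S * E ≤ A * (p0 / 2) * E := by gcongr
    nlinarith

/-- Two-sided exponential decay for even functions solving `D'' = p D + O(e^{-γ|x|})` outside
`[-R, R]`; the bound is linear in the data. -/
theorem decay_of_ode {D D1 D2 : ℝ → ℝ} {R γ p0 S B : ℝ} (h1 : ∀ x, HasDerivAt D (D1 x) x)
    (h2 : ∀ x, HasDerivAt D1 (D2 x) x) (heven : ∀ x, D (-x) = D x) (hR : 0 ≤ R) (hγ : 0 < γ)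
    (hγp : γ ^ 2 ≤ p0 / 2) (hp0 : 0 < p0) (hS0 : 0 ≤ S)
    (hS : ∀ x > R, ∃ p ≥ p0, |D2 x - p * D x| ≤ S * ew γ x)
    (hlim : Tendsto D atTop (𝓝 0)) (hB : ∀ x ∈ Icc 0 R, |D x| ≤ B) :
    ∀ x, |D x| ≤ (B * Real.exp (γ * R) + 2 * S / p0) * ew γ x := by
  set A := B * Real.exp (γ * R) + 2 * S / p0 with hA
  have hB0 : 0 ≤ B := (abs_nonneg _).trans (hB 0 ⟨le_rfl, hR⟩)
  have hS1 : 0 ≤ 2 * S / p0 := by positivity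
  have hBE : 0 ≤ B * Real.exp (γ * R) := by positivity
  have hA0 : 0 ≤ A := add_nonneg hBE hS1
  have hA1 : 2 * S / p0 ≤ A := le_add_of_nonneg_left hBE
  have hew : ∀ x, 0 ≤ x → ew γ x = Real.exp (-γ * x) := by
    intro x hx
    rw [ew, abs_of_nonneg hx, neg_mul]
  have hin : ∀ x ∈ Icc 0 R, |D x| ≤ A * ew γ x := by
    intro x hx
    refine (hB x hx).trans ?_
    have : 1 ≤ Real.exp (γ * R) * ew γ x := by
      rw [hew x hx.1, ← Real.exp_add]
      refine Real.one_le_exp ?_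
      nlinarith [hx.2]
    calc B ≤ B * (Real.exp (γ * R) * ew γ x) := le_mul_of_one_le_right hB0 this
      _ = B * Real.exp (γ * R) * ew γ x := by ring
      _ ≤ A * ew γ x := by
        gcongr
        exacts [ew_nonneg _ _, le_add_of_nonneg_right hS1]
  have hRR := hin R ⟨hR, le_rfl⟩
  rw [hew R hR] at hRR
  have hS' : ∀ x > R, ∃ p ≥ p0, |D2 x - p * D x| ≤ S * Real.exp (-γ * x) := by
    intro x hx
    rw [← hew x (hR.trans hx.le)]; exact hS x hx
  have hout : ∀ x ≥ R, |D x| ≤ A * ew γ x := by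
    intro x hx
    rw [hew x (hR.trans hx), abs_le]
    constructor
    · have := le_exp_of_ode (D := fun x => -D x) (fun x => (h1 x).neg) (fun x => (h2 x).neg) hγ hγp
        hp0 (R := R) (S := S) (A := A) (fun x hx => by
          obtain ⟨p, hp, hb⟩ := hS' x hx
          refine ⟨p, hp, ?_⟩
          rw [← abs_neg]; convert hb using 2; ring)
        (by simpa using hlim.neg) (neg_le.1 (neg_le_of_abs_le hRR)) hA0 hA1 x hx
      linarith
    · exact le_exp_of_ode h1 h2 hγ hγp hp0 hS' hlim (le_of_abs_le hRR) hA0 hA1 x hx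
  have hpos : ∀ x, 0 ≤ x → |D x| ≤ A * ew γ x := by
    intro x hx
    rcases le_total x R with h | h
    · exact hin x ⟨hx, h⟩
    · exact hout x h
  intro x
  rcases le_total 0 x with h | h
  · exact hpos x h
  · rw [← heven, ← ew_neg]; exact hpos (-x) (by linarith)

/-- A bound for the first derivative from bounds for the function and its second derivative. -/
theorem abs_deriv_le_of_abs_le {g g1 g2 : ℝ → ℝ} (h1 : ∀ x, HasDerivAt g (g1 x) x)
    (h2 : ∀ x, HasDerivAt g1 (g2 x) x) {x A : ℝ} (hg : ∀ y ∈ Icc x (x + 1), |g y| ≤ A)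
    (hg2 : ∀ y ∈ Icc x (x + 1), |g2 y| ≤ A) : |g1 x| ≤ 3 * A := by
  obtain ⟨ξ, hξ, e⟩ := exists_hasDerivAt_eq_slope g g1 (show x < x + 1 by linarith)
    (fun y _ => (h1 y).continuousAt.continuousWithinAt) (fun y _ => h1 y)
  have hA : 0 ≤ A := (abs_nonneg _).trans (hg x ⟨le_rfl, by linarith⟩)
  have b1 : |g1 ξ| ≤ 2 * A := by
    rw [e, show x + 1 - x = 1 by ring, div_one]
    have := hg x ⟨le_rfl, by linarith⟩
    have := hg (x + 1) ⟨by linarith, le_rfl⟩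
    have := abs_sub (g (x + 1)) (g x)
    linarith
  have b2 : |g1 x - g1 ξ| ≤ A := by
    have := (convex_Icc x (x + 1)).norm_image_sub_le_of_norm_hasDerivWithin_le
      (fun y _ => (h2 y).hasDerivWithinAt) hg2 (Ioo_subset_Icc_self hξ)
      (⟨le_rfl, by linarith⟩ : x ∈ Icc x (x + 1))
    refine this.trans ?_
    rw [Real.norm_eq_abs, abs_sub_comm, abs_of_pos (by linarith [hξ.1])]
    nlinarith [hξ.2]
  have := abs_add_le (g1 x - g1 ξ) (g1 ξ)
  rw [sub_add_cancel] at this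
  linarith

theorem abs_deriv_le_of_ew {g g1 g2 : ℝ → ℝ} (h1 : ∀ x, HasDerivAt g (g1 x) x)
    (h2 : ∀ x, HasDerivAt g1 (g2 x) x) {γ M : ℝ} (hγ : 0 ≤ γ) (hg : ∀ x, |g x| ≤ M * ew γ x)
    (hg2 : ∀ x, |g2 x| ≤ M * ew γ x) (x : ℝ) : |g1 x| ≤ 3 * (M * Real.exp γ) * ew γ x := by
  have hM : 0 ≤ M := nonneg_of_mul_nonneg_left ((abs_nonneg _).trans (hg 0)) (ew_pos _ _)
  have hs : ∀ y ∈ Icc x (x + 1), M * ew γ y ≤ M * Real.exp γ * ew γ x := by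
    intro y hy
    rw [mul_assoc]
    gcongr
    refine (ew_shift_le hγ x y).trans ?_
    gcongr
    · exact ew_nonneg _ _
    · have : |x - y| ≤ 1 := by rw [abs_le]; constructor <;> linarith [hy.1, hy.2]
      nlinarith
  have := abs_deriv_le_of_abs_le h1 h2 (x := x) (A := M * Real.exp γ * ew γ x)
    (fun y hy => (hg y).trans (hs y hy)) (fun y hy => (hg2 y).trans (hs y hy))
  linarith

/-! ### A single solitary wave -/

section Wave

variable {f : ℝ → ℝ} {c : ℝ} {q : ℝ → ℝ}

theorem IsNonlinearity.contDiff_three (hf : IsNonlinearity f) : ContDiff ℝ 3 f := by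
  obtain ⟨k, hk, h, -⟩ := hf.smooth
  exact h.of_le (by exact_mod_cast hk)

theorem IsNonlinearity.hasDerivAt (hf : IsNonlinearity f) (s : ℝ) :
    HasDerivAt f (deriv f s) s :=
  ((hf.contDiff_three.differentiable (by norm_num)) s).hasDerivAt

theorem IsNonlinearity.continuous (hf : IsNonlinearity f) : Continuous f :=
  hf.contDiff_three.continuous

theorem IsNonlinearity.contDiff_deriv (hf : IsNonlinearity f) : ContDiff ℝ 2 (deriv f) := by
  have h : ContDiff ℝ (2 + 1) f := by norm_num; exact hf.contDiff_three
  exact (contDiff_succ_iff_deriv.1 h).2.2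

theorem IsNonlinearity.contDiff_deriv2 (hf : IsNonlinearity f) :
    ContDiff ℝ 1 (deriv (deriv f)) := by
  have h : ContDiff ℝ (1 + 1) (deriv f) := by norm_num; exact hf.contDiff_deriv
  exact (contDiff_succ_iff_deriv.1 h).2.2

theorem IsNonlinearity.hasDerivAt_deriv (hf : IsNonlinearity f) (s : ℝ) :
    HasDerivAt (deriv f) (deriv (deriv f) s) s :=
  ((hf.contDiff_deriv.differentiable (by norm_num)) s).hasDerivAt

theorem IsSolitaryWave.hasDerivAt (hq : IsSolitaryWave f c q) (x : ℝ) :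
    HasDerivAt q (deriv q x) x :=
  ((hq.contDiff.differentiable (by norm_num)) x).hasDerivAt

theorem IsSolitaryWave.hasDerivAt_deriv (hq : IsSolitaryWave f c q) (x : ℝ) :
    HasDerivAt (deriv q) (c * q x - f (q x)) x := by
  have h : ContDiff ℝ (1 + 1) q := by norm_num; exact hq.contDiff
  have h1 := (((contDiff_succ_iff_deriv.1 h).2.2.differentiable (by norm_num)) x).hasDerivAt
  have h2 := hq.equation x
  rw [iteratedDeriv_succ, iteratedDeriv_one] at h2
  exact h1.congr_deriv (by linarith)

theorem IsSolitaryWave.tendsto_atTop (hq : IsSolitaryWave f c q) : Tendsto q atTop (𝓝 0) :=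
  hq.decay.mono_left atTop_le_cocompact

theorem IsSolitaryWave.tendsto_deriv (hf : IsNonlinearity f) (hq : IsSolitaryWave f c q) :
    Tendsto (deriv q) atTop (𝓝 0) := by
  have h2 : Tendsto (fun x => c * q x - f (q x)) atTop (𝓝 0) := by
    have := (hq.tendsto_atTop.const_mul c).sub
      ((hf.continuous.tendsto 0).comp hq.tendsto_atTop)
    simpa [hf.zero] using this
  rw [Metric.tendsto_atTop]
  intro ε hε
  obtain ⟨N1, hN1⟩ := Metric.tendsto_atTop.1 hq.tendsto_atTop (ε / 4) (by positivity)
  obtain ⟨N2, hN2⟩ := Metric.tendsto_atTop.1 h2 (ε / 4) (by positivity)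
  refine ⟨max N1 N2, fun x hx => ?_⟩
  have := abs_deriv_le_of_abs_le hq.hasDerivAt hq.hasDerivAt_deriv (x := x) (A := ε / 4)
    (fun y hy => by
      have := hN1 y ((le_max_left _ _).trans (hx.le.trans hy.1))
      rw [dist_zero_right] at this; exact this.le)
    (fun y hy => by
      have := hN2 y ((le_max_right _ _).trans (hx.le.trans hy.1))
      rw [dist_zero_right] at this; exact this.le)
  rw [dist_zero_right, Real.norm_eq_abs]
  linarith

/-- Conservation of energy: `q'² = c q² - 2 F(q)` with `F' = f`, `F(0) = 0`. -/
theorem IsSolitaryWave.energy (hf : IsNonlinearity f) (hq : IsSolitaryWave f c q) (x : ℝ) :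
    deriv q x ^ 2 = c * q x ^ 2 - 2 * ∫ s in (0 : ℝ)..q x, f s := by
  have hF : ∀ s, HasDerivAt (fun s => ∫ r in (0 : ℝ)..s, f r) (f s) s := fun s =>
    intervalIntegral.integral_hasDerivAt_right (hf.continuous.intervalIntegrable _ _)
      (hf.continuous.stronglyMeasurableAtFilter _ _) hf.continuous.continuousAt
  set H : ℝ → ℝ := fun x => deriv q x ^ 2 - c * q x ^ 2 + 2 * ∫ s in (0 : ℝ)..q x, f s with hH
  have hd : ∀ x, HasDerivAt H 0 x := by
    intro x
    have e := (((hq.hasDerivAt_deriv x).pow 2).sub (((hq.hasDerivAt x).pow 2).const_mul c)).add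
      (((hF (q x)).comp x (hq.hasDerivAt x)).const_mul 2)
    refine e.congr_deriv ?_
    simp; ring
  have hconst : ∀ x y, H x = H y :=
    is_const_of_deriv_eq_zero (fun x => (hd x).differentiableAt) fun x => (hd x).deriv
  have hlim : Tendsto H atTop (𝓝 0) := by
    have hF0 : Tendsto (fun x => ∫ s in (0 : ℝ)..q x, f s) atTop (𝓝 0) := by
      have := ((hF 0).continuousAt.tendsto).comp hq.tendsto_atTop
      simpa [Function.comp_def] using this
    have := (((hq.tendsto_deriv hf).pow 2).sub ((hq.tendsto_atTop.pow 2).const_mul c)).add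
      (hF0.const_mul 2)
    simpa using this
  have : H x = 0 := by
    refine tendsto_nhds_unique ?_ hlim
    rw [show H = fun _ => H x from funext fun y => hconst y x]
    exact tendsto_const_nhds
  rw [hH] at this
  dsimp only at this
  linarith

/-- Once the profile is small and decreasing it stays small and decreasing: by conservation of
energy `q'` cannot vanish where `q` is small. -/
theorem IsSolitaryWave.lt_of_trapped (hf : IsNonlinearity f) (hq : IsSolitaryWave f c q)
    {ε k R : ℝ} (hk : k < c) (hsmall : ∀ s ∈ Icc 0 ε, |f s| ≤ k * s) (hR : q R < ε)
    (hR' : deriv q R < 0) : ∀ x ≥ R, q x < ε := by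
  have hcont : Continuous (deriv q) :=
    continuous_iff_continuousAt.2 fun x => (hq.hasDerivAt_deriv x).continuousAt
  have hneg : ∀ x ≥ R, deriv q x < 0 := by
    by_contra! hc
    obtain ⟨x, hxR, hx⟩ := hc
    have hne : (Icc R x ∩ {y | deriv q y = 0}).Nonempty := by
      obtain ⟨y, hy, hy0⟩ := intermediate_value_Icc hxR hcont.continuousOn
        (show (0 : ℝ) ∈ Icc (deriv q R) (deriv q x) from ⟨hR'.le, hx⟩)
      exact ⟨y, hy, hy0⟩
    obtain ⟨x1, ⟨hx1, hz⟩, hleast⟩ :=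
      (isCompact_Icc.inter_right (isClosed_eq hcont continuous_const)).exists_isLeast hne
    have hlt : ∀ y ∈ Ico R x1, deriv q y < 0 := by
      intro y hy
      by_contra! hy'
      obtain ⟨w, hw, hw0⟩ := intermediate_value_Icc hy.1 hcont.continuousOn
        (show (0 : ℝ) ∈ Icc (deriv q R) (deriv q y) from ⟨hR'.le, hy'⟩)
      have := hleast ⟨⟨hw.1, hw.2.trans (hy.2.le.trans hx1.2)⟩, hw0⟩
      linarith [hw.2, hy.2]
    have hanti : AntitoneOn q (Icc R x1) := by
      refine antitoneOn_of_deriv_nonpos (convex_Icc _ _) hq.contDiff.continuous.continuousOn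
        (hq.contDiff.differentiable (by norm_num)).differentiableOn fun y hy => ?_
      rw [interior_Icc] at hy
      exact (hlt y ⟨hy.1.le, hy.2⟩).le
    have hq1 : q x1 < ε :=
      (hanti ⟨le_rfl, hx1.1⟩ ⟨hx1.1, le_rfl⟩ hx1.1).trans_lt hR
    have hE := hq.energy hf x1
    have hp := hq.pos x1
    have hF : ∫ s in (0 : ℝ)..q x1, f s ≤ k * (q x1 ^ 2 / 2) := by
      have := intervalIntegral.integral_mono_on hp.le (hf.continuous.intervalIntegrable _ _)
        ((continuous_const.mul continuous_id).intervalIntegrable 0 (q x1) (μ := volume))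
        (g := fun s => k * s)
        (fun s hs => (le_abs_self _).trans (hsmall s ⟨hs.1, hs.2.trans hq1.le⟩))
      refine this.trans (le_of_eq ?_)
      rw [intervalIntegral.integral_const_mul, integral_id]; ring
    rw [show deriv q x1 = 0 from hz] at hE
    nlinarith [pow_pos hp 2]
  intro x hx
  have hanti : AntitoneOn q (Ici R) := by
    refine antitoneOn_of_deriv_nonpos (convex_Ici _) hq.contDiff.continuous.continuousOn
      (hq.contDiff.differentiable (by norm_num)).differentiableOn fun y hy => ?_
    rw [interior_Ici] at hy
    exact (hneg y hy.le).le
  exact (hanti self_mem_Ici hx hx).trans_lt hR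

theorem IsSolitaryWave.exists_trapped (hq : IsSolitaryWave f c q) {ε : ℝ} (hε : 0 < ε) :
    ∃ R > 0, q R < ε ∧ deriv q R < 0 := by
  obtain ⟨X, hX⟩ := eventually_atTop.1 (hq.tendsto_atTop.eventually (gt_mem_nhds hε))
  by_contra! hc
  set Y := max X 1
  have hmono : MonotoneOn q (Ici Y) := by
    refine monotoneOn_of_deriv_nonneg (convex_Ici _) hq.contDiff.continuous.continuousOn
      (hq.contDiff.differentiable (by norm_num)).differentiableOn fun y hy => ?_
    rw [interior_Ici] at hy
    have hy1 : Y < y := hy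
    exact hc y (lt_of_lt_of_le one_pos ((le_max_right X 1).trans hy1.le))
      (hX y ((le_max_left X 1).trans hy1.le))
  have h0 : q Y ≤ 0 := by
    refine ge_of_tendsto hq.tendsto_atTop ?_
    filter_upwards [eventually_ge_atTop Y] with x hx using hmono self_mem_Ici hx hx
  exact absurd (hq.pos Y) (not_lt.2 h0)

end Wave

/-! ### Partial derivatives of functions of speed and position -/

/-- The derivative `∂_c g` of a family in its parameter. -/
def dSpeed (g : ℝ → ℝ → ℝ) (c x : ℝ) : ℝ := deriv (fun c' => g c' x) c

/-- The derivative `∂_x g` of a family in the space variable. -/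
def dSpace (g : ℝ → ℝ → ℝ) (c x : ℝ) : ℝ := deriv (g c) x

theorem zetaN_apply (Q : ℝ → ℝ → ℝ) (c a x : ℝ) : zetaN Q c a x = dSpeed Q c (x - a) := rfl

section Partial

variable {g : ℝ → ℝ → ℝ} {O : Set ℝ}

theorem contDiffAt_of_prod {n : ℕ∞ω} (hO : IsOpen O)
    (h : ContDiffOn ℝ n (Function.uncurry g) (O ×ˢ univ)) {c : ℝ} (hc : c ∈ O) (x : ℝ) :
    ContDiffAt ℝ n (Function.uncurry g) (c, x) :=
  h.contDiffAt ((hO.prod isOpen_univ).mem_nhds ⟨hc, mem_univ x⟩)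

theorem hasDerivAt_speed_aux {c x : ℝ} (h : DifferentiableAt ℝ (Function.uncurry g) (c, x)) :
    HasDerivAt (fun c' => g c' x) (fderiv ℝ (Function.uncurry g) (c, x) (1, 0)) c := by
  have h1 : HasDerivAt (fun c' : ℝ => (c', x)) ((1 : ℝ), (0 : ℝ)) c :=
    (hasDerivAt_id c).prodMk (hasDerivAt_const c x)
  exact h.hasFDerivAt.comp_hasDerivAt c h1

theorem hasDerivAt_space_aux {c x : ℝ} (h : DifferentiableAt ℝ (Function.uncurry g) (c, x)) :
    HasDerivAt (g c) (fderiv ℝ (Function.uncurry g) (c, x) (0, 1)) x := by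
  have h1 : HasDerivAt (fun x' : ℝ => (c, x')) ((0 : ℝ), (1 : ℝ)) x :=
    (hasDerivAt_const x c).prodMk (hasDerivAt_id x)
  exact h.hasFDerivAt.comp_hasDerivAt x h1

theorem hasDerivAt_dSpeed {c x : ℝ} (h : DifferentiableAt ℝ (Function.uncurry g) (c, x)) :
    HasDerivAt (fun c' => g c' x) (dSpeed g c x) c :=
  (hasDerivAt_speed_aux h).differentiableAt.hasDerivAt

theorem hasDerivAt_dSpace {c x : ℝ} (h : DifferentiableAt ℝ (Function.uncurry g) (c, x)) :
    HasDerivAt (g c) (dSpace g c x) x :=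
  (hasDerivAt_space_aux h).differentiableAt.hasDerivAt

theorem fderiv_eq_dSpeed_dSpace {c x : ℝ}
    (h : DifferentiableAt ℝ (Function.uncurry g) (c, x)) :
    fderiv ℝ (Function.uncurry g) (c, x) = (ContinuousLinearMap.fst ℝ ℝ ℝ).smulRight
      (dSpeed g c x) + (ContinuousLinearMap.snd ℝ ℝ ℝ).smulRight (dSpace g c x) := by
  ext
  · simpa using (hasDerivAt_speed_aux h).unique (hasDerivAt_dSpeed h)
  · simpa using (hasDerivAt_space_aux h).unique (hasDerivAt_dSpace h)

theorem dSpeed_eqOn (hO : IsOpen O) (h : ContDiffOn ℝ 1 (Function.uncurry g) (O ×ˢ univ)) :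
    EqOn (Function.uncurry (dSpeed g))
      (fun p => fderiv ℝ (Function.uncurry g) p ((1 : ℝ), (0 : ℝ))) (O ×ˢ univ) := fun p hp =>
  (hasDerivAt_speed_aux ((contDiffAt_of_prod hO h hp.1 p.2).differentiableAt (by norm_num))).deriv

theorem dSpace_eqOn (hO : IsOpen O) (h : ContDiffOn ℝ 1 (Function.uncurry g) (O ×ˢ univ)) :
    EqOn (Function.uncurry (dSpace g))
      (fun p => fderiv ℝ (Function.uncurry g) p ((0 : ℝ), (1 : ℝ))) (O ×ˢ univ) := fun p hp =>
  (hasDerivAt_space_aux ((contDiffAt_of_prod hO h hp.1 p.2).differentiableAt (by norm_num))).deriv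

theorem contDiffOn_dSpeed {n : ℕ∞ω} (hO : IsOpen O)
    (h : ContDiffOn ℝ (n + 1) (Function.uncurry g) (O ×ˢ univ)) :
    ContDiffOn ℝ n (Function.uncurry (dSpeed g)) (O ×ˢ univ) := by
  have h1 := h.fderiv_of_isOpen (m := n) (hO.prod isOpen_univ) le_rfl
  exact (h1.clm_apply contDiffOn_const).congr (dSpeed_eqOn hO (h.of_le le_add_self))

theorem contDiffOn_dSpace {n : ℕ∞ω} (hO : IsOpen O)
    (h : ContDiffOn ℝ (n + 1) (Function.uncurry g) (O ×ˢ univ)) :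
    ContDiffOn ℝ n (Function.uncurry (dSpace g)) (O ×ˢ univ) := by
  have h1 := h.fderiv_of_isOpen (m := n) (hO.prod isOpen_univ) le_rfl
  exact (h1.clm_apply contDiffOn_const).congr (dSpace_eqOn hO (h.of_le le_add_self))

/-- Equality of mixed partial derivatives. -/
theorem dSpace_dSpeed (hO : IsOpen O) (h : ContDiffOn ℝ 2 (Function.uncurry g) (O ×ˢ univ))
    {c : ℝ} (hc : c ∈ O) (x : ℝ) : dSpace (dSpeed g) c x = dSpeed (dSpace g) c x := by
  have h2 := contDiffAt_of_prod hO h hc x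
  have hd : DifferentiableAt ℝ (fderiv ℝ (Function.uncurry g)) (c, x) :=
    (h2.fderiv_right (m := 1) (by norm_num)).differentiableAt (by norm_num)
  have hs := h2.isSymmSndFDerivAt (by simp)
  have hn : O ×ˢ (univ : Set ℝ) ∈ 𝓝 (c, x) := (hO.prod isOpen_univ).mem_nhds ⟨hc, mem_univ x⟩
  have h1 := h.of_le (m := 1) (by norm_num)
  have e1 : Function.uncurry (dSpeed g) =ᶠ[𝓝 (c, x)]
      fun p => fderiv ℝ (Function.uncurry g) p ((1 : ℝ), (0 : ℝ)) :=
    (dSpeed_eqOn hO h1).eventuallyEq_of_mem hn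
  have e2 : Function.uncurry (dSpace g) =ᶠ[𝓝 (c, x)]
      fun p => fderiv ℝ (Function.uncurry g) p ((0 : ℝ), (1 : ℝ)) :=
    (dSpace_eqOn hO h1).eventuallyEq_of_mem hn
  have f1 := (hd.hasFDerivAt.clm_apply (hasFDerivAt_const ((1 : ℝ), (0 : ℝ)) (c, x)))
  have f2 := (hd.hasFDerivAt.clm_apply (hasFDerivAt_const ((0 : ℝ), (1 : ℝ)) (c, x)))
  have g1 := (hasDerivAt_space_aux (f1.congr_of_eventuallyEq e1).differentiableAt).deriv
  have g2 := (hasDerivAt_speed_aux (f2.congr_of_eventuallyEq e2).differentiableAt).deriv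
  rw [dSpace, dSpeed, g1, g2, (f1.congr_of_eventuallyEq e1).fderiv,
    (f2.congr_of_eventuallyEq e2).fderiv]
  simp only [ContinuousLinearMap.comp_zero, zero_add, ContinuousLinearMap.flip_apply]
  exact hs _ _

end Partial

/-! ### The family of solitary waves -/

section Family

variable {f : ℝ → ℝ} {I₀ : Set ℝ} {Q : ℝ → ℝ → ℝ}

namespace IsSolitaryWaveFamily

variable (hQ : IsSolitaryWaveFamily f I₀ Q)
include hQ

theorem contDiffOn_speed : ContDiffOn ℝ 2 (Function.uncurry (dSpeed Q)) (I₀ ×ˢ univ) :=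
  contDiffOn_dSpeed hQ.isOpen (by norm_num; exact hQ.contDiffOn)

theorem contDiffOn_space : ContDiffOn ℝ 2 (Function.uncurry (dSpace Q)) (I₀ ×ˢ univ) :=
  contDiffOn_dSpace hQ.isOpen (by norm_num; exact hQ.contDiffOn)

theorem contDiffOn_speed2 :
    ContDiffOn ℝ 1 (Function.uncurry (dSpeed (dSpeed Q))) (I₀ ×ˢ univ) :=
  contDiffOn_dSpeed hQ.isOpen (by norm_num; exact hQ.contDiffOn_speed)

theorem contDiffOn_speed_space :
    ContDiffOn ℝ 1 (Function.uncurry (dSpace (dSpeed Q))) (I₀ ×ˢ univ) :=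
  contDiffOn_dSpace hQ.isOpen (by norm_num; exact hQ.contDiffOn_speed)

variable {c : ℝ} (hc : c ∈ I₀)
include hc

theorem differentiableAt (x : ℝ) : DifferentiableAt ℝ (Function.uncurry Q) (c, x) :=
  (contDiffAt_of_prod hQ.isOpen hQ.contDiffOn hc x).differentiableAt (by norm_num)

theorem differentiableAt_speed (x : ℝ) :
    DifferentiableAt ℝ (Function.uncurry (dSpeed Q)) (c, x) :=
  (contDiffAt_of_prod hQ.isOpen hQ.contDiffOn_speed hc x).differentiableAt (by norm_num)

theorem hasDerivAt (x : ℝ) : HasDerivAt (Q c) (dSpace Q c x) x :=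
  hasDerivAt_dSpace (hQ.differentiableAt hc x)

theorem hasDerivAt_space (x : ℝ) : HasDerivAt (dSpace Q c) (c * Q c x - f (Q c x)) x :=
  (hQ.wave c hc).hasDerivAt_deriv x

theorem hasDerivAt_zeta (x : ℝ) :
    HasDerivAt (dSpeed Q c) (dSpace (dSpeed Q) c x) x :=
  hasDerivAt_dSpace (hQ.differentiableAt_speed hc x)

/-- Differentiating the profile equation in the speed: `(-∂ₓ² + c - f'(Q_c)) ∂_c Q_c = -Q_c`. -/
theorem hasDerivAt_zeta_space (hf : IsNonlinearity f) (x : ℝ) :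
    HasDerivAt (dSpace (dSpeed Q) c)
      ((c - deriv f (Q c x)) * dSpeed Q c x + Q c x) x := by
  have e : dSpace (dSpeed Q) c = dSpeed (dSpace Q) c :=
    funext fun y => dSpace_dSpeed hQ.isOpen (hQ.contDiffOn.of_le (by norm_num)) hc y
  have hd : DifferentiableAt ℝ (Function.uncurry (dSpeed (dSpace Q))) (c, x) :=
    (contDiffAt_of_prod hQ.isOpen (contDiffOn_dSpeed (n := 1) hQ.isOpen
      (by norm_num; exact hQ.contDiffOn_space)) hc x).differentiableAt (by norm_num)
  rw [e]
  refine (hasDerivAt_dSpace hd).congr_deriv ?_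
  rw [dSpace_dSpeed hQ.isOpen hQ.contDiffOn_space hc]
  -- near `c` the function `∂ₓ² Q` is `c Q - f(Q)`
  have e2 : (fun c' => dSpace (dSpace Q) c' x) =ᶠ[𝓝 c] fun c' => c' * Q c' x - f (Q c' x) := by
    filter_upwards [hQ.isOpen.mem_nhds hc] with c' hc'
    exact (hQ.hasDerivAt_space hc' x).deriv
  have h1 := hasDerivAt_dSpeed (hQ.differentiableAt hc x)
  have h2 := ((hasDerivAt_id c).mul h1).sub ((hf.hasDerivAt (Q c x)).comp c h1)
  rw [dSpeed, e2.deriv_eq]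
  refine (HasDerivAt.deriv h2).trans ?_
  simp; ring

theorem speed_even (x : ℝ) : dSpeed Q c (-x) = dSpeed Q c x := by
  refine Filter.EventuallyEq.deriv_eq ?_
  filter_upwards [hQ.isOpen.mem_nhds hc] with c' hc'
  exact (hQ.wave c' hc').even x

end IsSolitaryWaveFamily

end Family

/-! ### Locally uniform decay of the profiles and of their speed derivatives -/

section Nonlinearity

variable {f : ℝ → ℝ}

theorem IsNonlinearity.exists_deriv_bound (hf : IsNonlinearity f) (A : ℝ) :
    ∃ K > 0, (∀ s ∈ Icc (-A) A, |deriv f s| ≤ K) ∧ ∀ s ∈ Icc (-A) A, |deriv (deriv f) s| ≤ K := by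
  obtain ⟨K1, h1⟩ := (isCompact_Icc (a := -A) (b := A)).exists_bound_of_continuousOn
    hf.contDiff_deriv.continuous.continuousOn
  obtain ⟨K2, h2⟩ := (isCompact_Icc (a := -A) (b := A)).exists_bound_of_continuousOn
    hf.contDiff_deriv2.continuous.continuousOn
  refine ⟨max (max K1 K2) 1, lt_max_of_lt_right one_pos, fun s hs => (h1 s hs).trans ?_,
    fun s hs => (h2 s hs).trans ?_⟩
  · exact (le_max_left _ _).trans (le_max_left _ _)
  · exact (le_max_right _ _).trans (le_max_left _ _)

theorem IsNonlinearity.lipschitz (hf : IsNonlinearity f) {A K : ℝ}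
    (hK : ∀ s ∈ Icc (-A) A, |deriv f s| ≤ K) {s r : ℝ} (hs : s ∈ Icc (-A) A)
    (hr : r ∈ Icc (-A) A) : |f s - f r| ≤ K * |s - r| :=
  (convex_Icc (-A) A).norm_image_sub_le_of_norm_hasDerivWithin_le
    (fun y _ => (hf.hasDerivAt y).hasDerivWithinAt) hK hr hs

theorem IsNonlinearity.deriv_lipschitz (hf : IsNonlinearity f) {A K : ℝ}
    (hK : ∀ s ∈ Icc (-A) A, |deriv (deriv f) s| ≤ K) {s r : ℝ} (hs : s ∈ Icc (-A) A)
    (hr : r ∈ Icc (-A) A) : |deriv f s - deriv f r| ≤ K * |s - r| :=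
  (convex_Icc (-A) A).norm_image_sub_le_of_norm_hasDerivWithin_le
    (fun y _ => (hf.hasDerivAt_deriv y).hasDerivWithinAt) hK hr hs

theorem IsNonlinearity.taylor (hf : IsNonlinearity f) {A K : ℝ}
    (hK : ∀ s ∈ Icc (-A) A, |deriv (deriv f) s| ≤ K) {s r : ℝ} (hs : s ∈ Icc (-A) A)
    (hr : r ∈ Icc (-A) A) : |f s - f r - deriv f r * (s - r)| ≤ K * (s - r) ^ 2 := by
  have hK0 : 0 ≤ K := (abs_nonneg _).trans (hK s hs)
  have hsub : uIcc r s ⊆ Icc (-A) A := uIcc_subset_Icc hr hs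
  have := (convex_uIcc r s).norm_image_sub_le_of_norm_hasDerivWithin_le
    (f := fun y => f y - deriv f r * y) (f' := fun y => deriv f y - deriv f r * 1)
    (C := K * |s - r|)
    (fun y _ => ((hf.hasDerivAt y).sub ((hasDerivAt_id y).const_mul _)).hasDerivWithinAt)
    (fun y hy => by
      rw [mul_one]
      refine (hf.deriv_lipschitz hK (hsub hy) hr).trans ?_
      exact mul_le_mul_of_nonneg_left (abs_sub_left_of_mem_uIcc hy) hK0) left_mem_uIcc
      right_mem_uIcc
  rw [Real.norm_eq_abs, Real.norm_eq_abs, mul_assoc, ← sq, sq_abs] at this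
  convert this using 2; ring

end Nonlinearity

/-- The second difference quotient converges to the second derivative. -/
theorem abs_le_of_second_difference {g g1 : ℝ → ℝ} {c v A : ℝ}
    (h1 : ∀ᶠ y in 𝓝 c, HasDerivAt g (g1 y) y) (h2 : HasDerivAt g1 v c)
    (hb : ∀ᶠ h in 𝓝[>] (0 : ℝ), |g (c + h) - 2 * g c + g (c - h)| ≤ A * h ^ 2) : |v| ≤ A := by
  have ta : Tendsto (fun h : ℝ => c + h) (𝓝[>] 0) (𝓝 c) := by
    have : Tendsto (fun h : ℝ => c + h) (𝓝 0) (𝓝 (c + 0)) :=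
      (continuous_const.add continuous_id).tendsto 0
    rw [add_zero] at this; exact this.mono_left nhdsWithin_le_nhds
  have ts : Tendsto (fun h : ℝ => c - h) (𝓝[>] 0) (𝓝 c) := by
    have : Tendsto (fun h : ℝ => c - h) (𝓝 0) (𝓝 (c - 0)) :=
      (continuous_const.sub continuous_id).tendsto 0
    rw [sub_zero] at this; exact this.mono_left nhdsWithin_le_nhds
  have hg : ContinuousAt g c := h1.self_of_nhds.continuousAt
  have hlim : Tendsto (fun h => (g (c + h) - 2 * g c + g (c - h)) / h ^ 2) (𝓝[>] 0) (𝓝 v) := by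
    refine HasDerivAt.lhopital_zero_nhdsGT (f' := fun h => g1 (c + h) - g1 (c - h))
      (g' := fun h => 2 * h) ?_ ?_ ?_ ?_ ?_ ?_
    · filter_upwards [ta.eventually h1, ts.eventually h1] with h ha hs
      have e1 : HasDerivAt (fun h => g (c + h)) (g1 (c + h)) h := by
        exact ha.comp_const_add c h
      have e2 : HasDerivAt (fun h => g (c - h)) (-g1 (c - h)) h := by
        exact hs.comp_const_sub c h
      exact ((e1.sub_const (2 * g c)).add e2).congr_deriv (by ring)
    · filter_upwards with h
      simpa using hasDerivAt_pow 2 h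
    · filter_upwards [self_mem_nhdsWithin] with h (hh : 0 < h)
      positivity
    · have := ((hg.tendsto.comp ta).sub_const (2 * g c)).add (hg.tendsto.comp ts)
      simpa [two_mul] using this
    · have : Tendsto (fun h : ℝ => h ^ 2) (𝓝 0) (𝓝 (0 ^ 2)) := (continuous_pow 2).tendsto 0
      rw [zero_pow two_ne_zero] at this
      exact this.mono_left nhdsWithin_le_nhds
    · have s1 : Tendsto (fun h : ℝ => h⁻¹ • (g1 (c + h) - g1 c)) (𝓝[>] 0) (𝓝 v) :=
        h2.tendsto_slope_zero.mono_left (nhdsWithin_mono _ fun x hx => ne_of_gt hx)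
      have s2 : Tendsto (fun h : ℝ => (-h)⁻¹ • (g1 (c + -h) - g1 c)) (𝓝[>] 0) (𝓝 v) := by
        refine h2.tendsto_slope_zero.comp (f := fun h : ℝ => -h) ?_
        refine tendsto_nhdsWithin_iff.2 ⟨?_, ?_⟩
        · have : Tendsto (fun h : ℝ => -h) (𝓝 0) (𝓝 (-0)) := continuous_neg.tendsto 0
          rw [neg_zero] at this; exact this.mono_left nhdsWithin_le_nhds
        · filter_upwards [self_mem_nhdsWithin] with h (hh : 0 < h)
          exact neg_ne_zero.2 hh.ne'
      have := (s1.add s2).div_const 2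
      rw [show (v + v) / 2 = v by ring] at this
      refine this.congr' ?_
      filter_upwards [self_mem_nhdsWithin] with h (hh : 0 < h)
      simp only [smul_eq_mul, ← sub_eq_add_neg]
      field_simp
      ring
  have habs := hlim.abs
  refine le_of_tendsto habs ?_
  filter_upwards [hb, self_mem_nhdsWithin] with h hh (hp : 0 < h)
  rw [abs_div, abs_of_pos (pow_pos hp 2), div_le_iff₀ (pow_pos hp 2)]
  exact hh

theorem second_difference_le {g g1 g2 : ℝ → ℝ} {c h B : ℝ} (hh : 0 ≤ h)
    (h1 : ∀ y ∈ Icc (c - h) (c + h), HasDerivAt g (g1 y) y)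
    (h2 : ∀ y ∈ Icc (c - h) (c + h), HasDerivAt g1 (g2 y) y)
    (hB : ∀ y ∈ Icc (c - h) (c + h), |g2 y| ≤ B) :
    |g (c + h) - 2 * g c + g (c - h)| ≤ 2 * B * h ^ 2 := by
  have hB0 : 0 ≤ B := (abs_nonneg _).trans (hB c ⟨by linarith, by linarith⟩)
  have hd : ∀ s ∈ Icc 0 h, HasDerivWithinAt (fun s => g (c + s) - 2 * g c + g (c - s))
      (g1 (c + s) - g1 (c - s)) (Icc 0 h) s := by
    intro s hs
    have e1 : HasDerivAt (fun h => g (c + h)) (g1 (c + s)) s := by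
      exact (h1 (c + s) ⟨by linarith [hs.1], by linarith [hs.2]⟩).comp_const_add c s
    have e2 : HasDerivAt (fun h => g (c - h)) (-g1 (c - s)) s := by
      exact (h1 (c - s) ⟨by linarith [hs.2], by linarith [hs.1]⟩).comp_const_sub c s
    exact (((e1.sub_const (2 * g c)).add e2).congr_deriv (by ring)).hasDerivWithinAt
  have hb : ∀ s ∈ Icc 0 h, ‖g1 (c + s) - g1 (c - s)‖ ≤ 2 * B * h := by
    intro s hs
    have := (convex_Icc (c - h) (c + h)).norm_image_sub_le_of_norm_hasDerivWithin_le
      (fun y hy => (h2 y hy).hasDerivWithinAt) hB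
      (⟨by linarith [hs.2], by linarith [hs.1]⟩ : c - s ∈ Icc (c - h) (c + h))
      (⟨by linarith [hs.1], by linarith [hs.2]⟩ : c + s ∈ Icc (c - h) (c + h))
    refine this.trans ?_
    rw [Real.norm_eq_abs, show c + s - (c - s) = 2 * s by ring, abs_of_nonneg (by linarith [hs.1])]
    nlinarith [hs.2]
  have := (convex_Icc 0 h).norm_image_sub_le_of_norm_hasDerivWithin_le hd hb
    (left_mem_Icc.2 hh) (right_mem_Icc.2 hh)
  simp only [add_zero, sub_zero, Real.norm_eq_abs, abs_of_nonneg hh] at this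
  calc |g (c + h) - 2 * g c + g (c - h)|
      = |g (c + h) - 2 * g c + g (c - h) - (g c - 2 * g c + g c)| := by congr 1; ring
    _ ≤ 2 * B * h * h := this
    _ = _ := by ring

/-- A neighbourhood of the speed `c₀` on which all profiles are uniformly small outside
`[-R, R]`. -/
structure IsTrappedNear (f : ℝ → ℝ) (I₀ : Set ℝ) (Q : ℝ → ℝ → ℝ) (c₀ ρ ε R : ℝ) : Prop where
  pos : 0 < c₀
  rho_pos : 0 < ρ
  rho_le : ρ ≤ c₀ / 2
  R_pos : 0 < R
  subset : Metric.closedBall c₀ ρ ⊆ I₀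
  slope : ∀ s ∈ Icc (-ε) ε, |deriv f s| ≤ c₀ / 16
  small : ∀ c ∈ Metric.closedBall c₀ ρ, ∀ x ≥ R, Q c x < ε

section LocalDecay

variable {f : ℝ → ℝ} {I₀ : Set ℝ} {Q : ℝ → ℝ → ℝ} {c₀ ρ ε R : ℝ}

/-- The smallness of `Q_{c₀}` and the negative sign of its slope at one point `R` persist for
nearby speeds, and by conservation of energy they trap each such profile below `ε` beyond `R`. -/
theorem exists_isTrappedNear (hf : IsNonlinearity f) (hQ : IsSolitaryWaveFamily f I₀ Q)
    (hc₀ : c₀ ∈ I₀) : ∃ ρ ε R, IsTrappedNear f I₀ Q c₀ ρ ε R := by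
  have hpos : 0 < c₀ := hQ.pos hc₀
  have h0 : ∀ᶠ s in 𝓝 (0 : ℝ), |deriv f s| < c₀ / 16 := by
    have : Tendsto (fun s => |deriv f s|) (𝓝 0) (𝓝 |deriv f 0|) :=
      (hf.contDiff_deriv.continuous.abs).tendsto 0
    rw [hf.deriv_zero, abs_zero] at this
    exact this.eventually (gt_mem_nhds (by positivity))
  obtain ⟨ε, hε, hs⟩ := Metric.nhds_basis_closedBall.eventually_iff.1 h0
  have hslope : ∀ s ∈ Icc (-ε) ε, |deriv f s| ≤ c₀ / 16 := fun s hs' =>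
    (hs (by rw [Real.closedBall_eq_Icc]; simpa using hs')).le
  obtain ⟨R, hR, hR1, hR2⟩ := (hQ.wave c₀ hc₀).exists_trapped hε
  have hcQ : ContinuousAt (fun c => Q c R) c₀ :=
    ((hasDerivAt_dSpeed (hQ.differentiableAt hc₀ R)).continuousAt)
  have hcS : ContinuousAt (fun c => dSpace Q c R) c₀ :=
    (hasDerivAt_dSpeed ((contDiffAt_of_prod hQ.isOpen hQ.contDiffOn_space hc₀ R).differentiableAt
      (by norm_num))).continuousAt
  have ev : ∀ᶠ c in 𝓝 c₀, c ∈ I₀ ∧ Q c R < ε ∧ dSpace Q c R < 0 :=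
    (hQ.isOpen.eventually_mem hc₀).and ((hcQ.eventually (gt_mem_nhds hR1)).and
      (hcS.eventually (gt_mem_nhds hR2)))
  obtain ⟨ρ, hρ, hb⟩ := Metric.nhds_basis_closedBall.eventually_iff.1 ev
  refine ⟨min ρ (c₀ / 2), ε, R, hpos, lt_min hρ (by positivity), min_le_right _ _, hR, ?_, hslope,
    ?_⟩
  · exact fun c hc => (hb (Metric.closedBall_subset_closedBall (min_le_left _ _) hc)).1
  · intro c hc
    obtain ⟨hcI, h1, h2⟩ := hb (Metric.closedBall_subset_closedBall (min_le_left _ _) hc)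
    have hcl : c₀ / 2 ≤ c := by
      have := Metric.mem_closedBall.1 hc
      rw [Real.dist_eq, abs_le] at this
      linarith [this.1, min_le_right ρ (c₀ / 2)]
    refine (hQ.wave c hcI).lt_of_trapped hf (k := c₀ / 16) (by linarith) ?_ h1 h2
    intro s hs
    have := hf.lipschitz hslope (s := s) (r := 0) ⟨by linarith [hs.1], hs.2⟩ ⟨by linarith, hε.le⟩
    rwa [hf.zero, sub_zero, sub_zero, abs_of_nonneg hs.1] at this

namespace IsTrappedNear

variable (hT : IsTrappedNear f I₀ Q c₀ ρ ε R)
include hT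

theorem le_speed {c : ℝ} (hc : c ∈ Metric.closedBall c₀ ρ) : c₀ / 2 ≤ c ∧ c ≤ 2 * c₀ := by
  have := Metric.mem_closedBall.1 hc
  rw [Real.dist_eq, abs_le] at this
  have := hT.rho_le
  have := hT.pos
  constructor <;> linarith

theorem mem_Icc (hQ : IsSolitaryWaveFamily f I₀ Q) {c : ℝ} (hc : c ∈ Metric.closedBall c₀ ρ)
    {x : ℝ} (hx : R ≤ x) : Q c x ∈ Icc (-ε) ε := by
  have h1 := hT.small c hc x hx
  have h2 := (hQ.wave c (hT.subset hc)).pos x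
  exact ⟨by linarith, h1.le⟩

/-- The profile solves `Q'' = (c - f(Q)/Q) Q`, with a coefficient bounded below where it is
trapped, so it decays exponentially, uniformly in the speed. -/
theorem exists_profile_decay (hf : IsNonlinearity f) (hQ : IsSolitaryWaveFamily f I₀ Q) {γ : ℝ}
    (hγ : 0 < γ) (hγc : γ ^ 2 ≤ c₀ / 8) :
    ∃ M > 0, ∀ c ∈ Metric.closedBall c₀ ρ, ∀ x, |Q c x| ≤ M * ew γ x := by
  have hp := hT.pos
  obtain ⟨B, hB⟩ := ((isCompact_closedBall c₀ ρ).prod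
    (isCompact_Icc (a := 0) (b := R))).exists_bound_of_continuousOn
    (hQ.contDiffOn.continuousOn.mono (prod_mono hT.subset (subset_univ _)))
  refine ⟨max 1 (B * Real.exp (γ * R) + 2 * 0 / (c₀ / 4)), lt_max_of_lt_left one_pos,
    fun c hc x => ?_⟩
  have hcI := hT.subset hc
  refine (decay_of_ode (hQ.hasDerivAt hcI) (hQ.hasDerivAt_space hcI) (hQ.wave c hcI).even
    hT.R_pos.le hγ (p0 := c₀ / 4) (by linarith) (by linarith) le_rfl ?_
    (hQ.wave c hcI).tendsto_atTop (fun y hy => hB (c, y) ⟨hc, hy⟩) x).trans ?_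
  · intro y hy
    have hm := hT.mem_Icc hQ hc hy.le
    have h0 : (0 : ℝ) ∈ Icc (-ε) ε := ⟨by linarith [hm.1, hm.2], by linarith [hm.1, hm.2]⟩
    have hl := hf.lipschitz hT.slope hm h0
    have hq := (hQ.wave c hcI).pos y
    rw [hf.zero, sub_zero, sub_zero] at hl
    -- the profile is positive, so the quotient is a genuine one
    refine ⟨c - f (Q c y) / Q c y, ?_, ?_⟩
    · have : |f (Q c y) / Q c y| ≤ c₀ / 16 := by
        rw [abs_div]; exact div_le_of_le_mul₀ (abs_nonneg _) (by linarith) hl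
      have := (abs_le.1 this).2
      linarith [(hT.le_speed hc).1]
    · rw [sub_mul, div_mul_cancel₀ _ hq.ne']; simp
  · gcongr
    · exact ew_nonneg _ _
    · exact le_max_right _ _

/-- Lipschitz dependence of the profile on the speed, with exponential decay. -/
theorem exists_difference_decay (hf : IsNonlinearity f) (hQ : IsSolitaryWaveFamily f I₀ Q)
    {γ : ℝ} (hγ : 0 < γ) (hγc : γ ^ 2 ≤ c₀ / 8) :
    ∃ M > 0, ∀ c ∈ Metric.closedBall c₀ ρ, ∀ c' ∈ Metric.closedBall c₀ ρ, ∀ x,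
      |Q c' x - Q c x| ≤ M * |c' - c| * ew γ x := by
  have hp := hT.pos
  obtain ⟨M0, hM0, hdec⟩ := hT.exists_profile_decay hf hQ hγ hγc
  obtain ⟨B, hB⟩ := ((isCompact_closedBall c₀ ρ).prod
    (isCompact_Icc (a := 0) (b := R))).exists_bound_of_continuousOn
    (hQ.contDiffOn_speed.continuousOn.mono (prod_mono hT.subset (subset_univ _)))
  refine ⟨max 1 (B * Real.exp (γ * R) + 2 * M0 / (c₀ / 4)), lt_max_of_lt_left one_pos,
    fun c hc c' hc' x => ?_⟩
  have hcI := hT.subset hc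
  have hcI' := hT.subset hc'
  have key := decay_of_ode (D := fun x => Q c' x - Q c x)
    (fun y => (hQ.hasDerivAt hcI' y).sub (hQ.hasDerivAt hcI y))
    (fun y => (hQ.hasDerivAt_space hcI' y).sub (hQ.hasDerivAt_space hcI y))
    (fun y => by rw [(hQ.wave c hcI).even, (hQ.wave c' hcI').even])
    hT.R_pos.le hγ (p0 := c₀ / 4) (S := M0 * |c' - c|) (B := B * |c' - c|) (by linarith)
    (by linarith) (by positivity) ?_
    (by simpa using (hQ.wave c' hcI').tendsto_atTop.sub (hQ.wave c hcI).tendsto_atTop) ?_ x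
  · refine key.trans ?_
    have : B * |c' - c| * Real.exp (γ * R) + 2 * (M0 * |c' - c|) / (c₀ / 4)
        = (B * Real.exp (γ * R) + 2 * M0 / (c₀ / 4)) * |c' - c| := by ring
    rw [this]
    gcongr
    · exact ew_nonneg _ _
    · exact le_max_right _ _
  · intro y hy
    have hm := hT.mem_Icc hQ hc hy.le
    have hm' := hT.mem_Icc hQ hc' hy.le
    have hl := hf.lipschitz hT.slope hm' hm
    -- the difference solves a linear equation whose coefficient is a difference quotient of `f`;
    -- where the two profiles agree the quotient is `0`, which does no harm
    set m := (f (Q c' y) - f (Q c y)) / (Q c' y - Q c y) with hmdef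
    have hmD : m * (Q c' y - Q c y) = f (Q c' y) - f (Q c y) := by
      by_cases h : Q c' y - Q c y = 0
      · rw [h, abs_zero, mul_zero] at hl
        rw [h, mul_zero, abs_nonpos_iff.1 hl]
      · rw [hmdef, div_mul_cancel₀ _ h]
    refine ⟨c - m, ?_, ?_⟩
    · have : |m| ≤ c₀ / 16 := by
        rw [hmdef, abs_div]; exact div_le_of_le_mul₀ (abs_nonneg _) (by linarith) hl
      have := (abs_le.1 this).2
      linarith [(hT.le_speed hc).1]
    · have e : c' * Q c' y - f (Q c' y) - (c * Q c y - f (Q c y)) - (c - m) * (Q c' y - Q c y)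
          = (c' - c) * Q c' y := by linear_combination hmD
      rw [e, abs_mul]
      have := hdec c' hc' y
      calc |c' - c| * |Q c' y| ≤ |c' - c| * (M0 * ew γ y) := by gcongr
        _ = _ := by ring
  · intro y hy
    exact (convex_closedBall c₀ ρ).norm_image_sub_le_of_norm_hasDerivWithin_le
      (fun s hs => (hasDerivAt_dSpeed (hQ.differentiableAt (hT.subset hs) y)).hasDerivWithinAt)
      (fun s hs => hB (s, y) ⟨hs, hy⟩) hc hc'

/-- The second difference of the profile in the speed solves the linearized equation up to terms
that are quadratic in `h`, by Taylor expansion of `f`. -/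
theorem exists_second_difference_decay (hf : IsNonlinearity f)
    (hQ : IsSolitaryWaveFamily f I₀ Q) {γ : ℝ} (hγ : 0 < γ) (hγc : γ ^ 2 ≤ c₀ / 8) :
    ∃ M > 0, ∀ c h, 0 < h → Icc (c - h) (c + h) ⊆ Metric.closedBall c₀ ρ → ∀ x,
      |Q (c + h) x - 2 * Q c x + Q (c - h) x| ≤ M * h ^ 2 * ew γ x := by
  have hp := hT.pos
  obtain ⟨M1, hM1, hdiff⟩ := hT.exists_difference_decay hf hQ hγ hγc
  obtain ⟨B, hB⟩ := ((isCompact_closedBall c₀ ρ).prod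
    (isCompact_Icc (a := 0) (b := R))).exists_bound_of_continuousOn
    (hQ.contDiffOn_speed2.continuousOn.mono (prod_mono hT.subset (subset_univ _)))
  obtain ⟨K, hK0, -, hK⟩ := hf.exists_deriv_bound ε
  set S := 2 * M1 + 2 * K * M1 ^ 2 with hS
  have hS0 : 0 ≤ S := by positivity
  refine ⟨max 1 (2 * B * Real.exp (γ * R) + 2 * S / (c₀ / 4)), lt_max_of_lt_left one_pos,
    fun c h hh hsub x => ?_⟩
  have hc : c ∈ Metric.closedBall c₀ ρ := hsub ⟨by linarith, by linarith⟩
  have hcp : c + h ∈ Metric.closedBall c₀ ρ := hsub ⟨by linarith, by linarith⟩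
  have hcm : c - h ∈ Metric.closedBall c₀ ρ := hsub ⟨by linarith, by linarith⟩
  have hcI := hT.subset hc
  have hcIp := hT.subset hcp
  have hcIm := hT.subset hcm
  have key := decay_of_ode (D := fun x => Q (c + h) x - 2 * Q c x + Q (c - h) x)
    (fun y => ((hQ.hasDerivAt hcIp y).sub ((hQ.hasDerivAt hcI y).const_mul 2)).add
      (hQ.hasDerivAt hcIm y))
    (fun y => ((hQ.hasDerivAt_space hcIp y).sub ((hQ.hasDerivAt_space hcI y).const_mul 2)).add
      (hQ.hasDerivAt_space hcIm y))
    (fun y => by rw [(hQ.wave _ hcI).even, (hQ.wave _ hcIp).even, (hQ.wave _ hcIm).even])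
    hT.R_pos.le hγ (p0 := c₀ / 4) (S := S * h ^ 2) (B := 2 * B * h ^ 2) (by linarith)
    (by linarith) (by positivity) ?_
    (by simpa using ((hQ.wave _ hcIp).tendsto_atTop.sub
      ((hQ.wave _ hcI).tendsto_atTop.const_mul 2)).add (hQ.wave _ hcIm).tendsto_atTop) ?_ x
  · refine key.trans ?_
    have : 2 * B * h ^ 2 * Real.exp (γ * R) + 2 * (S * h ^ 2) / (c₀ / 4)
        = (2 * B * Real.exp (γ * R) + 2 * S / (c₀ / 4)) * h ^ 2 := by ring
    rw [this]
    gcongr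
    · exact ew_nonneg _ _
    · exact le_max_right _ _
  · intro y hy
    have hm := hT.mem_Icc hQ hc hy.le
    have hmp := hT.mem_Icc hQ hcp hy.le
    have hmm := hT.mem_Icc hQ hcm hy.le
    have tp := hf.taylor hK hmp hm
    have tm := hf.taylor hK hmm hm
    have dp := hdiff c hc _ hcp y
    have dm := hdiff c hc _ hcm y
    have dd := hdiff _ hcm _ hcp y
    rw [show c + h - c = h by ring, abs_of_pos hh] at dp
    rw [show c - h - c = -h by ring, abs_neg, abs_of_pos hh] at dm
    rw [show c + h - (c - h) = 2 * h by ring, abs_of_pos (show 0 < 2 * h by linarith)] at dd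
    refine ⟨c - deriv f (Q c y), ?_, ?_⟩
    · have := (abs_le.1 (hT.slope _ hm)).2
      linarith [(hT.le_speed hc).1]
    · have hsq : ∀ d : ℝ, |d| ≤ M1 * h * ew γ y → d ^ 2 ≤ M1 ^ 2 * h ^ 2 * ew γ y := by
        intro d hd
        have h1 := pow_le_pow_left₀ (abs_nonneg _) hd 2
        rw [sq_abs] at h1
        have h2 : ew γ y ^ 2 ≤ ew γ y := by
          have := ew_le_one hγ.le y
          have := ew_nonneg γ y
          nlinarith
        calc d ^ 2 ≤ M1 ^ 2 * h ^ 2 * ew γ y ^ 2 := by rw [← mul_pow, ← mul_pow]; exact h1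
          _ ≤ _ := by gcongr
      have sp := mul_le_mul_of_nonneg_left (hsq _ dp) hK0.le
      have sm := mul_le_mul_of_nonneg_left (hsq _ dm) hK0.le
      have sd : |h * (Q (c + h) y - Q (c - h) y)| ≤ h * (M1 * (2 * h) * ew γ y) := by
        rw [abs_mul, abs_of_pos hh]; gcongr
      rw [abs_le] at tp tm sd ⊢
      constructor <;> nlinarith [tp.1, tp.2, tm.1, tm.2, sd.1, sd.2]
  · intro y hy
    refine second_difference_le (g := fun c => Q c y) (g1 := fun c => dSpeed Q c y)
      (g2 := fun c => dSpeed (dSpeed Q) c y) hh.le ?_ ?_ ?_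
    · exact fun s hs => hasDerivAt_dSpeed (hQ.differentiableAt (hT.subset (hsub hs)) y)
    · exact fun s hs => hasDerivAt_dSpeed (hQ.differentiableAt_speed (hT.subset (hsub hs)) y)
    · exact fun s hs => hB (s, y) ⟨hsub hs, hy⟩

end IsTrappedNear

/-- Uniform exponential decay of the profiles with speed in a ball, and of their derivatives. -/
structure HasDecay (I₀ : Set ℝ) (Q : ℝ → ℝ → ℝ) (c₀ ρ γ M : ℝ) : Prop where
  rho_pos : 0 < ρ
  rate_pos : 0 < γ
  const_pos : 0 < M
  subset : Metric.ball c₀ ρ ⊆ I₀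
  le_speed : ∀ c ∈ Metric.ball c₀ ρ, c₀ / 2 ≤ c ∧ c ≤ 2 * c₀
  profile : ∀ c ∈ Metric.ball c₀ ρ, ∀ x, |Q c x| ≤ M * ew γ x
  space : ∀ c ∈ Metric.ball c₀ ρ, ∀ x, |dSpace Q c x| ≤ M * ew γ x
  speed : ∀ c ∈ Metric.ball c₀ ρ, ∀ x, |dSpeed Q c x| ≤ M * ew γ x
  speed_space : ∀ c ∈ Metric.ball c₀ ρ, ∀ x, |dSpace (dSpeed Q) c x| ≤ M * ew γ x
  speed_speed : ∀ c ∈ Metric.ball c₀ ρ, ∀ x, |dSpeed (dSpeed Q) c x| ≤ M * ew γ x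

/-- The decay of the speed derivatives follows from that of first and second differences; that of
the space derivatives follows from the differential equations. -/
theorem exists_hasDecay (hf : IsNonlinearity f) (hQ : IsSolitaryWaveFamily f I₀ Q)
    (hc₀ : c₀ ∈ I₀) : ∃ ρ γ M, HasDecay I₀ Q c₀ ρ γ M := by
  obtain ⟨ρ, ε, R, hT⟩ := exists_isTrappedNear hf hQ hc₀
  have hp := hT.pos
  set γ := √(c₀ / 8)
  have hγ : 0 < γ := Real.sqrt_pos.2 (by positivity)
  have hγc : γ ^ 2 ≤ c₀ / 8 := (Real.sq_sqrt (by positivity)).le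
  obtain ⟨M0, hM0, d0⟩ := hT.exists_profile_decay hf hQ hγ hγc
  obtain ⟨M1, hM1, d1⟩ := hT.exists_difference_decay hf hQ hγ hγc
  obtain ⟨M2, hM2, d2⟩ := hT.exists_second_difference_decay hf hQ hγ hγc
  have hsub : Metric.ball c₀ ρ ⊆ Metric.closedBall c₀ ρ := Metric.ball_subset_closedBall
  have e1 : ∀ c ∈ Metric.ball c₀ ρ, ∀ x, |dSpeed Q c x| ≤ M1 * ew γ x := by
    intro c hc x
    refine (hasDerivAt_dSpeed (hQ.differentiableAt (hT.subset (hsub hc)) x)).le_of_lip'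
      (by have := ew_nonneg γ x; positivity) ?_
    filter_upwards [Metric.isOpen_ball.mem_nhds hc] with c' hc'
    refine (d1 c (hsub hc) c' (hsub hc') x).trans (le_of_eq ?_)
    rw [Real.norm_eq_abs]; ring
  have e2 : ∀ c ∈ Metric.ball c₀ ρ, ∀ x, |dSpeed (dSpeed Q) c x| ≤ M2 * ew γ x := by
    intro c hc x
    refine abs_le_of_second_difference (g := fun c => Q c x) (g1 := fun c => dSpeed Q c x) (c := c)
      ?_ (hasDerivAt_dSpeed (hQ.differentiableAt_speed (hT.subset (hsub hc)) x)) ?_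
    · filter_upwards [Metric.isOpen_ball.mem_nhds hc] with c' hc'
      exact hasDerivAt_dSpeed (hQ.differentiableAt (hT.subset (hsub hc')) x)
    · obtain ⟨r, hr, hrb⟩ := Metric.nhds_basis_closedBall.mem_iff.1 (Metric.isOpen_ball.mem_nhds hc)
      filter_upwards [Ioc_mem_nhdsGT hr] with h hh
      refine (d2 c h hh.1 ?_ x).trans (le_of_eq (by ring))
      rw [← Real.closedBall_eq_Icc]
      exact (Metric.closedBall_subset_closedBall hh.2).trans (hrb.trans hsub)
  obtain ⟨K, hK0, hK, -⟩ := hf.exists_deriv_bound M0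
  have hmem : ∀ c ∈ Metric.ball c₀ ρ, ∀ x, Q c x ∈ Icc (-M0) M0 := by
    intro c hc x
    rw [mem_Icc, ← abs_le]
    refine (d0 c (hsub hc) x).trans ?_
    exact mul_le_of_le_one_right hM0.le (ew_le_one hγ.le x)
  set N := (2 * c₀ + K + 1) * (M0 + M1) with hN
  have hNK : 0 ≤ 2 * c₀ + K := by positivity
  have n0 : M0 ≤ N := by rw [hN]; nlinarith
  have n1 : M1 ≤ N := by rw [hN]; nlinarith
  have n2 : (2 * c₀ + K) * M0 ≤ N := by rw [hN]; nlinarith [mul_nonneg hNK hM1.le]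
  have n3 : (2 * c₀ + K) * M1 + M0 ≤ N := by rw [hN]; nlinarith [mul_nonneg hNK hM0.le]
  have hw := fun x => ew_nonneg γ x
  have e3 : ∀ c ∈ Metric.ball c₀ ρ, ∀ x, |dSpace Q c x| ≤ 3 * (N * Real.exp γ) * ew γ x := by
    intro c hc
    have hcI := hT.subset (hsub hc)
    obtain ⟨l1, l2⟩ := hT.le_speed (hsub hc)
    refine abs_deriv_le_of_ew (hQ.hasDerivAt hcI) (hQ.hasDerivAt_space hcI) hγ.le ?_ ?_
    · exact fun x => (d0 c (hsub hc) x).trans (by gcongr; exact hw x)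
    · intro x
      have h1 := hf.lipschitz hK (hmem c hc x) (r := 0) ⟨by linarith, hM0.le⟩
      rw [hf.zero, sub_zero, sub_zero] at h1
      have h2 := d0 c (hsub hc) x
      calc |c * Q c x - f (Q c x)| ≤ |c * Q c x| + |f (Q c x)| := abs_sub _ _
        _ ≤ 2 * c₀ * |Q c x| + K * |Q c x| := by
          rw [abs_mul, abs_of_nonneg (by linarith)]; gcongr
        _ = (2 * c₀ + K) * |Q c x| := by ring
        _ ≤ (2 * c₀ + K) * (M0 * ew γ x) := by gcongr
        _ = (2 * c₀ + K) * M0 * ew γ x := by ring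
        _ ≤ N * ew γ x := by gcongr; exact hw x
  have e4 : ∀ c ∈ Metric.ball c₀ ρ, ∀ x,
      |dSpace (dSpeed Q) c x| ≤ 3 * (N * Real.exp γ) * ew γ x := by
    intro c hc
    have hcI := hT.subset (hsub hc)
    obtain ⟨l1, l2⟩ := hT.le_speed (hsub hc)
    refine abs_deriv_le_of_ew (hQ.hasDerivAt_zeta hcI) (hQ.hasDerivAt_zeta_space hcI hf) hγ.le ?_ ?_
    · exact fun x => (e1 c hc x).trans (by gcongr; exact hw x)
    · intro x
      have h1 := hK _ (hmem c hc x)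
      have h2 := d0 c (hsub hc) x
      have h3 := e1 c hc x
      have h4 : |c - deriv f (Q c x)| ≤ 2 * c₀ + K := by
        refine (abs_sub _ _).trans ?_
        rw [abs_of_nonneg (show 0 ≤ c by linarith)]; linarith
      calc |(c - deriv f (Q c x)) * dSpeed Q c x + Q c x|
          ≤ |c - deriv f (Q c x)| * |dSpeed Q c x| + |Q c x| := by
            rw [← abs_mul]; exact abs_add_le _ _
        _ ≤ (2 * c₀ + K) * (M1 * ew γ x) + M0 * ew γ x := by gcongr
        _ = ((2 * c₀ + K) * M1 + M0) * ew γ x := by ring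
        _ ≤ N * ew γ x := by gcongr; exact hw x
  have hN0 : 0 ≤ N := hM0.le.trans n0
  have hEx : 1 ≤ Real.exp γ := Real.one_le_exp hγ.le
  have hN3 : N ≤ 3 * (N * Real.exp γ) := by nlinarith
  have hlift : ∀ A ≤ 3 * (N * Real.exp γ) + M2, ∀ v x, |v| ≤ A * ew γ x →
      |v| ≤ (3 * (N * Real.exp γ) + M2) * ew γ x := by
    intro A hA v x hv
    refine hv.trans ?_
    gcongr
    exact hw x
  refine ⟨ρ, γ, 3 * (N * Real.exp γ) + M2, hT.rho_pos, hγ, by positivity, hsub.trans hT.subset,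
    fun c hc => hT.le_speed (hsub hc), ?_, ?_, ?_, ?_, ?_⟩
  · exact fun c hc x => hlift M0 (by linarith) _ x (d0 c (hsub hc) x)
  · exact fun c hc x => hlift _ (by linarith) _ x (e3 c hc x)
  · exact fun c hc x => hlift M1 (by linarith) _ x (e1 c hc x)
  · exact fun c hc x => hlift _ (by linarith) _ x (e4 c hc x)
  · exact fun c hc x => hlift M2 (by linarith [mul_nonneg hN0 (Real.exp_pos γ).le]) _ x (e2 c hc x)

end LocalDecay

/-! ### Approximation by test functions -/

/-- A sequence of bump functions concentrating at the origin. -/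
def bumpSeq (n : ℕ) : ContDiffBump (0 : ℝ) where
  rIn := 1 / (n + 1) / 2
  rOut := 1 / (n + 1)
  rIn_pos := by positivity
  rIn_lt_rOut := by
    have : (0 : ℝ) < 1 / (n + 1) := by positivity
    linarith

theorem bumpSeq_rOut (n : ℕ) : (bumpSeq n).rOut = 1 / (n + 1) := rfl

theorem bumpSeq_rOut_le (n : ℕ) : (bumpSeq n).rOut ≤ 1 := by
  rw [bumpSeq_rOut, div_le_one (by positivity)]
  have : (0 : ℝ) ≤ n := Nat.cast_nonneg n
  linarith

theorem tendsto_bumpSeq_rOut : Tendsto (fun n => (bumpSeq n).rOut) atTop (𝓝 0) :=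
  tendsto_one_div_add_atTop_nhds_zero_nat

/-- Mollification by `bumpSeq`. -/
def mollify (n : ℕ) (g : ℝ → ℝ) : ℝ → ℝ :=
  convolution ((bumpSeq n).normed volume) g (ContinuousLinearMap.lsmul ℝ ℝ) volume

theorem mollify_isTest (n : ℕ) {g : ℝ → ℝ} (hg : Continuous g) (hc : HasCompactSupport g) :
    IsTest (mollify n g) :=
  ⟨(bumpSeq n).hasCompactSupport_normed.contDiff_convolution_left _ (bumpSeq n).contDiff_normed
    hg.locallyIntegrable, (bumpSeq n).hasCompactSupport_normed.convolution _ hc⟩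

theorem deriv_mollify (n : ℕ) {g g' : ℝ → ℝ} (hg : ∀ x, HasDerivAt g (g' x) x)
    (hg' : Continuous g') (hc : HasCompactSupport g) :
    deriv (mollify n g) = mollify n g' := by
  have e : deriv g = g' := funext fun x => (hg x).deriv
  have hC : ContDiff ℝ 1 g := contDiff_one_iff_deriv.2
    ⟨fun x => (hg x).differentiableAt, by rw [e]; exact hg'⟩
  funext x
  rw [mollify, (hc.hasDerivAt_convolution_right _
    ((bumpSeq n).continuous_normed.locallyIntegrable) hC x).deriv, e, mollify]

theorem tendsto_mollify {g : ℝ → ℝ} (hg : Continuous g) (hc : HasCompactSupport g) :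
    Tendsto (fun n => ∫ x, (mollify n g x - g x) ^ 2) atTop (𝓝 0) := by
  obtain ⟨r, hr⟩ := hc.isCompact.isBounded.subset_closedBall (0 : ℝ)
  have hu := hc.uniformContinuous_of_continuous hg
  have hsup : ∀ n x, x ∉ Metric.closedBall (0 : ℝ) (1 + r) → mollify n g x - g x = 0 := by
    intro n x hx
    have h1 : g x = 0 := by
      by_contra h
      have := hr (subset_tsupport g h)
      refine hx (Metric.closedBall_subset_closedBall (by linarith) this)
    have h2 : mollify n g x = 0 := by
      by_contra h
      have := support_convolution_subset (ContinuousLinearMap.lsmul ℝ ℝ) (μ := volume)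
        (f := (bumpSeq n).normed volume) (g := g) (show x ∈ Function.support _ from h)
      obtain ⟨y, hy, z, hz, rfl⟩ := Set.mem_add.1 this
      rw [(bumpSeq n).support_normed_eq, mem_ball_zero_iff] at hy
      have hz' := mem_closedBall_zero_iff.1 (hr (subset_tsupport g hz))
      refine hx (mem_closedBall_zero_iff.2 ((norm_add_le y z).trans ?_))
      linarith [bumpSeq_rOut_le n]
    rw [h1, h2, sub_zero]
  have hclose : ∀ᶠ n in atTop, ∀ x, |mollify n g x - g x| ≤ 1 := by
    obtain ⟨δ, hδ, hd⟩ := Metric.uniformContinuous_iff.1 hu 1 one_pos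
    filter_upwards [tendsto_bumpSeq_rOut.eventually (gt_mem_nhds hδ)] with n hn x
    exact (bumpSeq n).dist_normed_convolution_le hg.aestronglyMeasurable fun y hy =>
      (hd (lt_trans hy hn)).le
  have := tendsto_integral_filter_of_dominated_convergence (μ := volume) (l := atTop)
    (F := fun n x => (mollify n g x - g x) ^ 2) (f := fun _ : ℝ => (0 : ℝ))
    ((Metric.closedBall (0 : ℝ) (1 + r)).indicator fun _ => (1 : ℝ)) ?_ ?_ ?_ ?_
  · simpa using this
  · exact Eventually.of_forall fun n =>
      (((mollify_isTest n hg hc).1.continuous.sub hg).pow 2).aestronglyMeasurable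
  · filter_upwards [hclose] with n hn
    refine ae_of_all _ fun x => ?_
    by_cases hx : x ∈ Metric.closedBall (0 : ℝ) (1 + r)
    · rw [indicator_of_mem hx, Real.norm_eq_abs, abs_of_nonneg (sq_nonneg _), ← sq_abs]
      exact pow_le_one₀ (abs_nonneg _) (hn x)
    · rw [indicator_of_notMem hx, hsup n x hx]; simp
  · exact (integrable_indicator_iff Metric.isClosed_closedBall.measurableSet).2
      (integrableOn_const (isCompact_closedBall _ _).measure_lt_top.ne)
  · refine ae_of_all _ fun x => ?_
    have := ((ContDiffBump.convolution_tendsto_right_of_continuous (φ := bumpSeq) (μ := volume)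
      tendsto_bumpSeq_rOut hg x).sub_const (g x)).pow 2
    rw [sub_self, zero_pow two_ne_zero] at this
    exact this

/-- The fixed cutoff function `χ`, equal to one on `[-1, 1]` and supported in `[-2, 2]`. -/
def cutoffBump : ContDiffBump (0 : ℝ) := ⟨1, 2, one_pos, one_lt_two⟩

/-- The cutoff `χ_n(x) = χ(x/(n+1))`. -/
def cutoff (n : ℕ) (x : ℝ) : ℝ := cutoffBump (x / (n + 1))

/-- The first derivative of `cutoff n`. -/
def cutoff1 (n : ℕ) (x : ℝ) : ℝ := deriv cutoffBump (x / (n + 1)) / (n + 1)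

/-- The second derivative of `cutoff n`. -/
def cutoff2 (n : ℕ) (x : ℝ) : ℝ := deriv (deriv cutoffBump) (x / (n + 1)) / (n + 1) / (n + 1)

theorem hasCompactSupport_cutoff (n : ℕ) : HasCompactSupport (cutoff n) := by
  have h : ((n : ℝ) + 1)⁻¹ ≠ 0 := by positivity
  have := cutoffBump.hasCompactSupport.comp_smul h
  have e : cutoff n = fun x => cutoffBump (((n : ℝ) + 1)⁻¹ • x) := by
    ext x; rw [cutoff, div_eq_inv_mul, smul_eq_mul]
  rw [e]; exact this

theorem contDiff_deriv_cutoffBump : ContDiff ℝ ∞ (deriv cutoffBump) :=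
  (contDiff_infty_iff_deriv.1 cutoffBump.contDiff).2

theorem contDiff_deriv2_cutoffBump : ContDiff ℝ ∞ (deriv (deriv cutoffBump)) :=
  (contDiff_infty_iff_deriv.1 contDiff_deriv_cutoffBump).2

theorem hasDerivAt_div_const {g : ℝ → ℝ} (hg : Differentiable ℝ g) (n : ℕ) (x : ℝ) :
    HasDerivAt (fun x => g (x / (n + 1))) (deriv g (x / (n + 1)) / (n + 1)) x := by
  have := (hg (x / (n + 1))).hasDerivAt.comp x ((hasDerivAt_id x).div_const ((n : ℝ) + 1))
  exact this.congr_deriv (by rw [mul_one_div])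

theorem hasDerivAt_cutoff (n : ℕ) (x : ℝ) : HasDerivAt (cutoff n) (cutoff1 n x) x :=
  hasDerivAt_div_const (cutoffBump.contDiff.differentiable (n := ∞) (by simp)) n x

theorem hasDerivAt_cutoff1 (n : ℕ) (x : ℝ) : HasDerivAt (cutoff1 n) (cutoff2 n x) x :=
  (hasDerivAt_div_const (contDiff_deriv_cutoffBump.differentiable (by simp)) n x).div_const _

theorem tendsto_div_nat (x : ℝ) : Tendsto (fun n : ℕ => x / (n + 1)) atTop (𝓝 0) := by
  simpa [div_eq_mul_inv] using tendsto_one_div_add_atTop_nhds_zero_nat.const_mul x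

theorem tendsto_cutoff (x : ℝ) : Tendsto (fun n => cutoff n x) atTop (𝓝 1) := by
  have := (cutoffBump.continuous.tendsto 0).comp (tendsto_div_nat x)
  rwa [cutoffBump.one_of_mem_closedBall (by simp [cutoffBump])] at this

theorem tendsto_cutoff1 (x : ℝ) : Tendsto (fun n => cutoff1 n x) atTop (𝓝 0) := by
  have h1 := (contDiff_deriv_cutoffBump.continuous.tendsto 0).comp (tendsto_div_nat x)
  have := h1.mul tendsto_one_div_add_atTop_nhds_zero_nat
  simpa [cutoff1, div_eq_mul_inv, Function.comp_def] using this

theorem tendsto_cutoff2 (x : ℝ) : Tendsto (fun n => cutoff2 n x) atTop (𝓝 0) := by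
  have h1 := (contDiff_deriv2_cutoffBump.continuous.tendsto 0).comp (tendsto_div_nat x)
  have := (h1.mul tendsto_one_div_add_atTop_nhds_zero_nat).mul
    tendsto_one_div_add_atTop_nhds_zero_nat
  simpa [cutoff2, div_eq_mul_inv, Function.comp_def] using this

theorem abs_div_nat_le {a A : ℝ} (h : |a| ≤ A) (n : ℕ) : |a / ((n : ℝ) + 1)| ≤ A := by
  have h1 : (1 : ℝ) ≤ n + 1 := by
    have : (0 : ℝ) ≤ n := Nat.cast_nonneg n
    linarith
  rw [abs_div, abs_of_pos (show (0 : ℝ) < n + 1 by linarith)]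
  exact (div_le_self (abs_nonneg _) h1).trans h

theorem exists_cutoff_bound : ∃ A, ∀ n x, |cutoff n x| ≤ A ∧ |cutoff1 n x| ≤ A ∧
    |cutoff2 n x| ≤ A := by
  have hc1 : HasCompactSupport (deriv cutoffBump) := cutoffBump.hasCompactSupport.deriv
  obtain ⟨A0, h0⟩ := cutoffBump.hasCompactSupport.exists_bound_of_continuous cutoffBump.continuous
  obtain ⟨A1, h1⟩ := hc1.exists_bound_of_continuous contDiff_deriv_cutoffBump.continuous
  obtain ⟨A2, h2⟩ := hc1.deriv.exists_bound_of_continuous contDiff_deriv2_cutoffBump.continuous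
  refine ⟨max A0 (max A1 A2), fun n x => ⟨(h0 _).trans (le_max_left _ _), ?_, ?_⟩⟩
  · exact (abs_div_nat_le (h1 _) n).trans (le_max_of_le_right (le_max_left _ _))
  · exact (abs_div_nat_le (abs_div_nat_le (h2 _) n) n).trans
      (le_max_of_le_right (le_max_right _ _))

/-- Bounded pointwise convergent multipliers converge strongly on `L²`. -/
theorem tendsto_integral_sq_mul {k : ℕ → ℝ → ℝ} {l A : ℝ} {g : ℝ → ℝ}
    (hk : ∀ n, Continuous (k n)) (hA : ∀ n x, |k n x| ≤ A)
    (hl : ∀ x, Tendsto (fun n => k n x) atTop (𝓝 l)) (hg : MemLp g 2 volume) :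
    Tendsto (fun n => ∫ x, (k n x * g x - l * g x) ^ 2) atTop (𝓝 0) := by
  have := tendsto_integral_of_dominated_convergence (μ := volume)
    (F := fun n x => (k n x * g x - l * g x) ^ 2) (f := fun _ : ℝ => (0 : ℝ))
    (fun x => (A + |l|) ^ 2 * g x ^ 2) ?_ ?_ ?_ ?_
  · simpa using this
  · exact fun n => (((hk n).aestronglyMeasurable.mul hg.1).sub (hg.1.const_mul l)).pow 2
  · exact hg.integrable_sq.const_mul _
  · refine fun n => ae_of_all _ fun x => ?_
    rw [Real.norm_eq_abs, abs_of_nonneg (sq_nonneg _), ← sub_mul, mul_pow]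
    refine mul_le_mul_of_nonneg_right ?_ (sq_nonneg _)
    rw [← sq_abs]
    gcongr
    exact (abs_sub _ _).trans (by gcongr; exact hA n x)
  · refine ae_of_all _ fun x => ?_
    have := (((hl x).mul_const (g x)).sub_const (l * g x)).pow 2
    simpa using this

theorem integral_sq_add_le {g h : ℝ → ℝ} (hg : MemLp g 2 volume) (hh : MemLp h 2 volume) :
    ∫ x, (g x + h x) ^ 2 ≤ 2 * (∫ x, g x ^ 2) + 2 * ∫ x, h x ^ 2 := by
  rw [← integral_const_mul, ← integral_const_mul,
    ← integral_add (hg.integrable_sq.const_mul 2) (hh.integrable_sq.const_mul 2)]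
  refine integral_mono (hg.add hh).integrable_sq
    ((hg.integrable_sq.const_mul 2).add (hh.integrable_sq.const_mul 2)) fun x => ?_
  dsimp only
  nlinarith [sq_nonneg (g x - h x)]

theorem integral_sq_sub_le {g h k : ℝ → ℝ} (hg : MemLp g 2 volume) (hh : MemLp h 2 volume)
    (hk : MemLp k 2 volume) : ∫ x, (g x - k x) ^ 2 ≤
      2 * (∫ x, (g x - h x) ^ 2) + 2 * ∫ x, (h x - k x) ^ 2 := by
  have := integral_sq_add_le (hg.sub hh) (hh.sub hk)
  simpa using this

theorem tendsto_zero_of_add {p r s : ℕ → ℝ → ℝ} (hp : ∀ n, MemLp (p n) 2 volume)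
    (hr : ∀ n, MemLp (r n) 2 volume) (hs : ∀ n x, s n x = p n x + r n x)
    (tp : Tendsto (fun n => ∫ x, p n x ^ 2) atTop (𝓝 0))
    (tr : Tendsto (fun n => ∫ x, r n x ^ 2) atTop (𝓝 0)) :
    Tendsto (fun n => ∫ x, s n x ^ 2) atTop (𝓝 0) := by
  refine squeeze_zero (fun n => integral_nonneg fun x => sq_nonneg _) (fun n => ?_)
    (by simpa using (tp.const_mul 2).add (tr.const_mul 2))
  simp only [hs]
  exact integral_sq_add_le (hp n) (hr n)

section Approx

variable {φ φ1 φ2 : ℝ → ℝ}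

theorem memLp_mul_bounded {k g : ℝ → ℝ} {A : ℝ} (hk : Continuous k) (hA : ∀ x, |k x| ≤ A)
    (hg : MemLp g 2 volume) : MemLp (fun x => k x * g x) 2 volume := by
  refine MemLp.of_le_mul (c := A) hg (hk.aestronglyMeasurable.mul hg.1) (ae_of_all _ fun x => ?_)
  rw [norm_mul]
  gcongr
  exact hA x

/-- `C¹` functions in `H¹` are limits of test functions in `H¹`. -/
theorem exists_isTest_approx_one (h1 : ∀ x, HasDerivAt φ (φ1 x) x) (hc : Continuous φ1)
    (m : MemLp φ 2 volume) (m1 : MemLp φ1 2 volume) {ε : ℝ} (hε : 0 < ε) :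
    ∃ ψ, IsTest ψ ∧ ∫ x, (ψ x - φ x) ^ 2 ≤ ε ∧ ∫ x, (deriv ψ x - φ1 x) ^ 2 ≤ ε := by
  obtain ⟨A, hA⟩ := exists_cutoff_bound
  have c0 : ∀ n, Continuous (cutoff n) := fun n =>
    continuous_iff_continuousAt.2 fun x => (hasDerivAt_cutoff n x).continuousAt
  have c1 : ∀ n, Continuous (cutoff1 n) := fun n =>
    continuous_iff_continuousAt.2 fun x => (hasDerivAt_cutoff1 n x).continuousAt
  have cφ : Continuous φ := continuous_iff_continuousAt.2 fun x => (h1 x).continuousAt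
  set g : ℕ → ℝ → ℝ := fun n x => cutoff n x * φ x with hg
  set g1 : ℕ → ℝ → ℝ := fun n x => cutoff1 n x * φ x + cutoff n x * φ1 x with hg1
  have M00 := fun n => memLp_mul_bounded (c0 n) (fun x => (hA n x).1) m
  have M01 := fun n => memLp_mul_bounded (c0 n) (fun x => (hA n x).1) m1
  have M10 := fun n => memLp_mul_bounded (c1 n) (fun x => (hA n x).2.1) m
  have d1 : ∀ n x, HasDerivAt (g n) (g1 n x) x := fun n x => (hasDerivAt_cutoff n x).mul (h1 x)
  have t0 : Tendsto (fun n => ∫ x, (g n x - φ x) ^ 2) atTop (𝓝 0) := by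
    simpa using tendsto_integral_sq_mul c0 (fun n x => (hA n x).1) tendsto_cutoff m
  have t01 := tendsto_integral_sq_mul c0 (fun n x => (hA n x).1) tendsto_cutoff m1
  have t10 := tendsto_integral_sq_mul c1 (fun n x => (hA n x).2.1) tendsto_cutoff1 m
  simp only [zero_mul, sub_zero, one_mul] at t01 t10
  have t1 : Tendsto (fun n => ∫ x, (g1 n x - φ1 x) ^ 2) atTop (𝓝 0) :=
    tendsto_zero_of_add M10 (fun n => (M01 n).sub m1) (fun n x => by simp [hg1]; ring) t10 t01
  have hcs : ∀ n, HasCompactSupport (g n) := fun n => (hasCompactSupport_cutoff n).mul_right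
  have e4 : (0 : ℝ) < ε / 4 := by positivity
  obtain ⟨n, hn0, hn1⟩ := ((t0.eventually (gt_mem_nhds e4)).and
    (t1.eventually (gt_mem_nhds e4))).exists
  have cg : Continuous (g n) := (c0 n).mul cφ
  have cg1 : Continuous (g1 n) := ((c1 n).mul cφ).add ((c0 n).mul hc)
  have hcs1 : HasCompactSupport (g1 n) := by
    have : deriv (g n) = g1 n := funext fun x => (d1 n x).deriv
    rw [← this]; exact (hcs n).deriv
  obtain ⟨k, hk0, hk1⟩ := (((tendsto_mollify cg (hcs n)).eventually (gt_mem_nhds e4)).and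
    ((tendsto_mollify cg1 hcs1).eventually (gt_mem_nhds e4))).exists
  have hT := mollify_isTest k cg (hcs n)
  refine ⟨mollify k (g n), hT, ?_, ?_⟩
  · have := integral_sq_sub_le hT.memLp (M00 n) m
    linarith
  · have hd := deriv_mollify k (d1 n) cg1 (hcs n)
    have := integral_sq_sub_le (hT.deriv.memLp) ((M10 n).add (M01 n)) m1
    rw [hd] at this ⊢
    simp only [Pi.add_apply] at this
    linarith

/-- `C²` functions in `H²` are limits of test functions in `H²`. -/
theorem exists_isTest_approx_two (h1 : ∀ x, HasDerivAt φ (φ1 x) x)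
    (h2 : ∀ x, HasDerivAt φ1 (φ2 x) x) (hc : Continuous φ2) (m : MemLp φ 2 volume)
    (m1 : MemLp φ1 2 volume) (m2 : MemLp φ2 2 volume) {ε : ℝ} (hε : 0 < ε) :
    ∃ ψ, IsTest ψ ∧ ∫ x, (ψ x - φ x) ^ 2 ≤ ε ∧ ∫ x, (deriv ψ x - φ1 x) ^ 2 ≤ ε ∧
      ∫ x, (iteratedDeriv 2 ψ x - φ2 x) ^ 2 ≤ ε := by
  obtain ⟨A, hA⟩ := exists_cutoff_bound
  have c0 : ∀ n, Continuous (cutoff n) := fun n =>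
    continuous_iff_continuousAt.2 fun x => (hasDerivAt_cutoff n x).continuousAt
  have c1 : ∀ n, Continuous (cutoff1 n) := fun n =>
    continuous_iff_continuousAt.2 fun x => (hasDerivAt_cutoff1 n x).continuousAt
  have c2 : ∀ n, Continuous (cutoff2 n) := fun n => by
    have := contDiff_deriv2_cutoffBump.continuous
    unfold cutoff2; fun_prop
  have cφ : Continuous φ := continuous_iff_continuousAt.2 fun x => (h1 x).continuousAt
  have cφ1 : Continuous φ1 := continuous_iff_continuousAt.2 fun x => (h2 x).continuousAt
  set g : ℕ → ℝ → ℝ := fun n x => cutoff n x * φ x with hg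
  set g1 : ℕ → ℝ → ℝ := fun n x => cutoff1 n x * φ x + cutoff n x * φ1 x with hg1
  set g2 : ℕ → ℝ → ℝ := fun n x =>
    (cutoff2 n x * φ x + cutoff1 n x * φ1 x) + (cutoff1 n x * φ1 x + cutoff n x * φ2 x) with hg2
  have M00 := fun n => memLp_mul_bounded (c0 n) (fun x => (hA n x).1) m
  have M01 := fun n => memLp_mul_bounded (c0 n) (fun x => (hA n x).1) m1
  have M02 := fun n => memLp_mul_bounded (c0 n) (fun x => (hA n x).1) m2
  have M10 := fun n => memLp_mul_bounded (c1 n) (fun x => (hA n x).2.1) m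
  have M11 := fun n => memLp_mul_bounded (c1 n) (fun x => (hA n x).2.1) m1
  have M20 := fun n => memLp_mul_bounded (c2 n) (fun x => (hA n x).2.2) m
  have d1 : ∀ n x, HasDerivAt (g n) (g1 n x) x := fun n x => (hasDerivAt_cutoff n x).mul (h1 x)
  have d2 : ∀ n x, HasDerivAt (g1 n) (g2 n x) x := fun n x =>
    ((hasDerivAt_cutoff1 n x).mul (h1 x)).add ((hasDerivAt_cutoff n x).mul (h2 x))
  have t0 : Tendsto (fun n => ∫ x, (g n x - φ x) ^ 2) atTop (𝓝 0) := by
    simpa using tendsto_integral_sq_mul c0 (fun n x => (hA n x).1) tendsto_cutoff m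
  have t01 := tendsto_integral_sq_mul c0 (fun n x => (hA n x).1) tendsto_cutoff m1
  have t02 := tendsto_integral_sq_mul c0 (fun n x => (hA n x).1) tendsto_cutoff m2
  have t10 := tendsto_integral_sq_mul c1 (fun n x => (hA n x).2.1) tendsto_cutoff1 m
  have t11 := tendsto_integral_sq_mul c1 (fun n x => (hA n x).2.1) tendsto_cutoff1 m1
  have t20 := tendsto_integral_sq_mul c2 (fun n x => (hA n x).2.2) tendsto_cutoff2 m
  simp only [zero_mul, sub_zero, one_mul] at t01 t02 t10 t11 t20
  have t1 : Tendsto (fun n => ∫ x, (g1 n x - φ1 x) ^ 2) atTop (𝓝 0) :=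
    tendsto_zero_of_add M10 (fun n => (M01 n).sub m1) (fun n x => by simp [hg1]; ring) t10 t01
  have t2 : Tendsto (fun n => ∫ x, (g2 n x - φ2 x) ^ 2) atTop (𝓝 0) :=
    tendsto_zero_of_add (fun n => (M20 n).add (M11 n)) (fun n => (M11 n).add ((M02 n).sub m2))
      (fun n x => by simp [hg2]; ring)
      (tendsto_zero_of_add M20 M11 (fun n x => rfl) t20 t11)
      (tendsto_zero_of_add M11 (fun n => (M02 n).sub m2) (fun n x => rfl) t11 t02)
  have hcs : ∀ n, HasCompactSupport (g n) := fun n => (hasCompactSupport_cutoff n).mul_right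
  have e4 : (0 : ℝ) < ε / 4 := by positivity
  obtain ⟨n, hn0, hn1, hn2⟩ := ((t0.eventually (gt_mem_nhds e4)).and
    ((t1.eventually (gt_mem_nhds e4)).and (t2.eventually (gt_mem_nhds e4)))).exists
  have cg : Continuous (g n) := (c0 n).mul cφ
  have cg1 : Continuous (g1 n) := ((c1 n).mul cφ).add ((c0 n).mul cφ1)
  have cg2 : Continuous (g2 n) :=
    (((c2 n).mul cφ).add ((c1 n).mul cφ1)).add (((c1 n).mul cφ1).add ((c0 n).mul hc))
  have hcs1 : HasCompactSupport (g1 n) := by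
    have : deriv (g n) = g1 n := funext fun x => (d1 n x).deriv
    rw [← this]; exact (hcs n).deriv
  have hcs2 : HasCompactSupport (g2 n) := by
    have : deriv (g1 n) = g2 n := funext fun x => (d2 n x).deriv
    rw [← this]; exact hcs1.deriv
  obtain ⟨k, hk0, hk1, hk2⟩ := (((tendsto_mollify cg (hcs n)).eventually (gt_mem_nhds e4)).and
    (((tendsto_mollify cg1 hcs1).eventually (gt_mem_nhds e4)).and
      ((tendsto_mollify cg2 hcs2).eventually (gt_mem_nhds e4)))).exists
  have hT := mollify_isTest k cg (hcs n)
  have hd := deriv_mollify k (d1 n) cg1 (hcs n)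
  have hd2 : iteratedDeriv 2 (mollify k (g n)) = mollify k (g2 n) := by
    rw [iteratedDeriv_succ, iteratedDeriv_one, hd, deriv_mollify k (d2 n) cg2 hcs1]
  refine ⟨mollify k (g n), hT, ?_, ?_, ?_⟩
  · have := integral_sq_sub_le hT.memLp (M00 n) m
    linarith
  · have := integral_sq_sub_le (hT.deriv.memLp) ((M10 n).add (M01 n)) m1
    rw [hd] at this ⊢
    simp only [Pi.add_apply] at this
    linarith
  · have := integral_sq_sub_le (mollify_isTest k cg2 hcs2).memLp
      (((M20 n).add (M11 n)).add ((M11 n).add (M02 n))) m2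
    rw [hd2]
    simp only [Pi.add_apply] at this
    linarith

theorem abs_ip_L2_sub_le (v : L2) {ψ : ℝ → ℝ} (hψ : MemLp ψ 2 volume) (hφ : MemLp φ 2 volume)
    {ε : ℝ} (h : ∫ x, (ψ x - φ x) ^ 2 ≤ ε ^ 2) (hε : 0 ≤ ε) :
    |(∫ x, v x * ψ x) - ∫ x, v x * φ x| ≤ ‖v‖ * ε := by
  rw [← integral_sub (integrable_L2_mul v hψ) (integrable_L2_mul v hφ)]
  simp only [← mul_sub]
  refine (abs_ip_L2_le v (hψ.sub hφ)).trans ?_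
  gcongr
  rw [Real.sqrt_le_left hε]
  exact h

/-- Integration by parts between an `H¹` function and a classical one. -/
theorem H1.integral_mul_deriv (v : H1) (h1 : ∀ x, HasDerivAt φ (φ1 x) x) (hc : Continuous φ1)
    (m : MemLp φ 2 volume) (m1 : MemLp φ1 2 volume) :
    ∫ x, v.fn x * φ1 x = -∫ x, v.dx x * φ x := by
  by_contra hne
  set d := (∫ x, v.fn x * φ1 x) + ∫ x, v.dx x * φ x with hd
  have hd0 : 0 < |d| := abs_pos.2 fun h => hne (by linarith)
  set N := ‖v.1.fst‖ + ‖v.1.snd‖ + 1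
  have hN : 0 < N := by positivity
  have hε : 0 < |d| / (2 * N) := by positivity
  obtain ⟨ψ, hψ, a0, a1⟩ := exists_isTest_approx_one h1 hc m m1 (pow_pos hε 2)
  have b1 := abs_ip_L2_sub_le v.1.fst hψ.deriv.memLp m1 a1 hε.le
  have b0 := abs_ip_L2_sub_le v.1.snd hψ.memLp m a0 hε.le
  have hw : ∫ x, v.1.fst x * deriv ψ x = -∫ x, v.1.snd x * ψ x := v.2 ψ hψ
  have hle : |d| ≤ ‖v.1.fst‖ * (|d| / (2 * N)) + ‖v.1.snd‖ * (|d| / (2 * N)) := by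
    rw [hd]
    change |(∫ x, v.1.fst x * φ1 x) + ∫ x, v.1.snd x * φ x| ≤ _
    rw [abs_le] at b0 b1 ⊢
    constructor <;> linarith [b0.1, b0.2, b1.1, b1.2]
  have : N * (|d| / (2 * N)) = |d| / 2 := by field_simp
  have h3 : (‖v.1.fst‖ + ‖v.1.snd‖) * (|d| / (2 * N)) ≤ N * (|d| / (2 * N)) := by
    gcongr; linarith
  linarith

end Approx

/-! ### The Sobolev inequality on the line -/

/-- The difference of two bump functions of mass one is the derivative of a test function which
is bounded by one and supported in `[-1, 1]`. -/
theorem exists_primitive_bump (n m : ℕ) : ∃ Φ : ℝ → ℝ, IsTest Φ ∧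
    (∀ x, HasDerivAt Φ ((bumpSeq n).normed volume x - (bumpSeq m).normed volume x) x) ∧
    ∀ x, |Φ x| ≤ (Icc (-1) 1).indicator (fun _ => (1 : ℝ)) x := by
  set ρ : ℕ → ℝ → ℝ := fun n => (bumpSeq n).normed volume with hρ
  have hcont : ∀ n, Continuous (ρ n) := fun n => (bumpSeq n).continuous_normed
  have hnn : ∀ n x, 0 ≤ ρ n x := fun n x => (bumpSeq n).nonneg_normed x
  have hint : ∀ n, ∫ x, ρ n x = 1 := fun n => (bumpSeq n).integral_normed
  have hi : ∀ n, Integrable (ρ n) := fun n => (bumpSeq n).integrable_normed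
  have hz : ∀ n x, x ∉ Ioo (-1 : ℝ) 1 → ρ n x = 0 := by
    intro n x hx
    by_contra h
    have h1 : x ∈ Function.support ((bumpSeq n).normed volume) := h
    rw [(bumpSeq n).support_normed_eq, mem_ball_zero_iff, Real.norm_eq_abs] at h1
    have := h1.trans_le (bumpSeq_rOut_le n)
    exact hx (abs_lt.1 this)
  set Φ : ℝ → ℝ := fun x => ∫ s in (-2 : ℝ)..x, (ρ n s - ρ m s) with hΦ
  have hd : ∀ x, HasDerivAt Φ (ρ n x - ρ m x) x := fun x =>
    intervalIntegral.integral_hasDerivAt_right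
      (((hcont n).sub (hcont m)).intervalIntegrable _ _)
      ((hcont n).sub (hcont m)).stronglyMeasurable.stronglyMeasurableAtFilter
      ((hcont n).sub (hcont m)).continuousAt
  have hsplit : ∀ x, Φ x = (∫ s in (-2 : ℝ)..x, ρ n s) - ∫ s in (-2 : ℝ)..x, ρ m s := fun x =>
    intervalIntegral.integral_sub ((hcont n).intervalIntegrable _ _)
      ((hcont m).intervalIntegrable _ _)
  have hout : ∀ x, x ∉ Icc (-1 : ℝ) 1 → Φ x = 0 := by
    intro x hx
    rcases lt_or_ge x (-1) with h | h
    · rw [hΦ]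
      dsimp only
      rw [intervalIntegral.integral_congr (g := fun _ => (0 : ℝ))]
      · simp
      · intro s hs
        have hs1 : s ≤ -1 := hs.2.trans (max_le (by norm_num) h.le)
        have hs' : s ∉ Ioo (-1 : ℝ) 1 := fun h => absurd h.1 (not_lt.2 hs1)
        simp [hz _ s hs']
    · have h1 : 1 < x := by
        by_contra h2
        exact hx ⟨h, not_lt.1 h2⟩
      have hs : ∀ k, Function.support (ρ k) ⊆ Ioc (-2) x := by
        intro k s hs
        by_contra h2
        refine hs (hz k s fun h3 => h2 ⟨by linarith [h3.1], by linarith [h3.2]⟩)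
      rw [hsplit, intervalIntegral.integral_eq_integral_of_support_subset (hs n),
        intervalIntegral.integral_eq_integral_of_support_subset (hs m), hint, hint, sub_self]
  have hb : ∀ k x, -2 ≤ x → 0 ≤ ∫ s in (-2 : ℝ)..x, ρ k s ∧ ∫ s in (-2 : ℝ)..x, ρ k s ≤ 1 := by
    intro k x hx
    refine ⟨intervalIntegral.integral_nonneg hx fun s _ => hnn k s, ?_⟩
    rw [intervalIntegral.integral_of_le hx, ← hint k]
    exact setIntegral_le_integral (hi k) (ae_of_all _ (hnn k))
  have hder : deriv Φ = fun x => ρ n x - ρ m x := funext fun x => (hd x).deriv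
  refine ⟨Φ, ⟨?_, ?_⟩, hd, fun x => ?_⟩
  · rw [contDiff_infty_iff_deriv, hder]
    exact ⟨fun x => (hd x).differentiableAt,
      (bumpSeq n).contDiff_normed.sub (bumpSeq m).contDiff_normed⟩
  · exact HasCompactSupport.intro isCompact_Icc hout
  · by_cases hx : x ∈ Icc (-1 : ℝ) 1
    · rw [indicator_of_mem hx, hsplit, abs_le]
      have h1 := hb n x (by linarith [hx.1])
      have h2 := hb m x (by linarith [hx.1])
      constructor <;> linarith [h1.1, h1.2, h2.1, h2.2]
    · rw [indicator_of_notMem hx, hout x hx, abs_zero]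

theorem IsTest.comp_const_sub {Φ : ℝ → ℝ} (h : IsTest Φ) (x : ℝ) :
    IsTest fun y => Φ (x - y) :=
  ⟨h.1.comp (contDiff_const.sub contDiff_id), h.2.comp_homeomorph (Homeomorph.subLeft x)⟩

/-- The Sobolev embedding `H¹(ℝ) ⊂ L^∞(ℝ)`.  A local average of `v` at a small scale differs from
the one at scale one by the pairing of the weak derivative with a bounded primitive, and the local
averages converge to `v` almost everywhere. -/
theorem exists_sobolev_const : ∃ S > 0, ∀ v : H1, ∀ᵐ x, |v.fn x| ≤ S * ‖v‖ := by
  set θ : ℝ → ℝ := (bumpSeq 0).normed volume with hθ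
  have hθT : IsTest θ := ⟨(bumpSeq 0).contDiff_normed, (bumpSeq 0).hasCompactSupport_normed⟩
  refine ⟨√(∫ x, θ x ^ 2) + √2, by positivity, fun v => ?_⟩
  have hloc : LocallyIntegrable v.fn volume :=
    v.memLp_fn.locallyIntegrable (by norm_num)
  have hae := ContDiffBump.ae_convolution_tendsto_right_of_locallyIntegrable (μ := volume)
    (φ := bumpSeq) (K := 2) tendsto_bumpSeq_rOut (Eventually.of_forall fun n => by
      simp only [bumpSeq]; linarith) hloc
  filter_upwards [hae] with x hx
  refine le_of_tendsto hx.abs (Eventually.of_forall fun n => ?_)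
  obtain ⟨Φ, hΦ, hd, hb⟩ := exists_primitive_bump n 0
  have hT := hΦ.comp_const_sub x
  have hder : deriv (fun y => Φ (x - y)) =
      fun y => -((bumpSeq n).normed volume (x - y) - θ (x - y)) :=
    funext fun y => ((hd (x - y)).comp_const_sub x y).deriv
  have hρT : IsTest ((bumpSeq n).normed volume) :=
    ⟨(bumpSeq n).contDiff_normed, (bumpSeq n).hasCompactSupport_normed⟩
  have hw : ∫ y, v.1.fst y * deriv (fun y => Φ (x - y)) y = -∫ y, v.1.snd y * Φ (x - y) :=
    v.2 _ hT
  have i1 := integrable_L2_mul v.1.fst (hρT.comp_const_sub x).memLp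
  have i2 := integrable_L2_mul v.1.fst (hθT.comp_const_sub x).memLp
  have e : ∫ y, v.1.fst y * deriv (fun y => Φ (x - y)) y
      = (∫ y, v.1.fst y * θ (x - y)) - ∫ y, v.1.fst y * (bumpSeq n).normed volume (x - y) := by
    rw [← integral_sub i2 i1, hder]
    congr 1; ext y; ring
  have hconv : convolution ((bumpSeq n).normed volume) v.fn (ContinuousLinearMap.lsmul ℝ ℝ) volume x
      = ∫ y, v.1.fst y * (bumpSeq n).normed volume (x - y) := by
    rw [convolution_eq_swap]
    congr 1; ext y
    simp [mul_comm, H1.fn]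
  have b1 := abs_ip_L2_le v.1.fst (hθT.comp_const_sub x).memLp
  have b2 := abs_ip_L2_le v.1.snd hT.memLp
  rw [integral_sub_left_eq_self (fun y => θ y ^ 2) volume x] at b1
  rw [integral_sub_left_eq_self (fun y => Φ y ^ 2) volume x] at b2
  have hΦ2 : ∫ y, Φ y ^ 2 ≤ 2 := by
    have : ∫ y, Φ y ^ 2 ≤ ∫ y, (Icc (-1 : ℝ) 1).indicator (fun _ => (1 : ℝ)) y := by
      refine integral_mono hΦ.memLp.integrable_sq
        ((integrable_indicator_iff measurableSet_Icc).2 (integrableOn_const (by simp))) fun y => ?_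
      have h1 := hb y
      by_cases hy : y ∈ Icc (-1 : ℝ) 1
      · rw [indicator_of_mem hy] at h1 ⊢
        simp only
        rw [← sq_abs]; exact pow_le_one₀ (abs_nonneg _) h1
      · rw [indicator_of_notMem hy] at h1 ⊢
        simp [abs_nonpos_iff.1 h1]
    refine this.trans (le_of_eq ?_)
    rw [integral_indicator measurableSet_Icc]
    simp; norm_num
  have b3 : √(∫ y, Φ y ^ 2) ≤ √2 := Real.sqrt_le_sqrt hΦ2
  rw [hconv]
  have h4 : |∫ y, v.1.fst y * (bumpSeq n).normed volume (x - y)|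
      ≤ |∫ y, v.1.fst y * θ (x - y)| + |∫ y, v.1.snd y * Φ (x - y)| := by
    have : ∫ y, v.1.fst y * (bumpSeq n).normed volume (x - y)
        = (∫ y, v.1.fst y * θ (x - y)) + ∫ y, v.1.snd y * Φ (x - y) := by linarith
    rw [this]; exact abs_add_le _ _
  refine h4.trans ?_
  rw [add_mul]
  refine add_le_add (b1.trans ?_) (b2.trans ?_)
  · rw [mul_comm]; gcongr; exact v.norm_fst_le
  · rw [mul_comm]; gcongr; exact v.norm_snd_le

/-! ### The regularized antiderivative -/

section RegInv

variable {g : ℝ → ℝ} {M γ α : ℝ}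

theorem ew_mul_exp_le {γ α : ℝ} (hα : 0 ≤ α) {x y : ℝ} (h : y ≤ x) :
    ew γ y * Real.exp (α * (y - x)) ≤ ew (γ - α) y * ew α x := by
  rw [ew, ew, ew, ← Real.exp_add, ← Real.exp_add]
  refine Real.exp_le_exp.2 ?_
  rcases le_total 0 x with hx | hx
  · rw [abs_of_nonneg hx]
    nlinarith [le_abs_self y]
  · rw [abs_of_nonpos hx, abs_of_nonpos (h.trans hx)]
    nlinarith

theorem abs_setIntegral_le {s : Set ℝ} (hs : MeasurableSet s) {g b : ℝ → ℝ}
    (hb : IntegrableOn b s) (h : ∀ y ∈ s, |g y| ≤ b y) : |∫ y in s, g y| ≤ ∫ y in s, b y := by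
  rw [← Real.norm_eq_abs]
  exact norm_integral_le_of_norm_le hb ((ae_restrict_iff' hs).2 (ae_of_all _ h))

theorem regInv_eq (α : ℝ) (g : ℝ → ℝ) (x : ℝ) :
    regInv α g x = Real.exp (-(α * x)) * ∫ y in Iic x, g y * Real.exp (α * y) := by
  rw [regInv, ← integral_const_mul]
  congr 1; ext y
  rw [mul_left_comm, ← Real.exp_add]; congr 2; ring

theorem integrable_mul_exp (hg : Continuous g) (hb : ∀ x, |g x| ≤ M * ew γ x)
    (hα : 0 ≤ α) (hαγ : α < γ) : Integrable fun y => g y * Real.exp (α * y) := by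
  refine integrable_of_ew (B := M) (β := γ - α) (a := 0) (by linarith)
    (by fun_prop) fun x => ?_
  have hM : 0 ≤ M := nonneg_of_mul_nonneg_left ((abs_nonneg _).trans (hb 0)) (ew_pos _ _)
  rw [sub_zero, abs_mul, Real.abs_exp]
  refine (mul_le_mul_of_nonneg_right (hb x) (Real.exp_pos _).le).trans ?_
  rw [mul_assoc]
  gcongr
  rw [ew, ew, ← Real.exp_add]
  refine Real.exp_le_exp.2 ?_
  nlinarith [le_abs_self x]

theorem hasDerivAt_integral_Iic {h : ℝ → ℝ} (hc : Continuous h) (hi : Integrable h) (x : ℝ) :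
    HasDerivAt (fun x => ∫ y in Iic x, h y) (h x) x := by
  have e : (fun x => ∫ y in Iic x, h y) =
      fun x => (∫ y in Iic 0, h y) + ∫ y in (0 : ℝ)..x, h y := by
    ext x
    rw [← intervalIntegral.integral_Iic_sub_Iic hi.integrableOn hi.integrableOn]; ring
  rw [e]
  exact (intervalIntegral.integral_hasDerivAt_right (hc.intervalIntegrable _ _)
    (hc.stronglyMeasurableAtFilter _ _) hc.continuousAt).const_add _

theorem hasDerivAt_regInv (hg : Continuous g) (hb : ∀ x, |g x| ≤ M * ew γ x)
    (hα : 0 ≤ α) (hαγ : α < γ) (x : ℝ) :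
    HasDerivAt (regInv α g) (g x - α * regInv α g x) x := by
  have h1 := hasDerivAt_integral_Iic (h := fun y => g y * Real.exp (α * y)) (by fun_prop)
    (integrable_mul_exp hg hb hα hαγ) x
  have h2 : HasDerivAt (fun x => Real.exp (-(α * x))) (Real.exp (-(α * x)) * -(α * 1)) x :=
    ((hasDerivAt_id x).const_mul α).neg.exp
  rw [show regInv α g = fun x => _ from funext fun x => regInv_eq α g x]
  refine (h2.mul h1).congr_deriv ?_
  have e : Real.exp (-(α * x)) * Real.exp (α * x) = 1 := by rw [← Real.exp_add]; simp
  linear_combination g x * e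

theorem abs_regInv_le (hb : ∀ x, |g x| ≤ M * ew γ x) (hα : 0 ≤ α)
    (hγ : 0 < γ) (hαγ : α ≤ γ / 2) (x : ℝ) : |regInv α g x| ≤ 4 * M / γ * ew α x := by
  have hM : 0 ≤ M := nonneg_of_mul_nonneg_left ((abs_nonneg _).trans (hb 0)) (ew_pos _ _)
  have hd : 0 < γ - α := by linarith
  have hi : Integrable fun y => M * ew (γ - α) y * ew α x :=
    ((integrable_ew hd).const_mul M).mul_const _
  have h1 : |regInv α g x| ≤ ∫ y in Iic x, M * ew (γ - α) y * ew α x := by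
    refine abs_setIntegral_le measurableSet_Iic hi.integrableOn fun y hy => ?_
    rw [abs_mul, Real.abs_exp]
    refine (mul_le_mul_of_nonneg_right (hb y) (Real.exp_pos _).le).trans ?_
    rw [mul_assoc, mul_assoc]
    exact mul_le_mul_of_nonneg_left (ew_mul_exp_le hα hy) hM
  refine h1.trans ((setIntegral_le_integral hi (ae_of_all _ fun y => ?_)).trans ?_)
  · have := ew_nonneg (γ - α) y
    have := ew_nonneg α x
    simp only [Pi.zero_apply]; positivity
  · rw [integral_mul_const, integral_const_mul, integral_ew hd]
    refine mul_le_mul_of_nonneg_right ?_ (ew_nonneg _ _)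
    rw [mul_div_assoc', div_le_div_iff₀ hd hγ]
    nlinarith

theorem regInv_comp_sub (α a : ℝ) (g : ℝ → ℝ) (x : ℝ) :
    regInv α (fun y => g (y - a)) x = regInv α g (x - a) := by
  rw [regInv, regInv, ← integral_indicator measurableSet_Iic, ← integral_indicator measurableSet_Iic,
    ← integral_sub_right_eq_self ((Iic (x - a)).indicator _) a]
  congr 1; ext y
  by_cases h : y ≤ x
  · rw [indicator_of_mem (show y ∈ Iic x from h),
      indicator_of_mem (show y - a ∈ Iic (x - a) from by simpa using h)]
    congr 2; ring
  · rw [indicator_of_notMem (show y ∉ Iic x from h),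
      indicator_of_notMem (show y - a ∉ Iic (x - a) from by simpa using h)]

theorem regInv_eq_integral_Ioi (α : ℝ) (g : ℝ → ℝ) (x : ℝ) :
    regInv α g x = ∫ s in Ioi 0, g (x - s) * Real.exp (-(α * s)) := by
  have e := integral_comp_neg_Ioi (0 : ℝ) (fun y => g (x + y) * Real.exp (α * y))
  have e2 : regInv α g x = ∫ y in Iic (0 : ℝ), g (x + y) * Real.exp (α * y) := by
    rw [regInv, ← integral_indicator measurableSet_Iic, ← integral_indicator measurableSet_Iic,
      ← integral_add_right_eq_self _ x]
    congr 1; ext y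
    by_cases h : y ≤ 0
    · rw [indicator_of_mem (show y + x ∈ Iic x by simpa using h),
        indicator_of_mem (show y ∈ Iic 0 from h)]
      congr 2
      · ring
      · ring
    · rw [indicator_of_notMem (show y + x ∉ Iic x by simpa using h),
        indicator_of_notMem (show y ∉ Iic 0 from h)]
  rw [neg_zero] at e
  rw [e2, ← e]
  simp only [← sub_eq_add_neg, mul_neg]

/-- As `α → 0` the pairing of `g` with its regularized antiderivative tends to that with the
antiderivative, which is half the square of the mass of `g`. -/
theorem abs_integral_mul_regInv_sub_le (hg : Continuous g) (hb : ∀ x, |g x| ≤ M * ew γ x)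
    (hα : 0 ≤ α) (hγ : 0 < γ) (hαγ : α ≤ γ / 2) :
    |(∫ x, g x * regInv α g x) - (∫ x, g x) ^ 2 / 2| ≤ 48 * M ^ 2 / γ ^ 3 * α := by
  have hM : 0 ≤ M := nonneg_of_mul_nonneg_left ((abs_nonneg _).trans (hb 0)) (ew_pos _ _)
  have hgi : Integrable g := integrable_of_ew (a := 0) hγ hg.aestronglyMeasurable (by simpa using hb)
  set W : ℝ → ℝ := antideriv g with hW
  have dW : ∀ x, HasDerivAt W (g x) x := hasDerivAt_integral_Iic hg hgi
  have cW : Continuous W := continuous_iff_continuousAt.2 fun x => (dW x).continuousAt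
  have cw : Continuous (regInv α g) := continuous_iff_continuousAt.2 fun x =>
    (hasDerivAt_regInv hg hb hα (by linarith) x).continuousAt
  have bW : ∀ x, |W x| ≤ M * (2 / γ) := by
    intro x
    have h1 : |W x| ≤ ∫ y in Iic x, M * ew γ y :=
      abs_setIntegral_le measurableSet_Iic ((integrable_ew hγ).const_mul M).integrableOn
        fun y _ => hb y
    refine h1.trans ((setIntegral_le_integral ((integrable_ew hγ).const_mul M)
      (ae_of_all _ fun y => mul_nonneg hM (ew_nonneg γ y))).trans ?_)
    rw [integral_const_mul, integral_ew hγ]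
  have iW : Integrable fun x => g x * W x := by
    refine integrable_of_ew (B := M * (M * (2 / γ))) (β := γ) (a := 0) hγ
      (hg.mul cW).aestronglyMeasurable fun x => ?_
    rw [abs_mul, sub_zero]
    have := mul_le_mul (hb x) (bW x) (abs_nonneg _) (mul_nonneg hM (ew_nonneg γ x))
    linarith
  have iw : Integrable fun x => g x * regInv α g x := by
    refine integrable_of_ew (B := M * (4 * M / γ)) (β := γ) (a := 0) hγ
      (hg.mul cw).aestronglyMeasurable fun x => ?_
    rw [abs_mul, sub_zero]
    have h1 : |regInv α g x| ≤ 4 * M / γ := (abs_regInv_le hb hα hγ hαγ x).trans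
      (mul_le_of_le_one_right (by positivity) (ew_le_one hα x))
    have := mul_le_mul (hb x) h1 (abs_nonneg _) (mul_nonneg hM (ew_nonneg γ x))
    linarith
  have hsq : ∫ x, g x * W x = (∫ x, g x) ^ 2 / 2 := by
    have hbot : Tendsto W atBot (𝓝 0) := tendsto_integral_Iic_zero tendsto_id
    have htop : Tendsto W atTop (𝓝 (∫ x, g x)) :=
      (aecover_Iic tendsto_id).integral_tendsto_of_countably_generated hgi
    have := integral_of_hasDerivAt_of_tendsto (f := fun x => W x ^ 2 / 2)
      (f' := fun x => g x * W x) (fun x => (((dW x).pow 2).div_const 2).congr_deriv (by simp; ring))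
      iW (m := 0) (n := (∫ x, g x) ^ 2 / 2)
      (by simpa using (hbot.pow 2).div_const 2) ((htop.pow 2).div_const 2)
    rw [this, sub_zero]
  rw [← hsq, ← integral_sub iw iW]
  have hdiff : ∀ x, |regInv α g x - W x| ≤ α * (M * (|x| * (2 / γ) + 2 / γ * (2 / (γ / 2)))) := by
    intro x
    have hgw : ∀ y, |g y * (|x| + |y|)| ≤ M * (|x| * ew γ y + 2 / γ * ew (γ / 2) y) := by
      intro y
      rw [abs_mul, abs_of_nonneg (show 0 ≤ |x| + |y| by positivity)]
      have h1 := mul_le_mul_of_nonneg_right (hb y) (show 0 ≤ |x| + |y| by positivity)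
      have h2 := mul_le_mul_of_nonneg_left (abs_mul_ew_le hγ y) hM
      linarith
    have i1 : Integrable fun y => M * (|x| * ew γ y + 2 / γ * ew (γ / 2) y) :=
      (((integrable_ew hγ).const_mul _).add ((integrable_ew (half_pos hγ)).const_mul _)).const_mul M
    have ie : IntegrableOn (fun y => g y * Real.exp (α * (y - x))) (Iic x) := by
      refine Integrable.mono' (hgi.norm.integrableOn) (by fun_prop) ?_
      refine (ae_restrict_iff' measurableSet_Iic).2 (ae_of_all _ fun y hy => ?_)
      rw [norm_mul]
      refine mul_le_of_le_one_right (norm_nonneg _) ?_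
      rw [Real.norm_eq_abs, Real.abs_exp]
      have hy' : y ≤ x := hy
      exact Real.exp_le_one_iff.2 (by nlinarith)
    have e : regInv α g x - W x = ∫ y in Iic x, (g y * Real.exp (α * (y - x)) - g y) :=
      (integral_sub ie hgi.integrableOn).symm
    have h1 : |regInv α g x - W x| ≤
        ∫ y in Iic x, α * (M * (|x| * ew γ y + 2 / γ * ew (γ / 2) y)) := by
      rw [e]
      refine abs_setIntegral_le measurableSet_Iic (i1.const_mul α).integrableOn fun y hy => ?_
      have hy' : y ≤ x := hy
      have h2 : |Real.exp (α * (y - x)) - 1| ≤ α * (|x| + |y|) := by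
        have e1 := Real.add_one_le_exp (α * (y - x))
        have e2 : Real.exp (α * (y - x)) ≤ 1 := Real.exp_le_one_iff.2 (by nlinarith)
        have e3 : x - y ≤ |x| + |y| := by linarith [le_abs_self x, neg_abs_le y]
        rw [abs_of_nonpos (by linarith)]
        nlinarith
      calc |g y * Real.exp (α * (y - x)) - g y| = |g y| * |Real.exp (α * (y - x)) - 1| := by
            rw [← abs_mul]; congr 1; ring
        _ ≤ |g y| * (α * (|x| + |y|)) := by gcongr
        _ = α * |g y * (|x| + |y|)| := by
            rw [abs_mul, abs_of_nonneg (show 0 ≤ |x| + |y| by positivity)]; ring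
        _ ≤ _ := by gcongr; exact hgw y
    refine h1.trans ((setIntegral_le_integral (i1.const_mul α) (ae_of_all _ fun y => ?_)).trans ?_)
    · have := ew_nonneg γ y
      have := ew_nonneg (γ / 2) y
      simp only [Pi.zero_apply]; positivity
    · rw [integral_const_mul, integral_const_mul, integral_add ((integrable_ew hγ).const_mul _)
        ((integrable_ew (half_pos hγ)).const_mul _), integral_const_mul, integral_const_mul,
        integral_ew hγ, integral_ew (half_pos hγ)]
  have key := abs_integral_le_of_ew (g := fun x => g x * regInv α g x - g x * W x)
    (B := α * (M ^ 2 * (12 / γ ^ 2))) (a := 0) (half_pos hγ) ?_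
  · refine key.trans (le_of_eq ?_)
    field_simp; ring
  · intro x
    rw [sub_zero, ← mul_sub, abs_mul]
    have hx := abs_mul_ew_le hγ x
    have hew : ew γ x ≤ ew (γ / 2) x := ew_anti (by linarith) x
    have hR : 0 ≤ α * (M * (|x| * (2 / γ) + 2 / γ * (2 / (γ / 2)))) := by positivity
    calc |g x| * |regInv α g x - W x|
        ≤ (M * ew γ x) * (α * (M * (|x| * (2 / γ) + 2 / γ * (2 / (γ / 2))))) := by
          gcongr
          exacts [mul_nonneg hM (ew_nonneg _ _), hb x, hdiff x]
      _ = α * M ^ 2 * (2 / γ * (|x| * ew γ x) + 8 / γ ^ 2 * ew γ x) := by field_simp; ring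
      _ ≤ α * M ^ 2 * (2 / γ * (2 / γ * ew (γ / 2) x) + 8 / γ ^ 2 * ew (γ / 2) x) := by gcongr
      _ = _ := by field_simp; ring

end RegInv

/-! ### Localized families of profiles -/

/-- The linear form `(s, r) ↦ s u + r v` on the plane. -/
def planeForm (u v : ℝ) : ℝ × ℝ →L[ℝ] ℝ :=
  (ContinuousLinearMap.fst ℝ ℝ ℝ).smulRight u + (ContinuousLinearMap.snd ℝ ℝ ℝ).smulRight v

@[simp] theorem planeForm_apply (u v : ℝ) (p : ℝ × ℝ) :
    planeForm u v p = p.1 * u + p.2 * v := by simp [planeForm]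

theorem norm_planeForm_le (u v : ℝ) : ‖planeForm u v‖ ≤ |u| + |v| := by
  refine ContinuousLinearMap.opNorm_le_bound _ (by positivity) fun p => ?_
  rw [planeForm_apply, Real.norm_eq_abs]
  have h1 : |p.1| ≤ ‖p‖ := norm_fst_le p
  have h2 : |p.2| ≤ ‖p‖ := norm_snd_le p
  refine (abs_add_le _ _).trans ?_
  rw [abs_mul, abs_mul, add_mul, mul_comm |u|, mul_comm |v|]
  gcongr

theorem continuous_planeForm {u v : ℝ → ℝ} (hu : Continuous u) (hv : Continuous v) :
    Continuous fun x => planeForm (u x) (v x) :=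
  ((ContinuousLinearMap.smulRightL ℝ (ℝ × ℝ) ℝ
    (ContinuousLinearMap.fst ℝ ℝ ℝ)).continuous.comp hu).add
  ((ContinuousLinearMap.smulRightL ℝ (ℝ × ℝ) ℝ
    (ContinuousLinearMap.snd ℝ ℝ ℝ)).continuous.comp hv)

/-- A differentiable family `G(c, y)` with partial derivatives `Gc`, `Gy`, all decaying
exponentially in `y` at rate `β`, uniformly for `c` in a ball. -/
structure IsProfileFamily (G Gc Gy : ℝ → ℝ → ℝ) (c₀ ρ β M : ℝ) : Prop where
  hasFDerivAt : ∀ c ∈ Metric.ball c₀ ρ, ∀ y, HasFDerivAt (Function.uncurry G)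
    (planeForm (Gc c y) (Gy c y)) (c, y)
  continuous_speed : ∀ c ∈ Metric.ball c₀ ρ, Continuous (Gc c)
  continuous_space : ∀ c ∈ Metric.ball c₀ ρ, Continuous (Gy c)
  bound : ∀ c ∈ Metric.ball c₀ ρ, ∀ y, |G c y| ≤ M * ew β y
  bound_speed : ∀ c ∈ Metric.ball c₀ ρ, ∀ y, |Gc c y| ≤ M * ew β y
  bound_space : ∀ c ∈ Metric.ball c₀ ρ, ∀ y, |Gy c y| ≤ M * ew β y

theorem IsProfileFamily.mono {G Gc Gy : ℝ → ℝ → ℝ} {c₀ ρ β M β' M' : ℝ}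
    (h : IsProfileFamily G Gc Gy c₀ ρ β M) (hβ : β' ≤ β) (hM : M ≤ M') (hM' : 0 ≤ M') :
    IsProfileFamily G Gc Gy c₀ ρ β' M' := by
  have e : ∀ v y, |v| ≤ M * ew β y → |v| ≤ M' * ew β' y := fun v y hv =>
    hv.trans (mul_le_mul hM (ew_anti hβ y) (ew_nonneg _ _) hM')
  exact ⟨h.hasFDerivAt, h.continuous_speed, h.continuous_space,
    fun c hc y => e _ _ (h.bound c hc y), fun c hc y => e _ _ (h.bound_speed c hc y),
    fun c hc y => e _ _ (h.bound_space c hc y)⟩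

theorem IsProfileFamily.hasDerivAt_space {G Gc Gy : ℝ → ℝ → ℝ} {c₀ ρ β M : ℝ}
    (h : IsProfileFamily G Gc Gy c₀ ρ β M) {c : ℝ} (hc : c ∈ Metric.ball c₀ ρ) (y : ℝ) :
    HasDerivAt (G c) (Gy c y) y := by
  have h1 : HasDerivAt (fun x' : ℝ => (c, x')) ((0 : ℝ), (1 : ℝ)) y :=
    (hasDerivAt_const y c).prodMk (hasDerivAt_id y)
  simpa [Function.comp_def] using (h.hasFDerivAt c hc y).comp_hasDerivAt y h1

theorem continuous_slice {g : ℝ → ℝ → ℝ} {O : Set ℝ}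
    (h : ContinuousOn (Function.uncurry g) (O ×ˢ univ)) {c : ℝ} (hc : c ∈ O) :
    Continuous (g c) := by
  have : ContinuousOn (fun x : ℝ => Function.uncurry g (c, x)) univ :=
    h.comp (by fun_prop) fun x _ => ⟨hc, mem_univ x⟩
  exact continuousOn_univ.1 this

section Families

variable {f : ℝ → ℝ} {I₀ : Set ℝ} {Q : ℝ → ℝ → ℝ} {c₀ ρ γ M α : ℝ}

theorem HasDecay.isProfileFamily (hD : HasDecay I₀ Q c₀ ρ γ M)
    (hQ : IsSolitaryWaveFamily f I₀ Q) :
    IsProfileFamily Q (dSpeed Q) (dSpace Q) c₀ ρ γ M where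
  hasFDerivAt c hc y := by
    have h := hQ.differentiableAt (hD.subset hc) y
    rw [planeForm, ← fderiv_eq_dSpeed_dSpace h]; exact h.hasFDerivAt
  continuous_speed c hc := continuous_slice hQ.contDiffOn_speed.continuousOn (hD.subset hc)
  continuous_space c hc := continuous_slice hQ.contDiffOn_space.continuousOn (hD.subset hc)
  bound := hD.profile
  bound_speed := hD.speed
  bound_space := hD.space

theorem HasDecay.isProfileFamily_speed (hD : HasDecay I₀ Q c₀ ρ γ M)
    (hQ : IsSolitaryWaveFamily f I₀ Q) :
    IsProfileFamily (dSpeed Q) (dSpeed (dSpeed Q)) (dSpace (dSpeed Q)) c₀ ρ γ M where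
  hasFDerivAt c hc y := by
    have h := hQ.differentiableAt_speed (hD.subset hc) y
    rw [planeForm, ← fderiv_eq_dSpeed_dSpace h]; exact h.hasFDerivAt
  continuous_speed c hc := continuous_slice hQ.contDiffOn_speed2.continuousOn (hD.subset hc)
  continuous_space c hc := continuous_slice hQ.contDiffOn_speed_space.continuousOn (hD.subset hc)
  bound := hD.speed
  bound_speed := hD.speed_speed
  bound_space := hD.speed_space

/-- The regularized antiderivative of a localized family is a localized family, at rate `α`. -/
theorem IsProfileFamily.regInv {G Gc Gy : ℝ → ℝ → ℝ} (h : IsProfileFamily G Gc Gy c₀ ρ γ M)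
    (hγ : 0 < γ) (hM : 0 ≤ M) (hα : 0 < α) (hα1 : α ≤ 1) (hαγ : α ≤ γ / 2) :
    IsProfileFamily (fun c => regInv α (G c)) (fun c => regInv α (Gc c))
      (fun c y => G c y - α * regInv α (G c) y) c₀ ρ α (M + 4 * M / γ) := by
  have cG : ∀ c ∈ Metric.ball c₀ ρ, Continuous (G c) := fun c hc =>
    continuous_iff_continuousAt.2 fun y => (h.hasDerivAt_space hc y).continuousAt
  have dR : ∀ c ∈ Metric.ball c₀ ρ, ∀ y, HasDerivAt (BKdV.regInv α (G c))
      (G c y - α * BKdV.regInv α (G c) y) y := fun c hc y =>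
    hasDerivAt_regInv (cG c hc) (h.bound c hc) hα.le (by linarith) y
  have cR : ∀ c ∈ Metric.ball c₀ ρ, Continuous (BKdV.regInv α (G c)) := fun c hc =>
    continuous_iff_continuousAt.2 fun y => (dR c hc y).continuousAt
  have hK : 0 ≤ 4 * M / γ := by positivity
  have bR := fun c hc y => abs_regInv_le (h.bound c hc) hα.le hγ hαγ y
  have hexp : Integrable (fun s => Real.exp (-(α * s))) (volume.restrict (Ioi 0)) := by
    have : IntegrableOn (fun s => Real.exp (-(α * s))) (Ioi 0) volume := by
      simpa only [neg_mul] using exp_neg_integrableOn_Ioi 0 hα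
    exact this
  have hMew : ∀ v y, |v| ≤ M * ew γ y → |v| ≤ M := fun v y hv =>
    hv.trans (mul_le_of_le_one_right hM (ew_le_one hγ.le y))
  have cF : ∀ p ∈ Metric.ball c₀ ρ ×ˢ (univ : Set ℝ), Continuous fun s =>
      G p.1 (p.2 - s) * Real.exp (-(α * s)) := fun p hp => by
    have := cG p.1 hp.1
    fun_prop
  have cF' : ∀ p ∈ Metric.ball c₀ ρ ×ˢ (univ : Set ℝ), Continuous fun s =>
      Real.exp (-(α * s)) • planeForm (Gc p.1 (p.2 - s)) (Gy p.1 (p.2 - s)) := fun p hp =>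
    Continuous.smul (f := fun s => Real.exp (-(α * s))) (by fun_prop) (continuous_planeForm
      ((h.continuous_speed p.1 hp.1).comp (continuous_const.sub continuous_id))
      ((h.continuous_space p.1 hp.1).comp (continuous_const.sub continuous_id)))
  have bF' : ∀ p ∈ Metric.ball c₀ ρ ×ˢ (univ : Set ℝ), ∀ s,
      ‖Real.exp (-(α * s)) • planeForm (Gc p.1 (p.2 - s)) (Gy p.1 (p.2 - s))‖
        ≤ Real.exp (-(α * s)) * (M + M) := by
    intro p hp s
    rw [norm_smul, Real.norm_eq_abs, Real.abs_exp]
    gcongr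
    exact (norm_planeForm_le _ _).trans (add_le_add (hMew _ _ (h.bound_speed p.1 hp.1 _))
      (hMew _ _ (h.bound_space p.1 hp.1 _)))
  have hn : ∀ c ∈ Metric.ball c₀ ρ, ∀ y, Metric.ball c₀ ρ ×ˢ (univ : Set ℝ) ∈ 𝓝 (c, y) :=
    fun c hc y => (Metric.isOpen_ball.prod isOpen_univ).mem_nhds ⟨hc, mem_univ _⟩
  refine ⟨fun c hc y => ?_, fun c hc => ?_, fun c hc => (cG c hc).sub ((cR c hc).const_mul α),
    fun c hc y => ?_, fun c hc y => ?_, fun c hc y => ?_⟩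
  · have key := hasFDerivAt_integral_of_dominated_of_fderiv_le (𝕜 := ℝ)
      (μ := volume.restrict (Ioi (0 : ℝ)))
      (x₀ := (c, y)) (F := fun p s => G p.1 (p.2 - s) * Real.exp (-(α * s)))
      (F' := fun p s => Real.exp (-(α * s)) • planeForm (Gc p.1 (p.2 - s)) (Gy p.1 (p.2 - s)))
      (bound := fun s => Real.exp (-(α * s)) * (M + M)) (hn c hc y)
      (by filter_upwards [hn c hc y] with p hp using (cF p hp).aestronglyMeasurable) ?_
      (cF' (c, y) ⟨hc, mem_univ _⟩).aestronglyMeasurable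
      (ae_of_all _ fun s p hp => bF' p hp s) (hexp.mul_const _) ?_
    · have e : Function.uncurry (fun c => BKdV.regInv α (G c))
          = fun p : ℝ × ℝ => ∫ s in Ioi 0, G p.1 (p.2 - s) * Real.exp (-(α * s)) :=
        funext fun p => regInv_eq_integral_Ioi α _ _
      rw [← e] at key
      have d1 : HasDerivAt (fun x' : ℝ => (c, x')) ((0 : ℝ), (1 : ℝ)) y :=
        (hasDerivAt_const y c).prodMk (hasDerivAt_id y)
      have p2 := (key.comp_hasDerivAt y d1).unique (dR c hc y)
      have hint : Integrable (fun s => Real.exp (-(α * s)) •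
          planeForm (Gc c (y - s)) (Gy c (y - s))) (volume.restrict (Ioi 0)) :=
        (hexp.mul_const (M + M)).mono' (cF' (c, y) ⟨hc, mem_univ _⟩).aestronglyMeasurable
          (ae_of_all _ fun s => bF' (c, y) ⟨hc, mem_univ _⟩ s)
      have p1 : (∫ s in Ioi 0, Real.exp (-(α * s)) •
          planeForm (Gc c (y - s)) (Gy c (y - s))) ((1 : ℝ), (0 : ℝ))
          = BKdV.regInv α (Gc c) y := by
        rw [ContinuousLinearMap.integral_apply hint, regInv_eq_integral_Ioi]
        congr 1; ext s; simp [mul_comm]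
      refine key.congr_fderiv ?_
      ext
      · simp [p1]
      · simpa using p2
    · refine (hexp.mul_const M).mono' (cF (c, y) ⟨hc, mem_univ _⟩).aestronglyMeasurable
        (ae_of_all _ fun s => ?_)
      rw [norm_mul, Real.norm_eq_abs, Real.norm_eq_abs, Real.abs_exp, mul_comm]
      gcongr
      exact hMew _ _ (h.bound c hc _)
    · refine ae_of_all _ fun s p hp => ?_
      have h1 : HasFDerivAt (fun p : ℝ × ℝ => (p.1, p.2 - s)) (ContinuousLinearMap.id ℝ (ℝ × ℝ)) p :=
        (hasFDerivAt_fst.prodMk (hasFDerivAt_snd.sub_const s)).congr_fderiv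
          ContinuousLinearMap.fst_prod_snd
      have h2 : HasFDerivAt (fun p : ℝ × ℝ => G p.1 (p.2 - s))
          (planeForm (Gc p.1 (p.2 - s)) (Gy p.1 (p.2 - s))) p := by
        have h3 := HasFDerivAt.comp (g := Function.uncurry G) p
          (h.hasFDerivAt p.1 hp.1 (p.2 - s)) h1
        rw [ContinuousLinearMap.comp_id] at h3
        exact h3
      exact h2.mul_const (Real.exp (-(α * s)))
  · have hb := h.bound_speed c hc
    exact continuous_iff_continuousAt.2 fun y =>
      (hasDerivAt_regInv (h.continuous_speed c hc) hb hα.le (by linarith) y).continuousAt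
  · exact (bR c hc y).trans (mul_le_mul_of_nonneg_right (by linarith) (ew_nonneg _ _))
  · exact (abs_regInv_le (h.bound_speed c hc) hα.le hγ hαγ y).trans
      (mul_le_mul_of_nonneg_right (by linarith) (ew_nonneg _ _))
  · have h1 := h.bound c hc y
    have h2 := bR c hc y
    have h3 : M * ew γ y ≤ M * ew α y := by gcongr; exact ew_anti (by linarith) y
    have h4 : α * |BKdV.regInv α (G c) y| ≤ |BKdV.regInv α (G c) y| :=
      mul_le_of_le_one_left (abs_nonneg _) hα1
    have h5 := abs_sub (G c y) (α * BKdV.regInv α (G c) y)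
    rw [abs_mul, abs_of_pos hα] at h5
    rw [add_mul]
    linarith

end Families

/-! ### Symplectic orthogonality and uniform data of the profiles -/

theorem integral_eq_zero_of_odd {g : ℝ → ℝ} (h : ∀ x, g (-x) = -g x) : ∫ x, g x = 0 := by
  have h1 := integral_neg_eq_self g volume
  simp only [h, integral_neg] at h1
  linarith

theorem continuousAt_integral_of_ew {G : ℝ → ℝ → ℝ} {c₀ ρ β M : ℝ} (hρ : 0 < ρ) (hβ : 0 < β)
    (hG : ContinuousOn (Function.uncurry G) (Metric.ball c₀ ρ ×ˢ univ))
    (hb : ∀ c ∈ Metric.ball c₀ ρ, ∀ y, |G c y| ≤ M * ew β y) :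
    ContinuousAt (fun c => ∫ y, G c y) c₀ := by
  have hn : Metric.ball c₀ ρ ∈ 𝓝 c₀ := Metric.ball_mem_nhds _ hρ
  refine continuousAt_of_dominated (bound := fun y => M * ew β y) ?_ ?_
    ((integrable_ew hβ).const_mul M) (ae_of_all _ fun y => ?_)
  · filter_upwards [hn] with c hc using (continuous_slice hG hc).aestronglyMeasurable
  · filter_upwards [hn] with c hc using ae_of_all _ fun y => hb c hc y
  · have h1 : ContinuousAt (Function.uncurry G) (c₀, y) :=
      hG.continuousAt ((Metric.isOpen_ball.prod isOpen_univ).mem_nhds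
        ⟨Metric.mem_ball_self hρ, mem_univ _⟩)
    exact ContinuousAt.comp (f := fun c => (c, y)) (g := Function.uncurry G) h1
      (by fun_prop)

theorem zetaTr_apply (Q : ℝ → ℝ → ℝ) (c a x : ℝ) : zetaTr Q c a x = -dSpace Q c (x - a) := by
  rw [zetaTr, dSpace]
  exact deriv_comp_const_sub _ _ _

section Orth

variable {f : ℝ → ℝ} {I₀ : Set ℝ} {Q : ℝ → ℝ → ℝ} {c₀ ρ γ M α : ℝ}

theorem abs_mul_le_ew {u v M N β β' y : ℝ} (hM : 0 ≤ M) (hβ' : 0 ≤ β') (hu : |u| ≤ M * ew β y)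
    (hv : |v| ≤ N * ew β' y) : |u * v| ≤ M * N * ew β y := by
  have hN : 0 ≤ N := nonneg_of_mul_nonneg_left ((abs_nonneg _).trans hv) (ew_pos _ _)
  have h1 : |v| ≤ N := hv.trans (mul_le_of_le_one_right hN (ew_le_one hβ' y))
  rw [abs_mul]
  calc |u| * |v| ≤ M * ew β y * N := by
        gcongr
        exact mul_nonneg hM (ew_nonneg _ _)
    _ = _ := by ring

theorem IsSolitaryWaveFamily.dSpace_odd (hQ : IsSolitaryWaveFamily f I₀ Q) {c : ℝ} (hc : c ∈ I₀)
    (x : ℝ) : dSpace Q c (-x) = -dSpace Q c x := by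
  have h1 : HasDerivAt (fun y => Q c (-y)) (-dSpace Q c (-x)) x := by
    simpa using! (hQ.hasDerivAt hc (-x)).scomp x (hasDerivAt_neg x)
  have h2 : HasDerivAt (fun y => Q c (-y)) (dSpace Q c x) x := by
    rw [show (fun y => Q c (-y)) = Q c from funext (hQ.wave c hc).even]
    exact hQ.hasDerivAt hc x
  have := h1.unique h2
  linarith

theorem IsSolitaryWaveFamily.integral_dSpace_sq_pos (hQ : IsSolitaryWaveFamily f I₀ Q)
    (hD : HasDecay I₀ Q c₀ ρ γ M) {c : ℝ} (hc : c ∈ Metric.ball c₀ ρ) :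
    0 < ∫ x, dSpace Q c x ^ 2 := by
  have hcI := hD.subset hc
  have hP := hD.isProfileFamily hQ
  have hint : Integrable fun x => dSpace Q c x ^ 2 :=
    (memLp_of_ew (a := 0) hD.rate_pos (hP.continuous_space c hc).aestronglyMeasurable
      (by simpa using hD.space c hc)).integrable_sq
  refine (integral_nonneg fun x => sq_nonneg _).lt_of_ne fun h => ?_
  have h0 := (integral_eq_zero_iff_of_nonneg (fun x => sq_nonneg _) hint).1 h.symm
  have h1 : (fun x => dSpace Q c x ^ 2) = fun _ => 0 :=
    (Continuous.ae_eq_iff_eq volume ((hP.continuous_space c hc).pow 2) continuous_const).1 h0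
  have h2 : ∀ x, deriv (Q c) x = 0 := fun x => pow_eq_zero_iff two_ne_zero |>.1 (congrFun h1 x)
  have h3 := is_const_of_deriv_eq_zero (fun x => (hQ.hasDerivAt hcI x).differentiableAt) h2
  -- a constant profile does not vanish at infinity
  have h4 : Q c 0 = 0 := by
    refine tendsto_nhds_unique ?_ (hQ.wave c hcI).tendsto_atTop
    rw [show Q c = fun _ => Q c 0 from funext fun y => h3 y 0]
    exact tendsto_const_nhds
  exact absurd ((hQ.wave c hcI).pos 0) (by rw [h4]; exact lt_irrefl 0)

/-- On the tangent space the regularized symplectic operator is explicit: it maps the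
translation vector to `-Q` and the normalization vector to its regularized antiderivative, since
by parity the two vectors are orthogonal. -/
theorem regSymp_tangent (hQ : IsSolitaryWaveFamily f I₀ Q) (hD : HasDecay I₀ Q c₀ ρ γ M)
    {c : ℝ} (hc : c ∈ Metric.ball c₀ ρ) (a s r : ℝ) :
    regSymp Q α c a (s • zetaTr Q c a + r • zetaN Q c a)
      = fun x => -s * Q c (x - a) + r * regInv α (dSpeed Q c) (x - a) := by
  have hcI := hD.subset hc
  have hP := hD.isProfileFamily hQ
  have hPz := hD.isProfileFamily_speed hQ
  have hγ := hD.rate_pos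
  have ez : zetaTr Q c a = fun x => -dSpace Q c (x - a) := funext fun x => zetaTr_apply Q c a x
  have en : zetaN Q c a = fun x => dSpeed Q c (x - a) := rfl
  have cS := hP.continuous_space c hc
  have cN := hP.continuous_speed c hc
  have cS' : Continuous fun x => dSpace Q c (x - a) := by fun_prop
  have cN' : Continuous fun x => dSpeed Q c (x - a) := by fun_prop
  have mS : MemLp (fun x => dSpace Q c (x - a)) 2 volume :=
    memLp_of_ew hγ cS'.aestronglyMeasurable fun x => hD.space c hc (x - a)
  have mN : MemLp (fun x => dSpeed Q c (x - a)) 2 volume :=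
    memLp_of_ew hγ cN'.aestronglyMeasurable fun x => hD.speed c hc (x - a)
  have hself : ip (zetaTr Q c a) (zetaTr Q c a) = ∫ x, dSpace Q c x ^ 2 := by
    rw [ez, ip, ← integral_sub_right_eq_self (fun x => dSpace Q c x ^ 2) a]
    congr 1; ext x; ring
  have hpos : ip (zetaTr Q c a) (zetaTr Q c a) ≠ 0 := by
    rw [hself]; exact (hQ.integral_dSpace_sq_pos hD hc).ne'
  have hcross : ip (zetaTr Q c a) (zetaN Q c a) = 0 := by
    have : ip (zetaTr Q c a) (zetaN Q c a) = ∫ x, -dSpace Q c x * dSpeed Q c x := by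
      rw [ez, en, ip, ← integral_sub_right_eq_self (fun x => -dSpace Q c x * dSpeed Q c x) a]
    rw [this]
    refine integral_eq_zero_of_odd fun x => ?_
    rw [hQ.dSpace_odd hcI, hQ.speed_even hcI]; ring
  have hcoef : ip (zetaTr Q c a) (s • zetaTr Q c a + r • zetaN Q c a)
      = s * ip (zetaTr Q c a) (zetaTr Q c a) := by
    have e : ip (zetaTr Q c a) (s • zetaTr Q c a + r • zetaN Q c a)
        = s * ip (zetaTr Q c a) (zetaTr Q c a) + r * ip (zetaTr Q c a) (zetaN Q c a) := by
      simp only [ip]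
      rw [← integral_const_mul, ← integral_const_mul, ← integral_add]
      · congr 1; ext x; simp; ring
      · rw [ez]; exact ((mS.neg.integrable_mul mS.neg).const_mul s)
      · rw [ez, en]; exact ((mS.neg.integrable_mul mN).const_mul r)
    rw [e, hcross]; ring
  have hproj : projTr Q c a (s • zetaTr Q c a + r • zetaN Q c a) = s • zetaTr Q c a := by
    rw [projTr, hcoef, mul_div_assoc, div_self hpos, mul_one]
  have hanti : ∀ x, antideriv (s • zetaTr Q c a) x = -s * Q c (x - a) := by
    intro x
    have hlim : Tendsto (fun y => Q c (y - a)) atBot (𝓝 0) :=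
      ((hQ.wave c hcI).decay.mono_left atBot_le_cocompact).comp
        (tendsto_atBot_add_const_right _ _ tendsto_id)
    have := integral_Iic_of_hasDerivAt_of_tendsto' (a := x) (f := fun y => Q c (y - a))
      (f' := fun y => dSpace Q c (y - a))
      (fun y _ => (hQ.hasDerivAt hcI (y - a)).comp_sub_const y a)
      (integrable_of_ew hγ cS'.aestronglyMeasurable fun x => hD.space c hc (x - a)).integrableOn
      hlim
    rw [sub_zero] at this
    rw [antideriv, ez, ← this, ← integral_const_mul]
    congr 1; ext y; simp
  ext x
  rw [regSymp, hproj, Pi.add_apply, hanti, add_sub_cancel_left]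
  congr 1
  rw [← regInv_comp_sub, regInv, regInv, ← integral_const_mul]
  congr 1; ext y
  simp only [Pi.smul_apply, smul_eq_mul, en]; ring

/-- Symplectic orthogonality to the tangent space amounts to orthogonality to the profile and to the
regularized antiderivative of its speed derivative. -/
theorem sympOrthogonal_iff (hQ : IsSolitaryWaveFamily f I₀ Q) (hD : HasDecay I₀ Q c₀ ρ γ M)
    (hα : 0 < α) (hαγ : α ≤ γ / 2) {c : ℝ} (hc : c ∈ Metric.ball c₀ ρ) (a : ℝ) (ξ : H1) :
    SympOrthogonal Q α c a ξ ↔ ip ξ.fn (fun x => Q c (x - a)) = 0 ∧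
      ip ξ.fn (fun x => regInv α (dSpeed Q c) (x - a)) = 0 := by
  have hγ := hD.rate_pos
  have hP := hD.isProfileFamily hQ
  have dw : ∀ y, HasDerivAt (regInv α (dSpeed Q c)) _ y := fun y =>
    hasDerivAt_regInv (hP.continuous_speed c hc) (hD.speed c hc) hα.le (by linarith) y
  have cw : Continuous fun x => regInv α (dSpeed Q c) (x - a) :=
    (continuous_iff_continuousAt.2 fun y => (dw y).continuousAt).comp (by fun_prop)
  have cq : Continuous fun x => Q c (x - a) :=
    (hQ.wave c (hD.subset hc)).contDiff.continuous.comp (by fun_prop)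
  have mq : MemLp (fun x => Q c (x - a)) 2 volume :=
    memLp_of_ew hγ cq.aestronglyMeasurable fun x => hD.profile c hc (x - a)
  have mw : MemLp (fun x => regInv α (dSpeed Q c) (x - a)) 2 volume :=
    memLp_of_ew hα cw.aestronglyMeasurable fun x =>
      abs_regInv_le (hD.speed c hc) hα.le hγ hαγ (x - a)
  constructor
  · intro h
    have h1 := h _ (Submodule.mem_span_pair.2 ⟨-1, 0, rfl⟩)
    have h2 := h _ (Submodule.mem_span_pair.2 ⟨0, 1, rfl⟩)
    rw [regSymp_tangent hQ hD hc] at h1 h2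
    simp only [neg_neg, one_mul, zero_mul, add_zero, neg_zero, zero_add] at h1 h2
    exact ⟨h1, h2⟩
  · rintro ⟨h1, h2⟩ ζ hζ
    obtain ⟨s, r, rfl⟩ := Submodule.mem_span_pair.1 hζ
    rw [regSymp_tangent hQ hD hc]
    have e : ip ξ.fn (fun x => -s * Q c (x - a) + r * regInv α (dSpeed Q c) (x - a))
        = -s * ip ξ.fn (fun x => Q c (x - a))
          + r * ip ξ.fn (fun x => regInv α (dSpeed Q c) (x - a)) := by
      simp only [ip]
      rw [← integral_const_mul, ← integral_const_mul, ← integral_add]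
      · congr 1; ext x; ring
      · exact (ξ.memLp_fn.integrable_mul mq).const_mul _
      · exact (ξ.memLp_fn.integrable_mul mw).const_mul _
    rw [e, h1, h2]; ring

/-- `δ'(c) = ⟨∂_c Q_c, Q_c⟩`. -/
theorem HasDecay.hasDerivAt_delta (hQ : IsSolitaryWaveFamily f I₀ Q)
    (hD : HasDecay I₀ Q c₀ ρ γ M) {c : ℝ} (hc : c ∈ Metric.ball c₀ ρ) :
    HasDerivAt (delta Q) (∫ x, dSpeed Q c x * Q c x) c := by
  have hP := hD.isProfileFamily hQ
  have hM := hD.const_pos.le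
  have cQ : ∀ c ∈ Metric.ball c₀ ρ, Continuous (Q c) := fun c hc =>
    (hQ.wave c (hD.subset hc)).contDiff.continuous
  have hn := Metric.isOpen_ball.mem_nhds hc
  have := (hasDerivAt_integral_of_dominated_loc_of_deriv_le (μ := volume)
    (F := fun c x => Q c x ^ 2) (F' := fun c x => 2 * (dSpeed Q c x * Q c x))
    (bound := fun x => 2 * (M * M * ew γ x)) hn ?_ ?_ ?_ (ae_of_all _ fun x c' hc' => ?_)
    (((integrable_ew hD.rate_pos).const_mul _).const_mul 2)
    (ae_of_all _ fun x c' hc' => ?_)).2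
  · refine (this.const_mul (1 / 2)).congr_deriv ?_
    rw [integral_const_mul]; ring
  · filter_upwards [hn] with c' hc' using ((cQ c' hc').pow 2).aestronglyMeasurable
  · exact (memLp_of_ew (a := 0) hD.rate_pos (cQ c hc).aestronglyMeasurable
      (by simpa using hD.profile c hc)).integrable_sq
  · exact (((hP.continuous_speed c hc).mul (cQ c hc)).const_mul 2).aestronglyMeasurable
  · rw [norm_mul, Real.norm_eq_abs, Real.norm_eq_abs, abs_two]
    gcongr
    exact abs_mul_le_ew hM hD.rate_pos.le (hD.speed c' hc' x) (hD.profile c' hc' x)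
  · exact ((hasDerivAt_dSpeed (hQ.differentiableAt (hD.subset hc') x)).pow 2).congr_deriv
      (by simp; ring)

end Orth

/-- The functions attached to a profile `q` centred at `a` and the quantitative information about
them that the estimates use: `q1 = q'`, `z = ∂_c q`, `z1 = z'`, `V = ∂_c² q`, and the regularized
antiderivatives `w` of `z` and `wc` of `V`.  Upper bounds are expressed through `M`, lower bounds
through `d`; neither depends on `α`. -/
structure ProfileData (f : ℝ → ℝ) (c a α γ M d : ℝ) (q q1 z z1 V w wc : ℝ → ℝ) : Prop where
  alpha_pos : 0 < α
  alpha_le_one : α ≤ 1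
  alpha_le : α ≤ γ / 2
  one_le : 1 ≤ M
  d_pos : 0 < d
  speed_le : c ≤ M
  le_speed : d ≤ c
  hasDerivAt_q : ∀ x, HasDerivAt q (q1 x) x
  hasDerivAt_q1 : ∀ x, HasDerivAt q1 (c * q x - f (q x)) x
  hasDerivAt_z : ∀ x, HasDerivAt z (z1 x) x
  hasDerivAt_z1 : ∀ x, HasDerivAt z1 ((c - deriv f (q x)) * z x + q x) x
  hasDerivAt_w : ∀ x, HasDerivAt w (z x - α * w x) x
  hasDerivAt_wc : ∀ x, HasDerivAt wc (V x - α * wc x) x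
  continuous_V : Continuous V
  bound_q : ∀ x, |q x| ≤ M * ew γ (x - a)
  bound_q1 : ∀ x, |q1 x| ≤ M * ew γ (x - a)
  bound_z : ∀ x, |z x| ≤ M * ew γ (x - a)
  bound_z1 : ∀ x, |z1 x| ≤ M * ew γ (x - a)
  bound_V : ∀ x, |V x| ≤ M * ew γ (x - a)
  bound_w : ∀ x, |w x| ≤ M * ew α (x - a)
  bound_wc : ∀ x, |wc x| ≤ M * ew α (x - a)
  bound_fq : ∀ x, |f (q x)| ≤ M * ew γ (x - a)
  slope : ∀ x, |deriv f (q x)| ≤ M * ew γ (x - a)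
  taylor : ∀ x s, |s| ≤ 1 → |f (q x + s) - f (q x) - deriv f (q x) * s| ≤ M * s ^ 2
  parity : ∫ x, (x - a) * (q x * z x) = 0
  mass : |(∫ x, z x * w x) - (∫ x, z x) ^ 2 / 2| ≤ M * α
  le_mass_sq : d ≤ (∫ x, z x) ^ 2
  le_momentum_deriv : d ≤ ∫ x, z x * q x
  le_q1_sq : d ≤ ∫ x, q1 x ^ 2

section Build

variable {f : ℝ → ℝ} {I₀ : Set ℝ} {Q : ℝ → ℝ → ℝ} {c₀ : ℝ}

theorem HasDecay.mono {ρ ρ' γ M : ℝ} (h : HasDecay I₀ Q c₀ ρ γ M) (hρ' : 0 < ρ') (hle : ρ' ≤ ρ) :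
    HasDecay I₀ Q c₀ ρ' γ M := by
  have hs := Metric.ball_subset_ball (x := c₀) hle
  exact ⟨hρ', h.rate_pos, h.const_pos, hs.trans h.subset, fun c hc => h.le_speed c (hs hc),
    fun c hc => h.profile c (hs hc), fun c hc => h.space c (hs hc), fun c hc => h.speed c (hs hc),
    fun c hc => h.speed_space c (hs hc), fun c hc => h.speed_speed c (hs hc)⟩

/-- Near a speed at which the mass of `∂_c Q` and `δ'` do not vanish, the profiles satisfy all
estimates with common constants: the nondegenerate quantities are continuous in the speed. -/
theorem exists_profileData (hf : IsNonlinearity f) (hQ : IsSolitaryWaveFamily f I₀ Q)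
    (hc₀ : c₀ ∈ I₀) (hN : (∫ x, zetaN Q c₀ 0 x) ≠ 0) (hδ : 0 < deriv (delta Q) c₀) :
    ∃ ρ γ M₀ M d, HasDecay I₀ Q c₀ ρ γ M₀ ∧ ∀ c ∈ Metric.ball c₀ ρ, ∀ a α, 0 < α → α ≤ 1 →
      α ≤ γ / 2 → ProfileData f c a α γ M d (fun x => Q c (x - a)) (fun x => dSpace Q c (x - a))
        (fun x => dSpeed Q c (x - a)) (fun x => dSpace (dSpeed Q) c (x - a))
        (fun x => dSpeed (dSpeed Q) c (x - a)) (fun x => regInv α (dSpeed Q c) (x - a))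
        (fun x => regInv α (dSpeed (dSpeed Q) c) (x - a)) := by
  obtain ⟨ρ, γ, M₀, hD⟩ := exists_hasDecay hf hQ hc₀
  have hγ := hD.rate_pos
  have hM₀ := hD.const_pos
  have hpos : 0 < c₀ := hQ.pos hc₀
  have hc₀ρ := Metric.mem_ball_self (x := c₀) hD.rho_pos
  have hP := hD.isProfileFamily hQ
  have hPz := hD.isProfileFamily_speed hQ
  have onB : ∀ {g : ℝ → ℝ → ℝ}, ContinuousOn (Function.uncurry g) (I₀ ×ˢ univ) →
      ContinuousOn (Function.uncurry g) (Metric.ball c₀ ρ ×ˢ univ) := fun h =>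
    h.mono (prod_mono hD.subset (subset_univ _))
  have kQ := onB hQ.contDiffOn.continuousOn
  have kS := onB hQ.contDiffOn_space.continuousOn
  have kz := onB hQ.contDiffOn_speed.continuousOn
  -- the three nondegenerate quantities are continuous in the speed
  have C1 : ContinuousAt (fun c => ∫ y, dSpeed Q c y) c₀ :=
    continuousAt_integral_of_ew hD.rho_pos hγ kz hD.speed
  have C2 : ContinuousAt (fun c => ∫ y, dSpeed Q c y * Q c y) c₀ :=
    continuousAt_integral_of_ew (G := fun c y => dSpeed Q c y * Q c y) (M := M₀ * M₀)
      hD.rho_pos hγ (kz.mul kQ) fun c hc y =>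
        abs_mul_le_ew hM₀.le hγ.le (hD.speed c hc y) (hD.profile c hc y)
  have C3 : ContinuousAt (fun c => ∫ y, dSpace Q c y * dSpace Q c y) c₀ :=
    continuousAt_integral_of_ew (G := fun c y => dSpace Q c y * dSpace Q c y) (M := M₀ * M₀)
      hD.rho_pos hγ (kS.mul kS) fun c hc y =>
        abs_mul_le_ew hM₀.le hγ.le (hD.space c hc y) (hD.space c hc y)
  have p1 : 0 < (∫ y, dSpeed Q c₀ y) ^ 2 := by
    have : (∫ x, zetaN Q c₀ 0 x) = ∫ y, dSpeed Q c₀ y := by simp only [zetaN_apply, sub_zero]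
    rw [this] at hN
    positivity
  have p2 : 0 < ∫ y, dSpeed Q c₀ y * Q c₀ y := by
    rwa [(hD.hasDerivAt_delta hQ hc₀ρ).deriv] at hδ
  have p3 : 0 < ∫ y, dSpace Q c₀ y * dSpace Q c₀ y := by
    have := hQ.integral_dSpace_sq_pos hD hc₀ρ
    simpa only [sq] using this
  set d := min (c₀ / 2) (min ((∫ y, dSpeed Q c₀ y) ^ 2 / 2)
    (min ((∫ y, dSpeed Q c₀ y * Q c₀ y) / 2) ((∫ y, dSpace Q c₀ y * dSpace Q c₀ y) / 2))) with hd
  have hd0 : 0 < d := by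
    rw [hd]; refine lt_min (by positivity) (lt_min (by positivity) (lt_min ?_ ?_)) <;> linarith
  have hd1 : d < (∫ y, dSpeed Q c₀ y) ^ 2 := by
    have : d ≤ (∫ y, dSpeed Q c₀ y) ^ 2 / 2 := (min_le_right _ _).trans (min_le_left _ _)
    linarith
  have hd2 : d < ∫ y, dSpeed Q c₀ y * Q c₀ y := by
    have : d ≤ (∫ y, dSpeed Q c₀ y * Q c₀ y) / 2 :=
      (min_le_right _ _).trans ((min_le_right _ _).trans (min_le_left _ _))
    linarith
  have hd3 : d < ∫ y, dSpace Q c₀ y * dSpace Q c₀ y := by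
    have : d ≤ (∫ y, dSpace Q c₀ y * dSpace Q c₀ y) / 2 :=
      (min_le_right _ _).trans ((min_le_right _ _).trans (min_le_right _ _))
    linarith
  obtain ⟨r, hr, hball⟩ := Metric.nhds_basis_ball.eventually_iff.1
    (((C1.pow 2).eventually (lt_mem_nhds hd1)).and
      ((C2.eventually (lt_mem_nhds hd2)).and (C3.eventually (lt_mem_nhds hd3))))
  obtain ⟨K, hK0, hK', hK⟩ := hf.exists_deriv_bound (M₀ + 1)
  set N := M₀ + 1 + 2 * c₀ + 4 * M₀ / γ + K + K * M₀ + 48 * M₀ ^ 2 / γ ^ 3 with hNdef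
  have t1 : 0 ≤ 4 * M₀ / γ := by positivity
  have t2 : 0 ≤ K * M₀ := by positivity
  have t3 : 0 ≤ 48 * M₀ ^ 2 / γ ^ 3 := by positivity
  have hD' := hD.mono (ρ' := min ρ r) (lt_min hD.rho_pos hr) (min_le_left _ _)
  refine ⟨min ρ r, γ, M₀, N, d, hD', fun c hc' a α hα hα1 hαγ => ?_⟩
  have hc : c ∈ Metric.ball c₀ ρ := Metric.ball_subset_ball (min_le_left _ _) hc'
  have hcI := hD.subset hc
  obtain ⟨hm1, hm2, hm3⟩ := hball (Metric.ball_subset_ball (min_le_right _ _) hc')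
  obtain ⟨hs1, hs2⟩ := hD.le_speed c hc
  have cz := hP.continuous_speed c hc
  have up : ∀ {A v β x : ℝ}, |v| ≤ A * ew β x → A ≤ N → |v| ≤ N * ew β x := fun h hA =>
    h.trans (mul_le_mul_of_nonneg_right hA (ew_nonneg _ _))
  have hQb : ∀ x, |Q c x| ≤ M₀ := fun x =>
    (hD.profile c hc x).trans (mul_le_of_le_one_right hM₀.le (ew_le_one hγ.le x))
  have hmem : ∀ x, Q c x ∈ Icc (-(M₀ + 1)) (M₀ + 1) := fun x => by
    have := abs_le.1 (hQb x)
    exact ⟨by linarith [this.1], by linarith [this.2]⟩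
  have shift : ∀ g : ℝ → ℝ, ∫ x, g (x - a) = ∫ x, g x := fun g => integral_sub_right_eq_self g a
  refine
    { alpha_pos := hα
      alpha_le_one := hα1
      alpha_le := hαγ
      one_le := by rw [hNdef]; linarith
      d_pos := hd0
      speed_le := by rw [hNdef]; linarith
      le_speed := (min_le_left _ _).trans hs1
      hasDerivAt_q := fun x => (hQ.hasDerivAt hcI (x - a)).comp_sub_const x a
      hasDerivAt_q1 := fun x => (hQ.hasDerivAt_space hcI (x - a)).comp_sub_const x a
      hasDerivAt_z := fun x => (hQ.hasDerivAt_zeta hcI (x - a)).comp_sub_const x a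
      hasDerivAt_z1 := fun x => (hQ.hasDerivAt_zeta_space hcI hf (x - a)).comp_sub_const x a
      hasDerivAt_w := fun x => (hasDerivAt_regInv cz (hD.speed c hc) hα.le
        (by linarith) (x - a)).comp_sub_const x a
      hasDerivAt_wc := fun x => (hasDerivAt_regInv (hPz.continuous_speed c hc)
        (hD.speed_speed c hc) hα.le (by linarith) (x - a)).comp_sub_const x a
      continuous_V := (hPz.continuous_speed c hc).comp (by fun_prop)
      bound_q := fun x => up (hD.profile c hc _) (by rw [hNdef]; linarith)
      bound_q1 := fun x => up (hD.space c hc _) (by rw [hNdef]; linarith)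
      bound_z := fun x => up (hD.speed c hc _) (by rw [hNdef]; linarith)
      bound_z1 := fun x => up (hD.speed_space c hc _) (by rw [hNdef]; linarith)
      bound_V := fun x => up (hD.speed_speed c hc _) (by rw [hNdef]; linarith)
      bound_w := fun x => up (abs_regInv_le (hD.speed c hc) hα.le hγ hαγ _)
        (by rw [hNdef]; linarith)
      bound_wc := fun x => up (abs_regInv_le (hD.speed_speed c hc) hα.le hγ hαγ _)
        (by rw [hNdef]; linarith)
      bound_fq := fun x => ?_
      slope := fun x => ?_
      taylor := fun x s hs => ?_
      parity := ?_
      mass := ?_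
      le_mass_sq := ?_
      le_momentum_deriv := ?_
      le_q1_sq := ?_ }
  · have h1 := hf.lipschitz hK' (hmem (x - a)) (r := 0) ⟨by linarith, by linarith⟩
    rw [hf.zero, sub_zero, sub_zero] at h1
    refine up (A := K * M₀) (h1.trans ?_) (by rw [hNdef]; linarith)
    rw [mul_assoc]
    exact mul_le_mul_of_nonneg_left (hD.profile c hc _) hK0.le
  · have h1 := hf.deriv_lipschitz hK (hmem (x - a)) (r := 0) ⟨by linarith, by linarith⟩
    rw [hf.deriv_zero, sub_zero, sub_zero] at h1
    refine up (A := K * M₀) (h1.trans ?_) (by rw [hNdef]; linarith)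
    rw [mul_assoc]
    exact mul_le_mul_of_nonneg_left (hD.profile c hc _) hK0.le
  · have hq := abs_le.1 (hQb (x - a))
    have hs' := abs_le.1 hs
    have h1 := hf.taylor hK (s := Q c (x - a) + s) (r := Q c (x - a))
      ⟨by linarith [hq.1, hs'.1], by linarith [hq.2, hs'.2]⟩ (hmem (x - a))
    rw [add_sub_cancel_left] at h1
    exact h1.trans (mul_le_mul_of_nonneg_right (by rw [hNdef]; linarith) (sq_nonneg s))
  · rw [shift fun y => y * (Q c y * dSpeed Q c y)]
    refine integral_eq_zero_of_odd fun x => ?_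
    rw [(hQ.wave c hcI).even, hQ.speed_even hcI]; ring
  · rw [shift fun y => dSpeed Q c y * regInv α (dSpeed Q c) y, shift (dSpeed Q c)]
    refine (abs_integral_mul_regInv_sub_le cz (hD.speed c hc) hα.le hγ hαγ).trans ?_
    exact mul_le_mul_of_nonneg_right (by rw [hNdef]; linarith) hα.le
  · rw [shift (dSpeed Q c)]; exact hm1.le
  · rw [shift fun y => dSpeed Q c y * Q c y]; exact hm2.le
  · rw [shift fun y => dSpace Q c y ^ 2]
    simp only [sq]
    exact hm3.le

end Build

/-! ### The minimizer of the Hessian -/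

theorem H1.ip_fn_eq (v p : H1) : ip v.fn p.fn = inner ℝ v.1.fst p.1.fst := by
  rw [L2.inner_def]; simp only [ip]
  exact integral_congr_ae (ae_of_all _ fun x => by simp [H1.fn, mul_comm])

theorem H1.ip_dx_eq (v p : H1) : ip v.dx p.dx = inner ℝ v.1.snd p.1.snd := by
  rw [L2.inner_def]; simp only [ip]
  exact integral_congr_ae (ae_of_all _ fun x => by simp [H1.dx, mul_comm])

/-- The bilinear form `∫ v' p' + ∫ k v p` on `H¹`. -/
def energyForm (k : ℝ → ℝ) (v p : H1) : ℝ := ip v.dx p.dx + ip v.fn (fun x => k x * p.fn x)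

theorem energyForm_comm (k : ℝ → ℝ) (v p : H1) : energyForm k v p = energyForm k p v := by
  rw [energyForm, energyForm, ip_comm]
  congr 1
  exact integral_congr_ae (ae_of_all _ fun x => by dsimp only; ring)

section Form

variable {k : ℝ → ℝ} {A : ℝ} (hk : Continuous k) (hA : ∀ x, |k x| ≤ A)
include hk hA

theorem energyForm_add_smul (v p r : H1) (s : ℝ) :
    energyForm k v (p + s • r) = energyForm k v p + s * energyForm k v r := by
  have m : ∀ p : H1, Integrable fun x => v.fn x * (k x * p.fn x) := fun p =>
    v.memLp_fn.integrable_mul (memLp_mul_bounded hk hA p.memLp_fn)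
  have e : ip v.fn (fun x => k x * (p + s • r).fn x)
      = ip v.fn (fun x => k x * p.fn x) + s * ip v.fn (fun x => k x * r.fn x) := by
    simp only [ip]
    rw [← integral_const_mul, ← integral_add (m p) ((m r).const_mul s)]
    refine integral_congr_ae ?_
    filter_upwards [H1.fn_add p (s • r), H1.fn_smul s r] with x h1 h2
    rw [h1, h2]; ring
  rw [energyForm, e, H1.ip_dx_eq, energyForm, energyForm, H1.ip_dx_eq, H1.ip_dx_eq]
  have : (p + s • r).1.snd = p.1.snd + s • r.1.snd := rfl
  rw [this, inner_add_right, real_inner_smul_right]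
  ring

theorem energyForm_self_add_smul (v p : H1) (s : ℝ) :
    energyForm k (v + s • p) (v + s • p)
      = energyForm k v v + 2 * s * energyForm k v p + s ^ 2 * energyForm k p p := by
  rw [energyForm_add_smul hk hA, energyForm_comm k _ v, energyForm_comm k _ p,
    energyForm_add_smul hk hA, energyForm_add_smul hk hA, energyForm_comm k p v]
  ring

theorem integral_eq_energyForm (v : H1) :
    ∫ x, (v.dx x ^ 2 + k x * v.fn x ^ 2) = energyForm k v v := by
  have i1 : Integrable fun x => v.dx x * v.dx x := v.memLp_dx.integrable_mul v.memLp_dx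
  have i2 : Integrable fun x => v.fn x * (k x * v.fn x) :=
    v.memLp_fn.integrable_mul (memLp_mul_bounded hk hA v.memLp_fn)
  rw [energyForm, ip, ip, ← integral_add i1 i2]
  exact integral_congr_ae (ae_of_all _ fun x => by dsimp only; ring)

end Form

theorem H1.ip_fn_add_smul (v p r : H1) (s : ℝ) :
    ip v.fn (p + s • r).fn = ip v.fn p.fn + s * ip v.fn r.fn := by
  simp only [H1.ip_fn_eq]
  have : (p + s • r).1.fst = p.1.fst + s • r.1.fst := rfl
  rw [this, inner_add_right, real_inner_smul_right]

theorem H1.ip_fn_self_add_smul (v p : H1) (s : ℝ) :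
    ip (v + s • p).fn (v + s • p).fn
      = ip v.fn v.fn + 2 * s * ip v.fn p.fn + s ^ 2 * ip p.fn p.fn := by
  rw [H1.ip_fn_add_smul, ip_comm _ v.fn, ip_comm _ p.fn, H1.ip_fn_add_smul, H1.ip_fn_add_smul,
    ip_comm p.fn v.fn]
  ring

/-- `η` is a unit vector orthogonal to `q` and `w` at which the form attains its minimum among
such vectors. -/
structure IsFormMinimizer (k : ℝ → ℝ) (q w : H1) (η : H1) : Prop where
  orth_fst : ip q.fn η.fn = 0
  orth_snd : ip w.fn η.fn = 0
  unit : ip η.fn η.fn = 1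
  le : ∀ v : H1, ip q.fn v.fn = 0 → ip w.fn v.fn = 0 → ip v.fn v.fn = 1 →
    energyForm k η η ≤ energyForm k v v

section Minimizer

variable {k : ℝ → ℝ} {A : ℝ} {q w η : H1} (hk : Continuous k) (hA : ∀ x, |k x| ≤ A)
  (hη : IsFormMinimizer k q w η)
include hk hA hη

/-- The minimality extends to vectors that are not normalized, by homogeneity. -/
theorem IsFormMinimizer.mul_le (v : H1) (h1 : ip q.fn v.fn = 0) (h2 : ip w.fn v.fn = 0) :
    energyForm k η η * ip v.fn v.fn ≤ energyForm k v v := by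
  rcases eq_or_ne (ip v.fn v.fn) 0 with h | h
  · rw [h, mul_zero]
    have h3 : v.1.fst = 0 := by
      rw [H1.ip_self] at h; simpa using h
    have h4 : v.fn =ᵐ[volume] 0 := by
      rw [H1.fn, h3]; exact Lp.coeFn_zero _ _ _
    have h5 : ip v.fn (fun x => k x * v.fn x) = 0 := by
      rw [ip]
      refine integral_eq_zero_of_ae ?_
      filter_upwards [h4] with x hx
      rw [hx]; simp
    rw [energyForm, h5, add_zero, H1.ip_dx_eq]
    exact real_inner_self_nonneg
  · have hpos : 0 < ip v.fn v.fn := by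
      rw [H1.ip_self] at h ⊢; positivity
    set s := (√(ip v.fn v.fn))⁻¹
    have hs : s ^ 2 * ip v.fn v.fn = 1 := by
      rw [inv_pow, Real.sq_sqrt hpos.le, inv_mul_cancel₀ h]
    have e0 : ∀ p : H1, ip p.fn (0 : H1).fn = 0 := fun p => by
      rw [H1.ip_fn_eq]; exact inner_zero_right _
    have b0 : energyForm k 0 0 = 0 := by
      have := energyForm_self_add_smul hk hA 0 0 (-1)
      simp at this; linarith
    have b1 : energyForm k 0 v = 0 := by
      have := energyForm_add_smul hk hA v 0 0 (-1)
      rw [energyForm_comm]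
      simp at this; linarith
    have h3 := hη.le (0 + s • v) (by rw [H1.ip_fn_add_smul, e0, h1]; ring)
      (by rw [H1.ip_fn_add_smul, e0, h2]; ring)
      (by rw [H1.ip_fn_self_add_smul, e0, ip_comm, e0]; linarith)
    rw [energyForm_self_add_smul hk hA, b0, b1] at h3
    calc energyForm k η η * ip v.fn v.fn
        ≤ (s ^ 2 * energyForm k v v) * ip v.fn v.fn := by
          apply mul_le_mul_of_nonneg_right _ hpos.le; linarith
      _ = (s ^ 2 * ip v.fn v.fn) * energyForm k v v := by ring
      _ = _ := by rw [hs, one_mul]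

/-- The Euler–Lagrange equation of a constrained minimizer. -/
theorem IsFormMinimizer.energyForm_eq (v : H1) (h1 : ip q.fn v.fn = 0) (h2 : ip w.fn v.fn = 0) :
    energyForm k η v = energyForm k η η * ip η.fn v.fn := by
  have key : ∀ s : ℝ, 0 ≤ 2 * s * (energyForm k η v - energyForm k η η * ip η.fn v.fn)
      + s ^ 2 * (energyForm k v v - energyForm k η η * ip v.fn v.fn) := by
    intro s
    have := hη.mul_le hk hA (η + s • v) (by rw [H1.ip_fn_add_smul, hη.orth_fst, h1]; ring)
      (by rw [H1.ip_fn_add_smul, hη.orth_snd, h2]; ring)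
    rw [energyForm_self_add_smul hk hA, H1.ip_fn_self_add_smul, hη.unit] at this
    linarith
  set D := energyForm k η v - energyForm k η η * ip η.fn v.fn
  set E := energyForm k v v - energyForm k η η * ip v.fn v.fn
  have hE : 0 ≤ E := by have := key 1; have := key (-1); linarith
  have := key (-D / (E + 1))
  have e : 2 * (-D / (E + 1)) * D + (-D / (E + 1)) ^ 2 * E = -(D ^ 2 * (E + 2) / (E + 1) ^ 2) := by
    field_simp; ring
  rw [e] at this
  have h5 : D ^ 2 * (E + 2) / (E + 1) ^ 2 ≤ 0 := by linarith
  have h6 : D ^ 2 * (E + 2) ≤ 0 := by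
    have := (div_le_iff₀ (show (0:ℝ) < (E + 1) ^ 2 by positivity)).1 h5
    linarith
  have h7 : D ^ 2 = 0 := le_antisymm (by nlinarith [sq_nonneg D]) (sq_nonneg D)
  have := pow_eq_zero_iff two_ne_zero |>.1 h7
  simp only [D] at this; linarith

end Minimizer

/-- The normal equations of two vectors whose Gram matrix is `[[A₁₁, A₁₂], [A₁₂, A₂₂]]`, the
second being of size `1/√α` while the pairing of the two is bounded. -/
theorem exists_gram_solution {d K α G₁₁ G₁₂ G₂₂ : ℝ} (hd : 0 < d) (hK : 0 ≤ K) (hα : 0 < α)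
    (h11 : d ≤ G₁₁) (h22 : d / α ≤ G₂₂) (h12 : |G₁₂| ≤ K) (hs : 2 * K ^ 2 * α ≤ d ^ 2)
    (A₁ A₂ : ℝ) : ∃ s₁ s₂ : ℝ, A₁ = s₁ * G₁₁ + s₂ * G₁₂ ∧ A₂ = s₁ * G₁₂ + s₂ * G₂₂ ∧
      |s₁| ≤ 2 / d * |A₁| + 2 * K / d ^ 2 * (α * |A₂|) ∧
      |s₂| ≤ α * (2 / d * |A₂| + 2 * K / d ^ 2 * |A₁|) := by
  have p11 : 0 < G₁₁ := hd.trans_le h11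
  have p22 : 0 < G₂₂ := (div_pos hd hα).trans_le h22
  have h12' : G₁₂ ^ 2 ≤ K ^ 2 := by
    rw [← sq_abs]; exact pow_le_pow_left₀ (abs_nonneg _) h12 2
  have h22' : d ≤ α * G₂₂ := by rw [div_le_iff₀ hα] at h22; linarith
  have hdet : G₁₁ * G₂₂ / 2 ≤ G₁₁ * G₂₂ - G₁₂ ^ 2 := by
    have h1 : d * d ≤ α * (G₁₁ * G₂₂) := by nlinarith
    have h2 : α * (2 * K ^ 2) ≤ α * (G₁₁ * G₂₂) := by nlinarith
    have := le_of_mul_le_mul_left h2 hα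
    linarith
  set D := G₁₁ * G₂₂ - G₁₂ ^ 2 with hD
  have pD : 0 < D := lt_of_lt_of_le (by positivity) hdet
  have bd : ∀ n B : ℝ, |n| ≤ B * (G₁₁ * G₂₂ / 2) → 0 ≤ B → |n / D| ≤ B := by
    intro n B h hB
    rw [abs_div, abs_of_pos pD, div_le_iff₀ pD]
    exact h.trans (mul_le_mul_of_nonneg_left hdet hB)
  refine ⟨(A₁ * G₂₂ - A₂ * G₁₂) / D, (A₂ * G₁₁ - A₁ * G₁₂) / D, ?_, ?_, bd _ _ ?_ (by positivity),
    bd _ _ ?_ (by positivity)⟩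
  · field_simp; rw [hD]; ring
  · field_simp; rw [hD]; ring
  · refine (abs_sub _ _).trans ?_
    rw [abs_mul, abs_mul, abs_of_pos p22]
    have t1 : |A₁| * G₂₂ ≤ 2 / d * |A₁| * (G₁₁ * G₂₂ / 2) := by
      rw [show 2 / d * |A₁| * (G₁₁ * G₂₂ / 2) = |A₁| * G₂₂ * (G₁₁ / d) by field_simp]
      exact le_mul_of_one_le_right (by positivity) ((one_le_div hd).2 h11)
    have t2 : |A₂| * |G₁₂| ≤ 2 * K / d ^ 2 * (α * |A₂|) * (G₁₁ * G₂₂ / 2) := by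
      rw [show 2 * K / d ^ 2 * (α * |A₂|) * (G₁₁ * G₂₂ / 2)
        = |A₂| * K * ((G₁₁ / d) * (α * G₂₂ / d)) by field_simp]
      refine (mul_le_mul_of_nonneg_left h12 (abs_nonneg _)).trans ?_
      exact le_mul_of_one_le_right (by positivity)
        (one_le_mul_of_one_le_of_one_le ((one_le_div hd).2 h11) ((one_le_div hd).2 h22'))
    linarith
  · refine (abs_sub _ _).trans ?_
    rw [abs_mul, abs_mul, abs_of_pos p11]
    have t1 : |A₂| * G₁₁ ≤ α * (2 / d * |A₂|) * (G₁₁ * G₂₂ / 2) := by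
      rw [show α * (2 / d * |A₂|) * (G₁₁ * G₂₂ / 2) = |A₂| * G₁₁ * (α * G₂₂ / d) by field_simp]
      exact le_mul_of_one_le_right (by positivity) ((one_le_div hd).2 h22')
    have t2 : |A₁| * |G₁₂| ≤ α * (2 * K / d ^ 2 * |A₁|) * (G₁₁ * G₂₂ / 2) := by
      rw [show α * (2 * K / d ^ 2 * |A₁|) * (G₁₁ * G₂₂ / 2)
        = |A₁| * K * ((G₁₁ / d) * (α * G₂₂ / d)) by field_simp]
      refine (mul_le_mul_of_nonneg_left h12 (abs_nonneg _)).trans ?_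
      exact le_mul_of_one_le_right (by positivity)
        (one_le_mul_of_one_le_of_one_le ((one_le_div hd).2 h11) ((one_le_div hd).2 h22'))
    linarith

/-! ### Pairings of the minimizer with slowly varying functions -/

/-- `h` decays at rate `α / 2` around `a`, and its derivative `α h₁ + h₂` is the sum of a small
part that decays at the same rate and a part that decays at the fixed rate `γ / 2`. -/
structure IsSlow (α γ a B : ℝ) (h h₁ h₂ : ℝ → ℝ) : Prop where
  alpha_pos : 0 < α
  alpha_le_one : α ≤ 1
  gamma_pos : 0 < γ
  hasDerivAt : ∀ x, HasDerivAt h (α * h₁ x + h₂ x) x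
  continuous_fst : Continuous h₁
  continuous_snd : Continuous h₂
  bound : ∀ x, |h x| ≤ B * ew (α / 2) (x - a)
  bound_fst : ∀ x, |h₁ x| ≤ B * ew (α / 2) (x - a)
  bound_snd : ∀ x, |h₂ x| ≤ B * ew (γ / 2) (x - a)

namespace IsSlow

variable {α γ a B : ℝ} {h h₁ h₂ : ℝ → ℝ} (S : IsSlow α γ a B h h₁ h₂)
include S

theorem continuous : Continuous h :=
  continuous_iff_continuousAt.2 fun x => (S.hasDerivAt x).continuousAt

theorem memLp : MemLp h 2 volume :=
  memLp_of_ew (half_pos S.alpha_pos) S.continuous.aestronglyMeasurable S.bound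

theorem memLp_fst : MemLp h₁ 2 volume :=
  memLp_of_ew (half_pos S.alpha_pos) S.continuous_fst.aestronglyMeasurable S.bound_fst

theorem memLp_snd : MemLp h₂ 2 volume :=
  memLp_of_ew (half_pos S.gamma_pos) S.continuous_snd.aestronglyMeasurable S.bound_snd

/-- A slowly varying function as an element of `H¹`. -/
def toH1 : H1 :=
  mkH1 h (fun x => α * h₁ x + h₂ x) S.hasDerivAt S.memLp
    ((S.memLp_fst.const_mul α).add S.memLp_snd)

theorem toH1_fn : S.toH1.fn =ᵐ[volume] h := mkH1_fn _ _ _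

theorem toH1_dx : S.toH1.dx =ᵐ[volume] fun x => α * h₁ x + h₂ x := mkH1_dx _ _ _

theorem ip_toH1 (v : ℝ → ℝ) : ip v S.toH1.fn = ip v h := ip_congr (ae_eq_refl _) S.toH1_fn

theorem nonneg : 0 ≤ B := nonneg_of_ew S.bound

/-- Up to the zeroth-order constant term, the energy form of a slowly varying function is bounded
uniformly in `α`, although its `L²` norm is not. -/
theorem abs_energyForm_sub_le {g : ℝ → ℝ} {c M : ℝ} (hg : Continuous g)
    (hM : ∀ x, |g x| ≤ M * ew γ (x - a)) (v : H1) :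
    |energyForm (fun x => c - g x) v S.toH1 - c * ip v.fn h|
      ≤ (2 + (2 + M) / √γ) * B * ‖v‖ := by
  have hα := S.alpha_pos
  have hγ := S.gamma_pos
  have hB := S.nonneg
  have hM0 := nonneg_of_ew hM
  have cgh : Continuous fun x => g x * h x := hg.mul S.continuous
  have bgh : ∀ x, |g x * h x| ≤ M * B * ew γ (x - a) := fun x =>
    abs_mul_le_ew hM0 (half_pos hα).le (hM x) (S.bound x)
  have mgh : MemLp (fun x => g x * h x) 2 volume := memLp_of_ew hγ cgh.aestronglyMeasurable bgh
  have e1 : ip v.dx S.toH1.dx = α * ip v.dx h₁ + ip v.dx h₂ := by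
    rw [ip_congr (ae_eq_refl _) S.toH1_dx]
    simp only [ip]
    rw [← integral_const_mul, ← integral_add]
    · congr 1; ext x; ring
    · exact (v.memLp_dx.integrable_mul S.memLp_fst).const_mul α
    · exact v.memLp_dx.integrable_mul S.memLp_snd
  have e2 : ip v.fn (fun x => (c - g x) * S.toH1.fn x)
      = c * ip v.fn h - ip v.fn (fun x => g x * h x) := by
    simp only [ip]
    rw [← integral_const_mul, ← integral_sub]
    · refine integral_congr_ae ?_
      filter_upwards [S.toH1_fn] with x hx
      rw [hx]; ring
    · exact (v.memLp_fn.integrable_mul S.memLp).const_mul c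
    · exact v.memLp_fn.integrable_mul mgh
  have b1 : |ip v.dx h₁| ≤ ‖v‖ * (B / √(α / 2)) :=
    (abs_ip_L2_le_of_ew v.1.snd (half_pos hα) S.continuous_fst.aestronglyMeasurable
      S.bound_fst).trans (by gcongr; exact v.norm_snd_le)
  have b2 : |ip v.dx h₂| ≤ ‖v‖ * (B / √(γ / 2)) :=
    (abs_ip_L2_le_of_ew v.1.snd (half_pos hγ) S.continuous_snd.aestronglyMeasurable
      S.bound_snd).trans (by gcongr; exact v.norm_snd_le)
  have b3 : |ip v.fn (fun x => g x * h x)| ≤ ‖v‖ * (M * B / √γ) :=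
    v.abs_ip_le hγ cgh.aestronglyMeasurable bgh
  have half : ∀ {y : ℝ}, 0 < y → 1 / √(y / 2) ≤ 2 / √y := by
    intro y hy
    rw [div_le_div_iff₀ (Real.sqrt_pos.2 (half_pos hy)) (Real.sqrt_pos.2 hy), one_mul]
    refine Real.sqrt_le_iff.2 ⟨by positivity, ?_⟩
    rw [mul_pow, Real.sq_sqrt (half_pos hy).le]; linarith
  have ha : α * (1 / √(α / 2)) ≤ 2 := by
    have h1 : α * (1 / √(α / 2)) ≤ α * (2 / √α) := mul_le_mul_of_nonneg_left (half hα) hα.le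
    have h2 : α * (2 / √α) = 2 * √α := by
      have := Real.mul_self_sqrt hα.le
      have h0 := (Real.sqrt_pos.2 hα).ne'
      field_simp
      rw [sq]; linarith
    have h3 : √α ≤ 1 := Real.sqrt_le_one.2 S.alpha_le_one
    linarith
  rw [energyForm, e1, e2]
  rw [show α * ip v.dx h₁ + ip v.dx h₂ + (c * ip v.fn h - ip v.fn fun x => g x * h x) - c * ip v.fn h
    = α * ip v.dx h₁ + ip v.dx h₂ - ip v.fn fun x => g x * h x by ring]
  have hn : 0 ≤ B * ‖v‖ := mul_nonneg hB (norm_nonneg v)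
  calc |α * ip v.dx h₁ + ip v.dx h₂ - ip v.fn fun x => g x * h x|
      ≤ α * |ip v.dx h₁| + |ip v.dx h₂| + |ip v.fn fun x => g x * h x| := by
        refine (abs_sub _ _).trans (add_le_add_left ((abs_add_le _ _).trans ?_) _)
        rw [abs_mul, abs_of_pos hα]
    _ ≤ α * (‖v‖ * (B / √(α / 2))) + ‖v‖ * (B / √(γ / 2)) + ‖v‖ * (M * B / √γ) := by gcongr
    _ = (α * (1 / √(α / 2)) + 1 / √(γ / 2) + M / √γ) * (B * ‖v‖) := by ring
    _ ≤ (2 + 2 / √γ + M / √γ) * (B * ‖v‖) := by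
        apply mul_le_mul_of_nonneg_right _ hn
        linarith [half hγ]
    _ = _ := by ring

end IsSlow

namespace ProfileData

variable {f : ℝ → ℝ} {c a α γ M d : ℝ} {q q1 z z1 V w wc : ℝ → ℝ}
  (P : ProfileData f c a α γ M d q q1 z z1 V w wc)
include P

theorem gamma_pos : 0 < γ := by have := P.alpha_pos; have := P.alpha_le; linarith

theorem M_pos : 0 < M := by have := P.one_le; linarith

theorem continuous_q : Continuous q :=
  continuous_iff_continuousAt.2 fun x => (P.hasDerivAt_q x).continuousAt

theorem continuous_q1 : Continuous q1 :=
  continuous_iff_continuousAt.2 fun x => (P.hasDerivAt_q1 x).continuousAt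

theorem continuous_z : Continuous z :=
  continuous_iff_continuousAt.2 fun x => (P.hasDerivAt_z x).continuousAt

theorem continuous_z1 : Continuous z1 :=
  continuous_iff_continuousAt.2 fun x => (P.hasDerivAt_z1 x).continuousAt

theorem continuous_w : Continuous w :=
  continuous_iff_continuousAt.2 fun x => (P.hasDerivAt_w x).continuousAt

theorem continuous_wc : Continuous wc :=
  continuous_iff_continuousAt.2 fun x => (P.hasDerivAt_wc x).continuousAt

theorem weaken {v y : ℝ} {β β' : ℝ} (h : |v| ≤ M * ew β y) (hβ : β' ≤ β) : |v| ≤ M * ew β' y :=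
  h.trans (mul_le_mul_of_nonneg_left (ew_anti hβ y) P.M_pos.le)

theorem isSlow_q : IsSlow α γ a M q 0 q1 := by
  have := P.alpha_pos; have := P.alpha_le; have hM := P.M_pos
  refine ⟨P.alpha_pos, P.alpha_le_one, P.gamma_pos, fun x => ?_, continuous_const, P.continuous_q1,
    fun x => P.weaken (P.bound_q x) (by linarith), fun x => ?_,
    fun x => P.weaken (P.bound_q1 x) (by linarith)⟩
  · simpa using P.hasDerivAt_q x
  · simpa using mul_nonneg hM.le (ew_nonneg _ _)

theorem isSlow_w : IsSlow α γ a M w (-w) z := by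
  have := P.alpha_pos; have := P.alpha_le
  refine ⟨P.alpha_pos, P.alpha_le_one, P.gamma_pos, fun x => ?_, P.continuous_w.neg, P.continuous_z,
    fun x => P.weaken (P.bound_w x) (by linarith), fun x => ?_,
    fun x => P.weaken (P.bound_z x) (by linarith)⟩
  · exact (P.hasDerivAt_w x).congr_deriv (by simp; ring)
  · rw [Pi.neg_apply, abs_neg]; exact P.weaken (P.bound_w x) (by linarith)

theorem isSlow_wc : IsSlow α γ a M wc (-wc) V := by
  have := P.alpha_pos; have := P.alpha_le
  refine ⟨P.alpha_pos, P.alpha_le_one, P.gamma_pos, fun x => ?_, P.continuous_wc.neg, P.continuous_V,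
    fun x => P.weaken (P.bound_wc x) (by linarith), fun x => ?_,
    fun x => P.weaken (P.bound_V x) (by linarith)⟩
  · exact (P.hasDerivAt_wc x).congr_deriv (by simp; ring)
  · rw [Pi.neg_apply, abs_neg]; exact P.weaken (P.bound_wc x) (by linarith)

theorem memLp_q1 : MemLp q1 2 volume :=
  memLp_of_ew P.gamma_pos P.continuous_q1.aestronglyMeasurable P.bound_q1

theorem memLp_z : MemLp z 2 volume :=
  memLp_of_ew P.gamma_pos P.continuous_z.aestronglyMeasurable P.bound_z

/-- `α ‖w‖² = ⟨z, w⟩`, because `w' = z - α w`. -/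
theorem mul_integral_w_sq : α * ∫ x, w x ^ 2 = ∫ x, z x * w x := by
  have hα := P.alpha_pos
  have := P.alpha_le
  have hM := P.M_pos
  have h1 := P.alpha_le_one
  have i1 : Integrable fun x => z x * w x := P.memLp_z.integrable_mul P.isSlow_w.memLp
  have i2 : Integrable fun x => w x ^ 2 := P.isSlow_w.memLp.integrable_sq
  have h0 := integral_eq_zero_of_hasDerivAt_of_integrable
    (f := fun x => w x ^ 2) (f' := fun x => 2 * (z x * w x) - 2 * α * w x ^ 2)
    (fun x => ((P.hasDerivAt_w x).pow 2).congr_deriv (by simp; ring))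
    ((i1.const_mul 2).sub (i2.const_mul (2 * α))) i2
  rw [integral_sub (i1.const_mul 2) (i2.const_mul (2 * α)), integral_const_mul,
    integral_const_mul] at h0
  linarith

theorem le_integral_w_sq (h : 4 * M * α ≤ d) : d / 4 / α ≤ ip w w := by
  have h1 := abs_le.1 P.mass
  have h2 := P.le_mass_sq
  have h3 := P.mul_integral_w_sq
  have e : ip w w = ∫ x, w x ^ 2 := by simp only [ip, sq]
  rw [div_le_iff₀ P.alpha_pos, e]
  linarith [h1.1]

theorem le_integral_q_sq : d ^ 2 * γ / M ^ 2 ≤ ip q q := by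
  have hγ := P.gamma_pos
  have hM := P.M_pos
  have hd := P.d_pos
  have h1 : d ≤ |ip z q| := P.le_momentum_deriv.trans (le_abs_self _)
  have h2 := h1.trans (abs_ip_le P.memLp_z P.isSlow_q.memLp)
  have h3 : d ^ 2 ≤ (∫ x, z x ^ 2) * ∫ x, q x ^ 2 := by
    have := pow_le_pow_left₀ hd.le h2 2
    rwa [mul_pow, Real.sq_sqrt (integral_nonneg fun x => sq_nonneg _),
      Real.sq_sqrt (integral_nonneg fun x => sq_nonneg _)] at this
  have h4 := integral_sq_le_of_ew hγ P.bound_z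
  have e : ip q q = ∫ x, q x ^ 2 := by simp only [ip, sq]
  have h5 : 0 ≤ ∫ x, q x ^ 2 := integral_nonneg fun x => sq_nonneg _
  rw [e, div_le_iff₀ (by positivity)]
  calc d ^ 2 * γ ≤ (M ^ 2 / γ * ∫ x, q x ^ 2) * γ := by
        gcongr; exact h3.trans (by gcongr)
    _ = _ := by field_simp

theorem abs_ip_le_const {g h : ℝ → ℝ} {A B β : ℝ} (hβ : 0 ≤ β) (hg : ∀ x, |g x| ≤ A * ew γ (x - a))
    (hh : ∀ x, |h x| ≤ B * ew β (x - a)) : |ip g h| ≤ A * B * (2 / γ) :=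
  abs_integral_le_of_ew P.gamma_pos fun x =>
    abs_mul_le_ew (nonneg_of_ew hg) hβ (hg x) (hh x)

theorem abs_ip_q_w_le : |ip q w| ≤ M * M * (2 / γ) :=
  P.abs_ip_le_const P.alpha_pos.le P.bound_q P.bound_w

theorem abs_ip_q1_w_le : |ip q1 w| ≤ M * M * (2 / γ) :=
  P.abs_ip_le_const P.alpha_pos.le P.bound_q1 P.bound_w

theorem ip_q_q1 : ip q q1 = 0 := by
  have i1 : Integrable fun x => q x * q1 x := P.isSlow_q.memLp.integrable_mul P.memLp_q1
  have h0 := integral_eq_zero_of_hasDerivAt_of_integrable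
    (f := fun x => q x ^ 2) (f' := fun x => 2 * (q x * q1 x))
    (fun x => ((P.hasDerivAt_q x).pow 2).congr_deriv (by simp; ring))
    (i1.const_mul 2) P.isSlow_q.memLp.integrable_sq
  rw [integral_const_mul] at h0
  rw [ip]; linarith

end ProfileData

theorem norm_mkH1_sq {g g' : ℝ → ℝ} (hd : ∀ x, HasDerivAt g (g' x) x) (h : MemLp g 2 volume)
    (h' : MemLp g' 2 volume) : ‖mkH1 g g' hd h h'‖ ^ 2 = (∫ x, g x ^ 2) + ∫ x, g' x ^ 2 := by
  rw [H1.norm_sq, ← integral_sq_L2, ← integral_sq_L2]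
  congr 1
  · refine integral_congr_ae ?_
    filter_upwards [mkH1_fn hd h h'] with x hx
    rw [← hx]; rfl
  · refine integral_congr_ae ?_
    filter_upwards [mkH1_dx hd h h'] with x hx
    rw [← hx]; rfl

theorem norm_mkH1_le_of_ew {g g' : ℝ → ℝ} (hd : ∀ x, HasDerivAt g (g' x) x) (h : MemLp g 2 volume)
    (h' : MemLp g' 2 volume) {A B β a : ℝ} (hβ : 0 < β) (hg : ∀ x, |g x| ≤ A * ew β (x - a))
    (hg' : ∀ x, |g' x| ≤ B * ew β (x - a)) : ‖mkH1 g g' hd h h'‖ ≤ (A + B) / √β := by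
  have hA := nonneg_of_ew hg
  have hB := nonneg_of_ew hg'
  refine abs_le_of_sq_le_sq' ?_ (by positivity) |>.2
  rw [norm_mkH1_sq, div_pow, Real.sq_sqrt hβ.le]
  refine (add_le_add (integral_sq_le_of_ew hβ hg) (integral_sq_le_of_ew hβ hg')).trans ?_
  rw [← add_div]
  gcongr
  nlinarith [mul_nonneg hA hB]

namespace ProfileData

variable {f : ℝ → ℝ} {c a α γ M d : ℝ} {q q1 z z1 V w wc : ℝ → ℝ}
  (P : ProfileData f c a α γ M d q q1 z z1 V w wc)
include P

theorem continuous_slope (hf : IsNonlinearity f) : Continuous fun x => deriv f (q x) :=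
  hf.contDiff_deriv.continuous.comp P.continuous_q

/-- By the profile equation the second derivative of the wave is `c q - f(q)`. -/
theorem abs_q2_le (x : ℝ) : |c * q x - f (q x)| ≤ (M * M + M) * ew γ (x - a) := by
  have hc : |c| ≤ M := by
    rw [abs_of_pos (P.d_pos.trans_le P.le_speed)]; exact P.speed_le
  have hM := P.M_pos
  calc |c * q x - f (q x)| ≤ |c| * |q x| + |f (q x)| := (abs_sub _ _).trans (by rw [abs_mul])
    _ ≤ M * (M * ew γ (x - a)) + M * ew γ (x - a) := by
        gcongr
        exacts [P.bound_q x, P.bound_fq x]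
    _ = _ := by ring

theorem continuous_q2 (hf : IsNonlinearity f) : Continuous fun x => c * q x - f (q x) :=
  (continuous_const.mul P.continuous_q).sub (hf.continuous.comp P.continuous_q)

theorem memLp_q2 (hf : IsNonlinearity f) : MemLp (fun x => c * q x - f (q x)) 2 volume :=
  memLp_of_ew P.gamma_pos (P.continuous_q2 hf).aestronglyMeasurable P.abs_q2_le

theorem hasDerivAt_q2 (hf : IsNonlinearity f) (x : ℝ) :
    HasDerivAt (fun x => c * q x - f (q x)) ((c - deriv f (q x)) * q1 x) x :=
  (((P.hasDerivAt_q x).const_mul c).sub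
    ((hf.hasDerivAt (q x)).comp x (P.hasDerivAt_q x))).congr_deriv (by ring)

theorem abs_coeff_le (x : ℝ) : |c - deriv f (q x)| ≤ 2 * M := by
  have h1 : |deriv f (q x)| ≤ M :=
    (P.slope x).trans (mul_le_of_le_one_right P.M_pos.le (ew_le_one P.gamma_pos.le _))
  have h2 := abs_le.1 h1
  have h3 := P.d_pos.trans_le P.le_speed
  have h4 := P.speed_le
  rw [abs_le]; constructor <;> linarith [h2.1, h2.2]

theorem continuous_coeff (hf : IsNonlinearity f) : Continuous fun x => c - deriv f (q x) :=
  continuous_const.sub (P.continuous_slope hf)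

/-- The translation mode as an element of `H¹`. -/
def q1H1 (hf : IsNonlinearity f) : H1 :=
  mkH1 q1 (fun x => c * q x - f (q x)) P.hasDerivAt_q1 P.memLp_q1 (P.memLp_q2 hf)

/-- The translation mode is in the kernel of the Hessian. -/
theorem energyForm_q1 (hf : IsNonlinearity f) (v : H1) :
    energyForm (fun x => c - deriv f (q x)) v (P.q1H1 hf) = 0 := by
  have m : MemLp (fun x => (c - deriv f (q x)) * q1 x) 2 volume :=
    memLp_mul_bounded (P.continuous_coeff hf) P.abs_coeff_le P.memLp_q1
  have := v.integral_mul_deriv (P.hasDerivAt_q2 hf)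
    ((P.continuous_coeff hf).mul P.continuous_q1) (P.memLp_q2 hf) m
  rw [energyForm, q1H1, ip_congr (ae_eq_refl v.dx) (mkH1_dx _ _ _),
    ip_congr (ae_eq_refl v.fn) (g' := fun x => (c - deriv f (q x)) * q1 x)]
  · rw [ip, ip, this]; ring
  · filter_upwards [mkH1_fn P.hasDerivAt_q1 P.memLp_q1 (P.memLp_q2 hf)] with x hx
    rw [hx]

theorem norm_q1H1_le (hf : IsNonlinearity f) : ‖P.q1H1 hf‖ ≤ (M + (M * M + M)) / √γ :=
  norm_mkH1_le_of_ew _ _ _ P.gamma_pos P.bound_q1 P.abs_q2_le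

theorem norm_q_le : ‖P.isSlow_q.toH1‖ ≤ (M + M) / √γ :=
  norm_mkH1_le_of_ew _ _ _ P.gamma_pos P.bound_q fun x => by simpa using P.bound_q1 x

theorem norm_w_le : ‖P.isSlow_w.toH1‖ ≤ (M + (M + M)) / √α := by
  refine norm_mkH1_le_of_ew _ _ _ P.alpha_pos P.bound_w fun x => ?_
  have h1 := P.bound_w x
  have h2 : |z x| ≤ M * ew α (x - a) :=
    P.weaken (P.bound_z x) (by have := P.alpha_le; have := P.gamma_pos; linarith)
  rw [Pi.neg_apply]
  calc |α * -w x + z x| ≤ α * |w x| + |z x| := by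
        refine (abs_add_le _ _).trans ?_
        rw [abs_mul, abs_neg, abs_of_pos P.alpha_pos]
    _ ≤ 1 * (M * ew α (x - a)) + M * ew α (x - a) := by
        gcongr
        exact P.alpha_le_one
    _ = _ := by ring

end ProfileData

/-- The orthogonality constraints can be met by subtracting multiples of `q` and `w`; the
multiple of `w` carries a factor `α` because `‖w‖² ~ 1/α`. -/
theorem exists_gram_const {γ M d : ℝ} (hγ : 0 < γ) (hM : 0 < M) (hd : 0 < d) :
    ∃ S > 0, ∃ α₁ > 0, ∀ {f : ℝ → ℝ} {c a α : ℝ} {q q1 z z1 V w wc : ℝ → ℝ},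
      ProfileData f c a α γ M d q q1 z z1 V w wc → α ≤ α₁ → ∀ A₁ A₂ : ℝ, ∃ s₁ s₂ : ℝ,
        A₁ = s₁ * ip q q + s₂ * ip q w ∧ A₂ = s₁ * ip q w + s₂ * ip w w ∧
        |s₁| ≤ S * (|A₁| + α * |A₂|) ∧ |s₂| ≤ S * α * (|A₁| + |A₂|) := by
  set D := min (d ^ 2 * γ / M ^ 2) (d / 4) with hD
  have hD0 : 0 < D := lt_min (by positivity) (by positivity)
  set K := M * M * (2 / γ) with hK
  have hK0 : 0 < K := by positivity
  refine ⟨2 / D + 2 * K / D ^ 2, by positivity, min (d / (4 * M)) (D ^ 2 / (2 * K ^ 2)),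
    lt_min (by positivity) (by positivity), ?_⟩
  intro f c a α q q1 z z1 V w wc P hα A₁ A₂
  have hα0 := P.alpha_pos
  have h1 : 4 * M * α ≤ d := by
    have := hα.trans (min_le_left _ _)
    rw [le_div_iff₀ (by positivity)] at this; linarith
  have h2 : 2 * K ^ 2 * α ≤ D ^ 2 := by
    have := hα.trans (min_le_right _ _)
    rw [le_div_iff₀ (by positivity)] at this; linarith
  obtain ⟨s₁, s₂, e1, e2, b1, b2⟩ := exists_gram_solution hD0 hK0.le hα0
    ((min_le_left _ _).trans P.le_integral_q_sq)
    ((div_le_div_of_nonneg_right (min_le_right _ _) hα0.le).trans (P.le_integral_w_sq h1))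
    P.abs_ip_q_w_le h2 A₁ A₂
  have p1 : 0 ≤ 2 / D := by positivity
  have p2 : 0 ≤ 2 * K / D ^ 2 := by positivity
  have n1 := abs_nonneg A₁
  have n2 : 0 ≤ α * |A₂| := mul_nonneg hα0.le (abs_nonneg A₂)
  refine ⟨s₁, s₂, e1, e2, b1.trans ?_, b2.trans ?_⟩
  · nlinarith [mul_nonneg p1 n2, mul_nonneg p2 n1]
  · rw [mul_right_comm, mul_comm _ α]
    refine mul_le_mul_of_nonneg_left ?_ hα0.le
    nlinarith [mul_nonneg p1 n1, mul_nonneg p2 (abs_nonneg A₂)]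

section

variable {f : ℝ → ℝ} {c a α γ M d : ℝ} {q q1 z z1 V w wc : ℝ → ℝ}

theorem H1.ip_left_add_smul {g : ℝ → ℝ} (hg : MemLp g 2 volume) (v r : H1) (s : ℝ) :
    ip g (v + s • r).fn = ip g v.fn + s * ip g r.fn := by
  have i1 : Integrable fun x => g x * v.fn x := hg.integrable_mul v.memLp_fn
  have i2 : Integrable fun x => g x * r.fn x := hg.integrable_mul r.memLp_fn
  simp only [ip]
  rw [← integral_const_mul, ← integral_add i1 (i2.const_mul s)]
  refine integral_congr_ae ?_
  filter_upwards [H1.fn_add v (s • r), H1.fn_smul s r] with x h1 h2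
  rw [h1, h2]; ring

/-- The form associated with the Hessian has a minimum of size `O(α)` under the constraints:
the translation mode, corrected to be admissible, is a trial function. -/
theorem exists_minimum_const {γ M d : ℝ} (hγ : 0 < γ) (hM : 0 < M) (hd : 0 < d) :
    ∃ K > 0, ∃ α₁ > 0, ∀ {f : ℝ → ℝ} {c a α : ℝ} {q q1 z z1 V w wc : ℝ → ℝ}, IsNonlinearity f →
      ∀ P : ProfileData f c a α γ M d q q1 z z1 V w wc, α ≤ α₁ → ∀ η : H1,
      IsFormMinimizer (fun x => c - deriv f (q x)) P.isSlow_q.toH1 P.isSlow_w.toH1 η →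
      energyForm (fun x => c - deriv f (q x)) η η ≤ K * α := by
  obtain ⟨S, hS, α₁, hα₁, hgram⟩ := exists_gram_const hγ hM hd
  set K₁ := M * M * (2 / γ) with hK₁
  have hK₁0 : 0 < K₁ := by positivity
  set L := 2 + (2 + M) / √γ with hL
  have hL0 : 0 < L := by positivity
  set N := (M + (M * M + M)) / √γ + S * K₁ * ((M + M) / √γ) + S * K₁ * (M + (M + M)) with hN
  have hN0 : 0 < N := by positivity
  refine ⟨2 / d * (2 * (S * K₁) * (L * M * N)), by positivity,
    min α₁ (d / (2 * (S * K₁ * K₁))), lt_min hα₁ (by positivity), ?_⟩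
  intro f c a α q q1 z z1 V w wc hf P hα η hη
  have hα0 := P.alpha_pos
  have hα1 := P.alpha_le_one
  obtain ⟨s₁, s₂, e1, e2, b1, b2⟩ := hgram P (hα.trans (min_le_left _ _)) 0 (ip q1 w)
  have hA := P.abs_ip_q1_w_le
  rw [abs_zero, zero_add] at b1 b2
  replace b1 : |s₁| ≤ S * K₁ * α := b1.trans (by
    rw [mul_assoc, mul_comm K₁]; gcongr)
  replace b2 : |s₂| ≤ S * K₁ * α := b2.trans (by
    rw [mul_assoc, mul_assoc, mul_comm K₁]; gcongr)
  have hk := P.continuous_coeff hf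
  have hkA := P.abs_coeff_le
  set eq := P.isSlow_q.toH1 with heq
  set ew' := P.isSlow_w.toH1 with hew
  -- the trial function is the translation mode corrected by multiples of size `O(α)`
  set χ := P.q1H1 hf + (-s₁) • eq + (-s₂) • ew' with hχ
  have mq := P.isSlow_q.memLp
  have mw := P.isSlow_w.memLp
  have c1 : ∀ v : ℝ → ℝ, ip v (P.q1H1 hf).fn = ip v q1 := fun v =>
    ip_congr (ae_eq_refl v) (mkH1_fn _ _ _)
  have oq : ip q χ.fn = 0 := by
    rw [hχ, H1.ip_left_add_smul mq, H1.ip_left_add_smul mq, c1, P.isSlow_q.ip_toH1,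
      P.isSlow_w.ip_toH1, P.ip_q_q1]
    linarith
  have ow : ip w χ.fn = 0 := by
    rw [hχ, H1.ip_left_add_smul mw, H1.ip_left_add_smul mw, c1, P.isSlow_q.ip_toH1,
      P.isSlow_w.ip_toH1, ip_comm w q1, ip_comm w q]
    linarith
  have fq : ∀ v : ℝ → ℝ, ip eq.fn v = ip q v := fun v => ip_congr P.isSlow_q.toH1_fn (ae_eq_refl v)
  have fw : ∀ v : ℝ → ℝ, ip ew'.fn v = ip w v := fun v =>
    ip_congr P.isSlow_w.toH1_fn (ae_eq_refl v)
  have hmin := hη.mul_le hk hkA χ (by rw [fq, oq]) (by rw [fw, ow])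
  -- the trial function is bounded above and below
  have nχ : ‖χ‖ ≤ N := by
    have n3 : |s₂| * ‖ew'‖ ≤ S * K₁ * (M + (M + M)) := by
      calc |s₂| * ‖ew'‖ ≤ S * K₁ * α * ((M + (M + M)) / √α) :=
            mul_le_mul b2 P.norm_w_le (norm_nonneg _) (by positivity)
        _ = S * K₁ * (M + (M + M)) * (α / √α) := by ring
        _ ≤ _ := by
            refine mul_le_of_le_one_right (by positivity) ?_
            rw [Real.div_sqrt]; exact Real.sqrt_le_one.2 hα1
    have n2 : |s₁| * ‖eq‖ ≤ S * K₁ * ((M + M) / √γ) :=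
      mul_le_mul (b1.trans (mul_le_of_le_one_right (by positivity) hα1)) P.norm_q_le
        (norm_nonneg _) (by positivity)
    calc ‖χ‖ ≤ ‖P.q1H1 hf‖ + |s₁| * ‖eq‖ + |s₂| * ‖ew'‖ := by
          refine (norm_add_le _ _).trans (add_le_add ((norm_add_le _ _).trans ?_) ?_)
          · rw [norm_smul, norm_neg, Real.norm_eq_abs]
          · rw [norm_smul, norm_neg, Real.norm_eq_abs]
      _ ≤ N := by
          rw [hN]
          exact add_le_add (add_le_add (P.norm_q1H1_le hf) n2) n3
  have lχ : d / 2 ≤ ip χ.fn χ.fn := by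
    have h1 : ip χ.fn χ.fn = ip q1 χ.fn := by
      rw [hχ, H1.ip_fn_add_smul, H1.ip_fn_add_smul, ← hχ, ip_comm _ eq.fn, ip_comm _ ew'.fn, fq, fw,
        oq, ow, c1, ip_comm]
      ring
    have h2 : ip q1 χ.fn = ip q1 q1 - s₂ * ip q1 w := by
      rw [hχ, H1.ip_left_add_smul P.memLp_q1, H1.ip_left_add_smul P.memLp_q1, c1,
        P.isSlow_q.ip_toH1, P.isSlow_w.ip_toH1, ip_comm q1 q, P.ip_q_q1]
      ring
    have h3 : d ≤ ip q1 q1 := by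
      have := P.le_q1_sq
      simpa only [ip, sq] using this
    have h4 : |s₂ * ip q1 w| ≤ d / 2 := by
      rw [abs_mul]
      calc |s₂| * |ip q1 w| ≤ S * K₁ * α * K₁ := mul_le_mul b2 hA (abs_nonneg _) (by positivity)
        _ = α * (S * K₁ * K₁) := by ring
        _ ≤ d / 2 := by
            have := hα.trans (min_le_right _ _)
            rw [le_div_iff₀ (by positivity)] at this; linarith
    rw [h1, h2]
    linarith [le_abs_self (s₂ * ip q1 w)]
  -- its energy only involves the corrections
  have Eχ : energyForm (fun x => c - deriv f (q x)) χ χ ≤ 2 * (S * K₁) * (L * M * N) * α := by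
    have h1 : energyForm (fun x => c - deriv f (q x)) χ χ
        = -s₁ * energyForm (fun x => c - deriv f (q x)) χ eq
          + -s₂ * energyForm (fun x => c - deriv f (q x)) χ ew' := by
      conv_lhs => rw [hχ, energyForm_add_smul hk hkA, energyForm_add_smul hk hkA, ← hχ]
      rw [P.energyForm_q1 hf]; ring
    have h2 := P.isSlow_q.abs_energyForm_sub_le (c := c) (P.continuous_slope hf) P.slope χ
    have h3 := P.isSlow_w.abs_energyForm_sub_le (c := c) (P.continuous_slope hf) P.slope χ
    rw [ip_comm, oq, mul_zero, sub_zero] at h2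
    rw [ip_comm, ow, mul_zero, sub_zero] at h3
    have h4 : (2 + (2 + M) / √γ) * M * ‖χ‖ ≤ L * M * N := by gcongr
    have h5 := mul_le_mul b1 (h2.trans h4) (abs_nonneg _) (by positivity)
    have h6 := mul_le_mul b2 (h3.trans h4) (abs_nonneg _) (by positivity)
    rw [h1]
    rw [← abs_mul] at h5 h6
    have := neg_abs_le (s₁ * energyForm (fun x => c - deriv f (q x)) χ eq)
    have := neg_abs_le (s₂ * energyForm (fun x => c - deriv f (q x)) χ ew')
    linarith
  rcases le_or_gt (energyForm (fun x => c - deriv f (q x)) η η) 0 with hneg | hpos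
  · exact hneg.trans (by positivity)
  · have h1 := (mul_le_mul_of_nonneg_left lχ hpos.le).trans (hmin.trans Eχ)
    rw [mul_assoc, div_mul_eq_mul_div, le_div_iff₀ hd]
    linarith

/-- The pairing of the minimizer with a slowly varying function is bounded uniformly in `α`,
although the `L²` norm of such a function may be of size `1/√α`. -/
theorem exists_slow_pairing_const {γ M d : ℝ} (hγ : 0 < γ) (hM : 0 < M) (hd : 0 < d) :
    ∃ K > 0, ∃ α₁ > 0, ∀ {f : ℝ → ℝ} {c a α : ℝ} {q q1 z z1 V w wc : ℝ → ℝ}, IsNonlinearity f →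
      ∀ P : ProfileData f c a α γ M d q q1 z z1 V w wc, α ≤ α₁ → ∀ η : H1,
      IsFormMinimizer (fun x => c - deriv f (q x)) P.isSlow_q.toH1 P.isSlow_w.toH1 η →
      ‖η‖ ≤ K ∧
      ∀ {B : ℝ} {h h₁ h₂ : ℝ → ℝ}, IsSlow α γ a B h h₁ h₂ → |ip η.fn h| ≤ K * B := by
  obtain ⟨S, hS, α₁, hα₁, hgram⟩ := exists_gram_const hγ hM hd
  obtain ⟨K₀, hK₀, α₂, hα₂, hmu⟩ := exists_minimum_const hγ hM hd
  set L := 2 + (2 + M) / √γ with hL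
  have hL0 : 0 < L := by positivity
  set N := 1 + M with hN
  set R := S * (M * (2 / γ) + 2 * M) with hR
  have hR0 : 0 < R := by positivity
  have hN0 : 0 < N := by positivity
  set K₁ := 2 / d * (L * N * (1 + 2 * (R * M))) with hK₁
  have hK₁0 : 0 < K₁ := by positivity
  refine ⟨N + K₁, by positivity, min α₁ (min α₂ (d / (2 * K₀))),
    lt_min hα₁ (lt_min hα₂ (by positivity)), ?_⟩
  intro f c a α q q1 z z1 V w wc hf P hα η hη
  have hα0 := P.alpha_pos
  have hα1 := P.alpha_le_one
  have hk := P.continuous_coeff hf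
  have hkA := P.abs_coeff_le
  have hm := hmu hf P (hα.trans ((min_le_right _ _).trans (min_le_left _ _))) η hη
  have hm' : energyForm (fun x => c - deriv f (q x)) η η ≤ d / 2 := by
    have := hα.trans ((min_le_right _ _).trans (min_le_right _ _))
    rw [le_div_iff₀ (by positivity)] at this
    linarith
  set μ := energyForm (fun x => c - deriv f (q x)) η η with hμ
  have hc := P.le_speed
  -- the energy of the minimizer is at most `c`, and the potential is bounded
  have nη : ‖η‖ ≤ N := by
    have h1 : ip η.fn (fun x => (c - deriv f (q x)) * η.fn x) ≥ c - M := by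
      have i1 : Integrable fun x => η.fn x * ((c - deriv f (q x)) * η.fn x) :=
        η.memLp_fn.integrable_mul (memLp_mul_bounded hk hkA η.memLp_fn)
      have i2 : Integrable fun x => η.fn x * η.fn x := η.memLp_fn.integrable_mul η.memLp_fn
      have h2 : (c - M) * ip η.fn η.fn ≤ ip η.fn (fun x => (c - deriv f (q x)) * η.fn x) := by
        rw [ip, ← integral_const_mul]
        refine integral_mono (i2.const_mul _) i1 fun x => ?_
        have h3 : deriv f (q x) ≤ M := (le_abs_self _).trans
          ((P.slope x).trans (mul_le_of_le_one_right hM.le (ew_le_one hγ.le _)))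
        have := mul_self_nonneg (η.fn x)
        dsimp only
        nlinarith
      rw [hη.unit, mul_one] at h2; exact h2
    have h2 : ‖η‖ ^ 2 = ip η.fn η.fn + ip η.dx η.dx := by
      rw [H1.norm_sq, H1.ip_self, H1.ip_dx_eq, real_inner_self_eq_norm_sq]
    have h3 : ip η.dx η.dx = μ - ip η.fn (fun x => (c - deriv f (q x)) * η.fn x) := by
      rw [hμ, energyForm]; ring
    have h4 : ‖η‖ ^ 2 ≤ 1 + M := by rw [h2, h3, hη.unit]; linarith
    refine abs_le_of_sq_le_sq' (h4.trans ?_) hN0.le |>.2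
    rw [hN]; nlinarith
  refine ⟨nη.trans (by linarith), ?_⟩
  intro B h h₁ h₂ hS'
  have hB := hS'.nonneg
  obtain ⟨s₁, s₂, e1, e2, b1, b2⟩ := hgram P (hα.trans (min_le_left _ _)) (ip q h) (ip w h)
  have hA1 : |ip q h| ≤ M * B * (2 / γ) := P.abs_ip_le_const (half_pos hα0).le P.bound_q hS'.bound
  have hA2 : |ip w h| ≤ M * B * (2 / α) := abs_integral_le_of_ew hα0 fun x =>
    abs_mul_le_ew hM.le (half_pos hα0).le (P.bound_w x) (hS'.bound x)
  have hA2' : α * |ip w h| ≤ 2 * M * B := by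
    calc α * |ip w h| ≤ α * (M * B * (2 / α)) := by gcongr
      _ = 2 * M * B := by field_simp
  replace b1 : |s₁| ≤ R * B := by
    refine b1.trans ?_
    calc S * (|ip q h| + α * |ip w h|) ≤ S * (M * B * (2 / γ) + 2 * M * B) := by gcongr
      _ = R * B := by rw [hR]; ring
  replace b2 : |s₂| ≤ R * B := by
    refine b2.trans ?_
    calc S * α * (|ip q h| + |ip w h|) = S * (α * |ip q h| + α * |ip w h|) := by ring
      _ ≤ S * (1 * (M * B * (2 / γ)) + 2 * M * B) := by gcongr
      _ = R * B := by rw [hR]; ring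
  set eq := P.isSlow_q.toH1 with heq
  set ew' := P.isSlow_w.toH1 with hew
  -- the slowly varying function, made admissible, is a test vector for the Euler–Lagrange equation;
  -- in the form, it pairs with `η` to `c ⟨η, h⟩` up to `O(B)`, and `c` exceeds the minimum
  set p := hS'.toH1 + (-s₁) • eq + (-s₂) • ew' with hp
  have mq := P.isSlow_q.memLp
  have mw := P.isSlow_w.memLp
  have fq : ∀ v : ℝ → ℝ, ip eq.fn v = ip q v := fun v => ip_congr P.isSlow_q.toH1_fn (ae_eq_refl v)
  have fw : ∀ v : ℝ → ℝ, ip ew'.fn v = ip w v := fun v =>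
    ip_congr P.isSlow_w.toH1_fn (ae_eq_refl v)
  have oq : ip q p.fn = 0 := by
    rw [hp, H1.ip_left_add_smul mq, H1.ip_left_add_smul mq, hS'.ip_toH1, P.isSlow_q.ip_toH1,
      P.isSlow_w.ip_toH1]
    linarith
  have ow : ip w p.fn = 0 := by
    rw [hp, H1.ip_left_add_smul mw, H1.ip_left_add_smul mw, hS'.ip_toH1, P.isSlow_q.ip_toH1,
      P.isSlow_w.ip_toH1, ip_comm w q]
    linarith
  have hEL := hη.energyForm_eq hk hkA p (by rw [fq, oq]) (by rw [fw, ow])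
  have o1 : ip η.fn q = 0 := by rw [ip_comm, ← fq]; exact hη.orth_fst
  have o2 : ip η.fn w = 0 := by rw [ip_comm, ← fw]; exact hη.orth_snd
  have hip : ip η.fn p.fn = ip η.fn h := by
    rw [hp, H1.ip_fn_add_smul, H1.ip_fn_add_smul, hS'.ip_toH1, P.isSlow_q.ip_toH1,
      P.isSlow_w.ip_toH1, o1, o2]
    ring
  rw [hip, hp, energyForm_add_smul hk hkA, energyForm_add_smul hk hkA] at hEL
  have r0 := hS'.abs_energyForm_sub_le (c := c) (P.continuous_slope hf) P.slope η
  have r1 := P.isSlow_q.abs_energyForm_sub_le (c := c) (P.continuous_slope hf) P.slope η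
  have r2 := P.isSlow_w.abs_energyForm_sub_le (c := c) (P.continuous_slope hf) P.slope η
  rw [o1, mul_zero, sub_zero] at r1
  rw [o2, mul_zero, sub_zero] at r2
  replace r0 := r0.trans (show _ ≤ L * N * B by
    rw [mul_right_comm]; gcongr)
  replace r1 := r1.trans (show _ ≤ L * N * M by
    rw [mul_right_comm]; gcongr)
  replace r2 := r2.trans (show _ ≤ L * N * M by
    rw [mul_right_comm]; gcongr)
  have t1 := mul_le_mul b1 r1 (abs_nonneg _) (by positivity)
  have t2 := mul_le_mul b2 r2 (abs_nonneg _) (by positivity)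
  rw [← abs_mul] at t1 t2
  have key : |(c - μ) * ip η.fn h| ≤ L * N * (1 + 2 * (R * M)) * B := by
    rw [show (c - μ) * ip η.fn h
        = -(energyForm (fun x => c - deriv f (q x)) η hS'.toH1 - c * ip η.fn h)
          + s₁ * energyForm (fun x => c - deriv f (q x)) η eq
          + s₂ * energyForm (fun x => c - deriv f (q x)) η ew' by linarith]
    refine (abs_add_three _ _ _).trans ?_
    rw [abs_neg]
    linarith
  rw [abs_mul, abs_of_pos (show 0 < c - μ by linarith)] at key
  have h5 : d / 2 * |ip η.fn h| ≤ L * N * (1 + 2 * (R * M)) * B :=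
    (mul_le_mul_of_nonneg_right (by linarith) (abs_nonneg _)).trans key
  have h6 : |ip η.fn h| ≤ K₁ * B := by
    rw [hK₁, mul_assoc, div_mul_eq_mul_div, le_div_iff₀ hd]
    linarith
  exact h6.trans (mul_le_mul_of_nonneg_right (by linarith) hB)

end

/-! ### The potential -/

namespace IsPotential

variable {b : ℝ → ℝ → ℝ} {εa εt εx : ℝ} (hb : IsPotential b εa εt εx)
include hb

theorem hasDerivAt_space (t x : ℝ) :
    HasDerivAt (b t) (fderiv ℝ (Function.uncurry b) (t, x) (0, 1)) x := by
  have h1 : HasDerivAt (fun x' : ℝ => (t, x')) ((0 : ℝ), (1 : ℝ)) x :=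
    (hasDerivAt_const x t).prodMk (hasDerivAt_id x)
  simpa [Function.comp_def] using (hb.differentiable (t, x)).hasFDerivAt.comp_hasDerivAt x h1

theorem hasDerivAt_time (t x : ℝ) :
    HasDerivAt (fun s => b s x) (deriv (fun s => b s x) t) t := by
  have h1 : HasDerivAt (fun s : ℝ => (s, x)) ((1 : ℝ), (0 : ℝ)) t :=
    (hasDerivAt_id t).prodMk (hasDerivAt_const t x)
  exact (show HasDerivAt (fun s => b s x) _ t by
    simpa [Function.comp_def] using
      (hb.differentiable (t, x)).hasFDerivAt.comp_hasDerivAt t h1).differentiableAt.hasDerivAt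

theorem hasDerivAt (t x : ℝ) : HasDerivAt (b t) (deriv (b t) x) x :=
  (hb.hasDerivAt_space t x).differentiableAt.hasDerivAt

theorem hasDerivAt_deriv (t x : ℝ) : HasDerivAt (deriv (b t)) (deriv (deriv (b t)) x) x := by
  have e : deriv (b t) = fun x => fderiv ℝ (Function.uncurry b) (t, x) (0, 1) :=
    funext fun x => (hb.hasDerivAt_space t x).deriv
  have h1 : HasDerivAt (fun x' : ℝ => (t, x')) ((0 : ℝ), (1 : ℝ)) x :=
    (hasDerivAt_const x t).prodMk (hasDerivAt_id x)
  have h2 := (hb.differentiable_fderiv (t, x)).hasFDerivAt.comp_hasDerivAt x h1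
  have h3 := (ContinuousLinearMap.apply ℝ ℝ ((0 : ℝ), (1 : ℝ))).hasFDerivAt.comp_hasDerivAt x h2
  refine DifferentiableAt.hasDerivAt ?_
  rw [e]
  exact h3.differentiableAt

theorem continuous (t : ℝ) : Continuous (b t) :=
  continuous_iff_continuousAt.2 fun x => (hb.hasDerivAt t x).continuousAt

theorem continuous_deriv (t : ℝ) : Continuous (deriv (b t)) :=
  continuous_iff_continuousAt.2 fun x => (hb.hasDerivAt_deriv t x).continuousAt

theorem abs_le (t x : ℝ) : |b t x| ≤ εa := by
  simpa using hb.bound 0 0 (by norm_num) (by norm_num) (by norm_num) t x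

theorem abs_deriv_le (t x : ℝ) : |deriv (b t) x| ≤ εa * εx := by
  simpa using hb.bound 0 1 (by norm_num) (by norm_num) (by norm_num) t x

theorem abs_deriv2_le (t x : ℝ) : |deriv (deriv (b t)) x| ≤ εa * εx ^ 2 := by
  simpa [iteratedDeriv_succ] using hb.bound 0 2 (by norm_num) (by norm_num) (by norm_num) t x

theorem abs_deriv_time_le (t x : ℝ) : |deriv (fun s => b s x) t| ≤ εa * εt := by
  simpa [iteratedDeriv_succ] using hb.bound 1 0 (by norm_num) (by norm_num) (by norm_num) t x

theorem abs_sub_le (t x y : ℝ) : |b t x - b t y| ≤ εa * εx * |x - y| :=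
  convex_univ.norm_image_sub_le_of_norm_hasDerivWithin_le
    (fun s _ => (hb.hasDerivAt t s).hasDerivWithinAt) (fun s _ => hb.abs_deriv_le t s)
    (mem_univ y) (mem_univ x)

theorem abs_deriv_sub_le (t x y : ℝ) :
    |deriv (b t) x - deriv (b t) y| ≤ εa * εx ^ 2 * |x - y| :=
  convex_univ.norm_image_sub_le_of_norm_hasDerivWithin_le
    (fun s _ => (hb.hasDerivAt_deriv t s).hasDerivWithinAt) (fun s _ => hb.abs_deriv2_le t s)
    (mem_univ y) (mem_univ x)

theorem abs_time_sub_le (s t x : ℝ) : |b s x - b t x| ≤ εa * εt * |s - t| :=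
  convex_univ.norm_image_sub_le_of_norm_hasDerivWithin_le
    (fun r _ => (hb.hasDerivAt_time r x).hasDerivWithinAt) (fun r _ => hb.abs_deriv_time_le r x)
    (mem_univ t) (mem_univ s)

theorem taylor (t x y : ℝ) :
    |b t x - b t y - deriv (b t) y * (x - y)| ≤ εa * εx ^ 2 * |x - y| ^ 2 := by
  have h0 : 0 ≤ εa * εx ^ 2 := (abs_nonneg _).trans (hb.abs_deriv2_le t y)
  have := (convex_uIcc y x).norm_image_sub_le_of_norm_hasDerivWithin_le
    (f := fun s => b t s - deriv (b t) y * s) (f' := fun s => deriv (b t) s - deriv (b t) y * 1)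
    (C := εa * εx ^ 2 * |x - y|)
    (fun s _ => ((hb.hasDerivAt t s).sub ((hasDerivAt_id s).const_mul _)).hasDerivWithinAt)
    (fun s hs => by
      rw [mul_one, Real.norm_eq_abs]
      refine (hb.abs_deriv_sub_le t s y).trans (mul_le_mul_of_nonneg_left ?_ h0)
      exact abs_sub_left_of_mem_uIcc hs)
    left_mem_uIcc right_mem_uIcc
  rw [Real.norm_eq_abs, Real.norm_eq_abs] at this
  rw [sq |x - y|, ← mul_assoc]
  refine le_trans (le_of_eq ?_) this
  congr 1; ring

end IsPotential

/-! ### Expansion of the flux around the solitary wave -/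

/-- The weak form of `-∂ₓ(∂ₓ² u + f(u) - β u)` tested against a function with first and second
derivatives `φ₁`, `φ₂`. -/
def flux (f β : ℝ → ℝ) (u : H1) (φ₁ φ₂ : ℝ → ℝ) : ℝ :=
  ∫ x, (-(u.dx x * φ₂ x) + (f (u.fn x) - β x * u.fn x) * φ₁ x)

/-- Taylor expansion of the flux around the wave.  No derivative falls on the fluctuation, because
one integration by parts is possible against the test function. -/
theorem ProfileData.abs_flux_sub_le {f : ℝ → ℝ} {c a α γ M d : ℝ} {q q1 z z1 V w wc : ℝ → ℝ}
    (P : ProfileData f c a α γ M d q q1 z z1 V w wc) (hf : IsNonlinearity f) {β : ℝ → ℝ} {A : ℝ}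
    (hβ : Continuous β) (hA : ∀ x, |β x| ≤ A) {u ξ : H1}
    (hu : u.fn =ᵐ[volume] fun x => q x + ξ.fn x) (hξ : ∀ᵐ x, |ξ.fn x| ≤ 1) {φ₁ φ₂ φ₃ : ℝ → ℝ}
    {B ρ : ℝ} (hρ : 0 < ρ) (c₁ : Continuous φ₁) (d₂ : ∀ x, HasDerivAt φ₂ (φ₃ x) x)
    (c₃ : Continuous φ₃) (b₁ : ∀ x, |φ₁ x| ≤ B * ew ρ (x - a))
    (b₂ : ∀ x, |φ₂ x| ≤ B * ew ρ (x - a)) (b₃ : ∀ x, |φ₃ x| ≤ B * ew ρ (x - a)) :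
    |flux f β u φ₁ φ₂ - (ip q φ₃ + ip (fun x => f (q x)) φ₁ - ip q (fun x => β x * φ₁ x)
      + ip ξ.fn (fun x => φ₃ x + deriv f (q x) * φ₁ x) - ip ξ.fn (fun x => β x * φ₁ x))|
      ≤ M * B * ‖ξ‖ ^ 2 := by
  have hM := P.M_pos
  have hB := nonneg_of_ew b₁
  have c₂ : Continuous φ₂ := continuous_iff_continuousAt.2 fun x => (d₂ x).continuousAt
  have m₁ : MemLp φ₁ 2 volume := memLp_of_ew hρ c₁.aestronglyMeasurable b₁
  have m₂ : MemLp φ₂ 2 volume := memLp_of_ew hρ c₂.aestronglyMeasurable b₂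
  have m₃ : MemLp φ₃ 2 volume := memLp_of_ew hρ c₃.aestronglyMeasurable b₃
  have mβ : MemLp (fun x => β x * φ₁ x) 2 volume := memLp_mul_bounded hβ hA m₁
  have mf : MemLp (fun x => deriv f (q x) * φ₁ x) 2 volume :=
    memLp_mul_bounded (A := M) (P.continuous_slope hf) (fun x => (P.slope x).trans
      (mul_le_of_le_one_right hM.le (ew_le_one P.gamma_pos.le _))) m₁
  have mfq : MemLp (fun x => f (q x)) 2 volume :=
    memLp_of_ew P.gamma_pos (hf.continuous.comp P.continuous_q).aestronglyMeasurable P.bound_fq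
  have mq := P.isSlow_q.memLp
  set N : ℝ → ℝ := fun x => (f (q x + ξ.fn x) - f (q x) - deriv f (q x) * ξ.fn x) * φ₁ x with hN
  have iξ2 : Integrable fun x => ξ.fn x ^ 2 := ξ.memLp_fn.integrable_sq
  have bN : ∀ᵐ x, ‖N x‖ ≤ M * B * ξ.fn x ^ 2 := by
    filter_upwards [hξ] with x hx
    have h2 : |φ₁ x| ≤ B := (b₁ x).trans (mul_le_of_le_one_right hB (ew_le_one hρ.le _))
    rw [hN, norm_mul, Real.norm_eq_abs, Real.norm_eq_abs]
    calc _ ≤ M * ξ.fn x ^ 2 * B := by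
          gcongr
          exact P.taylor x _ hx
      _ = _ := by ring
  have sN : AEStronglyMeasurable N volume := by
    have h1 := P.continuous_q.aestronglyMeasurable.add ξ.memLp_fn.1
    exact (((hf.continuous.comp_aestronglyMeasurable h1).sub
      (hf.continuous.comp P.continuous_q).aestronglyMeasurable).sub
      ((P.continuous_slope hf).aestronglyMeasurable.mul ξ.memLp_fn.1)).mul c₁.aestronglyMeasurable
  have iN : Integrable N := (iξ2.const_mul (M * B)).mono' sN bN
  have i1 : Integrable fun x => u.dx x * φ₂ x := u.memLp_dx.integrable_mul m₂
  have i2 : Integrable fun x => f (q x) * φ₁ x := mfq.integrable_mul m₁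
  have i3 : Integrable fun x => q x * (β x * φ₁ x) := mq.integrable_mul mβ
  have i4 : Integrable fun x => ξ.fn x * (deriv f (q x) * φ₁ x) := ξ.memLp_fn.integrable_mul mf
  have i5 : Integrable fun x => ξ.fn x * (β x * φ₁ x) := ξ.memLp_fn.integrable_mul mβ
  have i6 : Integrable fun x => q x * φ₃ x := mq.integrable_mul m₃
  have i7 : Integrable fun x => ξ.fn x * φ₃ x := ξ.memLp_fn.integrable_mul m₃
  have e1 : flux f β u φ₁ φ₂ = -(∫ x, u.dx x * φ₂ x) + (((∫ x, f (q x) * φ₁ x)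
      - ∫ x, q x * (β x * φ₁ x)) + (∫ x, ξ.fn x * (deriv f (q x) * φ₁ x))
      - ∫ x, ξ.fn x * (β x * φ₁ x)) + ∫ x, N x := by
    have j1 : Integrable fun x => -(u.dx x * φ₂ x) + f (q x) * φ₁ x := i1.neg.add i2
    have j2 : Integrable fun x => -(u.dx x * φ₂ x) + f (q x) * φ₁ x - q x * (β x * φ₁ x) :=
      j1.sub i3
    have j3 : Integrable fun x => -(u.dx x * φ₂ x) + f (q x) * φ₁ x - q x * (β x * φ₁ x)
      + ξ.fn x * (deriv f (q x) * φ₁ x) := j2.add i4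
    have j4 : Integrable fun x => -(u.dx x * φ₂ x) + f (q x) * φ₁ x - q x * (β x * φ₁ x)
      + ξ.fn x * (deriv f (q x) * φ₁ x) - ξ.fn x * (β x * φ₁ x) := j3.sub i5
    have e0 : flux f β u φ₁ φ₂ = ∫ x, (-(u.dx x * φ₂ x) + f (q x) * φ₁ x - q x * (β x * φ₁ x)
        + ξ.fn x * (deriv f (q x) * φ₁ x) - ξ.fn x * (β x * φ₁ x) + N x) := by
      refine integral_congr_ae ?_
      filter_upwards [hu] with x hx
      rw [hx, hN]; ring
    rw [e0, integral_add j4 iN, integral_sub j3 i5, integral_add j2 i4, integral_sub j1 i3,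
      integral_add (f := fun x => -(u.dx x * φ₂ x)) i1.neg i2, integral_neg]
    ring
  have e2 : -(∫ x, u.dx x * φ₂ x) = (∫ x, q x * φ₃ x) + ∫ x, ξ.fn x * φ₃ x := by
    rw [← u.integral_mul_deriv d₂ c₃ m₂ m₃, ← integral_add i6 i7]
    refine integral_congr_ae ?_
    filter_upwards [hu] with x hx
    rw [hx]; ring
  have e3 : ip ξ.fn (fun x => φ₃ x + deriv f (q x) * φ₁ x)
      = (∫ x, ξ.fn x * φ₃ x) + ∫ x, ξ.fn x * (deriv f (q x) * φ₁ x) := by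
    rw [ip, ← integral_add i7 i4]
    congr 1; ext x; ring
  have e4 : flux f β u φ₁ φ₂ - (ip q φ₃ + ip (fun x => f (q x)) φ₁ - ip q (fun x => β x * φ₁ x)
      + ip ξ.fn (fun x => φ₃ x + deriv f (q x) * φ₁ x) - ip ξ.fn (fun x => β x * φ₁ x))
      = ∫ x, N x := by
    rw [e1, e2, e3]; simp only [ip]; ring
  rw [e4]
  have h1 := norm_integral_le_of_norm_le (iξ2.const_mul (M * B)) bN
  rw [integral_const_mul] at h1
  refine h1.trans (mul_le_mul_of_nonneg_left ?_ (by positivity))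
  rw [show ∫ x, ξ.fn x ^ 2 = ‖ξ.1.fst‖ ^ 2 from integral_sq_L2 _]
  exact pow_le_pow_left₀ (norm_nonneg _) ξ.norm_fst_le 2

section Rows

variable {f : ℝ → ℝ} {c a α γ M d : ℝ} {q q1 z z1 V w wc : ℝ → ℝ}

/-- A factor vanishing to first order at `a` costs a constant and half of the decay rate. -/
theorem abs_mul_le_of_lipschitz {p v e B β y : ℝ} (hβ : 0 < β) (h1 : |p| ≤ e * |y|)
    (h2 : |v| ≤ B * ew β y) (he : 0 ≤ e) : |p * v| ≤ e * B * (2 / β) * ew (β / 2) y := by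
  have hB : 0 ≤ B := nonneg_of_mul_nonneg_left ((abs_nonneg _).trans h2) (ew_pos _ _)
  rw [abs_mul]
  calc |p| * |v| ≤ e * |y| * (B * ew β y) := mul_le_mul h1 h2 (abs_nonneg _) (by positivity)
    _ = e * B * (|y| * ew β y) := by ring
    _ ≤ e * B * (2 / β * ew (β / 2) y) := by
        gcongr e * B * ?_
        exact abs_mul_ew_le hβ y
    _ = _ := by ring

theorem abs_mul_le_of_quadratic {p v e B β y : ℝ} (hβ : 0 < β) (h1 : |p| ≤ e * |y| ^ 2)
    (h2 : |v| ≤ B * ew β y) (he : 0 ≤ e) : |p * v| ≤ e * B * (8 / β ^ 2) * ew (β / 4) y := by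
  have hB : 0 ≤ B := nonneg_of_mul_nonneg_left ((abs_nonneg _).trans h2) (ew_pos _ _)
  rw [abs_mul]
  calc |p| * |v| ≤ e * |y| ^ 2 * (B * ew β y) := mul_le_mul h1 h2 (abs_nonneg _) (by positivity)
    _ = e * B * (|y| ^ 2 * ew β y) := by ring
    _ ≤ e * B * (8 / β ^ 2 * ew (β / 4) y) := by
        gcongr e * B * ?_
        exact sq_mul_ew_le hβ y
    _ = _ := by ring

/-- The leading part of the flux tested against the wave vanishes, being the integral of an exact
derivative. -/
theorem ProfileData.ip_q_flux (P : ProfileData f c a α γ M d q q1 z z1 V w wc)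
    (hf : IsNonlinearity f) :
    ip q (fun x => (c - deriv f (q x)) * q1 x) + ip (fun x => f (q x)) q1 = 0 := by
  have m3 : MemLp (fun x => (c - deriv f (q x)) * q1 x) 2 volume :=
    memLp_mul_bounded (P.continuous_coeff hf) P.abs_coeff_le P.memLp_q1
  have mf : MemLp (fun x => f (q x)) 2 volume :=
    memLp_of_ew P.gamma_pos (hf.continuous.comp P.continuous_q).aestronglyMeasurable P.bound_fq
  have i1 : Integrable fun x => q x * ((c - deriv f (q x)) * q1 x) :=
    P.isSlow_q.memLp.integrable_mul m3
  have i2 : Integrable fun x => f (q x) * q1 x := mf.integrable_mul P.memLp_q1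
  have i3 : Integrable fun x => q x * (c * q x - f (q x)) :=
    P.isSlow_q.memLp.integrable_mul (P.memLp_q2 hf)
  have i4 : Integrable fun x => q1 x ^ 2 := P.memLp_q1.integrable_sq
  have i5 : Integrable fun x => q x ^ 2 := P.isSlow_q.memLp.integrable_sq
  rw [ip, ip, ← integral_add i1 i2]
  -- the integrand is the derivative of `q q'' - q'² + c q² / 2`
  refine integral_eq_zero_of_hasDerivAt_of_integrable
    (f := fun x => q x * (c * q x - f (q x)) - q1 x ^ 2 + c / 2 * q x ^ 2) (fun x => ?_)
    (i1.add i2) ((i3.sub i4).add (i5.const_mul _))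
  exact ((((P.hasDerivAt_q x).mul (P.hasDerivAt_q2 hf x)).sub ((P.hasDerivAt_q1 x).pow 2)).add
    (((P.hasDerivAt_q x).pow 2).const_mul _)).congr_deriv (by simp; ring)

/-- The flux tested against the solitary wave itself. -/
theorem exists_flux_fst_const {γ M : ℝ} (hγ : 0 < γ) (hM : 0 < M) :
    ∃ K > 0, ∀ {f : ℝ → ℝ} {c a α d : ℝ} {q q1 z z1 V w wc : ℝ → ℝ}, IsNonlinearity f →
      ProfileData f c a α γ M d q q1 z z1 V w wc → ∀ {b : ℝ → ℝ → ℝ} {εa εt εx : ℝ},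
      0 < εa → 0 < εx → IsPotential b εa εt εx → ∀ (t : ℝ) {u ξ : H1},
      (u.fn =ᵐ[volume] fun x => q x + ξ.fn x) → (∀ᵐ x, |ξ.fn x| ≤ 1) →
      |flux f (b t) u q1 (fun x => c * q x - f (q x))
        - ((c - b t a) * ip ξ.fn q1 + deriv (b t) a * (1 / 2 * ∫ x, q x ^ 2))|
        ≤ K * (εa * εx ^ 2 + εa * εx * ‖ξ‖ + ‖ξ‖ ^ 2) := by
  refine ⟨M * M * (2 / γ) * (2 / (γ / 2)) + M * (2 / γ) / √(γ / 2) + M * (2 * (M * M) + M),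
    by positivity, ?_⟩
  intro f c a α d q q1 z z1 V w wc hf P b εa εt εx ha hx hb t u ξ hu hξ
  have mq := P.isSlow_q.memLp
  have cβ := hb.continuous t
  have m1b : MemLp (fun x => b t x * q1 x) 2 volume :=
    memLp_mul_bounded cβ (hb.abs_le t) P.memLp_q1
  have hflux := P.abs_flux_sub_le hf cβ (hb.abs_le t) hu hξ (B := 2 * (M * M) + M) hγ
    P.continuous_q1 (P.hasDerivAt_q2 hf) ((P.continuous_coeff hf).mul P.continuous_q1)
    (fun x => (P.bound_q1 x).trans
      (mul_le_mul_of_nonneg_right (by nlinarith) (ew_nonneg _ _)))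
    (fun x => (P.abs_q2_le x).trans
      (mul_le_mul_of_nonneg_right (by nlinarith) (ew_nonneg _ _)))
    (fun x => by
      rw [abs_mul]
      calc _ ≤ 2 * M * (M * ew γ (x - a)) :=
            mul_le_mul (P.abs_coeff_le x) (P.bound_q1 x) (abs_nonneg _) (by positivity)
        _ = 2 * (M * M) * ew γ (x - a) := by ring
        _ ≤ _ := mul_le_mul_of_nonneg_right (by linarith) (ew_nonneg _ _))
  have e1 := P.ip_q_flux hf
  have e2 : ip ξ.fn (fun x => (c - deriv f (q x)) * q1 x + deriv f (q x) * q1 x)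
      = c * ip ξ.fn q1 := by
    rw [ip, ip, ← integral_const_mul]; congr 1; ext x; ring
  -- integration by parts moves the derivative from the wave to the potential
  have i5 : Integrable fun x => q x ^ 2 := mq.integrable_sq
  have i6 : Integrable fun x => deriv (b t) x * q x ^ 2 :=
    i5.bdd_mul (hb.continuous_deriv t).aestronglyMeasurable (ae_of_all _ (hb.abs_deriv_le t))
  have e3 : -ip q (fun x => b t x * q1 x) = 1 / 2 * ∫ x, deriv (b t) x * q x ^ 2 := by
    have i7 : Integrable fun x => q x * (b t x * q1 x) := mq.integrable_mul m1b
    have i8 : Integrable fun x => b t x * q x ^ 2 :=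
      i5.bdd_mul cβ.aestronglyMeasurable (ae_of_all _ (hb.abs_le t))
    have h0 := integral_eq_zero_of_hasDerivAt_of_integrable
      (f := fun x => b t x * q x ^ 2)
      (f' := fun x => deriv (b t) x * q x ^ 2 + 2 * (q x * (b t x * q1 x)))
      (fun x => ((hb.hasDerivAt t x).mul ((P.hasDerivAt_q x).pow 2)).congr_deriv (by simp; ring))
      (i6.add (i7.const_mul 2)) i8
    rw [integral_add i6 (i7.const_mul 2), integral_const_mul] at h0
    rw [ip]; linarith
  have e4 : |1 / 2 * (∫ x, deriv (b t) x * q x ^ 2)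
      - deriv (b t) a * (1 / 2 * ∫ x, q x ^ 2)|
      ≤ M * M * (2 / γ) * (2 / (γ / 2)) * (εa * εx ^ 2) := by
    have h1 : |∫ x, (deriv (b t) x - deriv (b t) a) * q x ^ 2|
        ≤ εa * εx ^ 2 * (M * M) * (2 / γ) * (2 / (γ / 2)) := by
      refine abs_integral_le_of_ew (half_pos hγ) fun x =>
        abs_mul_le_of_lipschitz hγ (hb.abs_deriv_sub_le t x a) ?_ (by positivity)
      rw [sq]
      exact abs_mul_le_ew hM.le hγ.le (P.bound_q x) (P.bound_q x)
    have h2 : 1 / 2 * (∫ x, deriv (b t) x * q x ^ 2) - deriv (b t) a * (1 / 2 * ∫ x, q x ^ 2)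
        = 1 / 2 * ∫ x, (deriv (b t) x - deriv (b t) a) * q x ^ 2 := by
      simp only [sub_mul]
      rw [integral_sub i6 (i5.const_mul _), integral_const_mul]; ring
    rw [h2, abs_mul, abs_of_pos (by norm_num : (0:ℝ) < 1 / 2)]
    have := abs_nonneg (∫ x, (deriv (b t) x - deriv (b t) a) * q x ^ 2)
    linarith
  have e5 : |ip ξ.fn (fun x => b t x * q1 x) - b t a * ip ξ.fn q1|
      ≤ M * (2 / γ) / √(γ / 2) * (εa * εx * ‖ξ‖) := by
    have h1 : ip ξ.fn (fun x => b t x * q1 x) - b t a * ip ξ.fn q1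
        = ip ξ.fn (fun x => (b t x - b t a) * q1 x) := by
      rw [ip, ip, ip, ← integral_const_mul, ← integral_sub]
      · congr 1; ext x; ring
      · exact ξ.memLp_fn.integrable_mul m1b
      · exact (ξ.memLp_fn.integrable_mul P.memLp_q1).const_mul _
    rw [h1]
    refine (ξ.abs_ip_le (half_pos hγ)
      ((cβ.sub continuous_const).mul P.continuous_q1).aestronglyMeasurable fun x =>
        abs_mul_le_of_lipschitz hγ (hb.abs_sub_le t x a) (P.bound_q1 x) (by positivity)).trans ?_
    exact le_of_eq (by ring)
  rw [e1, e2] at hflux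
  have hX := norm_nonneg ξ
  set F := flux f (b t) u q1 (fun x => c * q x - f (q x)) with hF
  set J := ip ξ.fn (fun x => b t x * q1 x) with hJ
  rw [show F - ((c - b t a) * ip ξ.fn q1 + deriv (b t) a * (1 / 2 * ∫ x, q x ^ 2))
    = (F - (0 - ip q (fun x => b t x * q1 x) + c * ip ξ.fn q1 - J))
      + (1 / 2 * (∫ x, deriv (b t) x * q x ^ 2) - deriv (b t) a * (1 / 2 * ∫ x, q x ^ 2))
      + -(J - b t a * ip ξ.fn q1) by rw [← e3]; ring]
  refine (abs_add_three _ _ _).trans ?_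
  rw [abs_neg]
  have p1 : 0 ≤ M * M * (2 / γ) * (2 / (γ / 2)) := by positivity
  have p2 : 0 ≤ M * (2 / γ) / √(γ / 2) := by positivity
  have p3 : 0 ≤ M * (2 * (M * M) + M) := by positivity
  have y1 : 0 ≤ εa * εx ^ 2 := by positivity
  have y2 : 0 ≤ εa * εx * ‖ξ‖ := by positivity
  have y3 : 0 ≤ ‖ξ‖ ^ 2 := by positivity
  generalize M * M * (2 / γ) * (2 / (γ / 2)) = k1 at *
  generalize M * (2 / γ) / √(γ / 2) = k2 at *
  generalize M * (2 * (M * M) + M) = k3 at *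
  nlinarith [mul_nonneg p1 y2, mul_nonneg p1 y3, mul_nonneg p2 y1, mul_nonneg p2 y3,
    mul_nonneg p3 y1, mul_nonneg p3 y2]

theorem ProfileData.memLp_z1 (P : ProfileData f c a α γ M d q q1 z z1 V w wc) :
    MemLp z1 2 volume :=
  memLp_of_ew P.gamma_pos P.continuous_z1.aestronglyMeasurable P.bound_z1

/-- With `g = w' = z - α w`, the leading part of the flux reduces to the transport term. -/
theorem ProfileData.ip_q_flux_snd (P : ProfileData f c a α γ M d q q1 z z1 V w wc)
    (hf : IsNonlinearity f) :
    ip q (fun x => (c - deriv f (q x)) * z x + q x - α * (z1 x - α * (z x - α * w x)))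
      + ip (fun x => f (q x)) (fun x => z x - α * w x) = c * ip q (fun x => z x - α * w x) := by
  have mq := P.isSlow_q.memLp
  have m1 : MemLp (fun x => z x - α * w x) 2 volume :=
    P.memLp_z.sub (P.isSlow_w.memLp.const_mul α)
  have m2 : MemLp (fun x => z1 x - α * (z x - α * w x)) 2 volume :=
    P.memLp_z1.sub (m1.const_mul α)
  have m3 : MemLp
      (fun x => (c - deriv f (q x)) * z x + q x - α * (z1 x - α * (z x - α * w x))) 2 volume :=
    ((memLp_mul_bounded (P.continuous_coeff hf) P.abs_coeff_le P.memLp_z).add mq).sub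
      (m2.const_mul α)
  have mf : MemLp (fun x => f (q x)) 2 volume :=
    memLp_of_ew P.gamma_pos (hf.continuous.comp P.continuous_q).aestronglyMeasurable P.bound_fq
  have i1 : Integrable fun x =>
      q x * ((c - deriv f (q x)) * z x + q x - α * (z1 x - α * (z x - α * w x))) :=
    mq.integrable_mul m3
  have i2 : Integrable fun x => f (q x) * (z x - α * w x) := mf.integrable_mul m1
  have i3 : Integrable fun x => q x * (z x - α * w x) := mq.integrable_mul m1
  have i4 : Integrable fun x => q x * (z1 x - α * (z x - α * w x)) := mq.integrable_mul m2
  have i5 : Integrable fun x => q1 x * (z x - α * w x) := P.memLp_q1.integrable_mul m1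
  have i6 : Integrable fun x =>
      q x * ((c - deriv f (q x)) * z x + q x - α * (z1 x - α * (z x - α * w x)))
      + f (q x) * (z x - α * w x) := i1.add i2
  -- the integrand of the difference is the derivative of `q g' - q' g`
  have h0 := integral_eq_zero_of_hasDerivAt_of_integrable
    (f := fun x => q x * (z1 x - α * (z x - α * w x)) - q1 x * (z x - α * w x))
    (f' := fun x => q x * ((c - deriv f (q x)) * z x + q x - α * (z1 x - α * (z x - α * w x)))
      + f (q x) * (z x - α * w x) - c * (q x * (z x - α * w x)))
    (fun x => ?_) (i6.sub (i3.const_mul c)) (i4.sub i5)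
  · rw [integral_sub i6 (i3.const_mul c), integral_add i1 i2, integral_const_mul] at h0
    simp only [ip]; linarith
  · have dg := (P.hasDerivAt_z x).sub ((P.hasDerivAt_w x).const_mul α)
    have dg' := (P.hasDerivAt_z1 x).sub (dg.const_mul α)
    exact (((P.hasDerivAt_q x).mul dg').sub ((P.hasDerivAt_q1 x).mul dg)).congr_deriv
      (by simp; ring)

/-- The flux tested against the regularized antiderivative `w` of `∂_c q`. -/
theorem exists_flux_snd_const {γ M : ℝ} (hγ : 0 < γ) (hM : 0 < M) :
    ∃ K > 0, ∀ {f : ℝ → ℝ} {c a α d : ℝ} {q q1 z z1 V w wc : ℝ → ℝ}, IsNonlinearity f →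
      ProfileData f c a α γ M d q q1 z z1 V w wc → ∀ {b : ℝ → ℝ → ℝ} {εa εt εx : ℝ},
      0 < εa → 0 < εx → IsPotential b εa εt εx → ∀ (t : ℝ) {u ξ : H1},
      (u.fn =ᵐ[volume] fun x => q x + ξ.fn x) → (∀ᵐ x, |ξ.fn x| ≤ 1) →
      ip ξ.fn q = 0 → ip ξ.fn w = 0 →
      |flux f (b t) u (fun x => z x - α * w x) (fun x => z1 x - α * (z x - α * w x))
        - (c - b t a) * (ip q (fun x => z x - α * w x) + ip ξ.fn (fun x => z x - α * w x))|
        ≤ K * (α * (εa * εx) + εa * εx ^ 2 + α * ‖ξ‖ + εa * εx * ‖ξ‖ + ‖ξ‖ ^ 2)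
          + |ip ξ.fn (fun x => α * ((b t x - b t a) * w x))| := by
  refine ⟨M * M * (2 / γ) * (2 / (γ / 2)) + M * M * (8 / γ ^ 2) * (2 / (γ / 4))
    + (2 * M + M * M) / √γ + M * (2 / γ) / √(γ / 2) + M * (2 * (M * M) + 4 * M),
    by positivity, ?_⟩
  intro f c a α d q q1 z z1 V w wc hf P b εa εt εx ha hx hb t u ξ hu hξ oq ow
  have hα := P.alpha_pos
  have hα1 := P.alpha_le_one
  have hαγ := P.alpha_le
  have mq := P.isSlow_q.memLp
  have mw := P.isSlow_w.memLp
  have mz := P.memLp_z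
  have cβ := hb.continuous t
  have m1 : MemLp (fun x => z x - α * w x) 2 volume := mz.sub (mw.const_mul α)
  have bz : ∀ x, |z x| ≤ M * ew α (x - a) := fun x => P.weaken (P.bound_z x) (by linarith)
  have bq : ∀ x, |q x| ≤ M * ew α (x - a) := fun x => P.weaken (P.bound_q x) (by linarith)
  have bz1 : ∀ x, |z1 x| ≤ M * ew α (x - a) := fun x => P.weaken (P.bound_z1 x) (by linarith)
  have scale : ∀ {v B y : ℝ}, |v| ≤ B * ew α y → |α * v| ≤ B * ew α y := fun h => by
    rw [abs_mul, abs_of_pos hα]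
    exact (mul_le_of_le_one_left (abs_nonneg _) hα1).trans h
  have g1 : ∀ x, |z x - α * w x| ≤ 2 * M * ew α (x - a) := fun x =>
    ((abs_sub _ _).trans (add_le_add (bz x) (scale (P.bound_w x)))).trans (le_of_eq (by ring))
  have g2 : ∀ x, |z1 x - α * (z x - α * w x)| ≤ 3 * M * ew α (x - a) := fun x =>
    ((abs_sub _ _).trans (add_le_add (bz1 x) (scale (g1 x)))).trans (le_of_eq (by ring))
  have g3 : ∀ x, |(c - deriv f (q x)) * z x + q x - α * (z1 x - α * (z x - α * w x))|
      ≤ (2 * (M * M) + 4 * M) * ew α (x - a) := fun x => by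
    have h1 : |(c - deriv f (q x)) * z x| ≤ 2 * M * (M * ew α (x - a)) := by
      rw [abs_mul]
      exact mul_le_mul (P.abs_coeff_le x) (bz x) (abs_nonneg _) (by positivity)
    calc _ ≤ 2 * M * (M * ew α (x - a)) + M * ew α (x - a) + 3 * M * ew α (x - a) :=
          (abs_sub _ _).trans (add_le_add ((abs_add_le _ _).trans (add_le_add h1 (bq x)))
            (scale (g2 x)))
      _ = _ := by ring
  have d2 : ∀ x, HasDerivAt (fun x => z1 x - α * (z x - α * w x))
      ((c - deriv f (q x)) * z x + q x - α * (z1 x - α * (z x - α * w x))) x := fun x =>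
    (P.hasDerivAt_z1 x).sub
      (((P.hasDerivAt_z x).sub ((P.hasDerivAt_w x).const_mul α)).const_mul α)
  have cc := P.continuous_coeff hf
  have cz := P.continuous_z
  have cz1 := P.continuous_z1
  have cw := P.continuous_w
  have cq := P.continuous_q
  have hMM : 0 < M * M := by positivity
  have hflux := P.abs_flux_sub_le hf cβ (hb.abs_le t) hu hξ (B := 2 * (M * M) + 4 * M) hα
    (by fun_prop) d2 (by fun_prop)
    (fun x => (g1 x).trans (mul_le_mul_of_nonneg_right (by linarith) (ew_nonneg _ _)))
    (fun x => (g2 x).trans (mul_le_mul_of_nonneg_right (by linarith) (ew_nonneg _ _))) g3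
  rw [P.ip_q_flux_snd hf] at hflux
  set g : ℝ → ℝ := fun x => z x - α * w x with hg
  have mfw : MemLp (fun x => deriv f (q x) * w x) 2 volume := by
    have h : ∀ x, |deriv f (q x)| ≤ M := fun x => (P.slope x).trans
      (mul_le_of_le_one_right hM.le (ew_le_one hγ.le _))
    exact memLp_mul_bounded (P.continuous_slope hf) h mw
  -- in the linear term, orthogonality removes everything but the transport term and `O(α)`
  have e1 : ip ξ.fn (fun x => (c - deriv f (q x)) * z x + q x - α * (z1 x - α * (z x - α * w x))
      + deriv f (q x) * (z x - α * w x))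
      = c * ip ξ.fn g - α * ip ξ.fn (fun x => z1 x - α * z x + deriv f (q x) * w x) := by
    have mm : MemLp (fun x => z1 x - α * z x + deriv f (q x) * w x) 2 volume :=
      (P.memLp_z1.sub (mz.const_mul α)).add mfw
    have j1 : Integrable fun x => ξ.fn x * g x := ξ.memLp_fn.integrable_mul m1
    have j2 : Integrable fun x => ξ.fn x * (z1 x - α * z x + deriv f (q x) * w x) :=
      ξ.memLp_fn.integrable_mul mm
    have j3 : Integrable fun x => ξ.fn x * q x := ξ.memLp_fn.integrable_mul mq
    have j4 : Integrable fun x => ξ.fn x * w x := ξ.memLp_fn.integrable_mul mw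
    have : ip ξ.fn (fun x => (c - deriv f (q x)) * z x + q x - α * (z1 x - α * (z x - α * w x))
      + deriv f (q x) * (z x - α * w x))
      = c * ip ξ.fn g - α * ip ξ.fn (fun x => z1 x - α * z x + deriv f (q x) * w x)
        + ip ξ.fn q + (α * c - α ^ 3) * ip ξ.fn w := by
      simp only [ip]
      have j5 : Integrable fun x => c * (ξ.fn x * g x)
          - α * (ξ.fn x * (z1 x - α * z x + deriv f (q x) * w x)) :=
        (j1.const_mul c).sub (j2.const_mul α)
      have j6 : Integrable fun x => c * (ξ.fn x * g x)
          - α * (ξ.fn x * (z1 x - α * z x + deriv f (q x) * w x)) + ξ.fn x * q x := j5.add j3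
      rw [← integral_const_mul, ← integral_const_mul, ← integral_const_mul,
        ← integral_sub (j1.const_mul c) (j2.const_mul α), ← integral_add j5 j3,
        ← integral_add j6 (j4.const_mul (α * c - α ^ 3))]
      congr 1; ext x
      simp only [hg]; ring
    rw [this, oq, ow]; ring
  have e2 : |ip ξ.fn (fun x => z1 x - α * z x + deriv f (q x) * w x)|
      ≤ (2 * M + M * M) / √γ * ‖ξ‖ := by
    refine (ξ.abs_ip_le (B := 2 * M + M * M) (a := a) hγ ((cz1.sub (continuous_const.mul cz)).add
      ((P.continuous_slope hf).mul cw)).aestronglyMeasurable fun x => ?_).trans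
      (le_of_eq (by ring))
    have h1 : |α * z x| ≤ M * ew γ (x - a) := by
      rw [abs_mul, abs_of_pos hα]
      exact (mul_le_of_le_one_left (abs_nonneg _) hα1).trans (P.bound_z x)
    have h2 := abs_mul_le_ew hM.le hα.le (P.slope x) (P.bound_w x)
    calc _ ≤ M * ew γ (x - a) + M * ew γ (x - a) + M * M * ew γ (x - a) :=
          (abs_add_le _ _).trans (add_le_add ((abs_sub _ _).trans
            (add_le_add (P.bound_z1 x) h1)) h2)
      _ = _ := by ring
  -- the potential acting on the wave; by parity its linear part does not contribute
  have mb : ∀ {v : ℝ → ℝ}, MemLp v 2 volume → MemLp (fun x => b t x * v x) 2 volume := fun hv =>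
    memLp_mul_bounded cβ (hb.abs_le t) hv
  have cβ0 : Continuous fun x => b t x - b t a := cβ.sub continuous_const
  have bz' : ∀ x, |q x * z x| ≤ M * M * ew γ (x - a) := fun x =>
    abs_mul_le_ew hM.le hγ.le (P.bound_q x) (P.bound_z x)
  have bw' : ∀ x, |q x * w x| ≤ M * M * ew γ (x - a) := fun x =>
    abs_mul_le_ew hM.le hα.le (P.bound_q x) (P.bound_w x)
  have hz1 : ∀ x, |(b t x - b t a) * (q x * z x)|
      ≤ εa * εx * (M * M) * (2 / γ) * ew (γ / 2) (x - a) := fun x =>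
    abs_mul_le_of_lipschitz hγ (hb.abs_sub_le t x a) (bz' x) (by positivity)
  have hw1 : ∀ x, |(b t x - b t a) * (q x * w x)|
      ≤ εa * εx * (M * M) * (2 / γ) * ew (γ / 2) (x - a) := fun x =>
    abs_mul_le_of_lipschitz hγ (hb.abs_sub_le t x a) (bw' x) (by positivity)
  have iz : Integrable fun x => (b t x - b t a) * (q x * z x) :=
    integrable_of_ew (half_pos hγ) (cβ0.mul (cq.mul cz)).aestronglyMeasurable hz1
  have iw : Integrable fun x => (b t x - b t a) * (q x * w x) :=
    integrable_of_ew (half_pos hγ) (cβ0.mul (cq.mul cw)).aestronglyMeasurable hw1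
  have e3 : ip q (fun x => b t x * g x) - b t a * ip q g
      = (∫ x, (b t x - b t a) * (q x * z x)) - α * ∫ x, (b t x - b t a) * (q x * w x) := by
    rw [ip, ip, ← integral_const_mul, ← integral_const_mul, ← integral_sub, ← integral_sub]
    · congr 1; ext x; simp only [hg]; ring
    · exact iz
    · exact iw.const_mul α
    · exact mq.integrable_mul (mb m1)
    · exact (mq.integrable_mul m1).const_mul _
  have e4 : |∫ x, (b t x - b t a) * (q x * w x)|
      ≤ M * M * (2 / γ) * (2 / (γ / 2)) * (εa * εx) :=
    (abs_integral_le_of_ew (half_pos hγ) hw1).trans (le_of_eq (by ring))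
  have e5 : |∫ x, (b t x - b t a) * (q x * z x)|
      ≤ M * M * (8 / γ ^ 2) * (2 / (γ / 4)) * (εa * εx ^ 2) := by
    have il : Integrable fun x => (x - a) * (q x * z x) := by
      refine integrable_of_ew (half_pos hγ)
        ((continuous_id.sub continuous_const).mul (cq.mul cz)).aestronglyMeasurable fun x =>
          abs_mul_le_of_lipschitz (e := 1) hγ ?_ (bz' x) zero_le_one
      simp
    have h1 : ∫ x, (b t x - b t a) * (q x * z x)
        = ∫ x, (b t x - b t a - deriv (b t) a * (x - a)) * (q x * z x) := by
      have h2 : ∀ x, (b t x - b t a - deriv (b t) a * (x - a)) * (q x * z x)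
          = (b t x - b t a) * (q x * z x) - deriv (b t) a * ((x - a) * (q x * z x)) := fun x => by
        ring
      simp only [h2]
      rw [integral_sub iz (il.const_mul _), integral_const_mul, P.parity, mul_zero, sub_zero]
    rw [h1]
    have hγ4 : (0:ℝ) < γ / 4 := by positivity
    refine (abs_integral_le_of_ew hγ4 fun x =>
      abs_mul_le_of_quadratic hγ (hb.taylor t x a) (bz' x) (by positivity)).trans
      (le_of_eq (by ring))
  -- the potential acting on the fluctuation
  have e6 : ip ξ.fn (fun x => b t x * g x) - b t a * ip ξ.fn g
      = ip ξ.fn (fun x => (b t x - b t a) * z x)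
        - ip ξ.fn (fun x => α * ((b t x - b t a) * w x)) := by
    have mbz : MemLp (fun x => (b t x - b t a) * z x) 2 volume := by
      simpa only [sub_mul] using! (mb mz).sub (mz.const_mul (b t a))
    have mbw : MemLp (fun x => α * ((b t x - b t a) * w x)) 2 volume := by
      simpa only [sub_mul] using! ((mb mw).sub (mw.const_mul (b t a))).const_mul α
    simp only [ip]
    rw [← integral_const_mul, ← integral_sub, ← integral_sub]
    · congr 1; ext x; simp only [hg]; ring
    · exact ξ.memLp_fn.integrable_mul mbz
    · exact ξ.memLp_fn.integrable_mul mbw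
    · exact ξ.memLp_fn.integrable_mul (mb m1)
    · exact (ξ.memLp_fn.integrable_mul m1).const_mul _
  have e7 : |ip ξ.fn (fun x => (b t x - b t a) * z x)|
      ≤ M * (2 / γ) / √(γ / 2) * (εa * εx * ‖ξ‖) :=
    (ξ.abs_ip_le (half_pos hγ) (cβ0.mul cz).aestronglyMeasurable fun x =>
      abs_mul_le_of_lipschitz hγ (hb.abs_sub_le t x a) (P.bound_z x) (by positivity)).trans
      (le_of_eq (by ring))
  have hX := norm_nonneg ξ
  rw [e1] at hflux
  set F := flux f (b t) u g (fun x => z1 x - α * (z x - α * w x)) with hF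
  set J1 := ip q (fun x => b t x * g x)
  set J2 := ip ξ.fn (fun x => b t x * g x)
  set S := ip ξ.fn (fun x => z1 x - α * z x + deriv f (q x) * w x)
  set I1 := ∫ x, (b t x - b t a) * (q x * z x)
  set I2 := ∫ x, (b t x - b t a) * (q x * w x)
  set T := ip ξ.fn (fun x => (b t x - b t a) * z x)
  set U := ip ξ.fn (fun x => α * ((b t x - b t a) * w x))
  have hsum : |F - (c - b t a) * (ip q g + ip ξ.fn g)|
      ≤ M * (2 * (M * M) + 4 * M) * ‖ξ‖ ^ 2 + α * |S| + |I1| + α * |I2| + |T| + |U| := by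
    rw [show F - (c - b t a) * (ip q g + ip ξ.fn g)
      = (F - (c * ip q g - J1 + (c * ip ξ.fn g - α * S) - J2))
        + (-(α * S)) + -(J1 - b t a * ip q g) + -(J2 - b t a * ip ξ.fn g) by ring, e3, e6]
    have a1 : |α * S| = α * |S| := by rw [abs_mul, abs_of_pos hα]
    have a2 : |I1 - α * I2| ≤ |I1| + α * |I2| := by
      refine (abs_sub _ _).trans ?_
      rw [abs_mul, abs_of_pos hα]
    have a3 := abs_sub T U
    refine (abs_add_le _ _).trans ?_
    rw [abs_neg]
    refine (add_le_add ((abs_add_three _ _ _).trans (le_refl _)) a3).trans ?_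
    rw [abs_neg, abs_neg, a1]
    linarith
  refine hsum.trans ?_
  have a1 : α * |S| ≤ (2 * M + M * M) / √γ * (α * ‖ξ‖) :=
    (mul_le_mul_of_nonneg_left e2 hα.le).trans (le_of_eq (by ring))
  have a2 : α * |I2| ≤ M * M * (2 / γ) * (2 / (γ / 2)) * (α * (εa * εx)) :=
    (mul_le_mul_of_nonneg_left e4 hα.le).trans (le_of_eq (by ring))
  have p1 : 0 ≤ M * M * (2 / γ) * (2 / (γ / 2)) := by positivity
  have p2 : 0 ≤ M * M * (8 / γ ^ 2) * (2 / (γ / 4)) := by positivity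
  have p3 : 0 ≤ (2 * M + M * M) / √γ := by positivity
  have p4 : 0 ≤ M * (2 / γ) / √(γ / 2) := by positivity
  have p5 : 0 ≤ M * (2 * (M * M) + 4 * M) := by positivity
  have y1 : 0 ≤ α * (εa * εx) := by positivity
  have y2 : 0 ≤ εa * εx ^ 2 := by positivity
  have y3 : 0 ≤ α * ‖ξ‖ := by positivity
  have y4 : 0 ≤ εa * εx * ‖ξ‖ := by positivity
  have y5 : 0 ≤ ‖ξ‖ ^ 2 := by positivity
  clear_value F J1 J2 S I1 I2 T U
  generalize M * M * (2 / γ) * (2 / (γ / 2)) = k1 at *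
  generalize M * M * (8 / γ ^ 2) * (2 / (γ / 4)) = k2 at *
  generalize (2 * M + M * M) / √γ = k3 at *
  generalize M * (2 / γ) / √(γ / 2) = k4 at *
  generalize M * (2 * (M * M) + 4 * M) = k5 at *
  have key : (k1 + k2 + k3 + k4 + k5) *
      (α * (εa * εx) + εa * εx ^ 2 + α * ‖ξ‖ + εa * εx * ‖ξ‖ + ‖ξ‖ ^ 2)
      ≥ k1 * (α * (εa * εx)) + k2 * (εa * εx ^ 2) + k3 * (α * ‖ξ‖) + k4 * (εa * εx * ‖ξ‖)
        + k5 * ‖ξ‖ ^ 2 := by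
    generalize α * (εa * εx) = x1 at *
    generalize εa * εx ^ 2 = x2 at *
    generalize α * ‖ξ‖ = x3 at *
    generalize εa * εx * ‖ξ‖ = x4 at *
    generalize ‖ξ‖ ^ 2 = x5 at *
    have s1 : k1 * x1 ≤ k1 * (x1 + x2 + x3 + x4 + x5) :=
      mul_le_mul_of_nonneg_left (by linarith) p1
    have s2 : k2 * x2 ≤ k2 * (x1 + x2 + x3 + x4 + x5) :=
      mul_le_mul_of_nonneg_left (by linarith) p2
    have s3 : k3 * x3 ≤ k3 * (x1 + x2 + x3 + x4 + x5) :=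
      mul_le_mul_of_nonneg_left (by linarith) p3
    have s4 : k4 * x4 ≤ k4 * (x1 + x2 + x3 + x4 + x5) :=
      mul_le_mul_of_nonneg_left (by linarith) p4
    have s5 : k5 * x5 ≤ k5 * (x1 + x2 + x3 + x4 + x5) :=
      mul_le_mul_of_nonneg_left (by linarith) p5
    linarith
  linarith

/-- The product of the potential with `w` is slowly varying, with an amplitude that gains the
factor lost to the slow decay of `w`. -/
theorem ProfileData.isSlow_potential (P : ProfileData f c a α γ M d q q1 z z1 V w wc)
    {b : ℝ → ℝ → ℝ} {εa εt εx : ℝ} (ha : 0 < εa) (hx : 0 < εx) (hb : IsPotential b εa εt εx)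
    (t : ℝ) : IsSlow α γ a (M * (3 + 2 / γ) * (εa * εx)) (fun x => α * ((b t x - b t a) * w x))
      (fun x => deriv (b t) x * w x + -(α * ((b t x - b t a) * w x)))
      (fun x => α * ((b t x - b t a) * z x)) := by
  have hα := P.alpha_pos
  have hα1 := P.alpha_le_one
  have hγ := P.gamma_pos
  have hM := P.M_pos
  have cβ := hb.continuous t
  have cβ' := hb.continuous_deriv t
  have cw := P.continuous_w
  have cz := P.continuous_z
  have he : 0 ≤ εa * εx := by positivity
  have h0 : ∀ x, |α * ((b t x - b t a) * w x)| ≤ 2 * M * (εa * εx) * ew (α / 2) (x - a) := fun x => by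
    have := abs_mul_le_of_lipschitz hα (hb.abs_sub_le t x a) (P.bound_w x) he
    rw [abs_mul, abs_of_pos hα]
    calc _ ≤ α * (εa * εx * M * (2 / α) * ew (α / 2) (x - a)) := by gcongr
      _ = _ := by field_simp
  have h2γ : 0 ≤ M * (2 / γ) * (εa * εx) := by positivity
  have hMe : 0 ≤ M * (εa * εx) := by positivity
  refine ⟨hα, hα1, hγ, fun x => ?_, by fun_prop, by fun_prop, fun x => ?_, fun x => ?_, fun x => ?_⟩
  · exact ((((hb.hasDerivAt t x).sub_const (b t a)).mul (P.hasDerivAt_w x)).const_mul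
      α).congr_deriv (by ring)
  · exact (h0 x).trans (mul_le_mul_of_nonneg_right (by linarith) (ew_nonneg _ _))
  · have h1 : |deriv (b t) x * w x| ≤ M * (εa * εx) * ew (α / 2) (x - a) := by
      rw [abs_mul]
      calc _ ≤ εa * εx * (M * ew (α / 2) (x - a)) :=
            mul_le_mul (hb.abs_deriv_le t x) (P.weaken (P.bound_w x) (by linarith))
              (abs_nonneg _) he
        _ = _ := by ring
    refine (abs_add_le _ _).trans ?_
    rw [abs_neg]
    refine (add_le_add h1 (h0 x)).trans ?_
    rw [← add_mul]
    exact mul_le_mul_of_nonneg_right (by linarith) (ew_nonneg _ _)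
  · have h1 := abs_mul_le_of_lipschitz hγ (hb.abs_sub_le t x a) (P.bound_z x) he
    rw [abs_mul, abs_of_pos hα]
    refine (mul_le_of_le_one_left (abs_nonneg _) hα1).trans (h1.trans ?_)
    exact mul_le_mul_of_nonneg_right (by linarith) (ew_nonneg _ _)

end Rows

/-! ### The equation tested against functions that are not compactly supported -/

theorem integral_abs_mul_abs_le (v : L2) {g : ℝ → ℝ} (hg : MemLp g 2 volume) :
    ∫ x, |v x| * |g x| ≤ ‖v‖ * √(∫ x, g x ^ 2) := by
  have h : |(∫ x, |v x| * |g x|)| ≤ √(∫ x, |v x| ^ 2) * √(∫ x, |g x| ^ 2) :=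
    abs_ip_le (Lp.memLp v).abs hg.abs
  simp only [sq_abs, integral_sq_L2, Real.sqrt_sq (norm_nonneg v)] at h
  exact (le_abs_self _).trans h

theorem sqrt_integral_sq_le_add {g h : ℝ → ℝ} (hg : MemLp g 2 volume) (hh : MemLp h 2 volume)
    {τ : ℝ} (hτ : 0 ≤ τ) (hd : ∫ x, (g x - h x) ^ 2 ≤ τ ^ 2) :
    √(∫ x, g x ^ 2) ≤ √(∫ x, h x ^ 2) + τ := by
  have e : ∀ {k : ℝ → ℝ} (hk : MemLp k 2 volume), √(∫ x, k x ^ 2) = ‖hk.toLp k‖ := by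
    intro k hk
    rw [← Real.sqrt_sq (norm_nonneg (hk.toLp k)), ← integral_sq_L2]
    congr 1
    refine integral_congr_ae ?_
    filter_upwards [hk.coeFn_toLp] with x hx
    rw [hx]
  have h1 : ‖hg.toLp g - hh.toLp h‖ ≤ τ := by
    rw [← MemLp.toLp_sub, ← e (hg.sub hh)]
    exact Real.sqrt_le_iff.2 ⟨hτ, hd⟩
  rw [e hg, e hh]
  have := norm_le_norm_add_norm_sub' (hg.toLp g) (hh.toLp h)
  linarith

section Flux

variable {f : ℝ → ℝ} {A K E D : ℝ} (hfc : Continuous f)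
  (hK : ∀ s ∈ Icc (-A) A, ∀ r ∈ Icc (-A) A, |f s - f r| ≤ K * |s - r|)
include hfc hK

theorem memLp_reaction (hf0 : f 0 = 0) (hA : 0 ≤ A) {β : ℝ → ℝ} (hβ : Continuous β)
    (hE : ∀ x, |β x| ≤ E) {u : H1} (hu : ∀ᵐ x, |u.fn x| ≤ A) :
    MemLp (fun x => f (u.fn x) - β x * u.fn x) 2 volume := by
  refine MemLp.sub ?_ (memLp_mul_bounded hβ hE u.memLp_fn)
  refine MemLp.of_le_mul (c := K) u.memLp_fn
    (hfc.comp_aestronglyMeasurable u.memLp_fn.1) ?_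
  filter_upwards [hu] with x hx
  have := hK _ (abs_le.1 hx) 0 ⟨by linarith, hA⟩
  rwa [hf0, sub_zero, sub_zero] at this

/-- The flux depends in a Lipschitz way on the solution and on the potential. -/
theorem abs_flux_sub_flux_le (hf0 : f 0 = 0) (hA : 0 ≤ A) (hK0 : 0 ≤ K) {β₁ β₂ : ℝ → ℝ}
    (hβ₁ : Continuous β₁) (hβ₂ : Continuous β₂) (hE₁ : ∀ x, |β₁ x| ≤ E) (hE₂ : ∀ x, |β₂ x| ≤ E)
    (hD : ∀ x, |β₁ x - β₂ x| ≤ D) {u v : H1} (hu : ∀ᵐ x, |u.fn x| ≤ A)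
    (hv : ∀ᵐ x, |v.fn x| ≤ A) {ψ₁ ψ₂ : ℝ → ℝ} (m₁ : MemLp ψ₁ 2 volume) (m₂ : MemLp ψ₂ 2 volume) :
    |flux f β₁ u ψ₁ ψ₂ - flux f β₂ v ψ₁ ψ₂| ≤ ‖u - v‖ * √(∫ x, ψ₂ x ^ 2)
      + ((K + E) * ‖u - v‖ + D * ‖v‖) * √(∫ x, ψ₁ x ^ 2) := by
  have hE0 : 0 ≤ E := (abs_nonneg _).trans (hE₁ 0)
  have hD0 : 0 ≤ D := (abs_nonneg _).trans (hD 0)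
  have r₁ := memLp_reaction hfc hK hf0 hA hβ₁ hE₁ hu
  have r₂ := memLp_reaction hfc hK hf0 hA hβ₂ hE₂ hv
  have i1 : Integrable fun x => (u - v).dx x * ψ₂ x := (u - v).memLp_dx.integrable_mul m₂
  have i2 : Integrable fun x => (f (u.fn x) - β₁ x * u.fn x - (f (v.fn x) - β₂ x * v.fn x)) * ψ₁ x :=
    (r₁.sub r₂).integrable_mul m₁
  have j1 : Integrable fun x => -(u.dx x * ψ₂ x) + (f (u.fn x) - β₁ x * u.fn x) * ψ₁ x :=
    (u.memLp_dx.integrable_mul m₂).neg.add (r₁.integrable_mul m₁)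
  have j2 : Integrable fun x => -(v.dx x * ψ₂ x) + (f (v.fn x) - β₂ x * v.fn x) * ψ₁ x :=
    (v.memLp_dx.integrable_mul m₂).neg.add (r₂.integrable_mul m₁)
  have e : flux f β₁ u ψ₁ ψ₂ - flux f β₂ v ψ₁ ψ₂ = -(∫ x, (u - v).dx x * ψ₂ x)
      + ∫ x, (f (u.fn x) - β₁ x * u.fn x - (f (v.fn x) - β₂ x * v.fn x)) * ψ₁ x := by
    rw [flux, flux, ← integral_sub j1 j2, ← integral_neg,
      ← integral_add (f := fun x => -((u - v).dx x * ψ₂ x)) i1.neg i2]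
    refine integral_congr_ae ?_
    filter_upwards [H1.dx_sub u v] with x hx
    rw [hx]; ring
  have b1 : |∫ x, (u - v).dx x * ψ₂ x| ≤ ‖u - v‖ * √(∫ x, ψ₂ x ^ 2) :=
    (abs_ip_L2_le (u - v).1.snd m₂).trans (by gcongr; exact (u - v).norm_snd_le)
  have k1 : Integrable fun x => |(u - v).fn x| * |ψ₁ x| :=
    (u - v).memLp_fn.abs.integrable_mul m₁.abs
  have k2 : Integrable fun x => |v.fn x| * |ψ₁ x| := v.memLp_fn.abs.integrable_mul m₁.abs
  have b2 : |∫ x, (f (u.fn x) - β₁ x * u.fn x - (f (v.fn x) - β₂ x * v.fn x)) * ψ₁ x|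
      ≤ (K + E) * (‖u - v‖ * √(∫ x, ψ₁ x ^ 2)) + D * (‖v‖ * √(∫ x, ψ₁ x ^ 2)) := by
    have hb := norm_integral_le_of_norm_le (f := fun x =>
      (f (u.fn x) - β₁ x * u.fn x - (f (v.fn x) - β₂ x * v.fn x)) * ψ₁ x)
      ((k1.const_mul (K + E)).add (k2.const_mul D)) (by
        filter_upwards [hu, hv, H1.fn_sub u v] with x hux hvx hx
        rw [norm_mul, Real.norm_eq_abs, Real.norm_eq_abs, Pi.add_apply, hx, ← mul_assoc,
          ← mul_assoc, ← add_mul]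
        refine mul_le_mul_of_nonneg_right ?_ (abs_nonneg _)
        have h1 := hK _ (abs_le.1 hux) _ (abs_le.1 hvx)
        have h2 : |β₁ x * (u.fn x - v.fn x)| ≤ E * |u.fn x - v.fn x| := by
          rw [abs_mul]; gcongr; exact hE₁ x
        have h3 : |(β₁ x - β₂ x) * v.fn x| ≤ D * |v.fn x| := by
          rw [abs_mul]; gcongr; exact hD x
        rw [show f (u.fn x) - β₁ x * u.fn x - (f (v.fn x) - β₂ x * v.fn x)
          = (f (u.fn x) - f (v.fn x)) - β₁ x * (u.fn x - v.fn x) - (β₁ x - β₂ x) * v.fn x by ring]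
        refine (abs_sub _ _).trans ((add_le_add (abs_sub _ _) le_rfl).trans ?_)
        linarith)
    rw [Real.norm_eq_abs] at hb
    refine hb.trans ?_
    have hadd : ∫ x, ((fun x => (K + E) * (|(u - v).fn x| * |ψ₁ x|))
        + fun x => D * (|v.fn x| * |ψ₁ x|)) x
        = (K + E) * (∫ x, |(u - v).fn x| * |ψ₁ x|) + D * ∫ x, |v.fn x| * |ψ₁ x| := by
      rw [integral_add' (k1.const_mul _) (k2.const_mul _), integral_const_mul, integral_const_mul]
    rw [hadd]
    have c1 := integral_abs_mul_abs_le (u - v).1.fst m₁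
    have c2 := integral_abs_mul_abs_le v.1.fst m₁
    have hs := Real.sqrt_nonneg (∫ x, ψ₁ x ^ 2)
    gcongr
    · exact c1.trans (mul_le_mul_of_nonneg_right (u - v).norm_fst_le hs)
    · exact c2.trans (mul_le_mul_of_nonneg_right v.norm_fst_le hs)
  rw [e]
  refine (abs_add_le _ _).trans ?_
  rw [abs_neg]
  linarith

/-- The flux is continuous in the test function. -/
theorem abs_flux_sub_le_of_approx (hf0 : f 0 = 0) (hA : 0 ≤ A) (hK0 : 0 ≤ K) {β : ℝ → ℝ}
    (hβ : Continuous β) (hE : ∀ x, |β x| ≤ E) {u : H1} (hu : ∀ᵐ x, |u.fn x| ≤ A)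
    {ψ₁ ψ₂ φ₁ φ₂ : ℝ → ℝ} (m₁ : MemLp ψ₁ 2 volume) (m₂ : MemLp ψ₂ 2 volume)
    (n₁ : MemLp φ₁ 2 volume) (n₂ : MemLp φ₂ 2 volume) {τ : ℝ} (hτ : 0 ≤ τ)
    (h₁ : ∫ x, (ψ₁ x - φ₁ x) ^ 2 ≤ τ ^ 2) (h₂ : ∫ x, (ψ₂ x - φ₂ x) ^ 2 ≤ τ ^ 2) :
    |flux f β u ψ₁ ψ₂ - flux f β u φ₁ φ₂| ≤ (1 + (K + E)) * ‖u‖ * τ := by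
  have hE0 : 0 ≤ E := (abs_nonneg _).trans (hE 0)
  have r₁ := memLp_reaction hfc hK hf0 hA hβ hE hu
  have z0 : (0 : H1).fn =ᵐ[volume] 0 := Lp.coeFn_zero _ _ _
  have z1 : (0 : H1).dx =ᵐ[volume] 0 := Lp.coeFn_zero _ _ _
  have hz : ∀ᵐ x, |(0 : H1).fn x| ≤ A := by
    filter_upwards [z0] with x hx
    simpa [hx] using hA
  have e1 : flux f β u ψ₁ ψ₂ - flux f β u φ₁ φ₂
      = flux f β u (fun x => ψ₁ x - φ₁ x) (fun x => ψ₂ x - φ₂ x) := by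
    have j1 : Integrable fun x => -(u.dx x * ψ₂ x) + (f (u.fn x) - β x * u.fn x) * ψ₁ x :=
      (u.memLp_dx.integrable_mul m₂).neg.add (r₁.integrable_mul m₁)
    have j2 : Integrable fun x => -(u.dx x * φ₂ x) + (f (u.fn x) - β x * u.fn x) * φ₁ x :=
      (u.memLp_dx.integrable_mul n₂).neg.add (r₁.integrable_mul n₁)
    rw [flux, flux, flux, ← integral_sub j1 j2]
    congr 1; ext x; ring
  have e2 : ∀ ψ₁ ψ₂ : ℝ → ℝ, flux f β 0 ψ₁ ψ₂ = 0 := fun ψ₁ ψ₂ => by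
    refine integral_eq_zero_of_ae ?_
    filter_upwards [z0, z1] with x h0 h1
    simp [h0, h1, hf0]
  have := abs_flux_sub_flux_le hfc hK hf0 hA hK0 hβ hβ hE hE (D := 0) (by simp) hu hz
    (m₁.sub n₁) (m₂.sub n₂)
  rw [e1]
  simp only [Pi.sub_def, e2, sub_zero, zero_mul, add_zero] at this
  refine this.trans ?_
  have s1 : √(∫ x, (ψ₁ x - φ₁ x) ^ 2) ≤ τ := Real.sqrt_le_iff.2 ⟨hτ, h₁⟩
  have s2 : √(∫ x, (ψ₂ x - φ₂ x) ^ 2) ≤ τ := Real.sqrt_le_iff.2 ⟨hτ, h₂⟩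
  have hn := norm_nonneg u
  calc _ ≤ ‖u‖ * τ + (K + E) * ‖u‖ * τ := by gcongr
    _ = _ := by ring

end Flux

/-- A solution satisfies the equation also against test functions that are merely twice
differentiable and square integrable with their derivatives.  The time derivative survives the
approximation because the difference quotients converge uniformly on bounded sets of test
functions, by the continuity of the solution in `H¹`. -/
theorem IsSolution.hasDerivWithinAt_ip {f : ℝ → ℝ} (hf : IsNonlinearity f) {b : ℝ → ℝ → ℝ}
    {εa εt εx T : ℝ} (hb : IsPotential b εa εt εx) {u : ℝ → H1} (hu : IsSolution f b T u) {t : ℝ}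
    (ht : t ∈ Icc 0 T) {φ φ₁ φ₂ : ℝ → ℝ} (h₁ : ∀ x, HasDerivAt φ (φ₁ x) x)
    (h₂ : ∀ x, HasDerivAt φ₁ (φ₂ x) x) (hc : Continuous φ₂) (m : MemLp φ 2 volume)
    (m₁ : MemLp φ₁ 2 volume) (m₂ : MemLp φ₂ 2 volume) :
    HasDerivWithinAt (fun s => ip (u s).fn φ) (flux f (b t) (u t) φ₁ φ₂) (Icc 0 T) t := by
  obtain ⟨S, hS, hsob⟩ := exists_sobolev_const
  -- `f` is Lipschitz on the range of the solution at times close to `t`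
  set A := S * (‖u t‖ + 1) with hA
  have hA0 : 0 ≤ A := by positivity
  obtain ⟨K, hK0, hK', -⟩ := hf.exists_deriv_bound A
  have hK : ∀ s ∈ Icc (-A) A, ∀ r ∈ Icc (-A) A, |f s - f r| ≤ K * |s - r| := fun s hs r hr =>
    hf.lipschitz hK' hs hr
  have hfc := hf.continuous
  have hE0 : 0 ≤ εa := (abs_nonneg _).trans (hb.abs_le 0 0)
  have ubd : ∀ s, ‖u s‖ ≤ ‖u t‖ + 1 → ∀ᵐ x, |(u s).fn x| ≤ A := fun s hs => by
    filter_upwards [hsob (u s)] with x hx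
    exact hx.trans (mul_le_mul_of_nonneg_left hs hS.le)
  have utA := ubd t (by linarith)
  rw [hasDerivWithinAt_iff_isLittleO, Asymptotics.isLittleO_iff]
  intro ε hε
  set P₁ := √(∫ x, φ₁ x ^ 2) with hP₁
  set P₂ := √(∫ x, φ₂ x ^ 2) with hP₂
  have hP₁0 : 0 ≤ P₁ := Real.sqrt_nonneg _
  have hP₂0 : 0 ≤ P₂ := Real.sqrt_nonneg _
  set ε' := ε / (P₁ + P₂ + 1) with hε'
  have hε'0 : 0 < ε' := by positivity
  -- near `t` the flux is close to its value at `t`, uniformly on bounded sets of test functions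
  have hnear : ∃ δ > 0, ∀ s ∈ Icc 0 T, |s - t| < δ → ‖u s‖ ≤ ‖u t‖ + 1 ∧ ‖u s - u t‖ ≤ ε' ∧
      (K + εa) * ‖u s - u t‖ + εa * εt * |s - t| * ‖u t‖ ≤ ε' := by
    have hcont : ContinuousWithinAt (fun s => ‖u s - u t‖) (Icc 0 T) t :=
      ((hu.continuousOn t ht).sub continuousWithinAt_const).norm
    have hcont2 : ContinuousWithinAt
        (fun s => (K + εa) * ‖u s - u t‖ + εa * εt * |s - t| * ‖u t‖) (Icc 0 T) t := by
      refine (hcont.const_mul _).add (Continuous.continuousWithinAt ?_)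
      fun_prop
    have t1 : ∀ᶠ s in 𝓝[Icc 0 T] t, ‖u s - u t‖ < min 1 ε' :=
      hcont.eventually_lt continuousWithinAt_const (by simp [hε'0])
    have t2 : ∀ᶠ s in 𝓝[Icc 0 T] t,
        (K + εa) * ‖u s - u t‖ + εa * εt * |s - t| * ‖u t‖ < ε' :=
      hcont2.eventually_lt continuousWithinAt_const (by simp [hε'0])
    obtain ⟨δ, hδ, hball⟩ := Metric.mem_nhdsWithin_iff.1 (t1.and t2)
    refine ⟨δ, hδ, fun s hs hst => ?_⟩
    obtain ⟨h1, h2⟩ := hball ⟨by rwa [Metric.mem_ball, Real.dist_eq], hs⟩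
    refine ⟨?_, (h1.trans_le (min_le_right _ _)).le, h2.le⟩
    have := norm_le_norm_add_norm_sub' (u s) (u t)
    have := h1.trans_le (min_le_left _ _)
    linarith
  obtain ⟨δ, hδ, hnear⟩ := hnear
  have htest : ∀ s ∈ Icc 0 T, |s - t| < δ → ∀ ψ, IsTest ψ →
      |ip (u s).fn ψ - ip (u t).fn ψ - (s - t) * flux f (b t) (u t) (deriv ψ) (iteratedDeriv 2 ψ)|
        ≤ ε' * (√(∫ x, iteratedDeriv 2 ψ x ^ 2) + √(∫ x, deriv ψ x ^ 2)) * |s - t| := by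
    intro s hs hst ψ hψ
    have hψ2 : MemLp (iteratedDeriv 2 ψ) 2 volume := by
      rw [iteratedDeriv_succ, iteratedDeriv_one]; exact hψ.deriv.deriv.memLp
    have hsub : uIcc t s ⊆ Icc 0 T := (convex_Icc (0:ℝ) T).ordConnected.uIcc_subset ht hs
    set F := flux f (b t) (u t) (deriv ψ) (iteratedDeriv 2 ψ) with hF
    have := (convex_uIcc t s).norm_image_sub_le_of_norm_hasDerivWithin_le
      (f := fun r => ip (u r).fn ψ - r * F)
      (f' := fun r => flux f (b r) (u r) (deriv ψ) (iteratedDeriv 2 ψ) - 1 * F)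
      (C := ε' * (√(∫ x, iteratedDeriv 2 ψ x ^ 2) + √(∫ x, deriv ψ x ^ 2)))
      (fun r hr => ((hu.equation ψ hψ r (hsub hr)).mono hsub).sub
        ((hasDerivWithinAt_id _ _).mul_const F)) (fun r hr => ?_) left_mem_uIcc right_mem_uIcc
    · rw [Real.norm_eq_abs, Real.norm_eq_abs] at this
      refine le_trans (le_of_eq ?_) this
      congr 1; ring
    · have hrt : |r - t| < δ := lt_of_le_of_lt (abs_sub_left_of_mem_uIcc hr) hst
      obtain ⟨n1, n2, n3⟩ := hnear r (hsub hr) hrt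
      rw [Real.norm_eq_abs, one_mul, hF]
      refine (abs_flux_sub_flux_le hfc hK hf.zero hA0 hK0.le (hb.continuous r) (hb.continuous t)
        (hb.abs_le r) (hb.abs_le t) (hb.abs_time_sub_le r t) (ubd r n1) utA
        hψ.deriv.memLp hψ2).trans ?_
      rw [mul_add]
      gcongr
  filter_upwards [self_mem_nhdsWithin, mem_nhdsWithin_of_mem_nhds (Metric.ball_mem_nhds t hδ)]
    with s hs hst
  rw [Metric.mem_ball, Real.dist_eq] at hst
  rw [Real.norm_eq_abs, Real.norm_eq_abs, smul_eq_mul]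
  set R := flux f (b t) (u t) φ₁ φ₂ with hR
  have hlim : |ip (u s).fn φ - ip (u t).fn φ - (s - t) * R| ≤ ε' * (P₁ + P₂) * |s - t| := by
    refine le_of_forall_pos_le_add fun σ hσ => ?_
    set C := ‖u s‖ + ‖u t‖ + |s - t| * ((1 + (K + εa)) * ‖u t‖) + 2 * ε' * |s - t| + 1 with hC
    have hC0 : 0 < C := by positivity
    set τ := σ / C with hτ
    have hτ0 : 0 < τ := by positivity
    -- the error of the approximation is at most `σ` for this fixed `s`
    obtain ⟨ψ, hψ, a0, a1, a2⟩ := exists_isTest_approx_two h₁ h₂ hc m m₁ m₂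
      (show 0 < τ ^ 2 by positivity)
    have hψ2 : MemLp (iteratedDeriv 2 ψ) 2 volume := by
      rw [iteratedDeriv_succ, iteratedDeriv_one]; exact hψ.deriv.deriv.memLp
    have w1 := htest s hs hst ψ hψ
    have w2 : |ip (u s).fn ψ - ip (u s).fn φ| ≤ ‖u s‖ * τ :=
      (abs_ip_L2_sub_le (u s).1.fst hψ.memLp m a0 hτ0.le).trans
        (mul_le_mul_of_nonneg_right (u s).norm_fst_le hτ0.le)
    have w3 : |ip (u t).fn ψ - ip (u t).fn φ| ≤ ‖u t‖ * τ :=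
      (abs_ip_L2_sub_le (u t).1.fst hψ.memLp m a0 hτ0.le).trans
        (mul_le_mul_of_nonneg_right (u t).norm_fst_le hτ0.le)
    have w4 := abs_flux_sub_le_of_approx hfc hK hf.zero hA0 hK0.le (hb.continuous t) (hb.abs_le t)
      utA hψ.deriv.memLp hψ2 m₁ m₂ hτ0.le a1 a2
    have w5 := sqrt_integral_sq_le_add hψ.deriv.memLp m₁ hτ0.le a1
    have w6 := sqrt_integral_sq_le_add hψ2 m₂ hτ0.le a2
    set F := flux f (b t) (u t) (deriv ψ) (iteratedDeriv 2 ψ) with hF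
    have w7 : |(s - t) * (F - R)| ≤ |s - t| * ((1 + (K + εa)) * ‖u t‖ * τ) := by
      rw [abs_mul]; gcongr
    have w8 : ε' * (√(∫ x, iteratedDeriv 2 ψ x ^ 2) + √(∫ x, deriv ψ x ^ 2)) * |s - t|
        ≤ ε' * (P₁ + P₂ + 2 * τ) * |s - t| :=
      mul_le_mul_of_nonneg_right (mul_le_mul_of_nonneg_left (by linarith) hε'0.le) (abs_nonneg _)
    have hsum : |ip (u s).fn φ - ip (u t).fn φ - (s - t) * R|
        ≤ ε' * (P₁ + P₂ + 2 * τ) * |s - t| + ‖u s‖ * τ + ‖u t‖ * τ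
          + |s - t| * ((1 + (K + εa)) * ‖u t‖ * τ) := by
      rw [show ip (u s).fn φ - ip (u t).fn φ - (s - t) * R
        = (ip (u s).fn ψ - ip (u t).fn ψ - (s - t) * F) - (ip (u s).fn ψ - ip (u s).fn φ)
          + (ip (u t).fn ψ - ip (u t).fn φ) + (s - t) * (F - R) by ring]
      refine (abs_add_le _ _).trans (add_le_add ((abs_add_le _ _).trans
        (add_le_add ((abs_sub _ _).trans (add_le_add (w1.trans w8) w2)) w3)) w7)
    have hτC : τ * C = σ := by rw [hτ]; field_simp
    have : ε' * (P₁ + P₂ + 2 * τ) * |s - t| + ‖u s‖ * τ + ‖u t‖ * τ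
          + |s - t| * ((1 + (K + εa)) * ‖u t‖ * τ)
        = ε' * (P₁ + P₂) * |s - t| + (τ * C - τ) := by rw [hC]; ring
    rw [this] at hsum
    linarith
  refine hlim.trans (mul_le_mul_of_nonneg_right ?_ (abs_nonneg _))
  rw [hε', div_mul_eq_mul_div, div_le_iff₀ (by positivity)]
  exact mul_le_mul_of_nonneg_left (by linarith) hε.le

/-! ### Translates of localized families -/

namespace IsProfileFamily

variable {G Gc Gy H Hc Hy : ℝ → ℝ → ℝ} {c₀ ρ β M N : ℝ}

theorem continuous (h : IsProfileFamily G Gc Gy c₀ ρ β M) {c : ℝ} (hc : c ∈ Metric.ball c₀ ρ) :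
    Continuous (G c) :=
  continuous_iff_continuousAt.2 fun y => (h.hasDerivAt_space hc y).continuousAt

theorem mul (h : IsProfileFamily G Gc Gy c₀ ρ β M) (h' : IsProfileFamily H Hc Hy c₀ ρ β N)
    (hβ : 0 ≤ β) (hM : 0 ≤ M) (hN : 0 ≤ N) :
    IsProfileFamily (fun c y => G c y * H c y) (fun c y => Gc c y * H c y + G c y * Hc c y)
      (fun c y => Gy c y * H c y + G c y * Hy c y) c₀ ρ β (2 * (M * N)) := by
  have key : ∀ {u v y : ℝ}, |u| ≤ M * N * ew β y → |v| ≤ M * N * ew β y →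
      |u + v| ≤ 2 * (M * N) * ew β y := fun hu hv =>
    ((abs_add_le _ _).trans (add_le_add hu hv)).trans (le_of_eq (by ring))
  have hMN : 0 ≤ M * N := mul_nonneg hM hN
  refine ⟨fun c hc y => ?_, fun c hc => ?_, fun c hc => ?_, fun c hc y => ?_, fun c hc y => ?_,
    fun c hc y => ?_⟩
  · refine ((h.hasFDerivAt c hc y).mul (h'.hasFDerivAt c hc y)).congr_fderiv ?_
    ext <;> simp [Function.uncurry] <;> ring
  · exact ((h.continuous_speed c hc).mul (h'.continuous hc)).add
      ((h.continuous hc).mul (h'.continuous_speed c hc))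
  · exact ((h.continuous_space c hc).mul (h'.continuous hc)).add
      ((h.continuous hc).mul (h'.continuous_space c hc))
  · refine (abs_mul_le_ew hM hβ (h.bound c hc y) (h'.bound c hc y)).trans ?_
    exact mul_le_mul_of_nonneg_right (by linarith) (ew_nonneg _ _)
  · exact key (abs_mul_le_ew hM hβ (h.bound_speed c hc y) (h'.bound c hc y))
      (abs_mul_le_ew hM hβ (h.bound c hc y) (h'.bound_speed c hc y))
  · exact key (abs_mul_le_ew hM hβ (h.bound_space c hc y) (h'.bound c hc y))
      (abs_mul_le_ew hM hβ (h.bound c hc y) (h'.bound_space c hc y))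

variable (h : IsProfileFamily G Gc Gy c₀ ρ β M)
include h

theorem hasFDerivAt_shift {p : ℝ × ℝ} (hp : p.1 ∈ Metric.ball c₀ ρ) (x : ℝ) :
    HasFDerivAt (fun p : ℝ × ℝ => G p.1 (x - p.2))
      (planeForm (Gc p.1 (x - p.2)) (-Gy p.1 (x - p.2))) p := by
  have h1 : HasFDerivAt (fun p : ℝ × ℝ => (p.1, x - p.2))
      ((ContinuousLinearMap.fst ℝ ℝ ℝ).prod (-ContinuousLinearMap.snd ℝ ℝ ℝ)) p :=
    hasFDerivAt_fst.prodMk (hasFDerivAt_snd.const_sub x)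
  refine (HasFDerivAt.comp (g := Function.uncurry G) p
    (h.hasFDerivAt p.1 hp (x - p.2)) h1).congr_fderiv ?_
  ext <;> simp

theorem norm_shift_le (hβ : 0 ≤ β) (hM : 0 ≤ M) {p : ℝ × ℝ} (hp : p.1 ∈ Metric.ball c₀ ρ) {a : ℝ}
    (ha : |p.2 - a| ≤ 1) (x : ℝ) :
    ‖planeForm (Gc p.1 (x - p.2)) (-Gy p.1 (x - p.2))‖
      ≤ 2 * (M * Real.exp β) * ew β (x - a) := by
  have h1 : ew β (x - p.2) ≤ Real.exp β * ew β (x - a) := by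
    refine (ew_shift_le hβ (x - a) (x - p.2)).trans ?_
    refine mul_le_mul_of_nonneg_right (Real.exp_le_exp.2 ?_) (ew_nonneg _ _)
    rw [show x - a - (x - p.2) = p.2 - a by ring]
    exact mul_le_of_le_one_right hβ ha
  refine (norm_planeForm_le _ _).trans ?_
  rw [abs_neg]
  calc _ ≤ M * ew β (x - p.2) + M * ew β (x - p.2) :=
        add_le_add (h.bound_speed _ hp _) (h.bound_space _ hp _)
    _ = 2 * (M * ew β (x - p.2)) := by ring
    _ ≤ 2 * (M * (Real.exp β * ew β (x - a))) := by gcongr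
    _ = _ := by ring

theorem abs_shift_sub_le (hβ : 0 ≤ β) (hM : 0 ≤ M) {p p₀ : ℝ × ℝ} (hp : p.1 ∈ Metric.ball c₀ ρ)
    (hp₀ : p₀.1 ∈ Metric.ball c₀ ρ) (ha : |p.2 - p₀.2| ≤ 1) (x : ℝ) :
    |G p.1 (x - p.2) - G p₀.1 (x - p₀.2)|
      ≤ 2 * (M * Real.exp β) * ‖p - p₀‖ * ew β (x - p₀.2) := by
  have hconv : Convex ℝ (Metric.ball c₀ ρ ×ˢ Metric.closedBall p₀.2 1) :=
    (convex_ball _ _).prod (convex_closedBall _ _)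
  have := hconv.norm_image_sub_le_of_norm_hasFDerivWithin_le
    (f := fun p : ℝ × ℝ => G p.1 (x - p.2)) (x := p₀) (y := p)
    (fun r hr => (h.hasFDerivAt_shift hr.1 x).hasFDerivWithinAt)
    (fun r hr => h.norm_shift_le hβ hM hr.1
      (by have := Metric.mem_closedBall.1 hr.2; rwa [Real.dist_eq] at this) x)
    ⟨hp₀, Metric.mem_closedBall_self zero_le_one⟩
    ⟨hp, by rwa [Metric.mem_closedBall, Real.dist_eq]⟩
  exact this.trans (le_of_eq (by ring))

/-- Pairings with a translated family are differentiable in the speed and the translation. -/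
theorem hasFDerivAt_integral_shift (hβ : 0 < β) (hM : 0 ≤ M) {v : ℝ → ℝ}
    (hv : AEStronglyMeasurable v volume) {p₀ : ℝ × ℝ}
    (hvi : Integrable fun x => v x * ew β (x - p₀.2)) (hp₀ : p₀.1 ∈ Metric.ball c₀ ρ) :
    HasFDerivAt (fun p : ℝ × ℝ => ∫ x, v x * G p.1 (x - p.2))
      (planeForm (∫ x, v x * Gc p₀.1 (x - p₀.2)) (-∫ x, v x * Gy p₀.1 (x - p₀.2))) p₀ := by
  set O : Set (ℝ × ℝ) := Metric.ball c₀ ρ ×ˢ Metric.ball p₀.2 1 with hO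
  have hn : O ∈ 𝓝 p₀ := (Metric.isOpen_ball.prod Metric.isOpen_ball).mem_nhds
    ⟨hp₀, Metric.mem_ball_self one_pos⟩
  have cG : ∀ p ∈ O, Continuous fun x => G p.1 (x - p.2) := fun p hp =>
    (h.continuous hp.1).comp (by fun_prop)
  have c1 : Continuous fun x => Gc p₀.1 (x - p₀.2) := (h.continuous_speed _ hp₀).comp (by fun_prop)
  have c2 : Continuous fun x => Gy p₀.1 (x - p₀.2) := (h.continuous_space _ hp₀).comp (by fun_prop)
  set F' : ℝ × ℝ → ℝ → ℝ × ℝ →L[ℝ] ℝ := fun p x =>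
    v x • planeForm (Gc p.1 (x - p.2)) (-Gy p.1 (x - p.2)) with hF'
  have m' : AEStronglyMeasurable (F' p₀) volume :=
    hv.smul (continuous_planeForm c1 c2.neg).aestronglyMeasurable
  have bF' : ∀ p ∈ O, ∀ x, ‖F' p x‖ ≤ 2 * (M * Real.exp β) * ‖v x * ew β (x - p₀.2)‖ := by
    intro p hp x
    have hd : |p.2 - p₀.2| ≤ 1 := by
      have := Metric.mem_ball.1 hp.2; rw [Real.dist_eq] at this; exact this.le
    rw [hF', norm_smul, norm_mul, Real.norm_of_nonneg (ew_nonneg _ _)]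
    calc _ ≤ ‖v x‖ * (2 * (M * Real.exp β) * ew β (x - p₀.2)) := by
          gcongr
          exact h.norm_shift_le hβ.le hM hp.1 hd x
      _ = _ := by ring
  have dom : Integrable fun x => 2 * (M * Real.exp β) * ‖v x * ew β (x - p₀.2)‖ :=
    hvi.norm.const_mul _
  have dom' : ∀ {g : ℝ → ℝ}, Continuous g → (∀ x, |g x| ≤ M * ew β (x - p₀.2)) →
      Integrable fun x => v x * g x := by
    intro g hg hb
    refine (hvi.norm.const_mul M).mono' (hv.mul hg.aestronglyMeasurable) (ae_of_all _ fun x => ?_)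
    rw [norm_mul, norm_mul, Real.norm_of_nonneg (ew_nonneg _ _)]
    calc _ ≤ ‖v x‖ * (M * ew β (x - p₀.2)) := by
          gcongr
          exact hb x
      _ = _ := by ring
  have key := hasFDerivAt_integral_of_dominated_of_fderiv_le (𝕜 := ℝ) (μ := volume) (x₀ := p₀)
    (F := fun p x => v x * G p.1 (x - p.2)) (F' := F')
    (bound := fun x => 2 * (M * Real.exp β) * ‖v x * ew β (x - p₀.2)‖) hn
    (by filter_upwards [hn] with p hp using hv.mul (cG p hp).aestronglyMeasurable)
    (dom' (cG p₀ (mem_of_mem_nhds hn)) fun x => h.bound _ hp₀ _) m'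
    (ae_of_all _ fun x p hp => bF' p hp x) dom
    (ae_of_all _ fun x p hp => (h.hasFDerivAt_shift hp.1 x).const_mul (v x))
  have hint : Integrable (F' p₀) :=
    dom.mono' m' (ae_of_all _ fun x => bF' p₀ (mem_of_mem_nhds hn) x)
  refine key.congr_fderiv ?_
  ext
  · simp only [ContinuousLinearMap.coe_comp, Function.comp_apply]
    change (∫ x, F' p₀ x) (1, 0) = planeForm _ _ (1, 0)
    rw [ContinuousLinearMap.integral_apply hint, planeForm_apply]
    simp [hF']
  · simp only [ContinuousLinearMap.coe_comp, Function.comp_apply]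
    change (∫ x, F' p₀ x) (0, 1) = planeForm _ _ (0, 1)
    rw [ContinuousLinearMap.integral_apply hint, planeForm_apply]
    simp [hF', integral_neg]

end IsProfileFamily

/-! ### Differentiability of an implicitly defined curve in the plane -/

/-- A curve that satisfies two independent linear relations up to `o(|s - t| + |p(s) - p(t)|)` is
differentiable at `t`, and its velocity solves the linear system. -/
theorem exists_hasDerivWithinAt_of_isLittleO {p : ℝ → ℝ × ℝ} {S : Set ℝ} {t : ℝ}
    {a₁₁ a₁₂ a₂₁ a₂₂ r₁ r₂ : ℝ} (hdet : a₁₁ * a₂₂ - a₁₂ * a₂₁ ≠ 0)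
    (h₁ : (fun s => planeForm a₁₁ a₁₂ (p s - p t) + (s - t) * r₁) =o[𝓝[S] t]
      fun s => |s - t| + ‖p s - p t‖)
    (h₂ : (fun s => planeForm a₂₁ a₂₂ (p s - p t) + (s - t) * r₂) =o[𝓝[S] t]
      fun s => |s - t| + ‖p s - p t‖) :
    ∃ x y : ℝ, HasDerivWithinAt p (x, y) S t ∧ x * a₁₁ + y * a₁₂ + r₁ = 0 ∧
      x * a₂₁ + y * a₂₂ + r₂ = 0 := by
  set D := a₁₁ * a₂₂ - a₁₂ * a₂₁ with hD
  set x := (-r₁ * a₂₂ + r₂ * a₁₂) / D with hx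
  set y := (-r₂ * a₁₁ + r₁ * a₂₁) / D with hy
  have e1 : x * a₁₁ + y * a₁₂ + r₁ = 0 := by rw [hx, hy]; field_simp; rw [hD]; ring
  have e2 : x * a₂₁ + y * a₂₂ + r₂ = 0 := by rw [hx, hy]; field_simp; rw [hD]; ring
  refine ⟨x, y, ?_, e1, e2⟩
  set e : ℝ → ℝ × ℝ := fun s => p s - p t - (s - t) • (x, y) with he
  have l1 : (fun s => (e s).1) =o[𝓝[S] t] fun s => |s - t| + ‖p s - p t‖ := by
    have h := ((h₁.const_mul_left a₂₂).sub (h₂.const_mul_left a₁₂)).const_mul_left D⁻¹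
    refine h.congr_left fun s => ?_
    simp only [planeForm_apply, he, Prod.fst_sub, Prod.smul_fst, smul_eq_mul]
    rw [inv_mul_eq_div, div_eq_iff hdet]
    linear_combination (s - t) * (a₂₂ * e1 - a₁₂ * e2) + (-(p s - p t).1) * hD + (s - t) * x * hD
  have l2 : (fun s => (e s).2) =o[𝓝[S] t] fun s => |s - t| + ‖p s - p t‖ := by
    have h := ((h₂.const_mul_left a₁₁).sub (h₁.const_mul_left a₂₁)).const_mul_left D⁻¹
    refine h.congr_left fun s => ?_
    simp only [planeForm_apply, he, Prod.snd_sub, Prod.smul_snd, smul_eq_mul]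
    rw [inv_mul_eq_div, div_eq_iff hdet]
    linear_combination (s - t) * (a₁₁ * e2 - a₂₁ * e1) + (-(p s - p t).2) * hD + (s - t) * y * hD
  have l : e =o[𝓝[S] t] fun s => |s - t| + ‖p s - p t‖ := l1.prod_left l2
  -- the increments of the curve are controlled by those of the parameter
  have hO : (fun s => |s - t| + ‖p s - p t‖) =O[𝓝[S] t] fun s => s - t := by
    have hb := (Asymptotics.isLittleO_iff.1 l) (show (0:ℝ) < 1 / 2 by norm_num)
    refine Asymptotics.IsBigO.of_bound (2 + 2 * ‖((x, y) : ℝ × ℝ)‖) ?_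
    filter_upwards [hb] with s hs
    have n0 : 0 ≤ |s - t| + ‖p s - p t‖ := by positivity
    rw [Real.norm_of_nonneg n0] at hs ⊢
    rw [Real.norm_eq_abs]
    have h3 : ‖p s - p t‖ ≤ ‖e s‖ + |s - t| * ‖((x, y) : ℝ × ℝ)‖ := by
      have : p s - p t = e s + (s - t) • ((x, y) : ℝ × ℝ) := (sub_add_cancel _ _).symm
      rw [this]
      refine (norm_add_le _ _).trans ?_
      rw [norm_smul, Real.norm_eq_abs]
    linarith
  rw [hasDerivWithinAt_iff_isLittleO]
  exact l.trans_isBigO hO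

/-! ### Differentiability of the modulation parameters -/

theorem memLp_shift {g : ℝ → ℝ} {β B a : ℝ} (hβ : 0 < β) (hg : Continuous g)
    (hb : ∀ y, |g y| ≤ B * ew β y) : MemLp (fun x => g (x - a)) 2 volume :=
  memLp_of_ew (a := a) hβ (hg.comp (by fun_prop)).aestronglyMeasurable fun x => hb (x - a)

/-- Differentiating one orthogonality condition along the flow gives one linear relation for the
increments of the modulation parameters, up to terms of higher order. -/
theorem isLittleO_of_orthogonal {T t c₀ ρ β M N r : ℝ} {u ξ : ℝ → H1} {p : ℝ → ℝ × ℝ}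
    {G Gc Gy Φ Φc Φy : ℝ → ℝ → ℝ} (ht : t ∈ Icc 0 T)
    (hG : IsProfileFamily G Gc Gy c₀ ρ β M) (hΦ : IsProfileFamily Φ Φc Φy c₀ ρ β N)
    (hβ : 0 < β) (hM : 0 ≤ M) (hN : 0 ≤ N) (hu : ContinuousWithinAt u (Icc 0 T) t)
    (hp : ContinuousWithinAt p (Icc 0 T) t) (hpt : (p t).1 ∈ Metric.ball c₀ ρ)
    (hdec : ∀ᶠ s in 𝓝[Icc 0 T] t,
      (u s).fn =ᵐ[volume] fun x => G (p s).1 (x - (p s).2) + (ξ s).fn x)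
    (horth : ∀ᶠ s in 𝓝[Icc 0 T] t, ip (ξ s).fn (fun x => Φ (p s).1 (x - (p s).2)) = 0)
    (hr : HasDerivWithinAt (fun s => ip (u s).fn (fun x => Φ (p t).1 (x - (p t).2))) r
      (Icc 0 T) t) :
    (fun s => planeForm
        (ip (ξ t).fn (fun x => Φc (p t).1 (x - (p t).2))
          - ip (fun x => Gc (p t).1 (x - (p t).2)) (fun x => Φ (p t).1 (x - (p t).2)))
        (ip (fun x => Gy (p t).1 (x - (p t).2)) (fun x => Φ (p t).1 (x - (p t).2))
          - ip (ξ t).fn (fun x => Φy (p t).1 (x - (p t).2))) (p s - p t) + (s - t) * r)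
      =o[𝓝[Icc 0 T] t] fun s => |s - t| + ‖p s - p t‖ := by
  have memG : ∀ s, (p s).1 ∈ Metric.ball c₀ ρ →
      MemLp (fun x => G (p s).1 (x - (p s).2)) 2 volume := fun s hs =>
    memLp_shift hβ (hG.continuous hs) (hG.bound _ hs)
  have memΦ : ∀ s, (p s).1 ∈ Metric.ball c₀ ρ →
      MemLp (fun x => Φ (p s).1 (x - (p s).2)) 2 volume := fun s hs =>
    memLp_shift hβ (hΦ.continuous hs) (hΦ.bound _ hs)
  have mGc : MemLp (fun x => Gc (p t).1 (x - (p t).2)) 2 volume :=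
    memLp_shift hβ (hG.continuous_speed _ hpt) (hG.bound_speed _ hpt)
  have mGy : MemLp (fun x => Gy (p t).1 (x - (p t).2)) 2 volume :=
    memLp_shift hβ (hG.continuous_space _ hpt) (hG.bound_space _ hpt)
  have mΦc : MemLp (fun x => Φc (p t).1 (x - (p t).2)) 2 volume :=
    memLp_shift hβ (hΦ.continuous_speed _ hpt) (hΦ.bound_speed _ hpt)
  have mΦy : MemLp (fun x => Φy (p t).1 (x - (p t).2)) 2 volume :=
    memLp_shift hβ (hΦ.continuous_space _ hpt) (hΦ.bound_space _ hpt)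
  have mG := memG t hpt
  have mΦ := memΦ t hpt
  have hdt := hdec.self_of_nhdsWithin ht
  -- `Θ` pairs `u(t) - G` with `Φ` at arbitrary parameters; orthogonality at the time `s` says that
  -- `Θ` at the parameters of time `s` is the pairing of `u(t) - u(s)` with `Φ` there
  set Θ : ℝ × ℝ → ℝ := fun r => (∫ x, (u t).fn x * Φ r.1 (x - r.2))
    - ∫ x, 1 * (G r.1 (x - r.2) * Φ r.1 (x - r.2)) with hΘ
  -- `Θ` is differentiable at the current parameters
  have hdΘ : HasFDerivAt Θ (planeForm
        (ip (ξ t).fn (fun x => Φc (p t).1 (x - (p t).2))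
          - ip (fun x => Gc (p t).1 (x - (p t).2)) (fun x => Φ (p t).1 (x - (p t).2)))
        (ip (fun x => Gy (p t).1 (x - (p t).2)) (fun x => Φ (p t).1 (x - (p t).2))
          - ip (ξ t).fn (fun x => Φy (p t).1 (x - (p t).2)))) (p t) := by
    have mew : MemLp (fun x => ew β (x - (p t).2)) 2 volume :=
      memLp_of_ew (B := 1) (a := (p t).2) hβ
        ((continuous_ew β).comp (by fun_prop)).aestronglyMeasurable fun x => by
          rw [abs_of_nonneg (ew_nonneg _ _), one_mul]
    have d1 := hΦ.hasFDerivAt_integral_shift hβ hN (u t).memLp_fn.1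
      ((u t).memLp_fn.integrable_mul mew) hpt
    have d2 := (hG.mul hΦ hβ.le hM hN).hasFDerivAt_integral_shift hβ
      (by positivity) (v := fun _ => 1) aestronglyMeasurable_const
      (p₀ := p t) (by simpa using integrable_ew_sub hβ (p t).2) hpt
    refine (d1.sub d2).congr_fderiv ?_
    have e : ∀ {v k : ℝ → ℝ}, MemLp v 2 volume → MemLp k 2 volume →
        (∫ x, (u t).fn x * v x) - (∫ x, 1 * (k x * Φ (p t).1 (x - (p t).2)
          + G (p t).1 (x - (p t).2) * v x))
        = ip (ξ t).fn v - ip k (fun x => Φ (p t).1 (x - (p t).2)) := by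
      intro v k hv hk
      have i1 : Integrable fun x => (u t).fn x * v x := (u t).memLp_fn.integrable_mul hv
      have i2 : Integrable fun x => k x * Φ (p t).1 (x - (p t).2) := hk.integrable_mul mΦ
      have i3 : Integrable fun x => G (p t).1 (x - (p t).2) * v x := mG.integrable_mul hv
      have i4 : Integrable fun x => (ξ t).fn x * v x := (ξ t).memLp_fn.integrable_mul hv
      have e1 : ∫ x, (u t).fn x * v x
          = (∫ x, G (p t).1 (x - (p t).2) * v x) + ∫ x, (ξ t).fn x * v x := by
        rw [← integral_add i3 i4]
        refine integral_congr_ae ?_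
        filter_upwards [hdt] with x hx
        rw [hx]; ring
      simp only [one_mul]
      rw [integral_add i2 i3, e1, ip, ip]; ring
    have e1 := e mΦc mGc
    have e2 := e mΦy mGy
    ext
    · simp only [ContinuousLinearMap.coe_comp, Function.comp_apply, ContinuousLinearMap.inl_apply,
        sub_apply, planeForm_apply]
      linarith
    · simp only [ContinuousLinearMap.coe_comp, Function.comp_apply, ContinuousLinearMap.inr_apply,
        sub_apply, planeForm_apply]
      linarith
  have o1 := hdΘ.isLittleO.comp_tendsto hp
  have o2 := hasDerivWithinAt_iff_isLittleO.1 hr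
  have le1 : (fun s => p s - p t) =O[𝓝[Icc 0 T] t] fun s => |s - t| + ‖p s - p t‖ :=
    Asymptotics.IsBigO.of_bound 1 (Eventually.of_forall fun s => by
      rw [one_mul, Real.norm_of_nonneg (by positivity)]
      linarith [abs_nonneg (s - t)])
  have le2 : (fun s => s - t) =O[𝓝[Icc 0 T] t] fun s => |s - t| + ‖p s - p t‖ :=
    Asymptotics.IsBigO.of_bound 1 (Eventually.of_forall fun s => by
      rw [one_mul, Real.norm_of_nonneg (show 0 ≤ |s - t| + ‖p s - p t‖ by positivity),
        Real.norm_eq_abs]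
      linarith [norm_nonneg (p s - p t)])
  set φt : ℝ → ℝ := fun x => Φ (p t).1 (x - (p t).2) with hφt
  have hball : ∀ᶠ s in 𝓝[Icc 0 T] t, (p s).1 ∈ Metric.ball c₀ ρ ∧ |(p s).2 - (p t).2| ≤ 1 := by
    have h1 : ∀ᶠ s in 𝓝[Icc 0 T] t, (p s).1 ∈ Metric.ball c₀ ρ :=
      (continuous_fst.continuousAt.comp_continuousWithinAt hp).eventually
        (Metric.isOpen_ball.mem_nhds hpt)
    have h2 : ∀ᶠ s in 𝓝[Icc 0 T] t, (p s).2 ∈ Metric.ball (p t).2 1 :=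
      (continuous_snd.continuousAt.comp_continuousWithinAt hp).eventually
        (Metric.ball_mem_nhds _ one_pos)
    filter_upwards [h1, h2] with s a1 a2
    rw [Metric.mem_ball, Real.dist_eq] at a2
    exact ⟨a1, a2.le⟩
  -- the mixed term is of higher order because the solution is continuous in time
  have o3 : (fun s => Θ (p s) - Θ (p t) + (ip (u s).fn φt - ip (u t).fn φt))
      =o[𝓝[Icc 0 T] t] fun s => p s - p t := by
    rw [Asymptotics.isLittleO_iff]
    intro ε hε
    set C := 2 * (N * Real.exp β) / √β with hC
    have hC0 : 0 ≤ C := by positivity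
    have hsmall : ∀ᶠ s in 𝓝[Icc 0 T] t, ‖u s - u t‖ * C < ε :=
      ((hu.sub continuousWithinAt_const).norm.mul_const C).eventually_lt continuousWithinAt_const
        (by simpa using hε)
    have z : ∀ s, (p s).1 ∈ Metric.ball c₀ ρ →
        ((u s).fn =ᵐ[volume] fun x => G (p s).1 (x - (p s).2) + (ξ s).fn x) →
        ip (ξ s).fn (fun x => Φ (p s).1 (x - (p s).2)) = 0 →
        ip (u s).fn (fun x => Φ (p s).1 (x - (p s).2))
          = ∫ x, 1 * (G (p s).1 (x - (p s).2) * Φ (p s).1 (x - (p s).2)) := by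
      intro s hs hd ho
      have i3 : Integrable fun x => G (p s).1 (x - (p s).2) * Φ (p s).1 (x - (p s).2) :=
        (memG s hs).integrable_mul (memΦ s hs)
      have i4 : Integrable fun x => (ξ s).fn x * Φ (p s).1 (x - (p s).2) :=
        (ξ s).memLp_fn.integrable_mul (memΦ s hs)
      have : ip (u s).fn (fun x => Φ (p s).1 (x - (p s).2))
          = (∫ x, G (p s).1 (x - (p s).2) * Φ (p s).1 (x - (p s).2))
            + ip (ξ s).fn (fun x => Φ (p s).1 (x - (p s).2)) := by
        rw [ip, ip, ← integral_add i3 i4]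
        refine integral_congr_ae ?_
        filter_upwards [hd] with x hx
        rw [hx]; ring
      rw [this, ho, add_zero]
      simp only [one_mul]
    have Θt : Θ (p t) = 0 := by
      rw [hΘ]
      exact sub_eq_zero.2 (z t hpt hdt (horth.self_of_nhdsWithin ht))
    filter_upwards [hsmall, hdec, horth, hball] with s h1 h2 h3 h4
    have zs := z s h4.1 h2 h3
    have mΦs := memΦ s h4.1
    have e : Θ (p s) - Θ (p t) + (ip (u s).fn φt - ip (u t).fn φt)
        = -ip (u s - u t).fn (fun x => Φ (p s).1 (x - (p s).2) - φt x) := by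
      have i : ∀ {r : ℝ} {v : ℝ → ℝ}, MemLp v 2 volume →
          Integrable fun x => (u r).fn x * v x := fun hv => (u _).memLp_fn.integrable_mul hv
      have j : ∀ r, Integrable fun x =>
          (u r).fn x * Φ (p s).1 (x - (p s).2) - (u r).fn x * φt x := fun r =>
        (i mΦs).sub (i mΦ)
      have e1 : ip (u s - u t).fn (fun x => Φ (p s).1 (x - (p s).2) - φt x)
          = ip (u s).fn (fun x => Φ (p s).1 (x - (p s).2)) - ip (u s).fn φt
            - (ip (u t).fn (fun x => Φ (p s).1 (x - (p s).2)) - ip (u t).fn φt) := by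
        simp only [ip]
        rw [← integral_sub (i mΦs) (i mΦ), ← integral_sub (i mΦs) (i mΦ), ← integral_sub (j s) (j t)]
        refine integral_congr_ae ?_
        filter_upwards [H1.fn_sub (u s) (u t)] with x hx
        rw [hx]; ring
      rw [e1, Θt, hΘ, zs]
      simp only [ip]; ring
    rw [e, norm_neg, Real.norm_eq_abs]
    have hbd := (u s - u t).abs_ip_le hβ (mΦs.sub mΦ).1
      (fun x => hΦ.abs_shift_sub_le hβ.le hN h4.1 hpt h4.2 x)
    refine hbd.trans ?_
    calc _ = ‖u s - u t‖ * C * ‖p s - p t‖ := by rw [hC]; ring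
      _ ≤ ε * ‖p s - p t‖ := by gcongr
  have tot := ((o3.trans_isBigO le1).sub (o1.trans_isBigO le1)).sub (o2.trans_isBigO le2)
  refine tot.congr_left fun s => ?_
  simp only [Function.comp_apply, smul_eq_mul]
  ring

/-- The modulation parameters are differentiable, and their velocities solve the linear system
obtained by differentiating the two orthogonality conditions. -/
theorem exists_hasDerivWithinAt_modulation {f : ℝ → ℝ} (hf : IsNonlinearity f) {I₀ : Set ℝ}
    {Q : ℝ → ℝ → ℝ} (hQ : IsSolitaryWaveFamily f I₀ Q) {c₀ ρ γ M₀ M d α : ℝ}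
    (hD : HasDecay I₀ Q c₀ ρ γ M₀) {b : ℝ → ℝ → ℝ} {εa εt εx T : ℝ}
    (hb : IsPotential b εa εt εx) {u : ℝ → H1} (hu : IsSolution f b T u) {a c : ℝ → ℝ} {ξ : ℝ → H1}
    (hm : IsModulation Q I₀ α T u a c ξ) {t : ℝ} (ht : t ∈ Icc 0 T)
    (hc : c t ∈ Metric.ball c₀ ρ) {q q1 z z1 V w wc : ℝ → ℝ}
    (P : ProfileData f (c t) (a t) α γ M d q q1 z z1 V w wc)
    (eq : q = fun x => Q (c t) (x - a t)) (eq1 : q1 = fun x => dSpace Q (c t) (x - a t))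
    (ez : z = fun x => dSpeed Q (c t) (x - a t))
    (ew₁ : w = fun x => regInv α (dSpeed Q (c t)) (x - a t))
    (ewc : wc = fun x => regInv α (dSpeed (dSpeed Q) (c t)) (x - a t))
    (hdet : (ip (ξ t).fn z - ip z q) * (ip q1 w - ip (ξ t).fn (fun x => z x - α * w x))
      - (ip q1 q - ip (ξ t).fn q1) * (ip (ξ t).fn wc - ip z w) ≠ 0) :
    ∃ c' a' : ℝ, HasDerivWithinAt (fun s => (c s, a s)) (c', a') (Icc 0 T) t ∧
      c' * (ip (ξ t).fn z - ip z q) + a' * (ip q1 q - ip (ξ t).fn q1)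
        + flux f (b t) (u t) q1 (fun x => c t * q x - f (q x)) = 0 ∧
      c' * (ip (ξ t).fn wc - ip z w) + a' * (ip q1 w - ip (ξ t).fn (fun x => z x - α * w x))
        + flux f (b t) (u t) (fun x => z x - α * w x) (fun x => z1 x - α * (z x - α * w x)) = 0 := by
  have hα := P.alpha_pos
  have hα1 := P.alpha_le_one
  have hαγ := P.alpha_le
  have hγ := P.gamma_pos
  have hM₀ := hD.const_pos.le
  set N := M₀ + 4 * M₀ / γ with hN
  have hN0 : 0 ≤ N := by positivity
  have hMN : M₀ ≤ N := by rw [hN]; linarith [show 0 ≤ 4 * M₀ / γ by positivity]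
  have FQ : IsProfileFamily Q (dSpeed Q) (dSpace Q) c₀ ρ α N :=
    (hD.isProfileFamily hQ).mono (by linarith) hMN hN0
  have FW := (hD.isProfileFamily_speed hQ).regInv hγ hM₀ hα hα1 hαγ
  set p : ℝ → ℝ × ℝ := fun s => (c s, a s) with hp
  have pc : ContinuousWithinAt p (Icc 0 T) t :=
    (hm.continuousOn_c t ht).prodMk (hm.continuousOn_a t ht)
  have uc := hu.continuousOn t ht
  have hdec : ∀ᶠ s in 𝓝[Icc 0 T] t,
      (u s).fn =ᵐ[volume] fun x => Q (p s).1 (x - (p s).2) + (ξ s).fn x := by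
    filter_upwards [self_mem_nhdsWithin] with s hs using hm.decomposition s hs
  have hball : ∀ᶠ s in 𝓝[Icc 0 T] t, c s ∈ Metric.ball c₀ ρ :=
    (hm.continuousOn_c t ht).eventually (Metric.isOpen_ball.mem_nhds hc)
  have horth : ∀ᶠ s in 𝓝[Icc 0 T] t, ip (ξ s).fn (fun x => Q (p s).1 (x - (p s).2)) = 0 ∧
      ip (ξ s).fn (fun x => regInv α (dSpeed Q (p s).1) (x - (p s).2)) = 0 := by
    filter_upwards [self_mem_nhdsWithin, hball] with s hs hs'
    exact (sympOrthogonal_iff hQ hD hα hαγ hs' (a s) (ξ s)).1 (hm.orthogonal s hs)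
  have m1 : MemLp (fun x => z x - α * w x) 2 volume :=
    P.memLp_z.sub (P.isSlow_w.memLp.const_mul α)
  have c1 := P.continuous_z
  have c2 := P.continuous_z1
  have c3 := P.continuous_w
  have r1 := hu.hasDerivWithinAt_ip hf hb ht P.hasDerivAt_q P.hasDerivAt_q1 (P.continuous_q2 hf)
    P.isSlow_q.memLp P.memLp_q1 (P.memLp_q2 hf)
  have r2 := hu.hasDerivWithinAt_ip hf hb ht P.hasDerivAt_w
    (fun x => (P.hasDerivAt_z x).sub ((P.hasDerivAt_w x).const_mul α)) (by fun_prop)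
    P.isSlow_w.memLp m1 (P.memLp_z1.sub (m1.const_mul α))
  subst eq eq1 ez ew₁ ewc
  have l1 := isLittleO_of_orthogonal ht FQ FQ hα hN0 hN0 uc pc hc hdec
    (horth.mono fun _ h => h.1) r1
  have l2 := isLittleO_of_orthogonal ht FQ FW hα hN0 hN0 uc pc hc hdec
    (horth.mono fun _ h => h.2) r2
  exact exists_hasDerivWithinAt_of_isLittleO hdet l1 l2

/-! ### Solving for the velocities -/

/-- The size `g` of the perturbation of the linear system below which it stays invertible. -/
def rowThreshold (d m : ℝ) : ℝ :=
  min (d / 4) (min (d ^ 2 / (4 * (m + 1))) (d ^ 2 / (2 * (2 * d + m))))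

theorem rowThreshold_pos {d m : ℝ} (hd : 0 < d) (hm : 0 ≤ m) : 0 < rowThreshold d m :=
  lt_min (by positivity) (lt_min (by positivity) (by positivity))

/-- A small perturbation of the triangular matrix with rows `(D, 0)` and `(m₂, D)` is invertible. -/
theorem row_det_ne_zero {d m θ D A W m₂ p₁ p₂ : ℝ} (hd : 0 < d) (hm : 0 ≤ m) (hD : d ≤ D)
    (hm₂ : |m₂| ≤ m) (hp₁ : |p₁| ≤ θ) (hp₂ : |p₂| ≤ θ) (hA : |A - D| ≤ θ) (hW : |W - m₂| ≤ θ)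
    (hθ : θ ≤ rowThreshold d m) : (D - p₁) * A - p₂ * W ≠ 0 := by
  have hθ0 : 0 ≤ θ := (abs_nonneg _).trans hp₁
  have t1 : θ ≤ d / 4 := hθ.trans (min_le_left _ _)
  have t2 : θ * (4 * (m + 1)) ≤ d ^ 2 := by
    have := hθ.trans ((min_le_right _ _).trans (min_le_left _ _))
    rwa [le_div_iff₀ (by positivity)] at this
  have h1 : 3 / 4 * d ≤ D - p₁ := by linarith [le_abs_self p₁]
  have h2 : 3 / 4 * d ≤ A := by linarith [neg_abs_le (A - D)]
  have h3 : |W| ≤ m + θ := by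
    have := abs_add_le (W - m₂) m₂
    rw [sub_add_cancel] at this; linarith
  have h4 : |p₂ * W| ≤ θ * (m + θ) := by
    rw [abs_mul]; exact mul_le_mul hp₂ h3 (abs_nonneg _) hθ0
  have h5 : 3 / 4 * d * (3 / 4 * d) ≤ (D - p₁) * A := mul_le_mul h1 h2 (by positivity) (by linarith)
  have h6 : θ * θ ≤ d / 4 * (d / 4) := mul_le_mul t1 t1 hθ0 (by positivity)
  have h7 := le_abs_self (p₂ * W)
  have h8 : 0 < d * d := by positivity
  intro h
  nlinarith

/-- Perturbation of the triangular system `D s = β δ`, `D y + m₂ s = 0`. -/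
theorem row_solution_le {d m Δ k g e Λ D A W m₂ p₁ p₂ β δ E₁ E₂ s y : ℝ} (hd : 0 < d) (hm : 0 ≤ m)
    (hk : 0 ≤ k) (hΔ : 0 ≤ Δ) (hD : d ≤ D) (hm₂ : |m₂| ≤ m) (hg : 0 ≤ g) (hg1 : g ≤ 1)
    (hp₁ : |p₁| ≤ k * g) (hp₂ : |p₂| ≤ k * g) (hA : |A - D| ≤ k * g) (hW : |W - m₂| ≤ k * g)
    (hθ : k * g ≤ rowThreshold d m) (hβ : |β| ≤ e) (hδ : |δ| ≤ Δ) (hΛ : e * g ≤ Λ)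
    (hE₁ : |E₁| ≤ k * Λ) (hE₂ : |E₂| ≤ k * Λ) (h₁ : (D - p₁) * s + p₂ * y = β * δ + E₁)
    (h₂ : A * y + W * s = E₂) :
    |s - β * δ / D| ≤ (1 + m / d) / d * (k + k * ((2 * d + m) / d ^ 2 * 2 * (Δ + k))) * Λ ∧
    |y + m₂ * (β * δ) / D ^ 2|
      ≤ (1 + m / d) / d * (k + k * ((2 * d + m) / d ^ 2 * 2 * (Δ + k))) * Λ := by
  have he : 0 ≤ e := (abs_nonneg _).trans hβ
  have hΛ0 : 0 ≤ Λ := (mul_nonneg he hg).trans hΛ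
  have pD : 0 < D := hd.trans_le hD
  set θ := k * g with hθdef
  have hθ0 : 0 ≤ θ := mul_nonneg hk hg
  have t3 : θ * (2 * (2 * d + m)) ≤ d ^ 2 := by
    have := hθ.trans ((min_le_right _ _).trans (min_le_right _ _))
    rwa [le_div_iff₀ (by positivity)] at this
  set n := |s| with hn
  set r := |y| with hr
  have hn0 : 0 ≤ n := abs_nonneg _
  have hr0 : 0 ≤ r := abs_nonneg _
  set B := e * Δ + k * Λ with hB
  have hB0 : 0 ≤ B := by positivity
  have ps : |p₁ * s| ≤ θ * n := by rw [abs_mul]; gcongr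
  have py : |p₂ * y| ≤ θ * r := by rw [abs_mul]; gcongr
  have Ay : |(A - D) * y| ≤ θ * r := by rw [abs_mul]; gcongr
  have Ws : |(W - m₂) * s| ≤ θ * n := by rw [abs_mul]; gcongr
  have ms : |m₂ * s| ≤ m * n := by rw [abs_mul]; gcongr
  have βδ : |β * δ| ≤ e * Δ := by rw [abs_mul]; gcongr
  have aD : ∀ x : ℝ, D * |x| = |D * x| := fun x => by rw [abs_mul, abs_of_pos pD]
  -- a priori bound for the solution
  have b1 : d * n ≤ B + θ * (n + r) := by
    have e1 : D * s = β * δ + E₁ + p₁ * s - p₂ * y := by linarith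
    have : D * n ≤ B + θ * (n + r) := by
      refine (aD s).trans_le ?_
      rw [e1]
      refine (abs_sub _ _).trans ((add_le_add (abs_add_three _ _ _) le_rfl).trans ?_)
      linarith
    exact (mul_le_mul_of_nonneg_right hD hn0).trans this
  have b2 : d * r ≤ B + θ * (n + r) + m * n := by
    have e1 : D * y = E₂ - (A - D) * y - (W - m₂) * s - m₂ * s := by linarith
    have : D * r ≤ B + θ * (n + r) + m * n := by
      refine (aD y).trans_le ?_
      rw [e1]
      refine (abs_sub _ _).trans ((add_le_add ((abs_sub _ _).trans
        (add_le_add (abs_sub _ _) le_rfl)) le_rfl).trans ?_)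
      have : 0 ≤ e * Δ := by positivity
      linarith
    exact (mul_le_mul_of_nonneg_right hD hr0).trans this
  have b3 : d ^ 2 * (n + r) ≤ (2 * d + m) * (B + θ * (n + r)) := by
    have w1 := mul_le_mul_of_nonneg_left b1 hd.le
    have w2 := mul_le_mul_of_nonneg_left b2 hd.le
    have w3 := mul_le_mul_of_nonneg_left b1 hm
    calc d ^ 2 * (n + r) = d * (d * n) + d * (d * r) := by ring
      _ ≤ d * (B + θ * (n + r)) + d * (B + θ * (n + r) + m * n) := add_le_add w1 w2
      _ = 2 * d * (B + θ * (n + r)) + m * (d * n) := by ring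
      _ ≤ 2 * d * (B + θ * (n + r)) + m * (B + θ * (n + r)) := by linarith
      _ = _ := by ring
  have b4 : n + r ≤ (2 * d + m) / d ^ 2 * 2 * B := by
    rw [div_mul_eq_mul_div, div_mul_eq_mul_div, le_div_iff₀ (by positivity)]
    have w := mul_le_mul_of_nonneg_right t3 (add_nonneg hn0 hr0)
    have w' : (2 * d + m) * (B + θ * (n + r))
        = (2 * d + m) * B + θ * (2 * (2 * d + m)) * (n + r) / 2 := by ring
    rw [w'] at b3
    linarith
  have b5 : θ * (n + r) ≤ k * ((2 * d + m) / d ^ 2 * 2 * (Δ + k)) * Λ := by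
    have hH : 0 ≤ (2 * d + m) / d ^ 2 * 2 := by positivity
    have gB : g * B ≤ (Δ + k) * Λ := by
      have : g * B = (e * g) * Δ + g * (k * Λ) := by rw [hB]; ring
      rw [this]
      have h3 : g * (k * Λ) ≤ 1 * (k * Λ) := mul_le_mul_of_nonneg_right hg1 (by positivity)
      nlinarith [mul_le_mul_of_nonneg_right hΛ hΔ]
    calc θ * (n + r) ≤ k * g * ((2 * d + m) / d ^ 2 * 2 * B) :=
          mul_le_mul_of_nonneg_left b4 hθ0
      _ = k * ((2 * d + m) / d ^ 2 * 2) * (g * B) := by ring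
      _ ≤ k * ((2 * d + m) / d ^ 2 * 2) * ((Δ + k) * Λ) := by gcongr
      _ = _ := by ring
  set J := k + k * ((2 * d + m) / d ^ 2 * 2 * (Δ + k)) with hJ
  have hJ0 : 0 ≤ J := by positivity
  have c1 : D * |s - β * δ / D| ≤ J * Λ := by
    have e1 : D * (s - β * δ / D) = E₁ + p₁ * s - p₂ * y := by
      field_simp; linarith
    rw [aD, e1]
    refine (abs_sub _ _).trans ((add_le_add (abs_add_le _ _) le_rfl).trans ?_)
    rw [hJ]; linarith
  have c1' : |s - β * δ / D| ≤ J * Λ / d := by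
    rw [le_div_iff₀ hd, mul_comm]
    exact (mul_le_mul_of_nonneg_right hD (abs_nonneg _)).trans c1
  have c2 : D * |y + m₂ * (β * δ) / D ^ 2| ≤ J * Λ + m * (J * Λ / d) := by
    have e1 : D * (y + m₂ * (β * δ) / D ^ 2)
        = E₂ - (A - D) * y - (W - m₂) * s - m₂ * (s - β * δ / D) := by
      field_simp; linear_combination h₂ * D
    rw [aD, e1]
    refine (abs_sub _ _).trans (add_le_add ((abs_sub _ _).trans
      ((add_le_add (abs_sub _ _) le_rfl).trans ?_)) ?_)
    · rw [hJ]; linarith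
    · rw [abs_mul]
      exact mul_le_mul hm₂ c1' (abs_nonneg _) hm
  have hmd : 0 ≤ m / d := by positivity
  refine ⟨c1'.trans ?_, ?_⟩
  · rw [show (1 + m / d) / d * J * Λ = J * Λ / d + m / d * (J * Λ / d) by ring]
    have : 0 ≤ m / d * (J * Λ / d) := by positivity
    linarith
  · have c3 := (mul_le_mul_of_nonneg_right hD (abs_nonneg (y + m₂ * (β * δ) / D ^ 2))).trans c2
    rw [show (1 + m / d) / d * J * Λ = (J * Λ + m * (J * Λ / d)) / d by field_simp,
      le_div_iff₀ hd]
    linarith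

/-! ### Local form of the modulation equations -/

/-- By the characterization of symplectic orthogonality, a minimizer of the Hessian is one of the
form with two explicit constraints. -/
theorem isFormMinimizer_of_isHessianMinimizer {f : ℝ → ℝ} (hf : IsNonlinearity f) {I₀ : Set ℝ}
    {Q : ℝ → ℝ → ℝ} (hQ : IsSolitaryWaveFamily f I₀ Q) {c₀ ρ γ M₀ M d c a α : ℝ}
    (hD : HasDecay I₀ Q c₀ ρ γ M₀) (hc : c ∈ Metric.ball c₀ ρ) {q q1 z z1 V w wc : ℝ → ℝ}
    (P : ProfileData f c a α γ M d q q1 z z1 V w wc) (eq : q = fun x => Q c (x - a))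
    (ew₁ : w = fun x => regInv α (dSpeed Q c) (x - a)) {η : H1}
    (hη : IsHessianMinimizer f Q α c a η) :
    IsFormMinimizer (fun x => c - deriv f (q x)) P.isSlow_q.toH1 P.isSlow_w.toH1 η := by
  have horth : ∀ v : H1, SympOrthogonal Q α c a v ↔
      ip P.isSlow_q.toH1.fn v.fn = 0 ∧ ip P.isSlow_w.toH1.fn v.fn = 0 := by
    intro v
    rw [sympOrthogonal_iff hQ hD P.alpha_pos P.alpha_le hc a v, ip_comm _ v.fn, ip_comm _ v.fn,
      P.isSlow_q.ip_toH1, P.isSlow_w.ip_toH1, eq, ew₁]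
  have hform : ∀ v : H1,
      hessian f Q c a v = energyForm (fun x => c - deriv f (q x)) v v := by
    intro v
    rw [← integral_eq_energyForm (P.continuous_coeff hf) P.abs_coeff_le, eq]; rfl
  obtain ⟨⟨h1, h2⟩, h3⟩ := hη
  refine ⟨((horth η).1 h1).1, ((horth η).1 h1).2, h2, fun v v1 v2 v3 => ?_⟩
  rw [← hform, ← hform]
  exact h3 ⟨(horth v).2 ⟨v1, v2⟩, v3⟩

/-- The pairing of the fluctuation with a slowly varying function: only its good part feels the
large `L²` norm of such a function. -/
theorem abs_ip_slow_le {α γ a B K : ℝ} {h h₁ h₂ : ℝ → ℝ} (S : IsSlow α γ a B h h₁ h₂) {η ξ : H1}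
    (hK : ‖η‖ ≤ K) (hη : |ip η.fn h| ≤ K * B) :
    |ip ξ.fn h| ≤ (2 + K ^ 2) * B * ((√α)⁻¹ * ‖goodPart η ξ‖ + ‖ξ‖) := by
  have hα := S.alpha_pos
  have hB := S.nonneg
  have hK0 : 0 ≤ K := (norm_nonneg _).trans hK
  set Y := ‖goodPart η ξ‖ with hY
  have e : ip ξ.fn h = ip (goodPart η ξ).fn h + ip ξ.fn η.fn * ip η.fn h := by
    have h1 : ξ = goodPart η ξ + ip ξ.fn η.fn • η := by
      rw [goodPart, badPart, sub_add_cancel]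
    conv_lhs => rw [ip_comm, h1, H1.ip_left_add_smul S.memLp, ip_comm, ip_comm h η.fn]
  have b1 : |ip (goodPart η ξ).fn h| ≤ Y * (B / √(α / 2)) :=
    H1.abs_ip_le _ (half_pos hα) S.continuous.aestronglyMeasurable S.bound
  have b2 : |ip ξ.fn η.fn| ≤ ‖ξ‖ * K := by
    rw [H1.ip_fn_eq]
    exact (abs_real_inner_le_norm _ _).trans
      (mul_le_mul ξ.norm_fst_le (η.norm_fst_le.trans hK) (norm_nonneg _) (norm_nonneg _))
  have h2 : 1 / √(α / 2) ≤ 2 * (√α)⁻¹ := by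
    rw [← div_eq_mul_inv, div_le_div_iff₀ (Real.sqrt_pos.2 (half_pos hα)) (Real.sqrt_pos.2 hα),
      one_mul]
    refine Real.sqrt_le_iff.2 ⟨by positivity, ?_⟩
    rw [mul_pow, Real.sq_sqrt (half_pos hα).le]; linarith
  have hY0 : 0 ≤ Y := norm_nonneg _
  have hX := norm_nonneg ξ
  have hs : 0 ≤ (√α)⁻¹ * Y := by positivity
  rw [e]
  calc _ ≤ Y * (B / √(α / 2)) + ‖ξ‖ * K * (K * B) := by
        refine (abs_add_le _ _).trans (add_le_add b1 ?_)
        rw [abs_mul]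
        exact mul_le_mul b2 hη (abs_nonneg _) (by positivity)
    _ = Y * B * (1 / √(α / 2)) + K ^ 2 * B * ‖ξ‖ := by ring
    _ ≤ Y * B * (2 * (√α)⁻¹) + K ^ 2 * B * ‖ξ‖ := by gcongr
    _ = 2 * B * ((√α)⁻¹ * Y) + K ^ 2 * B * ‖ξ‖ := by ring
    _ ≤ _ := by nlinarith [mul_nonneg (mul_nonneg (sq_nonneg K) hB) hs, mul_nonneg hB hX]

/-- Integration by parts with `w' = z - α w`. -/
theorem ProfileData.ip_q1_w {f : ℝ → ℝ} {c a α γ M d : ℝ} {q q1 z z1 V w wc : ℝ → ℝ}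
    (P : ProfileData f c a α γ M d q q1 z z1 V w wc) :
    ip q1 w = -ip q (fun x => z x - α * w x) := by
  have m1 : MemLp (fun x => z x - α * w x) 2 volume :=
    P.memLp_z.sub (P.isSlow_w.memLp.const_mul α)
  have i1 : Integrable fun x => q1 x * w x := P.memLp_q1.integrable_mul P.isSlow_w.memLp
  have i2 : Integrable fun x => q x * (z x - α * w x) := P.isSlow_q.memLp.integrable_mul m1
  have i3 : Integrable fun x => q x * w x := P.isSlow_q.memLp.integrable_mul P.isSlow_w.memLp
  have := integral_eq_zero_of_hasDerivAt_of_integrable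
    (fun x => (P.hasDerivAt_q x).mul (P.hasDerivAt_w x)) (i1.add i2) i3
  rw [integral_add i1 i2] at this
  simp only [ip]; linarith

theorem hasDerivWithinAt_vec {a c : ℝ → ℝ} {S : Set ℝ} {t a' c' : ℝ} {v : EuclideanSpace ℝ (Fin 2)}
    (h : HasDerivWithinAt (fun s => (c s, a s)) (c', a') S t) (h0 : v 0 = a') (h1 : v 1 = c') :
    HasDerivWithinAt (fun s => !₂[a s, c s]) v S t := by
  have ha : HasDerivWithinAt a a' S t := by
    simpa [Function.comp_def] using
      (ContinuousLinearMap.snd ℝ ℝ ℝ).hasFDerivAt.comp_hasDerivWithinAt t h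
  have hc : HasDerivWithinAt c c' S t := by
    simpa [Function.comp_def] using
      (ContinuousLinearMap.fst ℝ ℝ ℝ).hasFDerivAt.comp_hasDerivWithinAt t h
  rw [hasDerivWithinAt_iff_hasFDerivWithinAt, hasFDerivWithinAt_euclidean, Fin.forall_fin_two]
  constructor
  · refine ha.hasFDerivWithinAt.congr_fderiv ?_
    ext; simp [h0]
  · refine hc.hasFDerivWithinAt.congr_fderiv ?_
    ext; simp [h1]

theorem norm_vec_le (x y : ℝ) : ‖(!₂[x, y] : EuclideanSpace ℝ (Fin 2))‖ ≤ |x| + |y| := by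
  rw [EuclideanSpace.norm_eq, Fin.sum_univ_two]
  refine Real.sqrt_le_iff.2 ⟨by positivity, ?_⟩
  simp only [Real.norm_eq_abs, Matrix.cons_val_zero, Matrix.cons_val_one]
  nlinarith [mul_nonneg (abs_nonneg x) (abs_nonneg y)]

/-- The modulation equations with an explicit error bound, at the times at which the speed
belongs to `A`. -/
def ModulationBound (f : ℝ → ℝ) (I₀ : Set ℝ) (Q : ℝ → ℝ → ℝ) (A : Set ℝ) (C κ α₀ : ℝ) : Prop :=
  ∀ α εa εt εx : ℝ, 0 < α → α ≤ 1 → α ≤ α₀ → 0 < εa → 0 < εt → 0 < εx → εx ≤ 1 →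
  ∀ b : ℝ → ℝ → ℝ, IsPotential b εa εt εx →
  ∀ (T : ℝ) (u : ℝ → H1), 0 < T → IsSolution f b T u →
  ∀ (a c : ℝ → ℝ) (ξ : ℝ → H1), IsModulation Q I₀ α T u a c ξ →
  ∀ t ∈ Set.Icc 0 T, c t ∈ A →
  ∀ η : H1, IsHessianMinimizer f Q α (c t) (a t) η →
  (√α)⁻¹ * ‖goodPart η (ξ t)‖ + ‖ξ t‖ ≤ κ →
  ∃ Z : EuclideanSpace ℝ (Fin 2),
    HasDerivWithinAt (fun s => !₂[a s, c s])
      (!₂[c t - b t (a t), 0]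
        + (deriv (b t) (a t) * (delta Q (c t) / deriv (delta Q) (c t) ^ 2)) •
          !₂[-(1 / 2) * (∫ x, zetaN Q (c t) (a t) x) ^ 2, deriv (delta Q) (c t)]
        + Z)
      (Set.Icc 0 T) t ∧
    ‖Z‖ ≤ C * (α * εa * εx + εa * εx ^ 2
      + (√α + (√α)⁻¹ * (εa * εx)) * ‖goodPart η (ξ t)‖
      + (α + εa * εx) * ‖ξ t‖ + ‖ξ t‖ ^ 2)

theorem ModulationBound.mono {f : ℝ → ℝ} {I₀ : Set ℝ} {Q : ℝ → ℝ → ℝ} {A A' : Set ℝ}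
    {C κ α₀ C' κ' α₀' : ℝ} (h : ModulationBound f I₀ Q A C κ α₀) (hA : A' ⊆ A) (hC : C ≤ C')
    (hκ : κ' ≤ κ) (hα₀ : α₀' ≤ α₀) : ModulationBound f I₀ Q A' C' κ' α₀' := by
  intro α εa εt εx h1 h2 h3 h4 h5 h6 h7 b h8 T u h9 h10 a c ξ h11 t h12 h13 η h14 h15
  obtain ⟨Z, hZ1, hZ2⟩ := h α εa εt εx h1 h2 (h3.trans hα₀) h4 h5 h6 h7 b h8 T u h9 h10 a c ξ h11 t
    h12 (hA h13) η h14 (h15.trans hκ)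
  exact ⟨Z, hZ1, hZ2.trans (mul_le_mul_of_nonneg_right hC (by positivity))⟩

set_option maxHeartbeats 800000 in
/-- The modulation equations hold with uniform constants near every admissible speed. -/
theorem exists_modulationBound_ball {f : ℝ → ℝ} (hf : IsNonlinearity f) {I₀ : Set ℝ}
    {Q : ℝ → ℝ → ℝ} (hQ : IsSolitaryWaveFamily f I₀ Q) {c₀ : ℝ} (hc₀ : c₀ ∈ I₀)
    (hN : (∫ x, zetaN Q c₀ 0 x) ≠ 0) (hδ : 0 < deriv (delta Q) c₀) :
    ∃ ρ > 0, ∃ C > 0, ∃ κ > 0, ∃ α₀ > 0,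
      ModulationBound f I₀ Q (Metric.ball c₀ ρ) C κ α₀ := by
  obtain ⟨ρ, γ, M₀, M, d, hD, hP⟩ := exists_profileData hf hQ hc₀ hN hδ
  have hγ := hD.rate_pos
  have P₀ := hP c₀ (Metric.mem_ball_self hD.rho_pos) 0 (min 1 (γ / 2))
    (lt_min one_pos (half_pos hγ)) (min_le_left _ _) (min_le_right _ _)
  have hM := P₀.M_pos
  have hd := P₀.d_pos
  obtain ⟨K₁, hK₁, α₁, hα₁, hpair⟩ := exists_slow_pairing_const hγ hM hd
  obtain ⟨K₂, hK₂, hflux1⟩ := exists_flux_fst_const hγ hM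
  obtain ⟨K₃, hK₃, hflux2⟩ := exists_flux_snd_const hγ hM
  obtain ⟨S, hS, hsob⟩ := exists_sobolev_const
  -- `m` and `Δ` bound half the squared mass of `∂_c q` and the momentum `δ`; `k` collects the
  -- constants of all estimates, and `κ` and `α₀` make the system a perturbation it can absorb
  set m := (M * (2 / γ)) ^ 2 / 2 with hm
  have hm0 : 0 ≤ m := by positivity
  set Δ := 1 / 2 * (M ^ 2 / γ) with hΔ
  set K₄ := 2 + K₁ ^ 2 with hK₄
  have hK₄0 : 0 < K₄ := by positivity
  have n1 : 0 < K₄ * (M * (3 + 2 / γ)) := by positivity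
  have n2 : 0 < K₄ * M := by positivity
  have n3 : 0 < M / √γ := by positivity
  have n4 : 0 < M * M * (2 / γ) := by positivity
  set k := K₂ + K₃ + K₄ * (M * (3 + 2 / γ)) + K₄ * M + M + M / √γ + M * M * (2 / γ) with hk
  have hk0 : 0 < k := by positivity
  set θ₀ := rowThreshold d m with hθ₀
  have hθ₀0 : 0 < θ₀ := rowThreshold_pos hd hm0
  set J := (1 + m / d) / d * (k + k * ((2 * d + m) / d ^ 2 * 2 * (Δ + k))) with hJ
  have hJ0 : 0 < J := by positivity
  refine ⟨ρ, hD.rho_pos, 2 * J, by positivity, min (1 / S) (min (1 / 2) (θ₀ / (2 * k))),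
    lt_min (by positivity) (lt_min (by norm_num) (by positivity)),
    min α₁ (min (γ / 2) (min (1 / 2) (θ₀ / (2 * k)))),
    lt_min hα₁ (lt_min (by positivity) (lt_min (by norm_num) (by positivity))), ?_⟩
  intro α εa εt εx hα hα1 hαα₀ ha _ hx _ b hb T u _ hu a c ξ hmod t ht hc η hη hκ
  have l1 : α ≤ α₁ := hαα₀.trans (min_le_left _ _)
  have l2 : α ≤ γ / 2 := hαα₀.trans ((min_le_right _ _).trans (min_le_left _ _))
  have l3 : α ≤ 1 / 2 :=
    hαα₀.trans ((min_le_right _ _).trans ((min_le_right _ _).trans (min_le_left _ _)))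
  have l4 : α ≤ θ₀ / (2 * k) :=
    hαα₀.trans ((min_le_right _ _).trans ((min_le_right _ _).trans (min_le_right _ _)))
  have P := hP (c t) hc (a t) α hα hα1 l2
  obtain ⟨q, eq⟩ : ∃ q, q = fun x => Q (c t) (x - a t) := ⟨_, rfl⟩
  obtain ⟨q1, eq1⟩ : ∃ q1, q1 = fun x => dSpace Q (c t) (x - a t) := ⟨_, rfl⟩
  obtain ⟨z, ez⟩ : ∃ z, z = fun x => dSpeed Q (c t) (x - a t) := ⟨_, rfl⟩
  obtain ⟨z1, ez1⟩ : ∃ z1, z1 = fun x => dSpace (dSpeed Q) (c t) (x - a t) := ⟨_, rfl⟩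
  obtain ⟨V, eV⟩ : ∃ V, V = fun x => dSpeed (dSpeed Q) (c t) (x - a t) := ⟨_, rfl⟩
  obtain ⟨w, ew₁⟩ : ∃ w, w = fun x => regInv α (dSpeed Q (c t)) (x - a t) := ⟨_, rfl⟩
  obtain ⟨wc, ewc⟩ : ∃ wc, wc = fun x => regInv α (dSpeed (dSpeed Q) (c t)) (x - a t) := ⟨_, rfl⟩
  rw [← eq, ← eq1, ← ez, ← ez1, ← eV, ← ew₁, ← ewc] at P
  set X := ‖ξ t‖ with hX
  set Y := ‖goodPart η (ξ t)‖ with hY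
  set G := (√α)⁻¹ * Y + X with hG
  have hX0 : 0 ≤ X := norm_nonneg _
  have hY0 : 0 ≤ Y := norm_nonneg _
  have hsY : 0 ≤ (√α)⁻¹ * Y := by positivity
  have hXG : X ≤ G := by rw [hG]; linarith
  have hG0 : 0 ≤ G := hX0.trans hXG
  have g1 : G ≤ 1 / S := hκ.trans (min_le_left _ _)
  have g2 : G ≤ 1 / 2 := hκ.trans ((min_le_right _ _).trans (min_le_left _ _))
  have g3 : G ≤ θ₀ / (2 * k) := hκ.trans ((min_le_right _ _).trans (min_le_right _ _))
  -- quantities attached to the profile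
  have hmass : ∫ x, zetaN Q (c t) (a t) x = ∫ x, z x := by rw [ez]; rfl
  have hdelta : delta Q (c t) = 1 / 2 * ∫ x, q x ^ 2 := by
    rw [delta, eq, integral_sub_right_eq_self (fun x => Q (c t) x ^ 2) (a t)]
  have hddelta : deriv (delta Q) (c t) = ip z q := by
    rw [(hD.hasDerivAt_delta hQ hc).deriv, ez, eq, ip,
      integral_sub_right_eq_self (fun x => dSpeed Q (c t) x * Q (c t) x) (a t)]
  rw [hmass, hdelta, hddelta]
  set D := ip z q with hDdef
  have hdD : d ≤ D := P.le_momentum_deriv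
  have pD : 0 < D := hd.trans_le hdD
  set mm := (∫ x, z x) ^ 2 / 2 with hmm
  have hmm_le : |mm| ≤ m := by
    have h1 := abs_integral_le_of_ew hγ P.bound_z
    rw [hmm, hm, abs_of_nonneg (by positivity), ← sq_abs]
    gcongr
  set δ := 1 / 2 * ∫ x, q x ^ 2 with hδdef
  have hδ_le : |δ| ≤ Δ := by
    have h1 := integral_sq_le_of_ew hγ P.bound_q
    have h2 : 0 ≤ ∫ x, q x ^ 2 := integral_nonneg fun x => sq_nonneg _
    rw [hδdef, abs_of_nonneg (by positivity), hΔ]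
    gcongr
  set β := deriv (b t) (a t) with hβdef
  set e := εa * εx with he
  have he0 : 0 < e := mul_pos ha hx
  have hβe : |β| ≤ e := hb.abs_deriv_le t (a t)
  -- orthogonality and smallness of the fluctuation
  obtain ⟨oq, ow⟩ : ip (ξ t).fn q = 0 ∧ ip (ξ t).fn w = 0 := by
    rw [eq, ew₁]
    exact (sympOrthogonal_iff hQ hD hα l2 hc (a t) (ξ t)).1 (hmod.orthogonal t ht)
  have hξ1 : ∀ᵐ x, |(ξ t).fn x| ≤ 1 := by
    filter_upwards [hsob (ξ t)] with x hx'
    refine hx'.trans ?_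
    have := hXG.trans g1
    rw [le_div_iff₀ hS] at this
    linarith
  have hdec : (u t).fn =ᵐ[volume] fun x => q x + (ξ t).fn x := by
    rw [eq]; exact hmod.decomposition t ht
  obtain ⟨hηK, hηs⟩ := hpair hf P l1 η
    (isFormMinimizer_of_isHessianMinimizer hf hQ hD hc P eq ew₁ hη)
  have s1 := abs_ip_slow_le P.isSlow_wc (ξ := ξ t) hηK (hηs P.isSlow_wc)
  have s2 := abs_ip_slow_le (P.isSlow_potential ha hx hb t) (ξ := ξ t) hηK
    (hηs (P.isSlow_potential ha hx hb t))
  have f1 := hflux1 hf P ha hx hb t hdec hξ1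
  have f2 := hflux2 hf P ha hx hb t hdec hξ1 oq ow
  rw [← hK₄, ← he, ← hX, ← hY, ← hG] at s2
  rw [← he, ← hX] at f1 f2
  rw [← hβdef, ← hδdef] at f1
  -- the coefficients of the linear system
  set p₁ := ip (ξ t).fn z with hp₁
  set p₂ := ip (ξ t).fn q1 with hp₂
  set A := ip q (fun x => z x - α * w x) + ip (ξ t).fn (fun x => z x - α * w x) with hA
  set W := ip z w - ip (ξ t).fn wc with hW
  have b1 : |p₁| ≤ M / √γ * X := by
    have := (ξ t).abs_ip_le hγ P.continuous_z.aestronglyMeasurable P.bound_z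
    rwa [mul_comm] at this
  have b2 : |p₂| ≤ M / √γ * X := by
    have := (ξ t).abs_ip_le hγ P.continuous_q1.aestronglyMeasurable P.bound_q1
    rwa [mul_comm] at this
  have hAD : A - D = -(α * ip q w) + p₁ := by
    have i : ∀ {v : ℝ → ℝ}, MemLp v 2 volume → ip v (fun x => z x - α * w x)
        = ip v z - α * ip v w := by
      intro v hv
      have i1 : Integrable fun x => v x * z x := hv.integrable_mul P.memLp_z
      have i2 : Integrable fun x => v x * w x := hv.integrable_mul P.isSlow_w.memLp
      rw [ip, ip, ip, ← integral_const_mul, ← integral_sub i1 (i2.const_mul α)]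
      congr 1; ext x; ring
    rw [hA, i P.isSlow_q.memLp, i (ξ t).memLp_fn, ow, hDdef, ip_comm z q]; ring
  set g := α + G with hg
  have hg0 : 0 ≤ g := by positivity
  have hg1 : g ≤ 1 := by rw [hg]; linarith
  have kg : k * g ≤ θ₀ := by
    rw [le_div_iff₀ (by positivity)] at l4 g3
    rw [hg]; linarith
  have kX : M / √γ * X ≤ k * g := by
    refine mul_le_mul ?_ (by rw [hg]; linarith) hX0 hk0.le
    rw [hk]; linarith
  have b3 : |A - D| ≤ k * g := by
    rw [hAD]
    refine (abs_add_le _ _).trans ?_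
    rw [abs_neg, abs_mul, abs_of_pos hα]
    have h1 : α * |ip q w| ≤ M * M * (2 / γ) * g := by
      rw [mul_comm]
      exact mul_le_mul P.abs_ip_q_w_le (by rw [hg]; linarith) hα.le n4.le
    have h2 : |p₁| ≤ M / √γ * g :=
      b1.trans (mul_le_mul_of_nonneg_left (by rw [hg]; linarith) n3.le)
    have h3 : (M * M * (2 / γ) + M / √γ) * g ≤ k * g :=
      mul_le_mul_of_nonneg_right (by rw [hk]; linarith) hg0
    linarith
  have b4 : |W - mm| ≤ k * g := by
    have h1 : |ip z w - mm| ≤ M * g :=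
      P.mass.trans (mul_le_mul_of_nonneg_left (by rw [hg]; linarith) hM.le)
    have h2 : |ip (ξ t).fn wc| ≤ K₄ * M * g :=
      s1.trans (mul_le_mul_of_nonneg_left (by rw [hg]; linarith) n2.le)
    have h3 : (M + K₄ * M) * g ≤ k * g :=
      mul_le_mul_of_nonneg_right (by rw [hk]; linarith) hg0
    rw [show W - mm = (ip z w - mm) - ip (ξ t).fn wc by rw [hW]; ring]
    refine (abs_sub _ _).trans ?_
    linarith
  have q1q : ip q1 q = 0 := by rw [ip_comm, P.ip_q_q1]
  have hdet := row_det_ne_zero hd hm0 hdD hmm_le (b1.trans kX) (b2.trans kX) b3 b4 kg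
  obtain ⟨c', a', hder, r1, r2⟩ := exists_hasDerivWithinAt_modulation hf hQ hD hb hu hmod ht hc P eq
    eq1 ez ew₁ ewc (by
      rw [q1q, P.ip_q1_w]
      refine fun h => hdet (Eq.trans ?_ h)
      rw [hA, hW]; ring)
  rw [q1q] at r1
  rw [P.ip_q1_w] at r2
  set F₁ := flux f (b t) (u t) q1 (fun x => c t * q x - f (q x)) with hF₁
  set F₂ := flux f (b t) (u t) (fun x => z x - α * w x) (fun x => z1 x - α * (z x - α * w x))
    with hF₂
  -- `F₁`, `F₂` are the right-hand sides, `Λ` the claimed size of the error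
  set Λ := α * εa * εx + εa * εx ^ 2 + (√α + (√α)⁻¹ * e) * Y + (α + e) * X + X ^ 2 with hΛ
  have R₁ : (D - p₁) * c' + p₂ * (a' - (c t - b t (a t)))
      = β * δ + (F₁ - ((c t - b t (a t)) * p₂ + β * δ)) := by linarith
  have R₂ : A * (a' - (c t - b t (a t))) + W * c' = F₂ - (c t - b t (a t)) * A := by
    rw [hA, hW]; linarith
  clear_value F₁ F₂ Λ A W p₁ p₂ δ β D mm
  clear r1 r2 hA hW
  clear_value g G e k X Y
  have z1' : 0 ≤ α * e := by positivity
  have z2' : 0 ≤ εa * εx ^ 2 := by positivity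
  have z3' : 0 ≤ √α * Y := by positivity
  have z4' : 0 ≤ (√α)⁻¹ * e * Y := by positivity
  have z5' : 0 ≤ α * X := by positivity
  have z6' : 0 ≤ e * X := by positivity
  have z7' : 0 ≤ X ^ 2 := by positivity
  have hΛ' : Λ = α * e + εa * εx ^ 2 + √α * Y + (√α)⁻¹ * e * Y + α * X + e * X + X ^ 2 := by
    rw [hΛ, he]; ring
  have hΛ0 : 0 ≤ Λ := by rw [hΛ']; positivity
  have eG : e * G ≤ Λ := by
    rw [hΛ', show e * G = (√α)⁻¹ * e * Y + e * X by rw [hG]; ring]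
    linarith
  have eg : e * g ≤ Λ := by
    rw [hΛ', show e * g = α * e + (√α)⁻¹ * e * Y + e * X by rw [hg, hG]; ring]
    linarith
  have hE₁ : |F₁ - ((c t - b t (a t)) * p₂ + β * δ)| ≤ k * Λ := by
    have h1 : K₂ * (εa * εx ^ 2 + e * X + X ^ 2) ≤ K₂ * Λ :=
      mul_le_mul_of_nonneg_left (by rw [hΛ']; linarith) hK₂.le
    have h2 : K₂ * Λ ≤ k * Λ := mul_le_mul_of_nonneg_right (by rw [hk]; linarith) hΛ0
    linarith
  have hE₂ : |F₂ - (c t - b t (a t)) * A| ≤ k * Λ := by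
    refine f2.trans ?_
    have h1 : K₃ * (α * e + εa * εx ^ 2 + α * X + e * X + X ^ 2) ≤ K₃ * Λ :=
      mul_le_mul_of_nonneg_left (by rw [hΛ']; linarith) hK₃.le
    have h2 : K₄ * (M * (3 + 2 / γ) * e) * G ≤ K₄ * (M * (3 + 2 / γ)) * Λ := by
      rw [show K₄ * (M * (3 + 2 / γ) * e) * G = K₄ * (M * (3 + 2 / γ)) * (e * G) by ring]
      exact mul_le_mul_of_nonneg_left eG n1.le
    have h3 : (K₃ + K₄ * (M * (3 + 2 / γ))) * Λ ≤ k * Λ :=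
      mul_le_mul_of_nonneg_right (by rw [hk]; linarith) hΛ0
    have h4 := s2.trans h2
    linarith
  obtain ⟨hs, hy⟩ := row_solution_le (s := c') (y := a' - (c t - b t (a t))) hd hm0 hk0.le
    (by positivity) hdD hmm_le hg0 hg1 (b1.trans kX) (b2.trans kX) b3 b4 kg hβe hδ_le eg hE₁ hE₂
    R₁ R₂
  refine ⟨!₂[a' - (c t - b t (a t)) + mm * (β * δ) / D ^ 2, c' - β * δ / D], ?_, ?_⟩
  · refine hasDerivWithinAt_vec hder ?_ ?_
    · simp [hmm]; ring
    · simp; field_simp; ring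
  · refine (norm_vec_le _ _).trans ?_
    rw [mul_assoc, two_mul]
    exact add_le_add hy hs

end BKdV

end

theorem mainTheorem5 (f : ℝ → ℝ) (hf : IsNonlinearity f)
    (I₀ : Set ℝ) (Q : ℝ → ℝ → ℝ) (hQ : IsSolitaryWaveFamily f I₀ Q)
    (I : Set ℝ) (hI : IsCompact I) (hI₀ : I ⊆ I₀)
    (hN : ∀ c ∈ I, (∫ x, zetaN Q c 0 x) ≠ 0)
    (hδ : ∀ c ∈ I, 0 < deriv (delta Q) c) :
    ∃ C > 0, ∃ κ > 0, ∃ α₀ > 0,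
      ∀ α εa εt εx : ℝ, 0 < α → α ≤ 1 → α ≤ α₀ → 0 < εa → 0 < εt → 0 < εx → εx ≤ 1 →
      ∀ b : ℝ → ℝ → ℝ, IsPotential b εa εt εx →
      ∀ (T : ℝ) (u : ℝ → H1), 0 < T → IsSolution f b T u →
      ∀ (a c : ℝ → ℝ) (ξ : ℝ → H1), IsModulation Q I₀ α T u a c ξ →
      ∀ t ∈ Set.Icc 0 T, c t ∈ I →
      ∀ η : H1, IsHessianMinimizer f Q α (c t) (a t) η →
      (√α)⁻¹ * ‖goodPart η (ξ t)‖ + ‖ξ t‖ ≤ κ →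
      ∃ Z : EuclideanSpace ℝ (Fin 2),
        HasDerivWithinAt (fun s => !₂[a s, c s])
          (!₂[c t - b t (a t), 0]
            + (deriv (b t) (a t) * (delta Q (c t) / deriv (delta Q) (c t) ^ 2)) •
              !₂[-(1 / 2) * (∫ x, zetaN Q (c t) (a t) x) ^ 2, deriv (delta Q) (c t)]
            + Z)
          (Set.Icc 0 T) t ∧
        ‖Z‖ ≤ C * (α * εa * εx + εa * εx ^ 2
          + (√α + (√α)⁻¹ * (εa * εx)) * ‖goodPart η (ξ t)‖
          + (α + εa * εx) * ‖ξ t‖ + ‖ξ t‖ ^ 2) := by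
  change ∃ C > 0, ∃ κ > 0, ∃ α₀ > 0, ModulationBound f I₀ Q I C κ α₀
  refine hI.induction_on (p := fun A => ∃ C > 0, ∃ κ > 0, ∃ α₀ > 0,
    ModulationBound f I₀ Q A C κ α₀) ?_ ?_ ?_ ?_
  · refine ⟨1, one_pos, 1, one_pos, 1, one_pos, ?_⟩
    intro α εa εt εx _ _ _ _ _ _ _ b _ T u _ _ a c ξ _ t _ h
    exact absurd h (notMem_empty _)
  · rintro A A' hA ⟨C, hC, κ, hκ, α₀, hα₀, h⟩
    exact ⟨C, hC, κ, hκ, α₀, hα₀, h.mono hA le_rfl le_rfl le_rfl⟩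
  · rintro A A' ⟨C, hC, κ, hκ, α₀, hα₀, h⟩ ⟨C', hC', κ', hκ', α₀', hα₀', h'⟩
    refine ⟨max C C', lt_max_of_lt_left hC, min κ κ', lt_min hκ hκ', min α₀ α₀',
      lt_min hα₀ hα₀', ?_⟩
    have w := h.mono subset_rfl (le_max_left C C') (min_le_left κ κ') (min_le_left α₀ α₀')
    have w' := h'.mono subset_rfl (le_max_right C C') (min_le_right κ κ') (min_le_right α₀ α₀')
    intro α εa εt εx h1 h2 h3 h4 h5 h6 h7 b h8 T u h9 h10 a c ξ h11 t h12 h13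
    rcases h13 with h13 | h13
    · exact w α εa εt εx h1 h2 h3 h4 h5 h6 h7 b h8 T u h9 h10 a c ξ h11 t h12 h13
    · exact w' α εa εt εx h1 h2 h3 h4 h5 h6 h7 b h8 T u h9 h10 a c ξ h11 t h12 h13
  · intro c₀ hc₀
    obtain ⟨ρ, hρ, h⟩ := exists_modulationBound_ball hf hQ (hI₀ hc₀) (hN c₀ hc₀) (hδ c₀ hc₀)
    exact ⟨Metric.ball c₀ ρ, mem_nhdsWithin_of_mem_nhds (Metric.ball_mem_nhds c₀ hρ), h⟩
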